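/- Let $N\ge 3$, $a'=N+1-a$, and let $q>0$. Let $\rho=(\frac N2-1,\frac N2-2,\dots,1,0,0,-1,\dots,-\frac N2+1)$ for $N$ even and $\rho=(\frac N2-1,\dots,\frac12,0,-\frac12,\dots,-\frac N2+1)$ for $N$ odd, $C_{ab}=q^{-\rho_a}\delta_{ab'}$, and let $R=(R^{ab}{}_{cd})$ be the standard Faddeev–Reshetikhin–Takhtajan $R$-matrix of the orthogonal series. $SO_q(N)$ is the complex Hopf algebra generated by the entries of $T=(T^a{}_b)_{a,b=1}^N$ with relations $R_{12}T_1T_2=T_2T_1R_{12}$, $TCT^t=C=T^tCT$, $\det_qT=1$, and with $\Delta(T^a{}_b)=\sum_cT^a{}_c\otimes T^c{}_b$, $\varepsilon(T^a{}_b)=\delta^a_b$, $\kappa(T)=CT^tC$. A conjugation on a Hopf algebra is an antilinear, antimultiplicative involution compatible with $\Delta$ and $\varepsilon$; conjugations $s,s'$ are equivalent if $s'=\alpha\circ s\circ\alpha^{-1}$ for a Hopf algebra automorphism $\alpha$. Let $\mathcal D$ be the permutation matrix exchanging the indices $n,n+1$ if $N=2n$, and the matrix $\mathrm{diag}(1,\dots,1,-1,1,\dots,1)$,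 with $-1$ in the middle, if $N=2n+1$. Let $\mathcal D'=\mathrm{diag}(\varepsilon_1,\dots,\varepsilon_N)$ range over the sign matrices with $\varepsilon_j=\pm1$, $\varepsilon_{j'}=\varepsilon_j$, and middle entries equal to $1$ ($\varepsilon_{n+1}=1$ for $N=2n+1$, $\varepsilon_n=\varepsilon_{n+1}=1$ for $N=2n$); let $k$ be the number of entries $-1$ of $\mathcal D'$, which is even. A family of conjugations $s_q$ on $SO_q(N)$, $q>0$, is said to give the real form $SO_q(l,m)$, $l+m=N$, if there are invertible matrices $M=M_q$, continuous in $q$, such that all entries of $T'=MTM^{-1}$ are fixed by $s_q$, the metric $C'=(M^{-1})^tCM^{-1}$ tends to $\mathrm{diag}(1,\dots,1,-1,\dots,-1)$ ($l$ entries $1$, $m$ entries $-1$) as $q\to1$, and, at $q=1$, $g\mapsto MgM^{-1}$ maps the group $\{g: f^{s_1}(g)=\overline{f(g)}\ \forall f\}$ of real points onto $SO(l,m)$. Then: 1. $T^\star=C^tTC^t$ defines a conjugation $\star$ on $SO_q(N)$, and $T^\sharp=\mathcal DT\mathcal D^{-1}$ defines an involutive Hopf algebra automorphism $\sharp$ commuting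 with $\star$. 2. Every $\mathcal D'$ commutes with $\mathcal D$, and $T^\natural=\mathcal D'T\mathcal D'^{-1}$ defines an involutive Hopf algebra automorphism $\natural$ commuting with $\sharp$ and $\star$. Hence $\star^\natural=\natural\circ\star$ and $\star^{\sharp\natural}=\natural\circ\sharp\circ\star$ are conjugations. 3. $\star^\natural$ gives the real form $SO_q(N-k,k)$ and $\star^{\sharp\natural}$ gives the real form $SO_q(N-k-1,k+1)$. For all $l+m=N$: if $N$ is odd, or if $l,m$ are both even, some $\star^\natural$ gives $SO_q(l,m)$; if $l,m$ are both odd, some $\star^{\sharp\natural}$ gives $SO_q(l,m)$. 4. Let $N=2n$. If $\mathcal D'_2=-\mathcal D'_1$ off the two middle entries, then $\star^{\sharp\natural_1}$ and $\star^{\sharp\natural_2}$ are equivalent: $\alpha(T)=ATA^{-1}$ with $A=\mathrm{diag}(-1,\dots,-1,1,\dots,1)$ ($n$ entries of each sign) is a Hopf algebra automorphism with $\star^{\sharp\natural_2}=\alpha\circ\star^{\sharp\natural_1}\circ\alpha^{-1}$. Consequently there are at most $2^{n-2}$ conjugations $\star^{\sharp\natural}$ up to equivalence, and for $q\ne1$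 there are exactly $2^{n-2}$. -/

import Mathlib

open scoped TensorProduct ComplexConjugate Matrix

set_option linter.unusedSectionVars false

noncomputable section

namespace QuantumOrthogonal

section MatrixRelations

/-! ### Matrices over a noncommutative algebra -/

variable {ι κ : Type} [Fintype ι] [DecidableEq ι]
variable {B B' : Type*} [Ring B] [Algebra ℂ B] [Ring B'] [Algebra ℂ B']

/-- A complex matrix, viewed as a matrix over the complex algebra `B`. -/
def scal (B : Type*) [Ring B] [Algebra ℂ B] {m n : Type} (M : Matrix m n ℂ) : Matrix m n B :=
  M.map (algebraMap ℂ B)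

/-- `X₁ X₂`, with entries `(X₁ X₂)^{ab}_{cd} = X^a_c X^b_d`. -/
def leg12 (X : Matrix ι ι B) : Matrix (ι × ι) (ι × ι) B :=
  Matrix.of fun p r => X p.1 r.1 * X p.2 r.2

/-- `X₂ X₁`, with entries `(X₂ X₁)^{ab}_{cd} = X^b_d X^a_c`. -/
def leg21 (X : Matrix ι ι B) : Matrix (ι × ι) (ι × ι) B :=
  Matrix.of fun p r => X p.2 r.2 * X p.1 r.1

/-- `X₁ X₂ ⋯ X_k`, with entries `X^{i_1}_{j_1} X^{i_2}_{j_2} ⋯ X^{i_k}_{j_k}` (in this order). -/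
def legs (k : ℕ) (X : Matrix ι ι B) : Matrix (Fin k → ι) (Fin k → ι) B :=
  Matrix.of fun i j => (List.ofFn fun s => X (i s) (j s)).prod

/-- `X_k ⋯ X₂ X₁`, with entries `X^{i_k}_{j_k} ⋯ X^{i_1}_{j_1}`. -/
def legsRev (k : ℕ) (X : Matrix ι ι B) : Matrix (Fin k → ι) (Fin k → ι) B :=
  Matrix.of fun i j => (List.ofFn fun s => X (i s) (j s)).reverse.prod

/-- The matrix `X` over `B` satisfies the relations `R X₁ X₂ = X₂ X₁ R`, `X C Xᵗ = C`,
`Xᵗ C X = C`, and fixes every tensor `E ∈ W`. -/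
structure IsPoint (R : Matrix (ι × ι) (ι × ι) ℂ) (C : Matrix ι ι ℂ) {k : ℕ}
    (W : Set ((Fin k → ι) → ℂ)) (X : Matrix ι ι B) : Prop where
  rtt : scal B R * leg12 X = leg21 X * scal B R
  orth₁ : X * scal B C * Xᵀ = scal B C
  orth₂ : Xᵀ * scal B C * X = scal B C
  det : ∀ E ∈ W, legs k X *ᵥ (fun j => algebraMap ℂ B (E j)) = fun i => algebraMap ℂ B (E i)

theorem scal_mul {m n p : Type} [Fintype n] (M : Matrix m n ℂ) (M' : Matrix n p ℂ) :
    scal B (M * M') = scal B M * scal B M' := by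
  simp [scal, Matrix.map_mul]

theorem scal_one : scal B (1 : Matrix ι ι ℂ) = 1 := by
  simp [scal]

theorem scal_comm_apply {m n : Type} (M : Matrix m n ℂ) (i : m) (j : n) (x : B) :
    scal B M i j * x = x * scal B M i j := by
  simp [scal, Algebra.commutes]

theorem leg12_mul {X Y : Matrix ι ι B} (h : ∀ a b c d, Commute (X a b) (Y c d)) :
    leg12 (X * Y) = leg12 X * leg12 Y := by
  ext ⟨a, b⟩ ⟨c, d⟩
  simp only [leg12, Matrix.of_apply, Matrix.mul_apply, Fintype.sum_prod_type, Finset.sum_mul_sum]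
  refine Finset.sum_congr rfl fun e _ => Finset.sum_congr rfl fun f _ => ?_
  rw [mul_assoc, ← mul_assoc (Y e c), ← (h b f e c).eq]
  simp only [mul_assoc]

theorem leg21_mul {X Y : Matrix ι ι B} (h : ∀ a b c d, Commute (X a b) (Y c d)) :
    leg21 (X * Y) = leg21 X * leg21 Y := by
  ext ⟨a, b⟩ ⟨c, d⟩
  simp only [leg21, Matrix.of_apply, Matrix.mul_apply, Fintype.sum_prod_type, Finset.sum_mul_sum]
  rw [Finset.sum_comm]
  refine Finset.sum_congr rfl fun e _ => Finset.sum_congr rfl fun f _ => ?_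
  rw [mul_assoc, ← mul_assoc (Y f d), ← (h a e f d).eq]
  simp only [mul_assoc]

theorem leg12_mul_leg21 {X Y : Matrix ι ι B} (h : X * Y = 1) : leg12 X * leg21 Y = 1 := by
  ext ⟨a, b⟩ ⟨c, d⟩
  have key : (leg12 X * leg21 Y) (a, b) (c, d) = ∑ e, X a e * (X * Y) b d * Y e c := by
    simp only [leg12, leg21, Matrix.of_apply, Matrix.mul_apply, Fintype.sum_prod_type,
      Finset.mul_sum, Finset.sum_mul, mul_assoc]
  rw [key, h]
  have h0 := congrFun (congrFun h a) c
  rw [Matrix.mul_apply] at h0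
  by_cases hbd : b = d
  · simp [hbd, h0, Matrix.one_apply]
  · simp [hbd]

theorem legs_zero (X : Matrix ι ι B) : legs 0 X = 1 := by
  ext i j
  have : i = j := Subsingleton.elim _ _
  subst this
  simp [legs]

theorem legs_succ_apply {k : ℕ} (X : Matrix ι ι B) (i j : Fin (k + 1) → ι) :
    legs (k + 1) X i j = X (i 0) (j 0) * legs k X (Fin.tail i) (Fin.tail j) := by
  simp [legs, List.ofFn_succ, Fin.tail]

theorem legsRev_succ_apply {k : ℕ} (X : Matrix ι ι B) (i j : Fin (k + 1) → ι) :
    legsRev (k + 1) X i j = legsRev k X (Fin.tail i) (Fin.tail j) * X (i 0) (j 0) := by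
  simp [legsRev, List.ofFn_succ, Fin.tail]

theorem sum_cons {k : ℕ} (f : (Fin (k + 1) → ι) → B) :
    ∑ l, f l = ∑ x : ι, ∑ l : Fin k → ι, f (Fin.cons x l) := by
  rw [← (Fin.consEquiv fun _ : Fin (k + 1) => ι).sum_comp, Fintype.sum_prod_type]
  rfl

theorem commute_legs {k : ℕ} {X : Matrix ι ι B} {y : B} (h : ∀ a b, Commute (X a b) y)
    (i j : Fin k → ι) : Commute (legs k X i j) y := by
  refine (Commute.list_prod_right _ _ fun x hx => ?_).symm
  obtain ⟨s, rfl⟩ := (List.mem_ofFn' _ _).1 hx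
  exact (h _ _).symm

theorem legs_mul {X Y : Matrix ι ι B} (h : ∀ a b c d, Commute (X a b) (Y c d)) (k : ℕ) :
    legs k (X * Y) = legs k X * legs k Y := by
  induction k with
  | zero => simp [legs_zero]
  | succ k ih =>
    ext i j
    rw [legs_succ_apply, ih, Matrix.mul_apply, Matrix.mul_apply, Matrix.mul_apply, sum_cons,
      Finset.sum_mul_sum]
    refine Finset.sum_congr rfl fun e _ => Finset.sum_congr rfl fun f _ => ?_
    rw [legs_succ_apply, legs_succ_apply]
    simp only [Fin.cons_zero, Fin.tail_cons]
    rw [mul_assoc, ← mul_assoc (Y e (j 0)),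
      ← (commute_legs (fun a b => h a b e (j 0)) (Fin.tail i) f).eq]
    simp only [mul_assoc]

theorem legs_one (k : ℕ) : legs k (1 : Matrix ι ι B) = 1 := by
  induction k with
  | zero => exact legs_zero _
  | succ k ih =>
    ext i j
    rw [legs_succ_apply, ih, Matrix.one_apply, Matrix.one_apply, Matrix.one_apply]
    have hij : i = j ↔ i 0 = j 0 ∧ Fin.tail i = Fin.tail j := by
      constructor
      · rintro rfl
        exact ⟨rfl, rfl⟩
      · rintro ⟨h0, h1⟩
        rw [← Fin.cons_self_tail i, ← Fin.cons_self_tail j, h0, h1]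
    by_cases h0 : i 0 = j 0 <;> by_cases h1 : Fin.tail i = Fin.tail j <;> simp [hij, h0, h1]

theorem legsRev_mul_legs {S X : Matrix ι ι B} (h : S * X = 1) (k : ℕ) :
    legsRev k S * legs k X = 1 := by
  induction k with
  | zero =>
    ext i j
    have : i = j := Subsingleton.elim _ _
    subst this
    simp [Matrix.mul_apply, legs, legsRev]
  | succ k ih =>
    ext i j
    have key : (legsRev (k + 1) S * legs (k + 1) X) i j =
        ∑ f, legsRev k S (Fin.tail i) f * (S * X) (i 0) (j 0) * legs k X f (Fin.tail j) := by
      rw [Matrix.mul_apply, sum_cons, Finset.sum_comm]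
      refine Finset.sum_congr rfl fun f _ => ?_
      rw [Matrix.mul_apply, Finset.mul_sum, Finset.sum_mul]
      refine Finset.sum_congr rfl fun e _ => ?_
      rw [legs_succ_apply, legsRev_succ_apply]
      simp only [Fin.cons_zero, Fin.tail_cons, mul_assoc]
    rw [key, h]
    have hij : i = j ↔ i 0 = j 0 ∧ Fin.tail i = Fin.tail j := by
      constructor
      · rintro rfl
        exact ⟨rfl, rfl⟩
      · rintro ⟨h0, h1⟩
        rw [← Fin.cons_self_tail i, ← Fin.cons_self_tail j, h0, h1]
    by_cases h0 : i 0 = j 0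
    · have := congrFun (congrFun ih (Fin.tail i)) (Fin.tail j)
      rw [Matrix.mul_apply] at this
      simp [h0, this, Matrix.one_apply, hij]
    · simp [h0, hij]

theorem IsPoint.map {R : Matrix (ι × ι) (ι × ι) ℂ} {C : Matrix ι ι ℂ} {k : ℕ}
    {W : Set ((Fin k → ι) → ℂ)} {X : Matrix ι ι B} (hX : IsPoint R C W X) (f : B →ₐ[ℂ] B') :
    IsPoint R C W (X.map f) := by
  have hs : ∀ {m n : Type} (M : Matrix m n ℂ), scal B' M = (scal B M).map f := by
    intro m n M
    ext i j
    simp [scal]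
  have h12 : leg12 (X.map f) = (leg12 X).map f := by
    ext i j
    simp [leg12]
  have h21 : leg21 (X.map f) = (leg21 X).map f := by
    ext i j
    simp [leg21]
  refine ⟨?_, ?_, ?_, ?_⟩
  · rw [hs, h12, h21, ← Matrix.map_mul, ← Matrix.map_mul, hX.rtt]
  · rw [hs, ← Matrix.transpose_map, ← Matrix.map_mul, ← Matrix.map_mul, hX.orth₁]
  · rw [hs, ← Matrix.transpose_map, ← Matrix.map_mul, ← Matrix.map_mul, hX.orth₂]
  · intro E hE
    ext i
    have h := congrArg f (congrFun (hX.det E hE) i)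
    simp only [Matrix.mulVec, dotProduct, map_sum, map_mul, AlgHom.commutes] at h ⊢
    rw [← h]
    refine Finset.sum_congr rfl fun j _ => ?_
    simp only [legs, Matrix.of_apply, map_list_prod, List.map_ofFn]
    rfl

theorem IsPoint.one (R : Matrix (ι × ι) (ι × ι) ℂ) (C : Matrix ι ι ℂ) {k : ℕ}
    (W : Set ((Fin k → ι) → ℂ)) : IsPoint R C W (1 : Matrix ι ι B) := by
  have h12 : leg12 (1 : Matrix ι ι B) = 1 := by
    ext ⟨a, b⟩ ⟨c, d⟩
    by_cases h0 : a = c <;> by_cases h1 : b = d <;> simp [leg12, Matrix.one_apply, h0, h1]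
  have h21 : leg21 (1 : Matrix ι ι B) = 1 := by
    ext ⟨a, b⟩ ⟨c, d⟩
    by_cases h0 : a = c <;> by_cases h1 : b = d <;> simp [leg21, Matrix.one_apply, h0, h1]
  refine ⟨?_, ?_, ?_, ?_⟩
  · rw [h12, h21, mul_one, one_mul]
  · simp
  · simp
  · intro E _
    rw [legs_one, Matrix.one_mulVec]

theorem transpose_mul_of_commute {X Y : Matrix ι ι B} (h : ∀ a b c d, Commute (X a b) (Y c d)) :
    (X * Y)ᵀ = Yᵀ * Xᵀ := by
  ext a b
  simp only [Matrix.transpose_apply, Matrix.mul_apply]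
  exact Finset.sum_congr rfl fun c _ => (h _ _ _ _).eq

theorem IsPoint.mul {R : Matrix (ι × ι) (ι × ι) ℂ} {C : Matrix ι ι ℂ} {k : ℕ}
    {W : Set ((Fin k → ι) → ℂ)} {X Y : Matrix ι ι B} (hX : IsPoint R C W X)
    (hY : IsPoint R C W Y) (h : ∀ a b c d, Commute (X a b) (Y c d)) : IsPoint R C W (X * Y) := by
  refine ⟨?_, ?_, ?_, ?_⟩
  · rw [leg12_mul h, leg21_mul h, ← mul_assoc, hX.rtt, mul_assoc, hY.rtt, mul_assoc]
  · rw [transpose_mul_of_commute h]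
    calc X * Y * scal B C * (Yᵀ * Xᵀ) = X * (Y * scal B C * Yᵀ) * Xᵀ := by simp only [mul_assoc]
      _ = scal B C := by rw [hY.orth₁, hX.orth₁]
  · rw [transpose_mul_of_commute h]
    calc Yᵀ * Xᵀ * scal B C * (X * Y) = Yᵀ * (Xᵀ * scal B C * X) * Y := by simp only [mul_assoc]
      _ = scal B C := by rw [hX.orth₂, hY.orth₂]
  · intro E hE
    rw [legs_mul h, ← Matrix.mulVec_mulVec, hY.det E hE, hX.det E hE]

end MatrixRelations

section FRTAlgebra

/-! ### The Hopf algebra generated by the entries of a universal point -/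

variable {ι : Type} [Fintype ι] [DecidableEq ι]

/-- The matrix of free generators. -/
def freeMat (ι : Type) : Matrix ι ι (FreeAlgebra ℂ (ι × ι)) :=
  Matrix.of fun a b => FreeAlgebra.ι ℂ (a, b)

/-- The defining relations of the algebra generated by a universal matrix `T` subject to
`R T₁ T₂ = T₂ T₁ R`, `T C Tᵗ = C`, `Tᵗ C T = C` and `T₁ ⋯ T_k E = E` for `E ∈ W`. -/
inductive Rel (R : Matrix (ι × ι) (ι × ι) ℂ) (C : Matrix ι ι ℂ) {k : ℕ}
    (W : Set ((Fin k → ι) → ℂ)) :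
    FreeAlgebra ℂ (ι × ι) → FreeAlgebra ℂ (ι × ι) → Prop
  | rtt (p r : ι × ι) :
      Rel R C W ((scal (FreeAlgebra ℂ (ι × ι)) R * leg12 (freeMat ι)) p r) ((leg21 (freeMat ι) * scal (FreeAlgebra ℂ (ι × ι)) R) p r)
  | orth₁ (a d : ι) :
      Rel R C W ((freeMat ι * scal (FreeAlgebra ℂ (ι × ι)) C * (freeMat ι)ᵀ) a d) (scal (FreeAlgebra ℂ (ι × ι)) C a d)
  | orth₂ (a d : ι) :
      Rel R C W (((freeMat ι)ᵀ * scal (FreeAlgebra ℂ (ι × ι)) C * freeMat ι) a d) (scal (FreeAlgebra ℂ (ι × ι)) C a d)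
  | det (E : (Fin k → ι) → ℂ) (hE : E ∈ W) (i : Fin k → ι) :
      Rel R C W ((legs k (freeMat ι) *ᵥ (fun j => algebraMap ℂ _ (E j))) i)
        (algebraMap ℂ _ (E i))

/-- The complex algebra generated by the entries of `T` subject to the relations `Rel`. -/
def FRTAlgebra (R : Matrix (ι × ι) (ι × ι) ℂ) (C : Matrix ι ι ℂ) {k : ℕ}
    (W : Set ((Fin k → ι) → ℂ)) : Type :=
  RingQuot (Rel R C W)

variable (R : Matrix (ι × ι) (ι × ι) ℂ) (C : Matrix ι ι ℂ) {k : ℕ} (W : Set ((Fin k → ι) → ℂ))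

instance : Ring (FRTAlgebra R C W) := inferInstanceAs (Ring (RingQuot (Rel R C W)))

instance : Algebra ℂ (FRTAlgebra R C W) := inferInstanceAs (Algebra ℂ (RingQuot (Rel R C W)))

/-- The quotient map from the free algebra. -/
def mkFRT : FreeAlgebra ℂ (ι × ι) →ₐ[ℂ] FRTAlgebra R C W :=
  RingQuot.mkAlgHom ℂ (Rel R C W)

/-- The matrix `T` of generators. -/
def univMat : Matrix ι ι (FRTAlgebra R C W) := (freeMat ι).map (mkFRT R C W)

theorem isPoint_univMat : IsPoint R C W (univMat R C W) := by
  have hrel : ∀ {x y}, Rel R C W x y → mkFRT R C W x = mkFRT R C W y :=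
    fun h => RingQuot.mkAlgHom_rel ℂ h
  have hs : ∀ {m n : Type} (M : Matrix m n ℂ),
      scal (FRTAlgebra R C W) M = (scal _ M).map (mkFRT R C W) := by
    intro m n M
    ext i j
    simp [scal]
  have h12 : leg12 (univMat R C W) = (leg12 (freeMat ι)).map (mkFRT R C W) := by
    ext i j
    simp [leg12, univMat]
  have h21 : leg21 (univMat R C W) = (leg21 (freeMat ι)).map (mkFRT R C W) := by
    ext i j
    simp [leg21, univMat]
  refine ⟨?_, ?_, ?_, ?_⟩
  · rw [hs, h12, h21, ← Matrix.map_mul, ← Matrix.map_mul]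
    ext p r
    exact hrel (Rel.rtt p r)
  · rw [hs, univMat, ← Matrix.transpose_map, ← Matrix.map_mul, ← Matrix.map_mul]
    ext a d
    exact hrel (Rel.orth₁ a d)
  · rw [hs, univMat, ← Matrix.transpose_map, ← Matrix.map_mul, ← Matrix.map_mul]
    ext a d
    exact hrel (Rel.orth₂ a d)
  · intro E hE
    ext i
    have h := hrel (Rel.det (R := R) (C := C) E hE i)
    simp only [Matrix.mulVec, dotProduct, map_sum, map_mul, AlgHom.commutes] at h ⊢
    rw [← h]
    refine Finset.sum_congr rfl fun j _ => ?_
    simp only [legs, Matrix.of_apply, map_list_prod, List.map_ofFn]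
    rfl

variable {R C W}

/-- The universal property: a point with values in `B` is an algebra map to `B`. -/
def liftFRT {B : Type*} [Ring B] [Algebra ℂ B] {X : Matrix ι ι B} (hX : IsPoint R C W X) :
    FRTAlgebra R C W →ₐ[ℂ] B :=
  RingQuot.liftAlgHom ℂ ⟨FreeAlgebra.lift ℂ fun p => X p.1 p.2, by
    set F : FreeAlgebra ℂ (ι × ι) →ₐ[ℂ] B := FreeAlgebra.lift ℂ fun p => X p.1 p.2 with hF
    have hX' : X = (freeMat ι).map F := by
      ext a b
      simp [freeMat, hF]
    have hs : ∀ {m n : Type} (M : Matrix m n ℂ), scal B M = (scal _ M).map F := by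
      intro m n M
      ext i j
      simp [scal]
    have h12 : leg12 X = (leg12 (freeMat ι)).map F := by
      rw [hX']
      ext i j
      simp [leg12]
    have h21 : leg21 X = (leg21 (freeMat ι)).map F := by
      rw [hX']
      ext i j
      simp [leg21]
    intro x y h
    cases h with
    | rtt p r =>
      have := hX.rtt
      rw [hs, h12, h21, ← Matrix.map_mul, ← Matrix.map_mul] at this
      exact congrFun (congrFun this p) r
    | orth₁ a d =>
      have := hX.orth₁
      rw [hs, hX', ← Matrix.transpose_map, ← Matrix.map_mul, ← Matrix.map_mul] at this
      exact congrFun (congrFun this a) d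
    | orth₂ a d =>
      have := hX.orth₂
      rw [hs, hX', ← Matrix.transpose_map, ← Matrix.map_mul, ← Matrix.map_mul] at this
      exact congrFun (congrFun this a) d
    | det E hE i =>
      have := congrFun (hX.det E hE) i
      simp only [Matrix.mulVec, dotProduct, map_sum, map_mul, AlgHom.commutes] at this ⊢
      rw [← this]
      refine Finset.sum_congr rfl fun j _ => ?_
      rw [hX']
      simp only [legs, Matrix.of_apply, map_list_prod, List.map_ofFn]
      rfl⟩

@[simp]
theorem liftFRT_univMat {B : Type*} [Ring B] [Algebra ℂ B] {X : Matrix ι ι B}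
    (hX : IsPoint R C W X) (a b : ι) : liftFRT hX (univMat R C W a b) = X a b := by
  have h : liftFRT hX (univMat R C W a b) =
      FreeAlgebra.lift ℂ (fun p : ι × ι => X p.1 p.2) (FreeAlgebra.ι ℂ (a, b)) :=
    RingQuot.liftAlgHom_mkAlgHom_apply ℂ _ _ _
  rw [h, FreeAlgebra.lift_ι_apply]

theorem algHom_ext {B : Type*} [Ring B] [Algebra ℂ B] {f g : FRTAlgebra R C W →ₐ[ℂ] B}
    (h : ∀ a b, f (univMat R C W a b) = g (univMat R C W a b)) : f = g := by
  refine RingQuot.ringQuot_ext' ℂ (s := Rel R C W) f g ?_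
  refine FreeAlgebra.hom_ext ?_
  funext p
  exact h p.1 p.2

theorem FRTAlgebra.induction {P : FRTAlgebra R C W → Prop}
    (hc : ∀ c : ℂ, P (algebraMap ℂ _ c)) (hT : ∀ a b, P (univMat R C W a b))
    (hadd : ∀ x y, P x → P y → P (x + y)) (hmul : ∀ x y, P x → P y → P (x * y))
    (x : FRTAlgebra R C W) : P x := by
  obtain ⟨y, rfl⟩ : ∃ y, mkFRT R C W y = x := RingQuot.mkAlgHom_surjective ℂ (Rel R C W) x
  induction y using FreeAlgebra.induction with
  | grade0 c => rw [AlgHom.commutes]; exact hc c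
  | grade1 p => exact hT p.1 p.2
  | mul a b ha hb => rw [map_mul]; exact hmul _ _ ha hb
  | add a b ha hb => rw [map_add]; exact hadd _ _ ha hb

/-- `T ⊗ T`, with entries `∑ c, T^a_c ⊗ T^c_b`. -/
def comulMat (R : Matrix (ι × ι) (ι × ι) ℂ) (C : Matrix ι ι ℂ) {k : ℕ}
    (W : Set ((Fin k → ι) → ℂ)) : Matrix ι ι (FRTAlgebra R C W ⊗[ℂ] FRTAlgebra R C W) :=
  Matrix.of fun a b => ∑ c, univMat R C W a c ⊗ₜ[ℂ] univMat R C W c b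

theorem comulMat_apply (a b : ι) :
    comulMat R C W a b = ∑ c, univMat R C W a c ⊗ₜ[ℂ] univMat R C W c b := rfl

theorem isPoint_comul : IsPoint R C W (comulMat R C W) := by
  have h := (isPoint_univMat R C W).map
    (Algebra.TensorProduct.includeLeft :
      FRTAlgebra R C W →ₐ[ℂ] FRTAlgebra R C W ⊗[ℂ] FRTAlgebra R C W)
  have h' := (isPoint_univMat R C W).map
    (Algebra.TensorProduct.includeRight :
      FRTAlgebra R C W →ₐ[ℂ] FRTAlgebra R C W ⊗[ℂ] FRTAlgebra R C W)
  have key := h.mul h' (fun a b c d => by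
    simp [Commute, SemiconjBy, Algebra.TensorProduct.tmul_mul_tmul])
  have e : comulMat R C W = (univMat R C W).map
      (Algebra.TensorProduct.includeLeft :
        FRTAlgebra R C W →ₐ[ℂ] FRTAlgebra R C W ⊗[ℂ] FRTAlgebra R C W) *
      (univMat R C W).map (Algebra.TensorProduct.includeRight :
        FRTAlgebra R C W →ₐ[ℂ] FRTAlgebra R C W ⊗[ℂ] FRTAlgebra R C W) := by
    ext a b
    rw [comulMat_apply]
    simp [Matrix.mul_apply, Algebra.TensorProduct.tmul_mul_tmul]
  rw [e]
  exact key

theorem isPoint_counit : IsPoint R C W (1 : Matrix ι ι ℂ) := IsPoint.one R C W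

/-- The coproduct `Δ(T^a_b) = ∑ c, T^a_c ⊗ T^c_b` and the counit `ε(T^a_b) = δ^a_b`. -/
instance : Bialgebra ℂ (FRTAlgebra R C W) :=
  Bialgebra.ofAlgHom (liftFRT isPoint_comul) (liftFRT isPoint_counit)
    (by
      refine algHom_ext fun a b => ?_
      simp only [AlgHom.comp_apply, liftFRT_univMat, comulMat_apply, map_sum,
        Algebra.TensorProduct.map_tmul, AlgHom.id_apply, TensorProduct.sum_tmul,
        TensorProduct.tmul_sum, AlgEquiv.coe_toAlgHom, Algebra.TensorProduct.assoc_tmul]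
      rw [Finset.sum_comm])
    (by
      refine algHom_ext fun a b => ?_
      simp only [AlgHom.comp_apply, liftFRT_univMat, comulMat_apply, map_sum,
        Algebra.TensorProduct.map_tmul, AlgHom.id_apply]
      simp [Matrix.one_apply, TensorProduct.ite_tmul])
    (by
      refine algHom_ext fun a b => ?_
      simp only [AlgHom.comp_apply, liftFRT_univMat, comulMat_apply, map_sum,
        Algebra.TensorProduct.map_tmul, AlgHom.id_apply]
      simp [Matrix.one_apply, TensorProduct.tmul_ite])

@[simp]
theorem comul_univMat (a b : ι) :
    Coalgebra.comul (R := ℂ) (univMat R C W a b) =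
      ∑ c, univMat R C W a c ⊗ₜ[ℂ] univMat R C W c b :=
  liftFRT_univMat isPoint_comul a b

@[simp]
theorem counit_univMat (a b : ι) :
    Coalgebra.counit (R := ℂ) (univMat R C W a b) = (1 : Matrix ι ι ℂ) a b :=
  liftFRT_univMat isPoint_counit a b


/-- `κ(T) = C Tᵗ C`. -/
def antipodeMat (R : Matrix (ι × ι) (ι × ι) ℂ) (C : Matrix ι ι ℂ) {k : ℕ}
    (W : Set ((Fin k → ι) → ℂ)) : Matrix ι ι (FRTAlgebra R C W) :=
  scal _ C * (univMat R C W)ᵀ * scal _ C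

theorem antipodeMat_mul (hC : C * C = 1) : antipodeMat R C W * univMat R C W = 1 := by
  have h := (isPoint_univMat R C W).orth₂
  have hC' : scal (FRTAlgebra R C W) C * scal _ C = 1 := by
    rw [← scal_mul, hC, scal_one]
  calc antipodeMat R C W * univMat R C W
      = scal _ C * ((univMat R C W)ᵀ * scal _ C * univMat R C W) := by
        simp only [antipodeMat, mul_assoc]
    _ = 1 := by rw [h, hC']

theorem mul_antipodeMat (hC : C * C = 1) : univMat R C W * antipodeMat R C W = 1 := by
  have h := (isPoint_univMat R C W).orth₁
  have hC' : scal (FRTAlgebra R C W) C * scal _ C = 1 := by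
    rw [← scal_mul, hC, scal_one]
  calc univMat R C W * antipodeMat R C W
      = (univMat R C W * scal _ C * (univMat R C W)ᵀ) * scal _ C := by
        simp only [antipodeMat, mul_assoc]
    _ = 1 := by rw [h, hC']

theorem antipodeMat_transpose :
    (antipodeMat R C W)ᵀ = scal _ Cᵀ * univMat R C W * scal _ Cᵀ := by
  ext a b
  simp only [antipodeMat, Matrix.transpose_apply, Matrix.mul_apply, Finset.sum_mul]
  rw [Finset.sum_comm]
  refine Finset.sum_congr rfl fun c _ => Finset.sum_congr rfl fun d _ => ?_
  simp only [scal, Matrix.map_apply, Matrix.transpose_apply]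
  rw [← Algebra.commutes (C d a), Algebra.commutes (C b c), mul_assoc]

theorem isPoint_antipode (hC : C * C = 1) :
    IsPoint R C W ((antipodeMat R C W).map (MulOpposite.op (α := FRTAlgebra R C W))) := by
  set S := antipodeMat R C W with hS
  set T := univMat R C W with hT
  have hP : IsPoint R C W T := isPoint_univMat R C W
  have hST : S * T = 1 := antipodeMat_mul hC
  have hTS : T * S = 1 := mul_antipodeMat hC
  have hCt : Cᵀ * Cᵀ = 1 := by rw [← Matrix.transpose_mul, hC, Matrix.transpose_one]
  have hC' : scal (FRTAlgebra R C W) C * scal _ C = 1 := by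
    rw [← scal_mul, hC, scal_one]
  have hCt' : scal (FRTAlgebra R C W) Cᵀ * scal _ Cᵀ = 1 := by
    rw [← scal_mul, hCt, scal_one]
  have hSt : Sᵀ = scal _ Cᵀ * T * scal _ Cᵀ := antipodeMat_transpose
  refine ⟨?_, ?_, ?_, ?_⟩
  · have h1 : leg12 S * leg21 T = 1 := leg12_mul_leg21 hST
    have h2 : leg12 T * leg21 S = 1 := leg12_mul_leg21 hTS
    have key : scal (FRTAlgebra R C W) R * leg21 S = leg12 S * scal _ R := by
      calc scal _ R * leg21 S = leg12 S * leg21 T * (scal _ R * leg21 S) := by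
            rw [h1, one_mul]
        _ = leg12 S * (leg21 T * scal _ R) * leg21 S := by simp only [mul_assoc]
        _ = leg12 S * (scal _ R * leg12 T) * leg21 S := by rw [hP.rtt]
        _ = leg12 S * scal _ R * (leg12 T * leg21 S) := by simp only [mul_assoc]
        _ = leg12 S * scal _ R := by rw [h2, mul_one]
    ext p r
    have := congrArg MulOpposite.op (congrFun (congrFun key p) r)
    simp only [Matrix.mul_apply, leg12, leg21, Matrix.of_apply, scal, Matrix.map_apply,
      Finset.op_sum, MulOpposite.op_mul] at this ⊢
    simp only [MulOpposite.algebraMap_apply]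
    convert this using 2 with x _ x _
    · simp only [← MulOpposite.op_mul, Algebra.commutes]
    · simp only [← MulOpposite.op_mul, Algebra.commutes]
  · have key : S * scal _ Cᵀ * Sᵀ = scal _ Cᵀ := by
      calc S * scal _ Cᵀ * Sᵀ
          = scal _ C * Tᵀ * scal _ C * (scal _ Cᵀ * scal _ Cᵀ) * T * scal _ Cᵀ := by
            rw [hSt, hS, antipodeMat, ← hT]
            simp only [mul_assoc]
        _ = scal _ C * (Tᵀ * scal _ C * T) * scal _ Cᵀ := by
            rw [hCt', mul_one]
            simp only [mul_assoc]
        _ = scal _ Cᵀ := by rw [hP.orth₂, hC', one_mul]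
    ext a d
    have := congrArg MulOpposite.op (congrFun (congrFun key d) a)
    simp only [Matrix.mul_apply, Matrix.transpose_apply, scal, Matrix.map_apply, Finset.sum_mul,
      Finset.op_sum, MulOpposite.op_mul] at this ⊢
    simp only [MulOpposite.algebraMap_apply]
    rw [← this, Finset.sum_comm]
    refine Finset.sum_congr rfl fun x _ => Finset.sum_congr rfl fun y _ => ?_
    simp only [← MulOpposite.op_mul, Algebra.commutes, mul_assoc]
  · have key : Sᵀ * scal _ Cᵀ * S = scal _ Cᵀ := by
      calc Sᵀ * scal _ Cᵀ * S
          = scal _ Cᵀ * T * (scal _ Cᵀ * scal _ Cᵀ) * scal _ C * Tᵀ * scal _ C := by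
            rw [hSt, hS, antipodeMat, ← hT]
            simp only [mul_assoc]
        _ = scal _ Cᵀ * (T * scal _ C * Tᵀ) * scal _ C := by
            rw [hCt', mul_one]
            simp only [mul_assoc]
        _ = scal _ Cᵀ := by rw [hP.orth₁, mul_assoc, hC', mul_one]
    ext a d
    have := congrArg MulOpposite.op (congrFun (congrFun key d) a)
    simp only [Matrix.mul_apply, Matrix.transpose_apply, scal, Matrix.map_apply, Finset.sum_mul,
      Finset.op_sum, MulOpposite.op_mul] at this ⊢
    simp only [MulOpposite.algebraMap_apply]
    rw [← this, Finset.sum_comm]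
    refine Finset.sum_congr rfl fun x _ => Finset.sum_congr rfl fun y _ => ?_
    simp only [← MulOpposite.op_mul, Algebra.commutes, mul_assoc]
  · intro E hE
    have key : legsRev k S *ᵥ (fun j => algebraMap ℂ _ (E j)) = fun i => algebraMap ℂ _ (E i) := by
      conv_lhs => rw [← hP.det E hE]
      rw [Matrix.mulVec_mulVec, legsRev_mul_legs hST, Matrix.one_mulVec]
    ext i
    have := congrArg MulOpposite.op (congrFun key i)
    simp only [Matrix.mulVec, dotProduct, Finset.op_sum] at this
    rw [MulOpposite.algebraMap_apply, ← this]
    simp only [Matrix.mulVec, dotProduct]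
    refine Finset.sum_congr rfl fun j _ => ?_
    rw [MulOpposite.algebraMap_apply, ← Algebra.commutes, MulOpposite.op_mul]
    congr 1
    simp only [legs, legsRev, Matrix.of_apply, Matrix.map_apply, MulOpposite.op_list_prod,
      List.map_reverse, List.reverse_reverse, List.map_ofFn]
    rfl

/-- The antipode, as an algebra map to the opposite algebra. -/
def antipodeHom (hC : C * C = 1) : FRTAlgebra R C W →ₐ[ℂ] (FRTAlgebra R C W)ᵐᵒᵖ :=
  liftFRT (isPoint_antipode hC)

/-- The antipode `κ`, an antimultiplicative linear map with `κ(T) = C Tᵗ C`. -/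
def antipodeLin (hC : C * C = 1) : FRTAlgebra R C W →ₗ[ℂ] FRTAlgebra R C W :=
  (MulOpposite.opLinearEquiv ℂ).symm.toLinearMap ∘ₗ (antipodeHom hC).toLinearMap

theorem antipodeLin_mul (hC : C * C = 1) (x y : FRTAlgebra R C W) :
    antipodeLin hC (x * y) = antipodeLin hC y * antipodeLin hC x := by
  simp [antipodeLin]

theorem antipodeLin_algebraMap (hC : C * C = 1) (c : ℂ) :
    antipodeLin hC (algebraMap ℂ (FRTAlgebra R C W) c) = algebraMap ℂ _ c := by
  simp [antipodeLin]

theorem antipodeLin_one (hC : C * C = 1) : antipodeLin hC (1 : FRTAlgebra R C W) = 1 := by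
  simp [antipodeLin]

theorem antipodeLin_univMat (hC : C * C = 1) (a b : ι) :
    antipodeLin hC (univMat R C W a b) = antipodeMat R C W a b := by
  simp [antipodeLin, antipodeHom]

/-- The Hopf algebra structure with antipode `κ(T) = C Tᵗ C`. -/
@[reducible]
def hopfFRT (hC : C * C = 1) : HopfAlgebra ℂ (FRTAlgebra R C W) where
  antipode := antipodeLin hC
  mul_antipode_rTensor_comul := by
    have hmul : ∀ u v : FRTAlgebra R C W ⊗[ℂ] FRTAlgebra R C W, ∀ c : ℂ,
        LinearMap.mul' ℂ _ ((antipodeLin hC).rTensor _ u) = algebraMap ℂ _ c →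
        LinearMap.mul' ℂ _ ((antipodeLin hC).rTensor _ (u * v)) =
          algebraMap ℂ _ c * LinearMap.mul' ℂ _ ((antipodeLin hC).rTensor _ v) := by
      intro u v c hu
      induction v using TensorProduct.induction_on with
      | zero => simp
      | add v w hv hw => rw [mul_add, map_add, map_add, map_add, map_add, mul_add, hv, hw]
      | tmul x y =>
        have : ∀ u : FRTAlgebra R C W ⊗[ℂ] FRTAlgebra R C W,
            LinearMap.mul' ℂ _ ((antipodeLin hC).rTensor _ (u * x ⊗ₜ[ℂ] y)) =
            antipodeLin hC x * LinearMap.mul' ℂ _ ((antipodeLin hC).rTensor _ u) * y := by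
          intro u
          induction u using TensorProduct.induction_on with
          | zero => simp
          | add v w hv hw => rw [add_mul, map_add, map_add, map_add, map_add, mul_add, add_mul,
              hv, hw]
          | tmul a b => simp [Algebra.TensorProduct.tmul_mul_tmul, antipodeLin_mul, mul_assoc]
        rw [this, hu, ← Algebra.commutes]
        simp [mul_assoc]
    ext x
    induction x using FRTAlgebra.induction with
    | hc c =>
      simp [Algebra.TensorProduct.algebraMap_apply, antipodeLin_algebraMap]
    | hT a b =>
      have h := congrFun (congrFun (antipodeMat_mul (R := R) (W := W) hC) a) b
      rw [Matrix.mul_apply] at h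
      simp [antipodeLin_univMat, h, Matrix.one_apply]
    | hadd x y hx hy =>
      simp only [map_add, hx, hy]
    | hmul x y hx hy =>
      simp only [LinearMap.comp_apply, Algebra.linearMap_apply] at hx hy ⊢
      rw [Bialgebra.comul_mul, hmul _ _ _ hx, hy, Bialgebra.counit_mul, map_mul]
  mul_antipode_lTensor_comul := by
    have hmul : ∀ u v : FRTAlgebra R C W ⊗[ℂ] FRTAlgebra R C W, ∀ c : ℂ,
        LinearMap.mul' ℂ _ ((antipodeLin hC).lTensor _ v) = algebraMap ℂ _ c →
        LinearMap.mul' ℂ _ ((antipodeLin hC).lTensor _ (u * v)) =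
          algebraMap ℂ _ c * LinearMap.mul' ℂ _ ((antipodeLin hC).lTensor _ u) := by
      intro u v c hv
      induction u using TensorProduct.induction_on with
      | zero => simp
      | add u w hu hw => rw [add_mul, map_add, map_add, map_add, map_add, mul_add, hu, hw]
      | tmul x y =>
        have : ∀ v : FRTAlgebra R C W ⊗[ℂ] FRTAlgebra R C W,
            LinearMap.mul' ℂ _ ((antipodeLin hC).lTensor _ (x ⊗ₜ[ℂ] y * v)) =
            x * LinearMap.mul' ℂ _ ((antipodeLin hC).lTensor _ v) * antipodeLin hC y := by
          intro v
          induction v using TensorProduct.induction_on with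
          | zero => simp
          | add v w hv hw => rw [mul_add, map_add, map_add, map_add, map_add, mul_add, add_mul,
              hv, hw]
          | tmul a b => simp [Algebra.TensorProduct.tmul_mul_tmul, antipodeLin_mul, mul_assoc]
        rw [this, hv, ← Algebra.commutes]
        simp [mul_assoc]
    ext x
    induction x using FRTAlgebra.induction with
    | hc c =>
      simp [Algebra.TensorProduct.algebraMap_apply, antipodeLin_one]
    | hT a b =>
      have h := congrFun (congrFun (mul_antipodeMat (R := R) (W := W) hC) a) b
      rw [Matrix.mul_apply] at h
      simp [antipodeLin_univMat, h, Matrix.one_apply]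
    | hadd x y hx hy =>
      simp only [map_add, hx, hy]
    | hmul x y hx hy =>
      simp only [LinearMap.comp_apply, Algebra.linearMap_apply] at hx hy ⊢
      rw [Bialgebra.comul_mul, hmul _ _ _ hy, hx, Bialgebra.counit_mul, map_mul,
        Algebra.commutes]

end FRTAlgebra

section SOq

/-! ### The quantum group `SO_q(N)`

Indices run over `Fin N = {0, …, N - 1}`; the primed index `a' = N + 1 - a` is `Fin.rev a`. -/

/-- Positive real deformation parameters. -/
abbrev PosReal : Type := {q : ℝ // 0 < q}

/-- The vector `ρ`: `(N/2 - 1, N/2 - 2, …, 1, 0, 0, -1, …, -N/2 + 1)` for `N` even and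
`(N/2 - 1, …, 1/2, 0, -1/2, …, -N/2 + 1)` for `N` odd. -/
def rho (N : ℕ) (a : Fin N) : ℝ :=
  if a < a.rev then (N : ℝ) / 2 - 1 - (a : ℕ)
  else if a.rev < a then -((N : ℝ) / 2 - 1 - (a.rev : ℕ))
  else 0

/-- The metric `C_{ab} = q^{-ρ_a} δ_{a b'}`. -/
def metricC (N : ℕ) (q : PosReal) : Matrix (Fin N) (Fin N) ℂ :=
  Matrix.of fun a b => if a = b.rev then (((q : ℝ) ^ (-rho N a) : ℝ) : ℂ) else 0

/-- The `R`-matrix of the orthogonal series; `matrixR N q (a, b) (c, d)` is `R^{ab}_{cd}`. -/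
def matrixR (N : ℕ) (q : PosReal) : Matrix (Fin N × Fin N) (Fin N × Fin N) ℂ :=
  Matrix.of fun p r =>
    let a := p.1
    let b := p.2
    let c := r.1
    let d := r.2
    let x : ℝ := q
    ((if c = a ∧ d = b then
        (if a = b then (if a = a.rev then 1 else x)
          else if b = a.rev then x⁻¹
          else 1)
      else if c = b ∧ d = a ∧ b < a ∧ b ≠ a.rev then x - x⁻¹
      else if b = a.rev ∧ c = a.rev ∧ d = a ∧ a.rev < a then
        (x - x⁻¹) * (1 - x ^ (rho N a - rho N a.rev))
      else if b = a.rev ∧ d = c.rev ∧ c < a ∧ c ≠ a.rev then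
        -(x - x⁻¹) * x ^ (rho N a - rho N c)
      else 0 : ℝ) : ℂ)

/-- The `q`-antisymmetric tensors of rank `N`: in every pair of neighbouring slots they lie in the
range of the `q`-antisymmetrizer, which is the eigenspace of `R̂`, `R̂^{ab}_{cd} = R^{ba}_{cd}`, for
the eigenvalue `-q⁻¹`. They are the multiples of the quantum epsilon tensor `ε_q^{i_1 … i_N}`, which
gives the top form of the `q`-exterior algebra. -/
def antisymTensors (N : ℕ) (q : PosReal) : Set ((Fin N → Fin N) → ℂ) :=
  {E | ∀ (s : ℕ) (hs : s + 1 < N) (i : Fin N → Fin N),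
    ∑ c, ∑ d, matrixR N q (i ⟨s + 1, hs⟩, i ⟨s, by omega⟩) (c, d) *
        E (Function.update (Function.update i ⟨s, by omega⟩ c) ⟨s + 1, hs⟩ d) =
      -(((q : ℝ)⁻¹ : ℝ) : ℂ) * E i}

/-- `SO_q(N)`: the algebra generated by the `T^a_b` with the `RTT` relations, the orthogonality
relations and `det_q T = 1`. As `T^{i_1}_{j_1} ⋯ T^{i_N}_{j_N} ε_q^{j_1 … j_N} =
ε_q^{i_1 … i_N} det_q T`, the last relation says that `T₁ ⋯ T_N` fixes the `q`-antisymmetric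
tensors. -/
abbrev SOq (N : ℕ) (q : PosReal) : Type :=
  FRTAlgebra (matrixR N q) (metricC N q) (antisymTensors N q)

/-- The matrix `T` of generators of `SO_q(N)`. -/
abbrev genT (N : ℕ) (q : PosReal) : Matrix (Fin N) (Fin N) (SOq N q) :=
  univMat (matrixR N q) (metricC N q) (antisymTensors N q)

theorem rho_rev (N : ℕ) (a : Fin N) : rho N a.rev = -rho N a := by
  unfold rho
  rcases lt_trichotomy a a.rev with h | h | h
  · simp [h, h.not_gt]
  · simp [← h]
  · simp [h, h.not_gt]

theorem metricC_mul_self (N : ℕ) (q : PosReal) : metricC N q * metricC N q = 1 := by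
  ext a b
  have hq : ((((q : ℝ) ^ (-rho N a) : ℝ) : ℂ)) * (((q : ℝ) ^ (rho N a) : ℝ) : ℂ) = 1 := by
    rw [← Complex.ofReal_mul, ← Real.rpow_add q.2]
    simp
  rw [Matrix.mul_apply, Finset.sum_eq_single a.rev]
  · by_cases h : a = b
    · subst h
      simp only [metricC, Matrix.of_apply, Fin.rev_rev, if_true, rho_rev, neg_neg,
        Matrix.one_apply_eq]
      exact hq
    · have h' : a.rev ≠ b.rev := fun e => h (Fin.rev_injective e)
      simp [metricC, h, h']
  · intro c _ hc
    have h' : a ≠ c.rev := fun e => hc (by rw [e, Fin.rev_rev])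
    simp [metricC, h']
  · simp

/-- The Hopf algebra structure of `SO_q(N)`: `Δ(T^a_b) = ∑ c, T^a_c ⊗ T^c_b`, `ε(T^a_b) = δ^a_b`,
`κ(T) = C Tᵗ C`. -/
instance (N : ℕ) (q : PosReal) : HopfAlgebra ℂ (SOq N q) := hopfFRT (metricC_mul_self N q)

/-- The matrix `P T Q`, for complex matrices `P` and `Q`. -/
def sandwich {N : ℕ} {q : PosReal} (P Q : Matrix (Fin N) (Fin N) ℂ) :
    Matrix (Fin N) (Fin N) (SOq N q) :=
  scal _ P * genT N q * scal _ Q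

end SOq

section Conjugations

/-! ### Star structures and real forms -/

variable {H : Type} [Ring H] [HopfAlgebra ℂ H]

/-- A conjugation (star structure) on a complex Hopf algebra: an antilinear, antimultiplicative,
involutive map that is compatible with the coproduct and the counit. -/
structure IsStarStructure (s : H →ₗ⋆[ℂ] H) : Prop where
  map_mul : ∀ x y, s (x * y) = s y * s x
  involutive : ∀ x, s (s x) = x
  comul : ∀ x, Coalgebra.comul (R := ℂ) (s x) = TensorProduct.map s s (Coalgebra.comul (R := ℂ) x)
  counit : ∀ x, Coalgebra.counit (R := ℂ) (s x) = conj (Coalgebra.counit (R := ℂ) x)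

/-- The composition `φ ∘ s` of a conjugation with a Hopf algebra automorphism. -/
def twist (φ : H ≃ₐc[ℂ] H) (s : H →ₗ⋆[ℂ] H) : H →ₗ⋆[ℂ] H where
  toFun x := φ (s x)
  map_add' x y := by simp
  map_smul' c x := by simp

/-- `t = α ∘ s ∘ α⁻¹` for a Hopf algebra automorphism `α`. -/
def StarEquivalent (s t : H →ₗ⋆[ℂ] H) : Prop :=
  ∃ α : H ≃ₐc[ℂ] H, ∀ x, t x = α (s (α.symm x))

/-- The equivalence relation given by `StarEquivalent`. -/
def starSetoid (H : Type) [Ring H] [HopfAlgebra ℂ H] : Setoid (H →ₗ⋆[ℂ] H) where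
  r := StarEquivalent
  iseqv :=
    { refl := fun s => ⟨BialgEquiv.refl ℂ H, fun x => rfl⟩
      symm := by
        rintro s t ⟨α, h⟩
        refine ⟨α.symm, fun x => ?_⟩
        have h1 : α.symm.symm x = α x := rfl
        have h2 : ∀ y, α.symm (α y) = y := fun y => α.left_inv y
        rw [h, h1, h2, h2]
      trans := by
        rintro s t u ⟨α, h⟩ ⟨β, h'⟩
        refine ⟨α.trans β, fun x => ?_⟩
        rw [h', h]
        rfl }

/-- `diag(1, …, 1, -1, …, -1)` with `l` entries `1`. -/
def signatureMatrix (N l : ℕ) : Matrix (Fin N) (Fin N) ℝ :=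
  Matrix.diagonal fun a => if (a : ℕ) < l then 1 else -1

/-- The group `SO(l, N - l)` of real matrices. -/
def realSO (N l : ℕ) : Set (Matrix (Fin N) (Fin N) ℝ) :=
  {g | gᵀ * signatureMatrix N l * g = signatureMatrix N l ∧ g.det = 1}

/-- The real points `{g ∈ SO(N, ℂ) | f^*(g) = conj (f(g)) for all f}` of a conjugation on the
undeformed algebra `SO_{q=1}(N)` of functions; a point `g`, i.e. a character `χ` of this algebra, is
represented by the matrix `T(g)`. -/
def realPoints {N : ℕ} (s : SOq N 1 →ₗ⋆[ℂ] SOq N 1) : Set (Matrix (Fin N) (Fin N) ℂ) :=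
  {g | ∃ χ : SOq N 1 →ₐ[ℂ] ℂ, (∀ f, χ (s f) = conj (χ f)) ∧ g = (genT N 1).map χ}

/-- The family of conjugations `s q` on `SO_q(N)`, `q > 0`, gives the real form `SO_q(l, m)`:
there is a linear transformation `T' = M T M⁻¹`, depending continuously on `q`, to generators that
are real for every `q`, in which the metric `C' = (M⁻¹)ᵗ C M⁻¹` becomes `diag(1, …, 1, -1, …, -1)`,
with `l` entries `1` and `m` entries `-1`, in the limit `q → 1`; and at `q = 1` the transformation
takes the group of real points of the conjugation onto `SO(l, m)`. -/
def GivesRealForm {N : ℕ} (s : ∀ q : PosReal, SOq N q →ₗ⋆[ℂ] SOq N q) (l m : ℕ) : Prop :=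
  l + m = N ∧ ∃ M : PosReal → Matrix (Fin N) (Fin N) ℂ,
    Continuous M ∧ (∀ q, IsUnit (M q)) ∧
    (∀ q, (sandwich (q := q) (M q) (M q)⁻¹).map (s q) = sandwich (M q) (M q)⁻¹) ∧
    Filter.Tendsto (fun q => ((M q)⁻¹)ᵀ * metricC N q * (M q)⁻¹) (nhds 1)
      (nhds ((signatureMatrix N l).map Complex.ofReal)) ∧
    (fun g => M 1 * g * (M 1)⁻¹) '' realPoints (s 1) =
      (fun g => g.map Complex.ofReal) '' realSO N l

/-- `a` is a middle index: `n` or `n + 1` for `N = 2n`, and `n + 1` for `N = 2n + 1`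
(counted from `1`). -/
def IsMiddle {N : ℕ} (a : Fin N) : Prop := (a : ℕ) = (N - 1) / 2 ∨ (a : ℕ) = N / 2

open Classical in
/-- The matrix `𝒟`: for `N = 2n` it exchanges the two middle indices; for `N = 2n + 1` it changes
the sign of the middle index. -/
def matD (N : ℕ) : Matrix (Fin N) (Fin N) ℂ :=
  Matrix.of fun a b =>
    if IsMiddle a then
      (if Even N then (if b = a.rev then 1 else 0) else (if b = a then -1 else 0))
    else (if b = a then 1 else 0)

/-- Sign vectors `(ε_1, …, ε_N)` with `ε_{j'} = ε_j` and middle entries equal to `1`. -/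
def SignVec (N : ℕ) : Type :=
  {ε : Fin N → ℤˣ // (∀ j, ε j.rev = ε j) ∧ ∀ j, IsMiddle j → ε j = 1}

/-- The matrix `𝒟' = diag(ε_1, …, ε_N)`. -/
def SignVec.mat {N : ℕ} (ε : SignVec N) : Matrix (Fin N) (Fin N) ℂ :=
  Matrix.diagonal fun j => ((ε.1 j : ℤ) : ℂ)

/-- The number of entries `ε_j = -1`. -/
def SignVec.negCount {N : ℕ} (ε : SignVec N) : ℕ :=
  (Finset.univ.filter fun j => ε.1 j = -1).card

/-- `diag(-1, …, -1, 1, …, 1)`, the first `n` entries of the `2n` being `-1`. -/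
def matA (N : ℕ) : Matrix (Fin N) (Fin N) ℂ :=
  Matrix.diagonal fun j => if (j : ℕ) < N / 2 then -1 else 1

end Conjugations

end QuantumOrthogonal

end

open QuantumOrthogonal

open scoped TensorProduct ComplexConjugate Matrix

set_option linter.unusedSectionVars false

noncomputable section

/-! An algebra map from `SO_q(N)` to an algebra is the same thing as a matrix satisfying the
defining relations (`liftFRT`). Automorphisms, conjugations, characters and skew derivations are
therefore all produced by showing that a suitable matrix is a point, and they are compared on the
entries of `T`. The determinant relation never needs an explicit epsilon tensor. A solution of the
RTT relation preserves `q`-antisymmetry (`slotOp_legs_mulVec`), and a `q`-antisymmetric tensor of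
rank `N` is determined by its component at `id` (`IsAntisym.eq_zero`).

Conjugation by `𝒟`, `𝒟'` or `A` is a Hopf automorphism because these matrices commute with `R` on
the two tensor factors and preserve the metric up to a sign (`IsSymmetry`). The conjugation `⋆` is a
point in the opposite algebra with conjugate scalars (`isPoint_star`): there the two legs are
exchanged, and `Cᵗ ⊗ Cᵗ` carries `R` to the `R`-matrix with exchanged factors.

For the real forms, conjugating by `diag(q^{-ρ/2})` turns `Cᵗ` into its value `J` at `q = 1`, which
reduces everything to one constant matrix. The rows `(e_a + e_{a'})/√2` and `i(e_a - e_{a'})/√2` are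
real and orthonormal for `J`, and they are eigenvectors of `𝒟𝒟'`; multiplying the rows of eigenvalue
`-1` by `i` gives the signature. At `q = 1` one has `R = 1` and the points are exactly the special
orthogonal matrices (`isPoint_one_iff`).

For the count at `N = 2n`, conjugation by `A` identifies the `n - 1` off-middle signs with their
negatives, which leaves at most `2^{n-2}` classes. The converse works in the dual. Each simple root
of `D_n` gives a character `κ` and a skew derivation `E` (`exists_isRootPair`). When `q ≠ 1` these
are the only skew derivations of their kind up to scalars (`IsSkew.exists_root`), so an automorphism
permutes them up to scalars and induces a diagram automorphism. Characters of order two show that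
the two fork nodes are preserved as a set, so all other nodes are fixed (`exists_root_pull_fixed`).
The commutator of `E` with its conjugate `E⋆` is a multiple of `κ - κ⋆`. If `E` is scaled by `z`,
then comparing two conjugations gives `η |z|² = 1`, where `η` is the ratio of the signs `ε_u ε_v`;
hence `η = 1` (`sign_eq_of_starEquivalent`). The products of neighbouring signs are thus invariants,
and they separate the `2^{n-2}` classes. -/

namespace QuantumOrthogonal

/-! ### Operators on neighbouring tensor slots -/

section SlotOperators

variable {ι : Type} [Fintype ι] [DecidableEq ι] {B : Type*} [Ring B] [Algebra ℂ B]
  {V : Type*} [AddCommGroup V] [Module ℂ V]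

/-- The matrix `P R`, with `P` the flip, acting on the slots `s`, `s + 1` of a tensor. -/
def slotOp (R : Matrix (ι × ι) (ι × ι) ℂ) {k : ℕ} (s : ℕ) (hs : s + 1 < k)
    (F : (Fin k → ι) → V) (i : Fin k → ι) : V :=
  ∑ c, ∑ d, R (i ⟨s + 1, hs⟩, i ⟨s, by omega⟩) (c, d) •
    F (Function.update (Function.update i ⟨s, by omega⟩ c) ⟨s + 1, hs⟩ d)

/-- This lemma and the next split off the first slot, in step with the recursion for `legs`; the
induction in `slotOp_legs_mulVec` then only meets a quadratic relation in slots `0` and `1`. -/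
theorem slotOp_zero_cons (R : Matrix (ι × ι) (ι × ι) ℂ) {k : ℕ} (F : (Fin (k + 2) → ι) → V)
    (x y : ι) (l : Fin k → ι) :
    slotOp R 0 (by omega) F (Fin.cons x (Fin.cons y l : Fin (k + 1) → ι)) =
      ∑ c, ∑ d, R (y, x) (c, d) • F (Fin.cons c (Fin.cons d l : Fin (k + 1) → ι)) := by
  unfold slotOp
  refine Finset.sum_congr rfl fun c _ => Finset.sum_congr rfl fun d _ => ?_
  have h0 : (⟨0, by omega⟩ : Fin (k + 2)) = 0 := rfl
  have h1 : (⟨0 + 1, by omega⟩ : Fin (k + 2)) = Fin.succ 0 := rfl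
  rw [h0, h1, Fin.update_cons_zero, ← Fin.cons_update, Fin.update_cons_zero]
  simp

theorem slotOp_succ_cons (R : Matrix (ι × ι) (ι × ι) ℂ) {k s : ℕ} (hs : s + 1 < k)
    (F : (Fin (k + 1) → ι) → V) (x : ι) (l : Fin k → ι) :
    slotOp R (s + 1) (by omega) F (Fin.cons x l : Fin (k + 1) → ι) =
      slotOp R s hs (fun l => F (Fin.cons x l : Fin (k + 1) → ι)) l := by
  unfold slotOp
  refine Finset.sum_congr rfl fun c _ => Finset.sum_congr rfl fun d _ => ?_
  have h0 : (⟨s + 1, by omega⟩ : Fin (k + 1)) = Fin.succ ⟨s, by omega⟩ := rfl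
  have h1 : (⟨s + 1 + 1, by omega⟩ : Fin (k + 1)) = Fin.succ ⟨s + 1, hs⟩ := rfl
  rw [h0, h1, ← Fin.cons_update, ← Fin.cons_update, Fin.cons_succ, Fin.cons_succ]

theorem slotOp_sum_mul (R : Matrix (ι × ι) (ι × ι) ℂ) {k s : ℕ} (hs : s + 1 < k) (X : ι → B)
    (F : ι → (Fin k → ι) → B) (i : Fin k → ι) :
    slotOp R s hs (fun l => ∑ y, X y * F y l) i = ∑ y, X y * slotOp R s hs (F y) i := by
  simp only [slotOp, Finset.smul_sum, Finset.mul_sum, mul_smul_comm]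
  simp only [← Finset.sum_product']
  exact Finset.sum_nbij' (fun p => (p.2.2, p.1, p.2.1)) (fun p => (p.2.1, p.2.2, p.1)) (by simp)
    (by simp) (by simp) (by simp) fun p _ => rfl

theorem slotOp_smul (R : Matrix (ι × ι) (ι × ι) ℂ) {k s : ℕ} (hs : s + 1 < k) (z : ℂ)
    (F : (Fin k → ι) → V) : slotOp R s hs (fun l => z • F l) = fun l => z • slotOp R s hs F l := by
  ext i
  simp only [slotOp, Finset.smul_sum, smul_comm z]

theorem slotOp_sub (R : Matrix (ι × ι) (ι × ι) ℂ) {k s : ℕ} (hs : s + 1 < k)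
    (F G : (Fin k → ι) → V) (i : Fin k → ι) :
    slotOp R s hs (fun l => F l - G l) i = slotOp R s hs F i - slotOp R s hs G i := by
  simp only [slotOp, smul_sub, Finset.sum_sub_distrib]

theorem legs_mulVec_cons {k : ℕ} (X : Matrix ι ι B) (F : (Fin (k + 1) → ι) → B) (x : ι)
    (l : Fin k → ι) :
    (legs (k + 1) X *ᵥ F) (Fin.cons x l : Fin (k + 1) → ι) =
      ∑ y, X x y * (legs k X *ᵥ fun l => F (Fin.cons y l : Fin (k + 1) → ι)) l := by
  simp only [Matrix.mulVec, dotProduct]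
  rw [sum_cons]
  refine Finset.sum_congr rfl fun y _ => ?_
  rw [Finset.mul_sum]
  refine Finset.sum_congr rfl fun j _ => ?_
  rw [legs_succ_apply]
  simp [mul_assoc]

/-- A solution of `R X₁ X₂ = X₂ X₁ R'` intertwines the slot operators of `R'` and `R`. -/
theorem slotOp_legs_mulVec {R R' : Matrix (ι × ι) (ι × ι) ℂ} {X : Matrix ι ι B}
    (h : scal B R * leg12 X = leg21 X * scal B R') {k : ℕ} :
    ∀ (s : ℕ) (hs : s + 1 < k) (F : (Fin k → ι) → B),
      slotOp R s hs (legs k X *ᵥ F) = legs k X *ᵥ slotOp R' s hs F := by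
  induction k with
  | zero => intro s hs; omega
  | succ k ih =>
    intro s hs F
    cases s with
    | succ s =>
      ext i
      rw [← Fin.cons_self_tail i, slotOp_succ_cons R (by omega : s + 1 < k), legs_mulVec_cons]
      simp_rw [legs_mulVec_cons, slotOp_succ_cons R' (by omega : s + 1 < k)]
      rw [slotOp_sum_mul]
      refine Finset.sum_congr rfl fun y _ => ?_
      rw [ih]
    | zero =>
      obtain ⟨k, rfl⟩ : ∃ m, k = m + 1 := ⟨k - 1, by omega⟩
      ext i
      obtain ⟨x, y, l, rfl⟩ : ∃ x y, ∃ l : Fin k → ι,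
          i = Fin.cons x (Fin.cons y l : Fin (k + 1) → ι) :=
        ⟨i 0, Fin.tail i 0, Fin.tail (Fin.tail i), by simp⟩
      rw [slotOp_zero_cons]
      simp only [legs_mulVec_cons]
      -- This is the quadratic relation read with the flip in front of `R`: the first index of `R`
      -- belongs to slot `s + 1`.
      have hR : ∀ z w, ∑ c, ∑ d, R (y, x) (c, d) • (X c z * X d w) =
          ∑ c, ∑ d, R' (c, d) (z, w) • (X x d * X y c) := by
        intro z w
        have := congrFun (congrFun h (y, x)) (z, w)
        simp only [Matrix.mul_apply, Fintype.sum_prod_type, leg12, leg21, scal, Matrix.of_apply,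
          Matrix.map_apply] at this
        simp only [Algebra.smul_def]
        rw [this]
        refine Finset.sum_congr rfl fun c _ => Finset.sum_congr rfl fun d _ => ?_
        rw [Algebra.commutes]
      set L : ι → ι → B := fun z w =>
        (legs k X *ᵥ fun l => F (Fin.cons z (Fin.cons w l : Fin (k + 1) → ι))) l with hL
      have e1 : ∀ c d, (legs k X *ᵥ fun l => slotOp R' 0 hs F
          (Fin.cons d (Fin.cons c l : Fin (k + 1) → ι))) l = ∑ z, ∑ w, R' (c, d) (z, w) • L z w := by
        intro c d
        simp only [slotOp_zero_cons, hL, Matrix.mulVec, dotProduct, Finset.mul_sum,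
          Finset.smul_sum, mul_smul_comm]
        rw [Finset.sum_comm]
        refine Finset.sum_congr rfl fun z _ => ?_
        rw [Finset.sum_comm]
      simp only [e1]
      calc _ = ∑ z, ∑ w, (∑ c, ∑ d, R (y, x) (c, d) • (X c z * X d w)) * L z w := by
            simp only [Finset.mul_sum, Finset.smul_sum, Finset.sum_mul]
            simp only [← Finset.sum_product']
            refine Finset.sum_nbij' (fun p => (p.2.2.1, p.2.2.2, p.1, p.2.1))
              (fun p => (p.2.2.1, p.2.2.2, p.1, p.2.1)) (by simp) (by simp) (by simp) (by simp)
              fun p _ => ?_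
            simp [hL, mul_assoc]
        _ = _ := by
            simp only [hR]
            simp only [Finset.mul_sum, Finset.sum_mul]
            simp only [← Finset.sum_product']
            refine Finset.sum_nbij' (fun p => (p.2.2.2, p.2.2.1, p.1, p.2.1))
              (fun p => (p.2.2.1, p.2.2.2, p.2.1, p.1)) (by simp) (by simp) (by simp) (by simp)
              fun p _ => ?_
            simp [mul_assoc]

end SlotOperators

/-! ### `q`-antisymmetric tensors with values in a module -/

section Antisymmetric

variable {N : ℕ} {q : PosReal} {V : Type*} [AddCommGroup V] [Module ℂ V]

/-- A tensor with values in `V` is `q`-antisymmetric in neighbouring slots. -/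
def IsAntisym (q : PosReal) (F : (Fin N → Fin N) → V) : Prop :=
  ∀ (s : ℕ) (hs : s + 1 < N) (i : Fin N → Fin N),
    slotOp (matrixR N q) s hs F i = (-(((q : ℝ)⁻¹ : ℝ) : ℂ)) • F i

theorem mem_antisymTensors {E : (Fin N → Fin N) → ℂ} :
    E ∈ antisymTensors N q ↔ IsAntisym q E := Iff.rfl

theorem isAntisym_algebraMap {B : Type*} [Ring B] [Algebra ℂ B] {E : (Fin N → Fin N) → ℂ}
    (hE : E ∈ antisymTensors N q) : IsAntisym q fun j => algebraMap ℂ B (E j) := by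
  intro s hs i
  have := congrArg (algebraMap ℂ B) (hE s hs i)
  simp only [slotOp, map_sum, map_mul, Algebra.smul_def] at this ⊢
  exact this

/-- The slot operators commute with `X₁ ⋯ X_N`, so their common eigenspace is preserved. -/
theorem IsAntisym.legs {B : Type*} [Ring B] [Algebra ℂ B] {X : Matrix (Fin N) (Fin N) B}
    (h : scal B (matrixR N q) * leg12 X = leg21 X * scal B (matrixR N q))
    {F : (Fin N → Fin N) → B} (hF : IsAntisym q F) : IsAntisym q (legs N X *ᵥ F) := by
  intro s hs i
  have e : slotOp (matrixR N q) s hs F = fun l => (-(((q : ℝ)⁻¹ : ℝ) : ℂ)) • F l :=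
    funext (hF s hs)
  rw [slotOp_legs_mulVec h, e]
  simp only [Matrix.mulVec, dotProduct, Finset.smul_sum, mul_smul_comm]

theorem IsAntisym.sub {F G : (Fin N → Fin N) → V} (hF : IsAntisym q F) (hG : IsAntisym q G) :
    IsAntisym q fun l => F l - G l := by
  intro s hs i
  rw [slotOp_sub, hF s hs, hG s hs, smul_sub]

end Antisymmetric

/-! ### The entries of the `R`-matrix -/

section RMatrix

/-- The diagonal entries `R^{ab}_{ab}`. -/
def rDiag (N : ℕ) (q : PosReal) (a b : Fin N) : ℝ :=
  if a = b then (if a = a.rev then 1 else q) else if b = a.rev then (q : ℝ)⁻¹ else 1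

/-- The entries of the `R`-matrix, as real numbers. -/
def realR (N : ℕ) (q : PosReal) (a b c d : Fin N) : ℝ :=
  (if c = a ∧ d = b then rDiag N q a b else 0) +
    (if c = b ∧ d = a ∧ b < a then (q : ℝ) - (q : ℝ)⁻¹ else 0) -
    (if b = a.rev ∧ d = c.rev ∧ c < a then
      ((q : ℝ) - (q : ℝ)⁻¹) * (q : ℝ) ^ (rho N a - rho N c) else 0)

/-- The entry `R^{aa'}_{a'a}` is the only place where the exchange term and the metric term overlap.
Its separate case in the definition is their sum, so the case distinction becomes a sum of three
independent terms. -/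
theorem matrixR_apply (N : ℕ) (q : PosReal) (a b c d : Fin N) :
    matrixR N q (a, b) (c, d) = (realR N q a b c d : ℂ) := by
  simp only [matrixR, Matrix.of_apply, realR, rDiag]
  congr 1
  by_cases h1 : c = a ∧ d = b
  · obtain ⟨rfl, rfl⟩ := h1
    have h2 : ¬ (c = d ∧ d = c ∧ d < c) := by rintro ⟨rfl, -, h⟩; exact lt_irrefl _ h
    simp [h2]
  · rw [if_neg h1, if_neg h1, zero_add]
    by_cases h2 : c = b ∧ d = a ∧ b < a
    · obtain ⟨rfl, rfl, h⟩ := h2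
      by_cases h3 : c = d.rev
      · have h4 : d.rev < d := h3 ▸ h
        simp [h3, h4, mul_sub]
      · simp [h, h3]
    · rw [if_neg h2, zero_sub]
      have h2' : ¬ (b = a.rev ∧ c = a.rev ∧ d = a ∧ a.rev < a) :=
        fun h => h2 ⟨h.2.1.trans h.1.symm, h.2.2.1, h.1 ▸ h.2.2.2⟩
      rw [if_neg (fun h => h2 ⟨h.1, h.2.1, h.2.2.1⟩), if_neg h2']
      by_cases h3 : b = a.rev ∧ d = c.rev ∧ c < a
      · have h4 : c ≠ a.rev := by
          rintro rfl
          exact h2 ⟨h3.1.symm, by simp [h3.2.1], h3.1 ▸ h3.2.2⟩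
        obtain ⟨h5, h6, h7⟩ := h3
        rw [if_pos ⟨h5, h6, h7, h4⟩, if_pos ⟨h5, h6, h7⟩, neg_mul]
      · rw [if_neg h3, if_neg (fun h => h3 ⟨h.1, h.2.1, h.2.2.1⟩), neg_zero]

theorem rDiag_pos (N : ℕ) (q : PosReal) (a b : Fin N) : 0 < rDiag N q a b := by
  unfold rDiag
  have := q.2
  split_ifs <;> positivity

theorem rDiag_comm (N : ℕ) (q : PosReal) (a b : Fin N) : rDiag N q a b = rDiag N q b a := by
  unfold rDiag
  have h : b = a.rev ↔ a = b.rev := ⟨fun h => by rw [h, Fin.rev_rev], fun h => by rw [h, Fin.rev_rev]⟩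
  by_cases h1 : a = b
  · subst h1; rfl
  · simp [h1, Ne.symm h1, h]

theorem rDiag_rev (N : ℕ) (q : PosReal) (a b : Fin N) :
    rDiag N q a.rev b.rev = rDiag N q a b := by
  unfold rDiag
  have h : b.rev = a ↔ b = a.rev := ⟨fun h => by rw [← h, Fin.rev_rev], fun h => by rw [h, Fin.rev_rev]⟩
  have h' : a.rev = a ↔ a = a.rev := eq_comm
  simp [Fin.rev_inj, h, h']

/-- `(Cᵗ ⊗ Cᵗ) R (Cᵗ ⊗ Cᵗ)` is the `R`-matrix with the two tensor factors exchanged. -/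
theorem realR_rev (N : ℕ) (q : PosReal) (a b c d : Fin N) :
    realR N q a.rev b.rev c.rev d.rev = realR N q b a d c := by
  unfold realR
  have h : ∀ x y : Fin N, x.rev = y ↔ x = y.rev := fun x y =>
    ⟨fun h => by rw [← h, Fin.rev_rev], fun h => by rw [h, Fin.rev_rev]⟩
  have h1 : (d = c.rev ↔ c = d.rev) :=
    ⟨fun h => by rw [h, Fin.rev_rev], fun h => by rw [h, Fin.rev_rev]⟩
  simp only [Fin.rev_lt_rev, rDiag_rev, Fin.rev_rev, h, rho_rev]
  congr 1
  · congr 1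
    · simp only [and_comm (a := c = a), rDiag_comm]
    · simp only [← and_assoc, and_comm (a := c = b)]
  · by_cases h2 : a = b.rev
    · by_cases h3 : c = d.rev
      · subst h2 h3
        simp [rho_rev, Fin.lt_rev_iff]
      · simp [h1, h3]
    · have : ¬ b = a.rev := fun e => h2 (by rw [e, Fin.rev_rev])
      simp [h2, this]

/-- The `R`-matrix preserves the weight. -/
theorem weight_eq_of_realR_ne_zero {N : ℕ} {q : PosReal} {a b c d : Fin N}
    (h : realR N q a b c d ≠ 0) {G : Type*} [CommMonoid G] {τ : Fin N → G}
    {z : G} (hτ : ∀ a, τ a * τ a.rev = z) : τ a * τ b = τ c * τ d := by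
  unfold realR at h
  by_cases h1 : c = a ∧ d = b
  · rw [h1.1, h1.2]
  by_cases h2 : c = b ∧ d = a ∧ b < a
  · rw [h2.1, h2.2.1, mul_comm]
  by_cases h3 : b = a.rev ∧ d = c.rev ∧ c < a
  · rw [h3.1, h3.2.1, hτ, hτ]
  · simp [h1, h2, h3] at h

end RMatrix

/-! ### One component determines an antisymmetric tensor of top rank -/

section Uniqueness

variable {N : ℕ} {q : PosReal} {V : Type*} [AddCommGroup V] [Module ℂ V]

/-- A tuple without a weak descent is a strictly increasing self-map of `Fin N`, and the identity is
the only one. -/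
theorem strictMono_or_exists_descent (i : Fin N → Fin N) :
    i = id ∨ ∃ (s : ℕ) (hs : s + 1 < N), i ⟨s + 1, hs⟩ ≤ i ⟨s, by omega⟩ := by
  by_cases h : ∃ (s : ℕ) (hs : s + 1 < N), i ⟨s + 1, hs⟩ ≤ i ⟨s, by omega⟩
  · exact Or.inr h
  · left
    push Not at h
    have hm : StrictMono i := by
      rcases N with - | N
      · exact fun a => a.elim0
      · rw [Fin.strictMono_iff_lt_succ]
        intro s
        exact h s (by omega)
    exact funext fun a => congrFun (congrArg DFunLike.coe
      (Subsingleton.elim (hm.orderIsoOfSurjective i (Finite.surjective_of_injective hm.injective))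
        (OrderIso.refl (Fin N)))) a

/-- A `q`-antisymmetric tensor of rank `N` is determined by one component. -/
theorem IsAntisym.eq_zero {F : (Fin N → Fin N) → V} (hF : IsAntisym q F) (h : F id = 0) :
    F = 0 := by
  have key : ∀ j : Lex (Fin N → Fin N), F (ofLex j) = 0 := by
    intro j
    induction j using WellFoundedLT.induction with
    | ind j ih =>
      set i := ofLex j with hi
      rcases strictMono_or_exists_descent i with hid | ⟨s, hs, hle⟩
      · rw [hid, h]
      -- Lowering the entry in slot `s` lowers the tuple lexicographically whatever stands in slot
      -- `s + 1`, so the induction hypothesis applies.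
      have hlt : ∀ c d, c < i ⟨s, by omega⟩ →
          F (Function.update (Function.update i ⟨s, by omega⟩ c) ⟨s + 1, hs⟩ d) = 0 := by
        intro c d hc
        refine ih (toLex (Function.update (Function.update i ⟨s, by omega⟩ c) ⟨s + 1, hs⟩ d)) ?_
        refine ⟨⟨s, by omega⟩, fun t ht => ?_, ?_⟩
        · have h1 : t ≠ ⟨s + 1, hs⟩ := by
            rintro rfl; simp [Fin.lt_def] at ht
          have h2 : t ≠ ⟨s, by omega⟩ := ht.ne
          change Function.update (Function.update i ⟨s, by omega⟩ c) ⟨s + 1, hs⟩ d t = i t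
          rw [Function.update_of_ne h1, Function.update_of_ne h2]
        · change Function.update (Function.update i ⟨s, by omega⟩ c) ⟨s + 1, hs⟩ d ⟨s, by omega⟩ <
            i ⟨s, by omega⟩
          rw [Function.update_of_ne (by simp [Fin.ext_iff]), Function.update_self]
          exact hc
      have hq := q.2
      have e := hF s hs i
      unfold slotOp at e
      -- At a weak descent every nonzero entry of `R̂` leads to a smaller tuple, except the diagonal
      -- one when the two indices agree. The eigenvalue equation thus reduces to a scalar multiple
      -- of `F i`.
      have hz : ∀ c d, c ≠ i ⟨s, by omega⟩ ∨ d ≠ i ⟨s + 1, hs⟩ ∨ i ⟨s + 1, hs⟩ ≠ i ⟨s, by omega⟩ →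
          matrixR N q (i ⟨s + 1, hs⟩, i ⟨s, by omega⟩) (c, d) •
          F (Function.update (Function.update i ⟨s, by omega⟩ c) ⟨s + 1, hs⟩ d) = 0 := by
        intro c d hcd
        by_cases hc : c < i ⟨s, by omega⟩
        · rw [hlt c d hc, smul_zero]
        · have : realR N q (i ⟨s + 1, hs⟩) (i ⟨s, by omega⟩) c d = 0 := by
            unfold realR
            rw [if_neg, if_neg, if_neg, add_zero, sub_zero]
            · rintro ⟨-, -, h⟩
              exact hc (h.trans_le hle)
            · rintro ⟨-, -, h⟩
              exact h.not_ge hle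
            · rintro ⟨h1, h2⟩
              have h3 : i ⟨s + 1, hs⟩ = i ⟨s, by omega⟩ :=
                le_antisymm hle (not_lt.1 (h1 ▸ hc))
              rw [h1, h2] at hcd
              simp [h3] at hcd
          rw [matrixR_apply, this, Complex.ofReal_zero, zero_smul]
      by_cases hab : i ⟨s + 1, hs⟩ = i ⟨s, by omega⟩
      · rw [Finset.sum_eq_single (i ⟨s, by omega⟩)
          (fun c _ hc => Finset.sum_eq_zero fun d _ => hz c d (Or.inl hc)) (by simp),
          Finset.sum_eq_single (i ⟨s + 1, hs⟩) (fun d _ hd => hz _ d (Or.inr (Or.inl hd))) (by simp),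
          Function.update_eq_self, Function.update_eq_self, matrixR_apply] at e
        have h0 : realR N q (i ⟨s + 1, hs⟩) (i ⟨s, by omega⟩) (i ⟨s, by omega⟩) (i ⟨s + 1, hs⟩) =
            rDiag N q (i ⟨s, by omega⟩) (i ⟨s, by omega⟩) := by
          rw [hab]; simp [realR]
        rw [h0, ← sub_eq_zero, ← sub_smul] at e
        refine (smul_eq_zero.1 e).resolve_left ?_
        have := rDiag_pos N q (i ⟨s, by omega⟩) (i ⟨s, by omega⟩)
        -- The equation reads `(rDiag + q⁻¹) F i = 0`, and both summands are positive.
        have h2 : rDiag N q (i ⟨s, by omega⟩) (i ⟨s, by omega⟩) + (q : ℝ)⁻¹ ≠ 0 := by positivity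
        rw [sub_neg_eq_add, ← Complex.ofReal_add]
        exact_mod_cast h2
      · rw [Finset.sum_eq_zero fun c _ => Finset.sum_eq_zero fun d _ =>
          hz c d (Or.inr (Or.inr hab))] at e
        refine (smul_eq_zero.1 e.symm).resolve_left ?_
        have h2 : (q : ℝ)⁻¹ ≠ 0 := by positivity
        rw [neg_eq_zero]
        exact_mod_cast h2
  exact funext fun i => key (toLex i)

/-- Every use of the determinant relation goes through this comparison of a single component; the
values lie in an arbitrary module, so it also applies over noncommutative algebras. -/
theorem IsAntisym.ext {F G : (Fin N → Fin N) → V} (hF : IsAntisym q F) (hG : IsAntisym q G)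
    (h : F id = G id) : F = G := by
  have := (hF.sub hG).eq_zero (sub_eq_zero.2 h)
  exact funext fun i => sub_eq_zero.1 (congrFun this i)

theorem legs_diagonal {ι : Type} [Fintype ι] [DecidableEq ι] {B : Type*} [Ring B] [Algebra ℂ B]
    (τ : ι → B) (k : ℕ) :
    legs k (Matrix.diagonal τ) = Matrix.diagonal fun i => (List.ofFn fun s => τ (i s)).prod := by
  ext i j
  by_cases hij : i = j
  · subst hij
    simp [legs]
  · rw [Matrix.diagonal_apply_ne _ hij]
    obtain ⟨s, hs⟩ := Function.ne_iff.1 hij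
    induction k with
    | zero => exact s.elim0
    | succ k ih =>
      rw [legs_succ_apply]
      by_cases h0 : i 0 = j 0
      · have hs0 : s ≠ 0 := by rintro rfl; exact hs h0
        obtain ⟨t, rfl⟩ := Fin.exists_succ_eq.2 hs0
        rw [ih (Fin.tail i) (Fin.tail j) (fun h => hs (congrFun h t)) t hs, mul_zero]
      · rw [Matrix.diagonal_apply_ne _ h0, zero_mul]

/-- A nonzero entry `R^{ab}_{cd}` satisfies `τ_a τ_b = τ_c τ_d`, since either the pair is merely
permuted or both pairs have the form `(x, x')` with `τ_x τ_{x'} = z`. -/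
theorem scal_matrixR_mul_leg12_diagonal {B : Type*} [CommRing B] [Algebra ℂ B] {τ : Fin N → B}
    {z : B} (hτ : ∀ a, τ a * τ a.rev = z) :
    scal B (matrixR N q) * leg12 (Matrix.diagonal τ) =
      leg21 (Matrix.diagonal τ) * scal B (matrixR N q) := by
  have h12 : leg12 (Matrix.diagonal τ) = Matrix.diagonal fun p : Fin N × Fin N => τ p.1 * τ p.2 := by
    ext ⟨a, b⟩ ⟨c, d⟩
    by_cases h1 : a = c <;> by_cases h2 : b = d <;> simp [leg12, h1, h2, Matrix.diagonal]
  have h21 : leg21 (Matrix.diagonal τ) = Matrix.diagonal fun p : Fin N × Fin N => τ p.1 * τ p.2 := by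
    ext ⟨a, b⟩ ⟨c, d⟩
    by_cases h1 : a = c <;> by_cases h2 : b = d <;> simp [leg21, h1, h2, Matrix.diagonal, mul_comm]
  rw [h12, h21]
  ext ⟨a, b⟩ ⟨c, d⟩
  rw [Matrix.mul_diagonal, Matrix.diagonal_mul]
  by_cases h : realR N q a b c d = 0
  · simp [scal, matrixR_apply, h]
  · rw [weight_eq_of_realR_ne_zero h hτ, mul_comm]

/-- The factors at `a` and `a'` cancel; only a fixed index `a = a'` is left over, which is why its
weight must be assumed to be `1`. -/
theorem prod_eq_one_of_mul_rev {B : Type*} [CommRing B] [NoZeroDivisors B] {τ : Fin N → B}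
    (hτ : ∀ a, τ a * τ a.rev = 1) (hm : ∀ a : Fin N, a = a.rev → τ a = 1) : ∏ a, τ a = 1 := by
  refine Finset.prod_involution (fun a _ => a.rev) (fun a _ => hτ a) ?_ (by simp) (by simp)
  intro a _ ha he
  exact ha (hm a he.symm)

/-- The components of a `q`-antisymmetric tensor of rank `N` have weight zero. -/
theorem prod_eq_one_of_antisym_ne_zero {E : (Fin N → Fin N) → ℂ} (hE : E ∈ antisymTensors N q)
    {τ : Fin N → ℂ} (hτ : ∀ a, τ a * τ a.rev = 1) (hm : ∀ a : Fin N, a = a.rev → τ a = 1)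
    {i : Fin N → Fin N} (hi : E i ≠ 0) : ∏ s, τ (i s) = 1 := by
  have h1 : IsAntisym q (legs N (Matrix.diagonal τ) *ᵥ E) :=
    IsAntisym.legs (scal_matrixR_mul_leg12_diagonal hτ) (mem_antisymTensors.1 hE)
  rw [legs_diagonal] at h1
  -- The torus element acts on the component at `id` by the product of all weights, which is `1`.
  -- Hence it fixes the whole tensor.
  have h2 := h1.ext (mem_antisymTensors.1 hE) (by
    rw [Matrix.mulVec_diagonal, List.prod_ofFn]
    simp [prod_eq_one_of_mul_rev hτ hm])
  have h3 := congrFun h2 i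
  rw [Matrix.mulVec_diagonal, List.prod_ofFn] at h3
  exact mul_right_cancel₀ hi (h3.trans (one_mul _).symm)

end Uniqueness

/-! ### Automorphisms `T ↦ P T P⁻¹` -/

section Sandwich

variable {ι : Type} [Fintype ι] [DecidableEq ι] {B : Type*} [Ring B] [Algebra ℂ B]

theorem commute_scal_left {ι' κ' : Type} (M : Matrix ι' κ' ℂ) (a : ι') (b : κ') (x : B) :
    Commute (scal B M a b) x := scal_comm_apply M a b x

theorem scal_transpose {m n : Type} (M : Matrix m n ℂ) : (scal B M)ᵀ = scal B Mᵀ := rfl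

theorem scal_smul {m n : Type} (z : ℂ) (M : Matrix m n ℂ) : scal B (z • M) = z • scal B M := by
  ext i j
  simp [scal, Algebra.smul_def]

theorem leg12_scal (P : Matrix ι ι ℂ) : leg12 (scal B P) = scal B (leg12 P) := by
  ext i j
  simp [leg12, scal]

theorem leg21_scal (P : Matrix ι ι ℂ) : leg21 (scal B P) = scal B (leg21 P) := by
  ext i j
  simp [leg21, scal]

theorem legs_scal (k : ℕ) (P : Matrix ι ι ℂ) : legs k (scal B P) = scal B (legs k P) := by
  ext i j
  simp only [legs, scal, Matrix.of_apply, Matrix.map_apply, map_list_prod, List.map_ofFn]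
  rfl

theorem scal_complex {m n : Type} (M : Matrix m n ℂ) : scal ℂ M = M := by
  ext i j
  simp [scal]

theorem leg21_eq_leg12 {B : Type*} [CommRing B] [Algebra ℂ B] (P : Matrix ι ι B) :
    leg21 P = leg12 P := by
  ext i j
  simp [leg12, leg21, mul_comm]

theorem scal_mulVec_algebraMap {m n : Type} [Fintype n] (M : Matrix m n ℂ) (E : n → ℂ) :
    scal B M *ᵥ (fun j => algebraMap ℂ B (E j)) = fun i => algebraMap ℂ B ((M *ᵥ E) i) := by
  ext i
  simp [Matrix.mulVec, dotProduct, scal]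

theorem rtt_mul {R R' R'' : Matrix (ι × ι) (ι × ι) ℂ} {X Y : Matrix ι ι B}
    (hX : scal B R * leg12 X = leg21 X * scal B R') (hY : scal B R' * leg12 Y = leg21 Y * scal B R'')
    (h : ∀ a b c d, Commute (X a b) (Y c d)) :
    scal B R * leg12 (X * Y) = leg21 (X * Y) * scal B R'' := by
  rw [leg12_mul h, leg21_mul h, ← mul_assoc, hX, mul_assoc, hY, mul_assoc]

theorem rtt_scal {R R' : Matrix (ι × ι) (ι × ι) ℂ} {P : Matrix ι ι ℂ}
    (h : R * leg12 P = leg12 P * R') :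
    scal B R * leg12 (scal B P) = leg21 (scal B P) * scal B R' := by
  rw [leg12_scal, leg21_scal, leg21_eq_leg12, ← scal_mul, ← scal_mul, h]

theorem transpose_scal_mul {m : Type} [Fintype m] {n p : Type} (P : Matrix n m ℂ) (X : Matrix m p B) :
    (scal B P * X)ᵀ = Xᵀ * scal B Pᵀ := by
  ext a b
  simp only [Matrix.transpose_apply, Matrix.mul_apply]
  exact Finset.sum_congr rfl fun c _ => (commute_scal_left _ _ _ _).eq

theorem transpose_mul_scal {m : Type} [Fintype m] {n p : Type} (X : Matrix n m B) (P : Matrix m p ℂ) :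
    (X * scal B P)ᵀ = scal B Pᵀ * Xᵀ := by
  ext a b
  simp only [Matrix.transpose_apply, Matrix.mul_apply]
  exact Finset.sum_congr rfl fun c _ => ((commute_scal_left _ _ _ _).eq).symm

/-- `P` is invertible with inverse `Q`, commutes with the `R`-matrix, and preserves the metric up to
a sign `η`. -/
structure IsSymmetry (R : Matrix (ι × ι) (ι × ι) ℂ) (C P Q : Matrix ι ι ℂ) (η : ℂ) : Prop where
  mul : P * Q = 1
  rtt : R * leg12 P = leg12 P * R
  orth : P * C * Pᵀ = η • C
  sign : η * η = 1

variable {R : Matrix (ι × ι) (ι × ι) ℂ} {C P Q : Matrix ι ι ℂ} {η : ℂ}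

theorem IsSymmetry.mul' (h : IsSymmetry R C P Q η) : Q * P = 1 := mul_eq_one_comm.1 h.mul

theorem IsSymmetry.symm (h : IsSymmetry R C P Q η) : IsSymmetry R C Q P η where
  mul := h.mul'
  rtt := by
    have h1 : leg12 P * leg12 Q = 1 := by
      have := leg12_mul_leg21 h.mul
      rwa [leg21_eq_leg12] at this
    have h2 : leg12 Q * leg12 P = 1 := mul_eq_one_comm.1 h1
    calc R * leg12 Q = leg12 Q * leg12 P * R * leg12 Q := by rw [h2, one_mul]
      _ = leg12 Q * (R * leg12 P) * leg12 Q := by rw [h.rtt]; simp only [mul_assoc]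
      _ = leg12 Q * R * (leg12 P * leg12 Q) := by simp only [mul_assoc]
      _ = leg12 Q * R := by rw [h1, mul_one]
  orth := by
    have h1 : Pᵀ * Qᵀ = 1 := by rw [← Matrix.transpose_mul, h.mul', Matrix.transpose_one]
    calc Q * C * Qᵀ = Q * ((η * η) • C) * Qᵀ := by rw [h.sign, one_smul]
      _ = η • (Q * (P * C * Pᵀ) * Qᵀ) := by
        rw [h.orth]; simp only [mul_smul, Matrix.mul_smul, Matrix.smul_mul]
      _ = η • ((Q * P) * C * (Pᵀ * Qᵀ)) := by simp only [mul_assoc]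
      _ = η • C := by rw [h.mul', h1, one_mul, mul_one]
  sign := h.sign

theorem IsSymmetry.orth' (h : IsSymmetry R C P Q η) (hC : C * C = 1) : Pᵀ * C * P = η • C := by
  have h1 : (C * Pᵀ) * (η • (C * P)) = 1 := by
    rw [mul_eq_one_comm]
    calc η • (C * P) * (C * Pᵀ) = η • (C * (P * C * Pᵀ)) := by
          rw [Matrix.smul_mul]; simp only [mul_assoc]
      _ = 1 := by rw [h.orth, Matrix.mul_smul, smul_smul, hC, h.sign, one_smul]
  calc Pᵀ * C * P = (C * C) * (Pᵀ * C * P) := by rw [hC, one_mul]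
    _ = (η * η) • ((C * C) * (Pᵀ * C * P)) := by rw [h.sign, one_smul]
    _ = η • (C * ((C * Pᵀ) * (η • (C * P)))) := by
      rw [mul_smul]; simp only [Matrix.mul_smul, mul_assoc]
    _ = η • C := by rw [h1, mul_one]

/-- The sign `η` enters the orthogonality relations once through `P` and once through `Q`, so it
cancels; this permits `P = A`, for which `η = -1`. For the determinant relation, `Q` moves a tensor
within `W`, the point fixes it, and `P` moves it back. -/
theorem IsPoint.sandwich (h : IsSymmetry R C P Q η) (hC : C * C = 1) {k : ℕ}
    {W : Set ((Fin k → ι) → ℂ)} (hW : ∀ E ∈ W, legs k Q *ᵥ E ∈ W) {X : Matrix ι ι B}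
    (hX : IsPoint R C W X) : IsPoint R C W (scal B P * X * scal B Q) := by
  have hc1 : ∀ a b c d, Commute (scal B P a b) (X c d) := fun _ _ _ _ => commute_scal_left _ _ _ _
  have hc2 : ∀ a b c d, Commute ((scal B P * X) a b) (scal B Q c d) :=
    fun _ _ _ _ => (commute_scal_left _ _ _ _).symm
  refine ⟨?_, ?_, ?_, ?_⟩
  · exact rtt_mul (rtt_mul (rtt_scal h.rtt) hX.rtt hc1) (rtt_scal h.symm.rtt) hc2
  · rw [transpose_mul_scal, transpose_scal_mul]
    calc scal B P * X * scal B Q * scal B C * (scal B Qᵀ * (Xᵀ * scal B Pᵀ))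
        = scal B P * (X * scal B (Q * C * Qᵀ) * Xᵀ) * scal B Pᵀ := by
          simp only [scal_mul, mul_assoc]
      _ = scal B C := by
          rw [h.symm.orth, scal_smul, Matrix.mul_smul, Matrix.smul_mul, hX.orth₁, Matrix.mul_smul,
            Matrix.smul_mul, ← scal_mul, ← scal_mul, h.orth, scal_smul, smul_smul, h.sign, one_smul]
  · rw [transpose_mul_scal, transpose_scal_mul]
    calc scal B Qᵀ * (Xᵀ * scal B Pᵀ) * scal B C * (scal B P * X * scal B Q)
        = scal B Qᵀ * (Xᵀ * scal B (Pᵀ * C * P) * X) * scal B Q := by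
          simp only [scal_mul, mul_assoc]
      _ = scal B C := by
          rw [h.orth' hC, scal_smul, Matrix.mul_smul, Matrix.smul_mul, hX.orth₂, Matrix.mul_smul,
            Matrix.smul_mul, ← scal_mul, ← scal_mul, h.symm.orth' hC, scal_smul, smul_smul, h.sign,
            one_smul]
  · intro E hE
    have h1 : legs k P * legs k Q = 1 := by
      rw [← legs_mul (fun _ _ _ _ => Commute.all _ _), h.mul, legs_one]
    rw [legs_mul hc2, legs_mul hc1, legs_scal, legs_scal, ← Matrix.mulVec_mulVec,
      scal_mulVec_algebraMap, ← Matrix.mulVec_mulVec, hX.det _ (hW E hE), scal_mulVec_algebraMap,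
      Matrix.mulVec_mulVec, h1, Matrix.one_mulVec]

theorem map_sandwich {A A' : Type*} [Ring A] [Algebra ℂ A] [Ring A'] [Algebra ℂ A']
    (f : A →ₐ[ℂ] A') (P Q : Matrix ι ι ℂ) (X : Matrix ι ι A) :
    (scal A P * X * scal A Q).map f = scal A' P * X.map f * scal A' Q := by
  have hs : ∀ M : Matrix ι ι ℂ, (scal A M).map f = scal A' M := by
    intro M
    ext i j
    simp [scal]
  rw [Matrix.map_mul, Matrix.map_mul, hs, hs]

end Sandwich

/-! ### Hopf automorphisms of `SO_q(N)` given by symmetries of `R` and `C` -/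

section ConjAut

variable {N : ℕ} {q : PosReal} {P Q : Matrix (Fin N) (Fin N) ℂ} {η : ℂ}

theorem IsSymmetry.legs_mem (h : IsSymmetry (matrixR N q) (metricC N q) P Q η)
    (E : (Fin N → Fin N) → ℂ) (hE : E ∈ antisymTensors N q) :
    legs N P *ᵥ E ∈ antisymTensors N q := by
  refine IsAntisym.legs ?_ (mem_antisymTensors.1 hE)
  rw [scal_complex, leg21_eq_leg12, h.rtt]

theorem isPoint_sandwich (h : IsSymmetry (matrixR N q) (metricC N q) P Q η) :
    IsPoint (matrixR N q) (metricC N q) (antisymTensors N q) (sandwich (q := q) P Q) :=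
  IsPoint.sandwich h (metricC_mul_self N q) h.symm.legs_mem (isPoint_univMat _ _ _)

/-- The algebra endomorphism `T ↦ P T P⁻¹`. -/
def conjHom (h : IsSymmetry (matrixR N q) (metricC N q) P Q η) : SOq N q →ₐ[ℂ] SOq N q :=
  liftFRT (isPoint_sandwich h)

theorem map_conjHom (h : IsSymmetry (matrixR N q) (metricC N q) P Q η) :
    (genT N q).map (conjHom h) = sandwich P Q := by
  ext a b
  exact liftFRT_univMat _ a b

theorem algHom_ext_map {A : Type*} [Ring A] [Algebra ℂ A] {f g : SOq N q →ₐ[ℂ] A}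
    (h : (genT N q).map f = (genT N q).map g) : f = g :=
  algHom_ext fun a b => congrFun (congrFun h a) b

theorem map_sandwich_SOq {A : Type*} [Ring A] [Algebra ℂ A] (f : SOq N q →ₐ[ℂ] A)
    (P Q : Matrix (Fin N) (Fin N) ℂ) :
    (sandwich (q := q) P Q).map f = scal A P * (genT N q).map f * scal A Q :=
  map_sandwich f P Q _

theorem scal_sandwich (P Q P' Q' : Matrix (Fin N) (Fin N) ℂ) :
    scal _ P * sandwich (q := q) P' Q' * scal _ Q = sandwich (P * P') (Q' * Q) := by
  simp only [sandwich, scal_mul, mul_assoc]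

theorem sandwich_one : sandwich (N := N) (q := q) 1 1 = genT N q := by
  simp [sandwich, scal_one]

/-- The order of the factors is reversed, because the outer map acts on the entries of `T` inside
`P' T Q'` and leaves the constant matrices alone. -/
theorem conjHom_comp (h : IsSymmetry (matrixR N q) (metricC N q) P Q η)
    {P' Q' : Matrix (Fin N) (Fin N) ℂ} {η' : ℂ}
    (h' : IsSymmetry (matrixR N q) (metricC N q) P' Q' η') :
    (genT N q).map ((conjHom h).comp (conjHom h')) = sandwich (P' * P) (Q * Q') := by
  have : (genT N q).map ((conjHom h).comp (conjHom h')) =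
      ((genT N q).map (conjHom h')).map (conjHom h) := rfl
  rw [this, map_conjHom, map_sandwich_SOq, map_conjHom, scal_sandwich]

theorem map_comul_genT : (genT N q).map (Bialgebra.comulAlgHom ℂ (SOq N q)) =
    (genT N q).map (Algebra.TensorProduct.includeLeft (R := ℂ) (S := ℂ) (B := SOq N q)) *
      (genT N q).map (Algebra.TensorProduct.includeRight (R := ℂ) (A := SOq N q)) := by
  ext a b
  simp [Matrix.mul_apply, Algebra.TensorProduct.tmul_mul_tmul]

/-- The Hopf algebra endomorphism `T ↦ P T P⁻¹`. -/
def conjBialgHom (h : IsSymmetry (matrixR N q) (metricC N q) P Q η) : SOq N q →ₐc[ℂ] SOq N q :=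
  BialgHom.ofAlgHom (conjHom h)
    (by
      refine algHom_ext_map ?_
      have e : (genT N q).map (Bialgebra.counitAlgHom ℂ (SOq N q)) = 1 := by
        ext a b
        simp
      have e1 : (genT N q).map ((Bialgebra.counitAlgHom ℂ (SOq N q)).comp (conjHom h)) =
        ((genT N q).map (conjHom h)).map (Bialgebra.counitAlgHom ℂ (SOq N q)) := rfl
      rw [e1, map_conjHom, map_sandwich_SOq, e, mul_one, ← scal_mul, h.mul, scal_one])
    (by
      refine algHom_ext_map ?_
      set L := (genT N q).map (Algebra.TensorProduct.includeLeft (R := ℂ) (S := ℂ) (B := SOq N q))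
      set L' := (genT N q).map (Algebra.TensorProduct.includeRight (R := ℂ) (A := SOq N q))
      have e1 : (genT N q).map ((Bialgebra.comulAlgHom ℂ (SOq N q)).comp (conjHom h)) =
        ((genT N q).map (conjHom h)).map (Bialgebra.comulAlgHom ℂ (SOq N q)) := rfl
      have e2 : (genT N q).map ((Algebra.TensorProduct.map (conjHom h) (conjHom h)).comp
          (Bialgebra.comulAlgHom ℂ (SOq N q))) =
        (((genT N q).map (conjHom h)).map
          (Algebra.TensorProduct.includeLeft (R := ℂ) (S := ℂ) (B := SOq N q))) *
        (((genT N q).map (conjHom h)).map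
          (Algebra.TensorProduct.includeRight (R := ℂ) (A := SOq N q))) := by
        ext a b
        simp [Matrix.mul_apply, Algebra.TensorProduct.tmul_mul_tmul]
      rw [e1, e2, map_conjHom, map_sandwich_SOq, map_sandwich_SOq, map_sandwich_SOq, map_comul_genT]
      have h2 : scal (SOq N q ⊗[ℂ] SOq N q) Q * scal _ P = 1 := by
        rw [← scal_mul, h.mul', scal_one]
      calc scal _ P * L * scal _ Q * (scal _ P * L' * scal _ Q)
          = scal _ P * L * (scal _ Q * scal _ P) * L' * scal _ Q := by simp only [mul_assoc]
        _ = scal _ P * (L * L') * scal _ Q := by rw [h2, mul_one]; simp only [mul_assoc])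

theorem conjHom_conjHom_symm (h : IsSymmetry (matrixR N q) (metricC N q) P Q η) :
    (conjHom h).comp (conjHom h.symm) = AlgHom.id ℂ _ := by
  refine algHom_ext_map ?_
  rw [conjHom_comp, h.mul', sandwich_one]
  ext a b
  rfl

/-- The Hopf algebra automorphism `T ↦ P T P⁻¹`. -/
def conjAut (h : IsSymmetry (matrixR N q) (metricC N q) P Q η) : SOq N q ≃ₐc[ℂ] SOq N q :=
  BialgEquiv.ofBialgHom (conjBialgHom h) (conjBialgHom h.symm)
    (BialgHom.ext fun x => congrArg (fun f : SOq N q →ₐ[ℂ] SOq N q => f x) (conjHom_conjHom_symm h))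
    (BialgHom.ext fun x =>
      congrArg (fun f : SOq N q →ₐ[ℂ] SOq N q => f x) (conjHom_conjHom_symm h.symm))

theorem conjAut_apply (h : IsSymmetry (matrixR N q) (metricC N q) P Q η) (x : SOq N q) :
    conjAut h x = conjHom h x := rfl

theorem map_conjAut (h : IsSymmetry (matrixR N q) (metricC N q) P Q η) :
    (genT N q).map (conjAut h) = sandwich P Q := map_conjHom h

theorem conjAut_conjAut (h : IsSymmetry (matrixR N q) (metricC N q) P Q η) (hP : P * P = 1)
    (x : SOq N q) : conjAut h (conjAut h x) = x := by
  have hQ : Q * Q = 1 := by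
    have : Q = P := by
      calc Q = P * P * Q := by rw [hP, one_mul]
        _ = P := by rw [mul_assoc, h.mul, mul_one]
    rw [this, hP]
  have : (conjHom h).comp (conjHom h) = AlgHom.id ℂ _ := by
    refine algHom_ext_map ?_
    rw [conjHom_comp, hP, hQ, sandwich_one]
    ext a b
    rfl
  exact congrArg (fun f : SOq N q →ₐ[ℂ] SOq N q => f x) this

theorem conjAut_comm (h : IsSymmetry (matrixR N q) (metricC N q) P Q η)
    {P' Q' : Matrix (Fin N) (Fin N) ℂ} {η' : ℂ}
    (h' : IsSymmetry (matrixR N q) (metricC N q) P' Q' η') (hP : P * P' = P' * P)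
    (x : SOq N q) : conjAut h (conjAut h' x) = conjAut h' (conjAut h x) := by
  have hQ : Q * Q' = Q' * Q := by
    calc Q * Q' = Q * Q' * ((P * P') * (Q' * Q)) := by
          rw [mul_assoc P, ← mul_assoc P', h'.mul, one_mul, h.mul, mul_one]
      _ = Q * (Q' * P') * P * Q' * Q := by rw [hP]; simp only [mul_assoc]
      _ = Q' * Q := by rw [h'.mul', mul_one, h.mul', one_mul]
  have : (conjHom h).comp (conjHom h') = (conjHom h').comp (conjHom h) := by
    refine algHom_ext_map ?_
    rw [conjHom_comp, conjHom_comp, hP, hQ]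
  exact congrArg (fun f : SOq N q →ₐ[ℂ] SOq N q => f x) this

theorem antipode_mul' (x y : SOq N q) : HopfAlgebra.antipode ℂ (x * y) =
    HopfAlgebra.antipode ℂ y * HopfAlgebra.antipode ℂ x :=
  antipodeLin_mul (metricC_mul_self N q) x y

theorem antipode_genT : (genT N q).map (HopfAlgebra.antipode ℂ) =
    scal _ (metricC N q) * (genT N q)ᵀ * scal _ (metricC N q) := by
  ext a b
  exact antipodeLin_univMat (metricC_mul_self N q) a b

/-- The antipode is antimultiplicative, so it suffices to look at `T`. There `C Qᵗ = η P C` and `Pᵗ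
C = η C Q` carry `C (P T Q)ᵗ C` to `P (C Tᵗ C) Q`, with the two signs cancelling. -/
theorem conjAut_antipode (h : IsSymmetry (matrixR N q) (metricC N q) P Q η) (x : SOq N q) :
    conjAut h (HopfAlgebra.antipode ℂ x) = HopfAlgebra.antipode ℂ (conjAut h x) := by
  induction x using FRTAlgebra.induction with
  | hc c =>
    have e : ∀ c, HopfAlgebra.antipode ℂ (algebraMap ℂ (SOq N q) c) = algebraMap ℂ (SOq N q) c :=
      antipodeLin_algebraMap (metricC_mul_self N q)
    have e' : conjAut h (algebraMap ℂ _ c) = algebraMap ℂ _ c := (conjHom h).commutes c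
    rw [e, e', e]
  | hadd x y hx hy => rw [map_add, map_add, map_add, map_add, hx, hy]
  | hmul x y hx hy => rw [antipode_mul', map_mul, map_mul, antipode_mul', hx, hy]
  | hT a b =>
    have hC := metricC_mul_self N q
    have e1 : ((genT N q).map (HopfAlgebra.antipode ℂ)).map (conjHom h) =
        (sandwich (q := q) P Q).map (HopfAlgebra.antipode ℂ) := by
      have e2 : (sandwich (q := q) P Q).map (HopfAlgebra.antipode ℂ) =
          scal _ P * (genT N q).map (HopfAlgebra.antipode ℂ) * scal _ Q := by
        ext a b
        simp only [sandwich, Matrix.map_apply, Matrix.mul_apply, scal, map_sum, Finset.sum_mul]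
        refine Finset.sum_congr rfl fun c _ => Finset.sum_congr rfl fun d _ => ?_
        rw [← Algebra.commutes, ← Algebra.smul_def, ← Algebra.smul_def, map_smul, map_smul,
          ← Algebra.commutes, ← Algebra.smul_def, ← Algebra.smul_def]
      have e3 : ((genT N q)ᵀ).map (conjHom h) = scal _ Qᵀ * (genT N q)ᵀ * scal _ Pᵀ := by
        rw [Matrix.transpose_map, map_conjHom, sandwich, transpose_mul_scal, transpose_scal_mul,
          mul_assoc]
      rw [e2, antipode_genT, map_sandwich, e3]
      have e4 : metricC N q * Qᵀ = η • (P * metricC N q) := by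
        calc metricC N q * Qᵀ = P * (Q * metricC N q * Qᵀ) := by
              rw [mul_assoc, ← mul_assoc P, h.mul, one_mul]
          _ = η • (P * metricC N q) := by rw [h.symm.orth, Matrix.mul_smul]
      have e5 : Pᵀ * metricC N q = η • (metricC N q * Q) := by
        calc Pᵀ * metricC N q = (Pᵀ * metricC N q * P) * Q := by
              rw [mul_assoc _ P, h.mul, mul_one]
          _ = η • (metricC N q * Q) := by rw [h.orth' hC, Matrix.smul_mul]
      calc scal _ (metricC N q) * (scal _ Qᵀ * (genT N q)ᵀ * scal _ Pᵀ) * scal _ (metricC N q)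
          = scal _ (metricC N q * Qᵀ) * (genT N q)ᵀ * scal _ (Pᵀ * metricC N q) := by
            simp only [scal_mul, mul_assoc]
        _ = _ := by
            rw [e4, e5, scal_smul, scal_smul, Matrix.smul_mul, Matrix.smul_mul, Matrix.mul_smul,
              smul_smul, h.sign, one_smul]
            simp only [scal_mul, mul_assoc]
    have e2 := congrFun (congrFun (map_conjHom h) a) b
    change conjHom h (genT N q a b) = _ at e2
    rw [conjAut_apply, conjAut_apply, e2]
    exact congrFun (congrFun e1 a) b

end ConjAut

/-! ### Antilinear antimultiplicative maps -/

/-- The opposite of a complex algebra, with conjugate scalars. -/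
def ConjOp (A : Type*) : Type _ := Aᵐᵒᵖ

section ConjOp

variable {A : Type*} [Ring A] [Algebra ℂ A]

instance : Ring (ConjOp A) := inferInstanceAs (Ring Aᵐᵒᵖ)

/-- With the scalars composed with complex conjugation, an algebra map into `ConjOp A` is precisely
an antilinear antimultiplicative unital map into `A`. The universal property thereby also produces
conjugations. -/
instance : Algebra ℂ (ConjOp A) where
  smul c x := MulOpposite.op (conj c • MulOpposite.unop x)
  algebraMap := (algebraMap ℂ Aᵐᵒᵖ).comp (starRingEnd ℂ)
  commutes' c x := Algebra.commutes (R := ℂ) (A := Aᵐᵒᵖ) (conj c) x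
  smul_def' c x := Algebra.smul_def (R := ℂ) (A := Aᵐᵒᵖ) (conj c) x

/-- The identity map to `ConjOp A`. -/
def toConjOp (x : A) : ConjOp A := MulOpposite.op x

/-- The identity map from `ConjOp A`. -/
def ofConjOp (x : ConjOp A) : A := MulOpposite.unop x

theorem toConjOp_mul (x y : A) : toConjOp (x * y) = toConjOp y * toConjOp x := rfl

theorem toConjOp_sum {ι : Type*} (s : Finset ι) (f : ι → A) :
    toConjOp (∑ i ∈ s, f i) = ∑ i ∈ s, toConjOp (f i) := Finset.op_sum s f

theorem algebraMap_conjOp (c : ℂ) :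
    algebraMap ℂ (ConjOp A) c = toConjOp (algebraMap ℂ A (conj c)) := rfl

theorem toConjOp_list_prod (l : List A) :
    toConjOp l.prod = (l.map toConjOp).reverse.prod := MulOpposite.op_list_prod l

end ConjOp

section AntiLift

variable {ι : Type} [Fintype ι] [DecidableEq ι] {R : Matrix (ι × ι) (ι × ι) ℂ} {C : Matrix ι ι ℂ}
  {k : ℕ} {W : Set ((Fin k → ι) → ℂ)} {A : Type*} [Ring A] [Algebra ℂ A]

/-- The antilinear antimultiplicative map given by a point with values in `ConjOp A`. -/
def antiLift {X : Matrix ι ι A} (hX : IsPoint R C W (X.map toConjOp)) :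
    FRTAlgebra R C W →ₗ⋆[ℂ] A where
  toFun x := ofConjOp (liftFRT hX x)
  map_add' x y := by rw [map_add]; rfl
  map_smul' c x := by rw [map_smul]; rfl

theorem antiLift_mul {X : Matrix ι ι A} (hX : IsPoint R C W (X.map toConjOp))
    (x y : FRTAlgebra R C W) : antiLift hX (x * y) = antiLift hX y * antiLift hX x := by
  change ofConjOp (liftFRT hX (x * y)) = _
  rw [map_mul]
  rfl

theorem antiLift_univMat {X : Matrix ι ι A} (hX : IsPoint R C W (X.map toConjOp)) (a b : ι) :
    antiLift hX (univMat R C W a b) = X a b := by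
  change ofConjOp (liftFRT hX _) = _
  rw [liftFRT_univMat]
  rfl

theorem antiLift_one {X : Matrix ι ι A} (hX : IsPoint R C W (X.map toConjOp)) :
    antiLift hX (1 : FRTAlgebra R C W) = 1 := by
  change ofConjOp (liftFRT hX 1) = _
  rw [map_one]
  rfl

end AntiLift

section AntiMaps

variable {ι : Type} [Fintype ι] [DecidableEq ι] {R : Matrix (ι × ι) (ι × ι) ℂ} {C : Matrix ι ι ℂ}
  {k : ℕ} {W : Set ((Fin k → ι) → ℂ)} {A : Type*} [Ring A] [Algebra ℂ A]

theorem map_algebraMap_of_one {A' : Type*} [Ring A'] [Algebra ℂ A'] {s : A →ₗ⋆[ℂ] A'}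
    (h1 : s 1 = 1) (c : ℂ) : s (algebraMap ℂ A c) = algebraMap ℂ A' (conj c) := by
  rw [Algebra.algebraMap_eq_smul_one, LinearMap.map_smulₛₗ, h1, Algebra.algebraMap_eq_smul_one]

theorem antiMap_scal_mul_scal {A' : Type*} [Ring A'] [Algebra ℂ A'] (s : A →ₗ⋆[ℂ] A')
    (P Q : Matrix ι ι ℂ) (X : Matrix ι ι A) :
    (scal A P * X * scal A Q).map s = scal A' (P.map conj) * X.map s * scal A' (Q.map conj) := by
  ext a b
  simp only [Matrix.map_apply, Matrix.mul_apply, scal, map_sum, Finset.sum_mul]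
  refine Finset.sum_congr rfl fun c _ => Finset.sum_congr rfl fun d _ => ?_
  rw [← Algebra.commutes, ← Algebra.smul_def, ← Algebra.smul_def, LinearMap.map_smulₛₗ,
    LinearMap.map_smulₛₗ, ← Algebra.commutes (conj (Q c b)), ← Algebra.smul_def, ← Algebra.smul_def]

end AntiMaps

/-! ### The conjugation `⋆` and its twists -/

section Star

variable {N : ℕ} {q : PosReal}

theorem metricC_conj : (metricC N q).map conj = metricC N q := by
  ext a b
  simp only [metricC, Matrix.map_apply, Matrix.of_apply]
  split_ifs <;> simp

theorem matrixR_conj (p r : Fin N × Fin N) : conj (matrixR N q p r) = matrixR N q p r := by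
  rw [matrixR_apply, Complex.conj_ofReal]

theorem metricC_transpose_mul_self : (metricC N q)ᵀ * (metricC N q)ᵀ = 1 := by
  rw [← Matrix.transpose_mul, metricC_mul_self, Matrix.transpose_one]

theorem metricC_transpose_apply (a b : Fin N) : (metricC N q)ᵀ a b =
    if b = a.rev then (((q : ℝ) ^ rho N a : ℝ) : ℂ) else 0 := by
  simp only [metricC, Matrix.transpose_apply, Matrix.of_apply]
  split_ifs with h
  · rw [h, rho_rev, neg_neg]
  · rfl

/-- The `R`-matrix with exchanged tensor factors. -/
def flipR (N : ℕ) (q : PosReal) : Matrix (Fin N × Fin N) (Fin N × Fin N) ℂ :=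
  Matrix.of fun p r => matrixR N q p.swap r.swap

/-- `Cᵗ ⊗ Cᵗ` replaces each index by its primed one and multiplies by `q^{ρ_a + ρ_b}`. The entries
match by `realR_rev`, and the powers of `q` match because `R` preserves the weight `ρ`. -/
theorem matrixR_mul_leg12_metricC : matrixR N q * leg12 (metricC N q)ᵀ =
    leg12 (metricC N q)ᵀ * flipR N q := by
  have hl : ∀ a b c d, leg12 (metricC N q)ᵀ (a, b) (c, d) = if (c, d) = (a.rev, b.rev) then
      (((q : ℝ) ^ (rho N a + rho N b) : ℝ) : ℂ) else 0 := by
    intro a b c d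
    simp only [leg12, Matrix.of_apply, metricC_transpose_apply, Real.rpow_add q.2,
      Complex.ofReal_mul, Prod.mk.injEq]
    by_cases h1 : c = a.rev <;> by_cases h2 : d = b.rev <;> simp [h1, h2]
  ext ⟨a, b⟩ ⟨c, d⟩
  rw [Matrix.mul_apply, Matrix.mul_apply, Finset.sum_eq_single (c.rev, d.rev),
    Finset.sum_eq_single (a.rev, b.rev), hl, hl]
  · simp only [flipR, Matrix.of_apply, Prod.swap_prod_mk, Fin.rev_rev, if_true, matrixR_apply,
      ← Complex.ofReal_mul]
    congr 1
    have e : realR N q b.rev a.rev d c = realR N q a b c.rev d.rev := by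
      simpa using realR_rev N q b a d.rev c.rev
    rw [e]
    by_cases h : realR N q a b c.rev d.rev = 0
    · simp [h]
    · have := weight_eq_of_realR_ne_zero h
        (τ := fun a => Multiplicative.ofAdd (rho N a)) (z := 1) (by
          intro a; rw [rho_rev, ← ofAdd_add]; simp)
      have h2 : rho N a + rho N b = rho N c.rev + rho N d.rev := this
      rw [h2, mul_comm]
  · rintro ⟨e, f⟩ _ h
    rw [hl, if_neg h, zero_mul]
  · simp
  · rintro ⟨e, f⟩ _ h
    rw [hl, if_neg, mul_zero]
    rintro h'
    apply h
    simp only [Prod.mk.injEq] at h' ⊢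
    simp [h'.1, h'.2]
  · simp

/-- Reversing the order of the slots moves the pair `(s, s + 1)` to `(N - 2 - s, N - 1 - s)` in
opposite order, which is absorbed by exchanging the tensor factors of `R`. -/
theorem slotOp_comp_rev {E : (Fin N → Fin N) → ℂ} (hE : E ∈ antisymTensors N q) (s : ℕ)
    (hs : s + 1 < N) (i : Fin N → Fin N) :
    slotOp (flipR N q) s hs (fun l => E (l ∘ Fin.rev)) i =
      (-(((q : ℝ)⁻¹ : ℝ) : ℂ)) * E (i ∘ Fin.rev) := by
  have h := hE (N - 2 - s) (by omega) (i ∘ Fin.rev)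
  have h0 : Fin.rev (⟨N - 2 - s + 1, by omega⟩ : Fin N) = ⟨s, by omega⟩ := by
    ext; simp only [Fin.val_rev]; omega
  have h1 : Fin.rev (⟨N - 2 - s, by omega⟩ : Fin N) = ⟨s + 1, by omega⟩ := by
    ext; simp only [Fin.val_rev]; omega
  rw [← h]
  simp only [Function.comp_apply, h0, h1, slotOp]
  rw [Finset.sum_comm]
  refine Finset.sum_congr rfl fun c _ => Finset.sum_congr rfl fun d _ => ?_
  simp only [flipR, Matrix.of_apply, Prod.swap_prod_mk, smul_eq_mul]
  congr 2
  ext t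
  simp only [Function.comp_apply, Function.update_apply]
  have e0 : t.rev = ⟨s, by omega⟩ ↔ t = ⟨N - 2 - s + 1, by omega⟩ := by
    rw [← h0, Fin.rev_inj]
  have e1 : t.rev = ⟨s + 1, by omega⟩ ↔ t = ⟨N - 2 - s, by omega⟩ := by
    rw [← h1, Fin.rev_inj]
  simp only [e0, e1]
  by_cases k0 : t = ⟨N - 2 - s + 1, by omega⟩
  · have : t ≠ ⟨N - 2 - s, by omega⟩ := by
      rw [k0]; simp [Fin.ext_iff]
    simp [k0]
  · simp [k0]

/-- Reversal of the slots exchanges the factors of `R`, and `Cᵗ` in every slot exchanges them back.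
-/
theorem legs_metricC_comp_rev_mem {E : (Fin N → Fin N) → ℂ} (hE : E ∈ antisymTensors N q) :
    (legs N (metricC N q)ᵀ *ᵥ fun l => E (l ∘ Fin.rev)) ∈ antisymTensors N q := by
  intro s hs i
  have h := slotOp_legs_mulVec (B := ℂ) (R := matrixR N q) (R' := flipR N q) (X := (metricC N q)ᵀ)
    (by rw [scal_complex, scal_complex, leg21_eq_leg12, matrixR_mul_leg12_metricC]) s hs
    (fun l => E (l ∘ Fin.rev))
  have h2 : slotOp (flipR N q) s hs (fun l => E (l ∘ Fin.rev)) =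
      (-(((q : ℝ)⁻¹ : ℝ) : ℂ)) • fun l => E (l ∘ Fin.rev) :=
    funext fun l => slotOp_comp_rev hE s hs l
  rw [h2, Matrix.mulVec_smul] at h
  exact congrFun h i

/-- A product in the opposite algebra is read backwards, which amounts to reversing the slots on
both sides. -/
theorem legs_comp_rev {ι : Type} [Fintype ι] [DecidableEq ι] {A : Type*} [Ring A] [Algebra ℂ A]
    (k : ℕ) (X : Matrix ι ι A) (i j : Fin k → ι) :
    legs k (X.map toConjOp) i j = toConjOp (legs k X (i ∘ Fin.rev) (j ∘ Fin.rev)) := by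
  simp only [legs, Matrix.of_apply, toConjOp_list_prod, List.map_ofFn]
  congr 1
  refine List.ext_getElem (by simp) fun n h1 h2 => ?_
  simp only [List.length_ofFn] at h1
  simp only [List.getElem_ofFn, List.getElem_reverse, List.length_ofFn, Function.comp_apply,
    Matrix.map_apply]
  have e : Fin.rev (⟨k - 1 - n, by omega⟩ : Fin k) = ⟨n, h1⟩ := by
    ext; simp only [Fin.val_rev]; omega
  rw [e]

theorem conj_mem_antisymTensors {E : (Fin N → Fin N) → ℂ} (hE : E ∈ antisymTensors N q) :
    (fun i => conj (E i)) ∈ antisymTensors N q := by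
  intro s hs i
  have := congrArg conj (hE s hs i)
  simp only [map_sum, map_mul, matrixR_conj, map_neg, Complex.conj_ofReal] at this
  exact this

theorem scal_mul_map_toConjOp {A : Type*} [Ring A] [Algebra ℂ A] {m n p : Type} [Fintype n]
    (M : Matrix m n ℂ) (X : Matrix n p A) :
    scal (ConjOp A) M * X.map toConjOp = (scal A (M.map conj) * X).map toConjOp := by
  ext a b
  simp only [Matrix.mul_apply, Matrix.map_apply, scal, toConjOp_sum, algebraMap_conjOp,
    ← toConjOp_mul, Algebra.commutes]

theorem map_toConjOp_mul_scal {A : Type*} [Ring A] [Algebra ℂ A] {m n p : Type} [Fintype n]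
    (X : Matrix m n A) (M : Matrix n p ℂ) :
    X.map toConjOp * scal (ConjOp A) M = (X * scal A (M.map conj)).map toConjOp := by
  ext a b
  simp only [Matrix.mul_apply, Matrix.map_apply, scal, toConjOp_sum, algebraMap_conjOp,
    ← toConjOp_mul, Algebra.commutes]

theorem map_toConjOp_mul {A : Type*} [Ring A] [Algebra ℂ A] {m n p : Type} [Fintype n]
    (X : Matrix m n A) (Y : Matrix n p A) :
    (X.map toConjOp * Y.map toConjOp : Matrix m p (ConjOp A)) = ((Yᵀ * Xᵀ)ᵀ).map toConjOp := by
  ext a b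
  simp only [Matrix.mul_apply, Matrix.map_apply, Matrix.transpose_apply]
  exact (toConjOp_sum _ _).symm

theorem flipR_leg21 {A : Type*} [Ring A] [Algebra ℂ A] {X : Matrix (Fin N) (Fin N) A}
    (h : scal A (matrixR N q) * leg12 X = leg21 X * scal A (matrixR N q)) :
    scal A (flipR N q) * leg21 X = leg12 X * scal A (flipR N q) := by
  ext p r
  have := congrFun (congrFun h p.swap) r.swap
  simp only [Matrix.mul_apply] at this ⊢
  rw [← (Equiv.prodComm (Fin N) (Fin N)).sum_comp] at this
  rw [← (Equiv.prodComm (Fin N) (Fin N)).sum_comp (fun j => leg21 X p.swap j * _)] at this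
  exact this

theorem matrixR_map_conj : (matrixR N q).map conj = matrixR N q := by
  ext p r
  exact matrixR_conj p r

/-- The relation `T₁ ⋯ T_N E' = E'` is applied to the tensor `E'` obtained from the conjugate of `E`
by reversing slots and applying `Cᵗ` in each. The outer factors `Cᵗ` then cancel since `Cᵗ Cᵗ = 1`.
-/
theorem legs_star_mulVec {E : (Fin N → Fin N) → ℂ} (hE : E ∈ antisymTensors N q) :
    legs N (sandwich (q := q) (metricC N q)ᵀ (metricC N q)ᵀ) *ᵥ
        (fun j => algebraMap ℂ (SOq N q) (conj (E (j ∘ Fin.rev)))) =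
      fun i => algebraMap ℂ (SOq N q) (conj (E (i ∘ Fin.rev))) := by
  have hmem := legs_metricC_comp_rev_mem (conj_mem_antisymTensors hE)
  have h1 : legs N (metricC N q)ᵀ * legs N (metricC N q)ᵀ = 1 := by
    rw [← legs_mul (fun _ _ _ _ => Commute.all _ _), metricC_transpose_mul_self, legs_one]
  have hP := (isPoint_univMat (matrixR N q) (metricC N q) (antisymTensors N q)).det _ hmem
  rw [sandwich, legs_mul fun _ _ _ _ => (commute_scal_left _ _ _ _).symm,
    legs_mul fun _ _ _ _ => commute_scal_left _ _ _ _, legs_scal, ← Matrix.mulVec_mulVec,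
    scal_mulVec_algebraMap, ← Matrix.mulVec_mulVec, hP, scal_mulVec_algebraMap,
    Matrix.mulVec_mulVec, h1, Matrix.one_mulVec]

/-- `Cᵗ T Cᵗ` is a point with values in the conjugate opposite algebra. -/
theorem isPoint_star : IsPoint (matrixR N q) (metricC N q) (antisymTensors N q)
    ((sandwich (q := q) (metricC N q)ᵀ (metricC N q)ᵀ).map toConjOp) := by
  set T := genT N q with hT
  set K := (metricC N q)ᵀ with hK
  have hP : IsPoint (matrixR N q) (metricC N q) (antisymTensors N q) T := isPoint_univMat _ _ _
  have hKK : K * K = 1 := metricC_transpose_mul_self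
  have hKt : Kᵀ = metricC N q := Matrix.transpose_transpose _
  have hsK : scal (SOq N q) K * scal _ K = 1 := by rw [← scal_mul, hKK, scal_one]
  have hsC : scal (SOq N q) (metricC N q) * scal _ (metricC N q) = 1 := by
    rw [← scal_mul, metricC_mul_self, scal_one]
  have hS : sandwich (q := q) K K = scal _ K * T * scal _ K := rfl
  set S := sandwich (q := q) K K
  have hc1 : ∀ a b c d, Commute (scal (SOq N q) K a b) (T c d) :=
    fun _ _ _ _ => commute_scal_left _ _ _ _
  have hc2 : ∀ a b c d, Commute ((scal (SOq N q) K * T) a b) (scal (SOq N q) K c d) :=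
    fun _ _ _ _ => (commute_scal_left _ _ _ _).symm
  have hSt : Sᵀ = scal _ (metricC N q) * Tᵀ * scal _ (metricC N q) := by
    rw [hS, transpose_mul_scal, transpose_scal_mul, hKt, mul_assoc]
  refine ⟨?_, ?_, ?_, ?_⟩
  -- The opposite product exchanges the two legs and `R` is real, so the relation to be proved is `R
  -- S₂ S₁ = S₁ S₂ R`. It follows from the RTT relation for `T` with exchanged factors, conjugated
  -- by `Cᵗ ⊗ Cᵗ`.
  · have h12 : leg12 (S.map toConjOp) = (leg21 S).map toConjOp := rfl
    have h21 : leg21 (S.map toConjOp) = (leg12 S).map toConjOp := rfl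
    rw [h12, h21, scal_mul_map_toConjOp, map_toConjOp_mul_scal, matrixR_map_conj]
    congr 1
    have hRK : matrixR N q * leg12 K = leg12 K * flipR N q := matrixR_mul_leg12_metricC
    have k1 : leg12 K * leg12 K = 1 := by
      have := leg12_mul_leg21 hKK
      rwa [leg21_eq_leg12] at this
    have k2 : flipR N q * leg12 K = leg12 K * matrixR N q := by
      calc flipR N q * leg12 K = leg12 K * (leg12 K * flipR N q) * leg12 K := by
            rw [← mul_assoc (leg12 K), k1, one_mul]
        _ = leg12 K * matrixR N q * (leg12 K * leg12 K) := by
            rw [← hRK]; simp only [mul_assoc]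
        _ = leg12 K * matrixR N q := by rw [k1, mul_one]
    have e1 : leg21 S = scal _ (leg12 K) * leg21 T * scal _ (leg12 K) := by
      rw [hS, leg21_mul hc2, leg21_mul hc1, leg21_scal, leg21_eq_leg12]
    have e2 : leg12 S = scal _ (leg12 K) * leg12 T * scal _ (leg12 K) := by
      rw [hS, leg12_mul hc2, leg12_mul hc1, leg12_scal]
    rw [e1, e2]
    calc scal _ (matrixR N q) * (scal _ (leg12 K) * leg21 T * scal _ (leg12 K))
        = scal _ (matrixR N q * leg12 K) * leg21 T * scal _ (leg12 K) := by
          simp only [scal_mul, mul_assoc]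
      _ = scal _ (leg12 K) * (scal _ (flipR N q) * leg21 T) * scal _ (leg12 K) := by
          rw [hRK]; simp only [scal_mul, mul_assoc]
      _ = scal _ (leg12 K) * leg12 T * scal _ (flipR N q * leg12 K) := by
          rw [flipR_leg21 hP.rtt]; simp only [scal_mul, mul_assoc]
      _ = _ := by rw [k2]; simp only [scal_mul, mul_assoc]
  · have h1 : (S.map toConjOp)ᵀ = Sᵀ.map toConjOp := rfl
    have h2 : scal (ConjOp (SOq N q)) (metricC N q) = (scal _ (metricC N q)).map toConjOp := by
      have := scal_mul_map_toConjOp (metricC N q) (1 : Matrix (Fin N) (Fin N) (SOq N q))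
      have e : (1 : Matrix (Fin N) (Fin N) (SOq N q)).map toConjOp = 1 :=
        Matrix.map_one _ rfl rfl
      rwa [e, mul_one, mul_one, metricC_conj] at this
    rw [map_toConjOp_mul_scal, h1, map_toConjOp_mul, h2, metricC_conj, Matrix.transpose_transpose]
    congr 1
    rw [transpose_mul_scal, hSt, hS, ← Matrix.transpose_inj, Matrix.transpose_transpose,
      scal_transpose, ← hK]
    calc scal _ K * T * scal _ K * (scal _ K * (scal _ (metricC N q) * Tᵀ * scal _ (metricC N q)))
        = scal _ K * T * (scal _ K * scal _ K) * scal _ (metricC N q) * Tᵀ *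
            scal _ (metricC N q) := by simp only [mul_assoc]
      _ = scal _ K * (T * scal _ (metricC N q) * Tᵀ) * scal _ (metricC N q) := by
          rw [hsK, mul_one]; simp only [mul_assoc]
      _ = scal _ K := by rw [hP.orth₁, mul_assoc, hsC, mul_one]
  · have h1 : (S.map toConjOp)ᵀ = Sᵀ.map toConjOp := rfl
    have h2 : scal (ConjOp (SOq N q)) (metricC N q) = (scal _ (metricC N q)).map toConjOp := by
      have := scal_mul_map_toConjOp (metricC N q) (1 : Matrix (Fin N) (Fin N) (SOq N q))
      have e : (1 : Matrix (Fin N) (Fin N) (SOq N q)).map toConjOp = 1 :=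
        Matrix.map_one _ rfl rfl
      rwa [e, mul_one, mul_one, metricC_conj] at this
    rw [h1, map_toConjOp_mul_scal, map_toConjOp_mul, h2, metricC_conj]
    congr 1
    rw [transpose_mul_scal, Matrix.transpose_transpose, hSt, hS, ← Matrix.transpose_inj,
      Matrix.transpose_transpose, scal_transpose, ← hK]
    calc scal _ (metricC N q) * Tᵀ * scal _ (metricC N q) *
          (scal _ K * (scal _ K * T * scal _ K))
        = scal _ (metricC N q) * Tᵀ * scal _ (metricC N q) * (scal _ K * scal _ K) * T *
            scal _ K := by simp only [mul_assoc]
      _ = scal _ (metricC N q) * (Tᵀ * scal _ (metricC N q) * T) * scal _ K := by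
          rw [hsK, mul_one]; simp only [mul_assoc]
      _ = scal _ K := by rw [hP.orth₂, hsC, one_mul]
  · intro E hE
    ext i
    have hfix := legs_star_mulVec hE
    have h3 := congrArg toConjOp (congrFun hfix (i ∘ Fin.rev))
    have hrr : ∀ j : Fin N → Fin N, (j ∘ Fin.rev) ∘ Fin.rev = j := by
      intro j; ext t; simp
    simp only [Matrix.mulVec, dotProduct, toConjOp_sum, hrr] at h3
    rw [algebraMap_conjOp, ← h3]
    simp only [Matrix.mulVec, dotProduct]
    -- Reindexing the sum by reversed tuples matches the reversed order of factors in the opposite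
    -- algebra.
    refine Finset.sum_nbij' (fun j => j ∘ Fin.rev) (fun j => j ∘ Fin.rev) (by simp) (by simp)
      (by simp [hrr]) (by simp [hrr]) fun j _ => ?_
    rw [legs_comp_rev, algebraMap_conjOp, ← toConjOp_mul, hrr, Algebra.commutes]

variable (N q) in
/-- The conjugation `⋆`, with `T^⋆ = Cᵗ T Cᵗ`. -/
def starConj : SOq N q →ₗ⋆[ℂ] SOq N q := antiLift isPoint_star

theorem map_starConj : (genT N q).map (starConj N q) =
    sandwich (metricC N q)ᵀ (metricC N q)ᵀ := by
  ext a b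
  exact antiLift_univMat isPoint_star a b

theorem starConj_mul (x y : SOq N q) : starConj N q (x * y) = starConj N q y * starConj N q x :=
  antiLift_mul isPoint_star x y

theorem starConj_one : starConj N q 1 = 1 := antiLift_one isPoint_star

theorem antiMap_sandwich (s : SOq N q →ₗ⋆[ℂ] SOq N q) (P Q : Matrix (Fin N) (Fin N) ℂ) :
    (sandwich P Q).map s = scal _ (P.map conj) * (genT N q).map s * scal _ (Q.map conj) :=
  antiMap_scal_mul_scal s P Q _

theorem map_map_comul_mul {H : Type} [Ring H] [HopfAlgebra ℂ H] {s : H →ₗ⋆[ℂ] H}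
    (hs : ∀ x y, s (x * y) = s y * s x) (u v : H ⊗[ℂ] H) :
    TensorProduct.map s s (u * v) = TensorProduct.map s s v * TensorProduct.map s s u := by
  induction u using TensorProduct.induction_on with
  | zero => simp
  | add u w hu hw => rw [add_mul, map_add, map_add, mul_add, hu, hw]
  | tmul a b =>
    induction v using TensorProduct.induction_on with
    | zero => simp
    | add u w hu hw => rw [mul_add, map_add, map_add, add_mul, hu, hw]
    | tmul c d => simp [Algebra.TensorProduct.tmul_mul_tmul, hs]

/-- An antilinear antimultiplicative map with `T ↦ P T Q` is a conjugation if `Q = P⁻¹` and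
`conj P = P⁻¹`. -/
theorem isStarStructure_of_map_genT {s : SOq N q →ₗ⋆[ℂ] SOq N q}
    (hs : ∀ x y, s (x * y) = s y * s x) (h1 : s 1 = 1) {P Q : Matrix (Fin N) (Fin N) ℂ}
    (hT : (genT N q).map s = sandwich P Q) (hPQ : P * Q = 1) (hP : P.map conj * P = 1) :
    IsStarStructure s := by
  have hQP : Q * P = 1 := mul_eq_one_comm.1 hPQ
  -- Since `conj P` and `Q` are both inverse to `P`, applying `s` twice sends `T` to `conj P P T Q
  -- conj Q = T`.
  have hPc : P.map conj = Q := by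
    calc P.map conj = P.map conj * P * Q := by rw [mul_assoc, hPQ, mul_one]
      _ = Q := by rw [hP, one_mul]
  have hQc : Q * Q.map conj = 1 := by
    have h2 : P.map conj * Q.map conj = 1 := by
      rw [← Matrix.map_mul, hPQ]
      exact Matrix.map_one _ (map_zero _) (map_one _)
    rwa [hPc] at h2
  refine ⟨hs, fun x => ?_, fun x => ?_, fun x => ?_⟩
  · induction x using FRTAlgebra.induction with
    | hc c => simp [map_algebraMap_of_one h1]
    | hadd x y hx hy => rw [map_add, map_add, hx, hy]
    | hmul x y hx hy => rw [hs, hs, hx, hy]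
    | hT a b =>
      have e : ((genT N q).map s).map s = genT N q := by
        rw [hT, antiMap_sandwich, hT, scal_sandwich, hP, hQc, sandwich_one]
      exact congrFun (congrFun e a) b
  · induction x using FRTAlgebra.induction with
    | hc c =>
      rw [map_algebraMap_of_one h1]
      simp [Algebra.TensorProduct.algebraMap_apply, map_algebraMap_of_one h1, h1]
    | hadd x y hx hy => simp only [map_add, hx, hy]
    | hmul x y hx hy =>
      rw [hs, Bialgebra.comul_mul, Bialgebra.comul_mul, hx, hy, map_map_comul_mul hs]
    | hT a b =>
      have e1 := congrFun (congrFun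
        (map_sandwich_SOq (Bialgebra.comulAlgHom ℂ (SOq N q)) P Q) a) b
      have e2 : ∀ a b, s (genT N q a b) = sandwich P Q a b := fun a b =>
        congrFun (congrFun hT a) b
      rw [e2]
      refine e1.trans ?_
      rw [map_comul_genT]
      set L := (genT N q).map (Algebra.TensorProduct.includeLeft (R := ℂ) (S := ℂ) (B := SOq N q))
      set L' := (genT N q).map (Algebra.TensorProduct.includeRight (R := ℂ) (A := SOq N q))
      have h2 : scal (SOq N q ⊗[ℂ] SOq N q) Q * scal _ P = 1 := by
        rw [← scal_mul, hQP, scal_one]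
      have e3 : scal _ P * (L * L') * scal _ Q =
          (sandwich P Q).map (Algebra.TensorProduct.includeLeft (R := ℂ) (S := ℂ) (B := SOq N q)) *
          (sandwich P Q).map (Algebra.TensorProduct.includeRight (R := ℂ) (A := SOq N q)) := by
        rw [map_sandwich_SOq, map_sandwich_SOq]
        calc scal _ P * (L * L') * scal _ Q
            = scal _ P * L * (scal _ Q * scal _ P) * L' * scal _ Q := by
              rw [h2, mul_one]; simp only [mul_assoc]
          _ = scal _ P * L * scal _ Q * (scal _ P * L' * scal _ Q) := by simp only [mul_assoc]
      rw [e3, comul_univMat, map_sum, Matrix.mul_apply]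
      refine Finset.sum_congr rfl fun c _ => ?_
      rw [TensorProduct.map_tmul, e2, e2]
      simp [Algebra.TensorProduct.tmul_mul_tmul]
  · induction x using FRTAlgebra.induction with
    | hc c => simp [map_algebraMap_of_one h1]
    | hadd x y hx hy => simp only [map_add, hx, hy]
    | hmul x y hx hy => rw [hs, Bialgebra.counit_mul, Bialgebra.counit_mul, hx, hy, map_mul, mul_comm]
    | hT a b =>
      have e1 := congrFun (congrFun
        (map_sandwich_SOq (Bialgebra.counitAlgHom ℂ (SOq N q)) P Q) a) b
      have e2 : s (genT N q a b) = sandwich P Q a b := congrFun (congrFun hT a) b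
      have e : (genT N q).map (Bialgebra.counitAlgHom ℂ (SOq N q)) = 1 := by
        ext a b
        simp
      rw [e2]
      refine e1.trans ?_
      rw [e, mul_one, ← scal_mul, hPQ, scal_one, counit_univMat, Matrix.one_apply]
      split_ifs <;> simp

theorem isStarStructure_starConj : IsStarStructure (starConj N q) := by
  refine isStarStructure_of_map_genT starConj_mul starConj_one map_starConj
    metricC_transpose_mul_self ?_
  rw [Matrix.transpose_map, metricC_conj, metricC_transpose_mul_self]

/-- A conjugation composed with a commuting involutive automorphism is a conjugation. -/
theorem IsStarStructure.twist {H : Type} [Ring H] [HopfAlgebra ℂ H] {s : H →ₗ⋆[ℂ] H}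
    (hs : IsStarStructure s) {φ : H ≃ₐc[ℂ] H} (hφ : ∀ x, φ (φ x) = x)
    (hc : ∀ x, φ (s x) = s (φ x)) : IsStarStructure (twist φ s) where
  map_mul x y := by
    change φ (s (x * y)) = φ (s y) * φ (s x)
    rw [hs.map_mul, _root_.map_mul]
  involutive x := by
    change φ (s (φ (s x))) = x
    rw [← hc, hφ, hs.involutive]
  comul x := by
    change Coalgebra.comul (R := ℂ) (φ (s x)) = _
    have h1 : ∀ y, Coalgebra.comul (R := ℂ) (φ y) =
        TensorProduct.map φ.toLinearMap φ.toLinearMap (Coalgebra.comul (R := ℂ) y) :=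
      fun y => (CoalgHomClass.map_comp_comul_apply φ y).symm
    rw [h1, hs.comul]
    induction Coalgebra.comul (R := ℂ) x using TensorProduct.induction_on with
    | zero => simp
    | add u v hu hv => simp only [map_add, hu, hv]
    | tmul a b => rfl
  counit x := by
    change Coalgebra.counit (R := ℂ) (φ (s x)) = _
    rw [CoalgHomClass.counit_comp_apply, hs.counit]

theorem map_twist (φ : SOq N q ≃ₐc[ℂ] SOq N q) (s : SOq N q →ₗ⋆[ℂ] SOq N q) :
    (genT N q).map (twist φ s) = ((genT N q).map s).map φ := rfl

theorem map_sandwich_equiv (φ : SOq N q ≃ₐc[ℂ] SOq N q) (P Q : Matrix (Fin N) (Fin N) ℂ) :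
    (sandwich (q := q) P Q).map φ = scal _ P * (genT N q).map φ * scal _ Q :=
  map_sandwich_SOq (φ : SOq N q →ₐ[ℂ] SOq N q) P Q

/-- Two antilinear antimultiplicative maps agree if they agree on the generators. -/
theorem antiMap_ext {A : Type*} [Ring A] [Algebra ℂ A] {s t : SOq N q →ₗ⋆[ℂ] A}
    (hs : ∀ x y, s (x * y) = s y * s x)
    (ht : ∀ x y, t (x * y) = t y * t x) (hs1 : s 1 = 1) (ht1 : t 1 = 1)
    (h : (genT N q).map s = (genT N q).map t) : s = t := by
  ext x
  induction x using FRTAlgebra.induction with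
  | hc c => rw [map_algebraMap_of_one hs1, map_algebraMap_of_one ht1]
  | hadd x y hx hy => rw [map_add, map_add, hx, hy]
  | hmul x y hx hy => rw [hs, ht, hx, hy]
  | hT a b => exact congrFun (congrFun h a) b

theorem IsStarStructure.map_one {H : Type} [Ring H] [HopfAlgebra ℂ H] {s : H →ₗ⋆[ℂ] H}
    (hs : IsStarStructure s) : s 1 = 1 := by
  have := hs.map_mul 1 (s 1)
  rw [one_mul, hs.involutive, one_mul] at this
  exact this.symm

theorem twist_mul {H : Type} [Ring H] [HopfAlgebra ℂ H] {s : H →ₗ⋆[ℂ] H}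
    (hs : ∀ x y, s (x * y) = s y * s x) (φ : H ≃ₐc[ℂ] H) (x y : H) :
    twist φ s (x * y) = twist φ s y * twist φ s x := by
  change φ (s (x * y)) = φ (s y) * φ (s x)
  rw [hs, map_mul]

theorem twist_one {H : Type} [Ring H] [HopfAlgebra ℂ H] {s : H →ₗ⋆[ℂ] H} (hs : s 1 = 1)
    (φ : H ≃ₐc[ℂ] H) : twist φ s 1 = 1 := by
  change φ (s 1) = 1
  rw [hs, _root_.map_one]

end Star

/-! ### The matrices `𝒟`, `𝒟'`, `A` -/

section Middle

variable {N : ℕ} {q : PosReal}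

theorem IsMiddle.rev {a : Fin N} (h : IsMiddle a) : IsMiddle a.rev := by
  unfold IsMiddle at *
  rw [Fin.val_rev]
  omega

theorem isMiddle_rev {a : Fin N} : IsMiddle a.rev ↔ IsMiddle a :=
  ⟨fun h => by simpa using h.rev, IsMiddle.rev⟩

theorem isMiddle_of_eq_rev {a : Fin N} (h : a = a.rev) : IsMiddle a := by
  unfold IsMiddle
  rw [Fin.ext_iff, Fin.val_rev] at h
  omega

theorem eq_or_eq_rev_of_isMiddle {a b : Fin N} (ha : IsMiddle a) (hb : IsMiddle b) :
    b = a ∨ b = a.rev := by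
  unfold IsMiddle at *
  rw [Fin.ext_iff, Fin.ext_iff, Fin.val_rev]
  omega

theorem eq_rev_of_isMiddle (hN : Odd N) {a : Fin N} (h : IsMiddle a) : a = a.rev := by
  obtain ⟨n, rfl⟩ := hN
  unfold IsMiddle at h
  rw [Fin.ext_iff, Fin.val_rev]
  omega

theorem ne_rev_of_even (hN : Even N) (a : Fin N) : a ≠ a.rev := by
  obtain ⟨n, rfl⟩ := hN
  rw [Ne, Fin.ext_iff, Fin.val_rev]
  omega

theorem rho_eq_zero_of_isMiddle {a : Fin N} (h : IsMiddle a) : rho N a = 0 := by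
  have hn : (N : ℝ) / 2 - 1 - ((N - 1) / 2 : ℕ) = 0 ∨ Odd N := by
    rcases Nat.even_or_odd N with ⟨n, rfl⟩ | h
    · left
      have hn : 0 < n := by have := a.2; omega
      have : (n + n - 1) / 2 = n - 1 := by omega
      rw [this, Nat.cast_sub (by omega)]
      push_cast
      ring
    · exact Or.inr h
  unfold rho
  split_ifs with h1 h2
  · have h3 : (a : ℕ) = (N - 1) / 2 := by
      unfold IsMiddle at h
      rw [Fin.lt_def, Fin.val_rev] at h1
      omega
    rcases hn with hn | hn
    · rw [h3, hn]
    · exact absurd (eq_rev_of_isMiddle hn h) h1.ne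
  · have h3 : (a.rev : ℕ) = (N - 1) / 2 := by
      unfold IsMiddle at h
      rw [Fin.lt_def, Fin.val_rev] at h2
      rw [Fin.val_rev]
      omega
    rcases hn with hn | hn
    · rw [h3, hn, neg_zero]
    · exact absurd (eq_rev_of_isMiddle hn h).symm h2.ne
  · rfl

open Classical in
/-- The permutation exchanging the middle indices. -/
def midSwap (a : Fin N) : Fin N := if IsMiddle a then a.rev else a

theorem midSwap_of_isMiddle {a : Fin N} (h : IsMiddle a) : midSwap a = a.rev := if_pos h

theorem midSwap_of_not_isMiddle {a : Fin N} (h : ¬ IsMiddle a) : midSwap a = a := if_neg h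

theorem isMiddle_midSwap {a : Fin N} : IsMiddle (midSwap a) ↔ IsMiddle a := by
  by_cases h : IsMiddle a
  · rw [midSwap_of_isMiddle h, isMiddle_rev]
  · rw [midSwap_of_not_isMiddle h]

theorem midSwap_midSwap (a : Fin N) : midSwap (midSwap a) = a := by
  by_cases h : IsMiddle a
  · rw [midSwap_of_isMiddle h, midSwap_of_isMiddle h.rev, Fin.rev_rev]
  · rw [midSwap_of_not_isMiddle h, midSwap_of_not_isMiddle h]

theorem midSwap_inj {a b : Fin N} : midSwap a = midSwap b ↔ a = b :=
  ⟨fun h => by rw [← midSwap_midSwap a, h, midSwap_midSwap], fun h => by rw [h]⟩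

theorem midSwap_eq_iff {a b : Fin N} : midSwap a = b ↔ a = midSwap b :=
  ⟨fun h => by rw [← h, midSwap_midSwap], fun h => by rw [h, midSwap_midSwap]⟩

theorem midSwap_rev (a : Fin N) : midSwap a.rev = (midSwap a).rev := by
  by_cases h : IsMiddle a
  · rw [midSwap_of_isMiddle h, midSwap_of_isMiddle h.rev]
  · rw [midSwap_of_not_isMiddle h, midSwap_of_not_isMiddle (mt isMiddle_rev.1 h)]

theorem rho_midSwap (a : Fin N) : rho N (midSwap a) = rho N a := by
  by_cases h : IsMiddle a
  · rw [midSwap_of_isMiddle h, rho_eq_zero_of_isMiddle h, rho_eq_zero_of_isMiddle h.rev]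
  · rw [midSwap_of_not_isMiddle h]

/-- The middle indices are adjacent, so their exchange can only alter the order between the two of
them. -/
theorem midSwap_lt_midSwap {a b : Fin N} (h : ¬ (IsMiddle a ∧ IsMiddle b)) :
    midSwap a < midSwap b ↔ a < b := by
  by_cases ha : IsMiddle a
  · have hb : ¬ IsMiddle b := fun hb => h ⟨ha, hb⟩
    rw [midSwap_of_isMiddle ha, midSwap_of_not_isMiddle hb]
    unfold IsMiddle at *
    simp only [Fin.lt_def, Fin.val_rev]
    omega
  · rw [midSwap_of_not_isMiddle ha]
    by_cases hb : IsMiddle b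
    · rw [midSwap_of_isMiddle hb]
      unfold IsMiddle at *
      simp only [Fin.lt_def, Fin.val_rev]
      omega
    · rw [midSwap_of_not_isMiddle hb]

/-- The exchange term `q - q⁻¹` and the metric term `(q - q⁻¹) q^{ρ_a - ρ_{a'}}` cancel because `ρ`
vanishes at both middle indices. This is what makes the exchange of the middle indices a symmetry of
`R`. -/
theorem realR_rev_self_of_isMiddle (hN : Even N) {a d : Fin N} (ha : IsMiddle a) :
    realR N q a a.rev a.rev d = 0 := by
  unfold realR
  have h := ne_rev_of_even hN a
  rw [if_neg (fun h' => h h'.1.symm), rho_eq_zero_of_isMiddle ha, rho_eq_zero_of_isMiddle ha.rev]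
  simp

/-- The entries of `R` depend on the order of the indices only through `b < a` with `c = b`, or
through `c < a`. The exchange could affect this only if `a` and `c` are the two different middle
indices, and then the entry vanishes on both sides. -/
theorem realR_midSwap (hN : Even N) (a b c d : Fin N) :
    realR N q (midSwap a) (midSwap b) (midSwap c) (midSwap d) = realR N q a b c d := by
  by_cases hac : IsMiddle a ∧ IsMiddle c
  · rcases eq_or_eq_rev_of_isMiddle hac.1 hac.2 with rfl | rfl
    · have h0 : midSwap b = (midSwap c).rev ↔ b = c.rev := by rw [← midSwap_rev, midSwap_inj]
      have h1 : rDiag N q (midSwap c) (midSwap b) = rDiag N q c b := by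
        unfold rDiag
        simp only [midSwap_inj, ← midSwap_rev]
      have h2 : ¬ (c = b ∧ d = c ∧ b < c) := by
        rintro ⟨rfl, -, h⟩; exact lt_irrefl _ h
      have h3 : ¬ (c = b ∧ d = c ∧ midSwap b < midSwap c) := by
        rintro ⟨rfl, -, h⟩; exact lt_irrefl _ h
      unfold realR
      simp only [h1, midSwap_inj, true_and, h2, h3, lt_irrefl, and_false, if_false]
    · by_cases hb : b = a.rev
      · subst hb
        rw [realR_rev_self_of_isMiddle hN hac.1, midSwap_rev,
          realR_rev_self_of_isMiddle hN (isMiddle_midSwap.2 hac.1)]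
      · have h0 : ¬ midSwap b = (midSwap a).rev := by rwa [← midSwap_rev, midSwap_inj]
        have h1 : ¬ midSwap a.rev = midSwap b := by
          rw [midSwap_inj]; exact Ne.symm hb
        have h2 : ¬ midSwap a.rev = midSwap a := by
          rw [midSwap_inj]; exact (ne_rev_of_even hN a).symm
        unfold realR
        simp [hb, Ne.symm hb, h0, h1, h2, (ne_rev_of_even hN a).symm]
  · have h0 : ∀ x y : Fin N, midSwap x = (midSwap y).rev ↔ x = y.rev := fun x y => by
      rw [← midSwap_rev, midSwap_inj]
    have h1 : rDiag N q (midSwap a) (midSwap b) = rDiag N q a b := by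
      unfold rDiag
      simp only [midSwap_inj, h0]
    have h2 : midSwap c < midSwap a ↔ c < a := midSwap_lt_midSwap fun h => hac h.symm
    have h3 : (c = b ∧ d = a ∧ midSwap b < midSwap a) ↔ (c = b ∧ d = a ∧ b < a) := by
      constructor
      · rintro ⟨rfl, h, h'⟩; exact ⟨rfl, h, h2.1 h'⟩
      · rintro ⟨rfl, h, h'⟩; exact ⟨rfl, h, h2.2 h'⟩
    unfold realR
    simp only [midSwap_inj, h0, h1, h2, h3, rho_midSwap]

/-- The permutation matrix of `midSwap`. -/
def midSwapMat (N : ℕ) : Matrix (Fin N) (Fin N) ℂ := Matrix.of fun a b => if b = midSwap a then 1 else 0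

theorem midSwapMat_mul (X : Matrix (Fin N) (Fin N) ℂ) (a b : Fin N) :
    (midSwapMat N * X) a b = X (midSwap a) b := by
  simp [midSwapMat, Matrix.mul_apply]

theorem mul_midSwapMat (X : Matrix (Fin N) (Fin N) ℂ) (a b : Fin N) :
    (X * midSwapMat N) a b = X a (midSwap b) := by
  simp [midSwapMat, Matrix.mul_apply, eq_comm (a := b), midSwap_eq_iff]

theorem midSwapMat_transpose : (midSwapMat N)ᵀ = midSwapMat N := by
  ext a b
  simp [midSwapMat, eq_comm (a := a), midSwap_eq_iff]

theorem midSwapMat_mul_self : midSwapMat N * midSwapMat N = 1 := by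
  ext a b
  rw [midSwapMat_mul, midSwapMat, Matrix.of_apply, midSwap_midSwap, Matrix.one_apply]
  simp [eq_comm]

theorem metricC_apply (a b : Fin N) : metricC N q a b =
    if b = a.rev then (((q : ℝ) ^ (-rho N a) : ℝ) : ℂ) else 0 := by
  have h : a = b.rev ↔ b = a.rev :=
    ⟨fun h => by rw [h, Fin.rev_rev], fun h => by rw [h, Fin.rev_rev]⟩
  simp only [metricC, Matrix.of_apply, h]

theorem metricC_midSwap (a b : Fin N) :
    metricC N q (midSwap a) (midSwap b) = metricC N q a b := by
  simp only [metricC_apply, ← midSwap_rev, midSwap_inj, rho_midSwap]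

theorem isSymmetry_midSwapMat (hN : Even N) :
    IsSymmetry (matrixR N q) (metricC N q) (midSwapMat N) (midSwapMat N) 1 where
  mul := midSwapMat_mul_self
  rtt := by
    have h12 : ∀ a b c d, leg12 (midSwapMat N) (a, b) (c, d) =
        if (c, d) = (midSwap a, midSwap b) then 1 else 0 := by
      intro a b c d
      simp only [leg12, midSwapMat, Matrix.of_apply, Prod.mk.injEq]
      by_cases h1 : c = midSwap a <;> by_cases h2 : d = midSwap b <;> simp [h1, h2]
    ext ⟨a, b⟩ ⟨c, d⟩
    rw [Matrix.mul_apply, Matrix.mul_apply, Finset.sum_eq_single (midSwap c, midSwap d),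
      Finset.sum_eq_single (midSwap a, midSwap b), h12, h12]
    · simp only [midSwap_midSwap, if_true, mul_one, one_mul, matrixR_apply]
      rw [← realR_midSwap hN, midSwap_midSwap, midSwap_midSwap]
    · rintro ⟨e, f⟩ _ h
      rw [h12, if_neg h, zero_mul]
    · simp
    · rintro ⟨e, f⟩ _ h
      rw [h12, if_neg, mul_zero]
      rintro h'
      apply h
      simp only [Prod.mk.injEq] at h' ⊢
      simp [h'.1, h'.2, midSwap_midSwap]
    · simp
  orth := by
    ext a b
    rw [midSwapMat_transpose, mul_midSwapMat, midSwapMat_mul, metricC_midSwap, one_smul]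
  sign := one_mul 1

/-- `R` preserves weights and the metric pairs `a` with `a'`, so the single condition that `τ_a
τ_{a'}` be constant gives both compatibilities. The matrices `𝒟'`, `A`, and `𝒟` for odd `N`, are all
of this kind. -/
theorem isSymmetry_diagonal {τ : Fin N → ℂ} {η : ℂ} (hτ : ∀ a, τ a * τ a.rev = η)
    (hη : η * η = 1) : IsSymmetry (matrixR N q) (metricC N q) (Matrix.diagonal τ)
      (Matrix.diagonal τ)⁻¹ η where
  mul := by
    have h : Matrix.diagonal τ * Matrix.diagonal (fun a => η * τ a.rev) = 1 := by
      rw [Matrix.diagonal_mul_diagonal, ← Matrix.diagonal_one]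
      congr 1
      ext a
      rw [mul_left_comm, hτ, hη]
    rw [Matrix.inv_eq_right_inv h, h]
  rtt := by
    have := scal_matrixR_mul_leg12_diagonal (q := q) (B := ℂ) hτ
    rwa [scal_complex, leg21_eq_leg12] at this
  orth := by
    ext a b
    rw [Matrix.diagonal_transpose, Matrix.mul_diagonal, Matrix.diagonal_mul, Matrix.smul_apply,
      metricC_apply, smul_eq_mul]
    split_ifs with h
    · rw [h, mul_right_comm, hτ]
    · simp
  sign := hη

theorem matD_of_even (hN : Even N) : matD N = midSwapMat N := by
  classical
  ext a b
  simp only [matD, midSwapMat, Matrix.of_apply, midSwap, hN, if_true]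
  split_ifs <;> simp_all

open Classical in
theorem matD_of_odd (hN : Odd N) : matD N = Matrix.diagonal fun a => if IsMiddle a then -1 else 1 := by
  ext a b
  simp only [matD, Matrix.of_apply, Nat.not_even_iff_odd.2 hN, if_false, Matrix.diagonal_apply,
    eq_comm (a := b)]
  split_ifs <;> rfl

theorem matD_mul_self : matD N * matD N = 1 := by
  classical
  rcases Nat.even_or_odd N with h | h
  · rw [matD_of_even h, midSwapMat_mul_self]
  · rw [matD_of_odd h, Matrix.diagonal_mul_diagonal, ← Matrix.diagonal_one]
    congr 1
    ext a
    split_ifs <;> simp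

theorem matD_inv : (matD N)⁻¹ = matD N := Matrix.inv_eq_right_inv matD_mul_self

variable (N q) in
theorem isSymmetry_matD : IsSymmetry (matrixR N q) (metricC N q) (matD N) (matD N)⁻¹ 1 := by
  classical
  rcases Nat.even_or_odd N with h | h
  · rw [matD_inv, matD_of_even h]
    exact isSymmetry_midSwapMat h
  · rw [matD_of_odd h]
    refine isSymmetry_diagonal (fun a => ?_) (one_mul 1)
    simp only [isMiddle_rev]
    split_ifs <;> simp

theorem matD_conj : (matD N).map conj = matD N := by
  ext a b
  simp only [matD, Matrix.map_apply, Matrix.of_apply]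
  split_ifs <;> simp

theorem matD_comm_metricC : matD N * (metricC N q)ᵀ = (metricC N q)ᵀ * matD N := by
  classical
  rcases Nat.even_or_odd N with h | h
  · ext a b
    rw [matD_of_even h, midSwapMat_mul, mul_midSwapMat, Matrix.transpose_apply,
      Matrix.transpose_apply, ← metricC_midSwap, midSwap_midSwap]
  · ext a b
    rw [matD_of_odd h, Matrix.mul_diagonal, Matrix.diagonal_mul, metricC_transpose_apply]
    by_cases hb : b = a.rev
    · subst hb
      simp only [isMiddle_rev]
      ring
    · simp [hb]

namespace SignVec

variable (ε : SignVec N)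

theorem val_rev (j : Fin N) : ε.1 j.rev = ε.1 j := ε.2.1 j

theorem val_of_isMiddle {j : Fin N} (h : IsMiddle j) : ε.1 j = 1 := ε.2.2 j h

theorem cast_mul_self (j : Fin N) : ((ε.1 j : ℤ) : ℂ) * ((ε.1 j : ℤ) : ℂ) = 1 := by
  rcases Int.units_eq_one_or (ε.1 j) with h | h <;> simp [h]

theorem mat_mul_self : ε.mat * ε.mat = 1 := by
  rw [mat, Matrix.diagonal_mul_diagonal, ← Matrix.diagonal_one]
  congr 1
  ext j
  exact ε.cast_mul_self j

theorem mat_inv : ε.mat⁻¹ = ε.mat := Matrix.inv_eq_right_inv ε.mat_mul_self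

theorem mat_conj : ε.mat.map conj = ε.mat := by
  rw [mat, Matrix.diagonal_map (map_zero _)]
  congr 1
  ext j
  simp

theorem isSymmetry_mat (q : PosReal) :
    IsSymmetry (matrixR N q) (metricC N q) ε.mat ε.mat⁻¹ 1 :=
  isSymmetry_diagonal (fun a => by rw [val_rev, ε.cast_mul_self]) (one_mul 1)

theorem mat_comm_metricC : ε.mat * (metricC N q)ᵀ = (metricC N q)ᵀ * ε.mat := by
  ext a b
  rw [mat, Matrix.mul_diagonal, Matrix.diagonal_mul, metricC_transpose_apply]
  split_ifs with h
  · rw [h, val_rev, mul_comm]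
  · simp

theorem matD_comm_mat : matD N * ε.mat = ε.mat * matD N := by
  classical
  rcases Nat.even_or_odd N with h | h
  · ext a b
    rw [matD_of_even h, mat, Matrix.mul_diagonal, Matrix.diagonal_mul, midSwapMat, Matrix.of_apply]
    split_ifs with hb
    · rw [hb]
      by_cases hm : IsMiddle a
      · rw [midSwap_of_isMiddle hm, val_rev, mul_comm]
      · rw [midSwap_of_not_isMiddle hm, mul_comm]
    · simp
  · rw [matD_of_odd h, mat, Matrix.diagonal_mul_diagonal, Matrix.diagonal_mul_diagonal]
    congr 1
    ext a
    rw [mul_comm]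

end SignVec

variable (N q) in
/-- The automorphism `♯`, with `T^♯ = 𝒟 T 𝒟⁻¹`. -/
def sharpAut : SOq N q ≃ₐc[ℂ] SOq N q := conjAut (isSymmetry_matD N q)

variable (q) in
/-- The automorphism `♮`, with `T^♮ = 𝒟' T 𝒟'⁻¹`. -/
def natAut (ε : SignVec N) : SOq N q ≃ₐc[ℂ] SOq N q := conjAut (ε.isSymmetry_mat q)

/-- Both composites are antilinear and antimultiplicative, and on `T` they give `Cᵗ P T Q Cᵗ` and `P
Cᵗ T Cᵗ Q`. A real matrix commuting with `Cᵗ` makes these agree, since its inverse has the same two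
properties. -/
theorem conjAut_starConj {P Q : Matrix (Fin N) (Fin N) ℂ} {η : ℂ}
    (h : IsSymmetry (matrixR N q) (metricC N q) P Q η) (hPc : P.map conj = P)
    (hPC : P * (metricC N q)ᵀ = (metricC N q)ᵀ * P) (x : SOq N q) :
    conjAut h (starConj N q x) = starConj N q (conjAut h x) := by
  have hQc : Q.map conj = Q := by
    have : P * Q.map conj = 1 := by
      conv_lhs => rw [← hPc]
      rw [← Matrix.map_mul, h.mul]
      exact Matrix.map_one _ (map_zero _) (map_one _)
    calc Q.map conj = Q * (P * Q.map conj) := by rw [← mul_assoc, h.mul', one_mul]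
      _ = Q := by rw [this, mul_one]
  have hQC : Q * (metricC N q)ᵀ = (metricC N q)ᵀ * Q := by
    calc Q * (metricC N q)ᵀ = Q * ((metricC N q)ᵀ * P) * Q := by
          rw [mul_assoc, mul_assoc, h.mul, mul_one]
      _ = (Q * P) * (metricC N q)ᵀ * Q := by rw [← hPC]; simp only [mul_assoc]
      _ = (metricC N q)ᵀ * Q := by rw [h.mul', one_mul]
  have key : twist (conjAut h) (starConj N q) =
      (starConj N q).comp ((conjAut h : SOq N q →ₐ[ℂ] SOq N q).toLinearMap) := by
    refine antiMap_ext (twist_mul starConj_mul _) (fun x y => ?_) (twist_one starConj_one _) ?_ ?_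
    · change starConj N q (conjAut h (x * y)) = _
      rw [map_mul, starConj_mul]
      rfl
    · change starConj N q (conjAut h 1) = _
      rw [map_one, starConj_one]
    · rw [map_twist, map_starConj, map_sandwich_equiv, map_conjAut, scal_sandwich]
      have : (genT N q).map ((starConj N q).comp
          ((conjAut h : SOq N q →ₐ[ℂ] SOq N q).toLinearMap)) =
          ((genT N q).map (conjAut h)).map (starConj N q) := rfl
      rw [this, map_conjAut, antiMap_sandwich, map_starConj, scal_sandwich, hPc, hQc, hPC, hQC]
  exact congrArg (fun f : SOq N q →ₗ⋆[ℂ] SOq N q => f x) key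

theorem map_twist_natAut (ε : SignVec N) : (genT N q).map (twist (natAut q ε) (starConj N q)) =
    sandwich ((metricC N q)ᵀ * ε.mat) (ε.mat * (metricC N q)ᵀ) := by
  rw [map_twist, map_starConj, map_sandwich_equiv, natAut, map_conjAut, scal_sandwich,
    ε.mat_inv]

theorem map_twist_sharp_natAut (ε : SignVec N) :
    (genT N q).map (twist ((sharpAut N q).trans (natAut q ε)) (starConj N q)) =
    sandwich ((metricC N q)ᵀ * (matD N * ε.mat)) (matD N * ε.mat * (metricC N q)ᵀ) := by
  have : (genT N q).map (twist ((sharpAut N q).trans (natAut q ε)) (starConj N q)) =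
    (((genT N q).map (starConj N q)).map (sharpAut N q)).map (natAut q ε) := rfl
  rw [this, map_starConj, map_sandwich_equiv, sharpAut, map_conjAut, scal_sandwich,
    map_sandwich_equiv, natAut, map_conjAut, scal_sandwich, ε.mat_inv, matD_inv, mul_assoc,
    ← mul_assoc ε.mat, ε.matD_comm_mat]

theorem matA_mul_rev (hN : Even N) (a : Fin N) :
    (if (a : ℕ) < N / 2 then (-1 : ℂ) else 1) * (if (a.rev : ℕ) < N / 2 then -1 else 1) = -1 := by
  obtain ⟨n, rfl⟩ := hN
  rw [Fin.val_rev]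
  have := a.2
  by_cases h : (a : ℕ) < (n + n) / 2
  · rw [if_pos h, if_neg (by omega)]; simp
  · rw [if_neg h, if_pos (by omega)]; simp

variable (q) in
theorem isSymmetry_matA (hN : Even N) :
    IsSymmetry (matrixR N q) (metricC N q) (matA N) (matA N)⁻¹ (-1) :=
  isSymmetry_diagonal (matA_mul_rev hN) (by norm_num)

theorem matA_mul_self : matA N * matA N = 1 := by
  rw [matA, Matrix.diagonal_mul_diagonal, ← Matrix.diagonal_one]
  congr 1
  ext a
  split_ifs <;> simp

theorem matA_inv : (matA N)⁻¹ = matA N := Matrix.inv_eq_right_inv matA_mul_self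

theorem matA_conj : (matA N).map conj = matA N := by
  rw [matA, Matrix.diagonal_map (map_zero _)]
  congr 1
  ext j
  split_ifs <;> simp

/-- Off the middle, the nonzero entries of `Cᵗ 𝒟 𝒟'` sit at `(a, a')`, where `A_a A_{a'} = -1`
accounts for the change of sign of `𝒟'`. In the middle `𝒟` undoes the reversal, the entries are
diagonal, and both sign vectors equal `1`. This is why the middle entries are exempt from the sign
change. -/
theorem matA_intertwines (hN : Even N) {ε₁ ε₂ : SignVec N}
    (h : ∀ j, ¬ IsMiddle j → ε₂.1 j = -ε₁.1 j) :
    matA N * ((metricC N q)ᵀ * (matD N * ε₂.mat)) =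
      (metricC N q)ᵀ * (matD N * ε₁.mat) * matA N := by
  rw [← mul_assoc, ← mul_assoc, ← mul_assoc, mul_assoc (matA N)]
  ext a b
  rw [matD_of_even hN, SignVec.mat, SignVec.mat, matA, Matrix.mul_diagonal, Matrix.diagonal_mul,
    Matrix.mul_diagonal, Matrix.mul_diagonal, mul_midSwapMat, metricC_transpose_apply]
  by_cases hb : midSwap b = a.rev
  · rw [if_pos hb]
    have ha : a = (midSwap b).rev := by rw [hb, Fin.rev_rev]
    by_cases hm : IsMiddle b
    · rw [midSwap_of_isMiddle hm, Fin.rev_rev] at ha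
      rw [ha, ε₁.val_of_isMiddle hm, ε₂.val_of_isMiddle hm]
      ring
    · rw [midSwap_of_not_isMiddle hm] at ha
      have h1 := matA_mul_rev hN b
      rw [ha, h b hm]
      push_cast
      have h2 : ∀ x y : ℂ, x * x = 1 → x * y = -1 → y = -x := by
        intro x y hx hxy
        calc y = (x * x) * y := by rw [hx, one_mul]
          _ = -x := by rw [mul_assoc, hxy]; ring
      rw [h2 _ _ (by split_ifs <;> simp) h1]
      ring
  · rw [if_neg hb]
    simp

theorem star_sharp_mul_inv (ε : SignVec N) :
    (metricC N q)ᵀ * (matD N * ε.mat) * (matD N * ε.mat * (metricC N q)ᵀ) = 1 := by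
  calc (metricC N q)ᵀ * (matD N * ε.mat) * (matD N * ε.mat * (metricC N q)ᵀ)
      = (metricC N q)ᵀ * (matD N * (ε.mat * matD N) * ε.mat) * (metricC N q)ᵀ := by
        simp only [mul_assoc]
    _ = (metricC N q)ᵀ * ((matD N * matD N) * (ε.mat * ε.mat)) * (metricC N q)ᵀ := by
        rw [← ε.matD_comm_mat]; simp only [mul_assoc]
    _ = 1 := by rw [matD_mul_self, ε.mat_mul_self, mul_one, mul_one, metricC_transpose_mul_self]

theorem exists_conjAut_matA (hN : Even N) (ε₁ ε₂ : SignVec N)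
    (h : ∀ j, ¬ IsMiddle j → ε₂.1 j = -ε₁.1 j) : ∃ α : SOq N q ≃ₐc[ℂ] SOq N q,
    (genT N q).map α = sandwich (matA N) (matA N)⁻¹ ∧
    ∀ x, twist ((sharpAut N q).trans (natAut q ε₂)) (starConj N q) x =
      α (twist ((sharpAut N q).trans (natAut q ε₁)) (starConj N q) (α.symm x)) := by
  set α := conjAut (isSymmetry_matA q hN) with hα
  refine ⟨α, map_conjAut _, fun x => ?_⟩
  set s₁ := twist ((sharpAut N q).trans (natAut q ε₁)) (starConj N q) with hs₁
  set s₂ := twist ((sharpAut N q).trans (natAut q ε₂)) (starConj N q) with hs₂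
  have key : twist α s₁ = s₂.comp ((α : SOq N q →ₐ[ℂ] SOq N q).toLinearMap) := by
    refine antiMap_ext (twist_mul (twist_mul starConj_mul _) _) (fun x y => ?_)
      (twist_one (twist_one starConj_one _) _) ?_ ?_
    · change s₂ (α (x * y)) = _
      rw [map_mul, hs₂, twist_mul starConj_mul]
      rfl
    · change s₂ (α 1) = _
      rw [map_one, hs₂, twist_one starConj_one]
    · have : (genT N q).map (s₂.comp ((α : SOq N q →ₐ[ℂ] SOq N q).toLinearMap)) =
          ((genT N q).map α).map s₂ := rfl
      rw [this, map_twist, hs₁, map_twist_sharp_natAut, map_sandwich_equiv, hα, map_conjAut,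
        scal_sandwich, antiMap_sandwich, hs₂, map_twist_sharp_natAut, scal_sandwich, matA_inv,
        matA_conj, matA_intertwines hN h]
      -- The left factors agree by the intertwining relation. The right factors are the inverses of
      -- the intertwined matrices, so their equality is the inverted relation.
      congr 1
      have hA := matA_mul_self (N := N)
      have e := matA_intertwines (q := q) hN h
      have h1 := star_sharp_mul_inv (q := q) ε₁
      have h2 := star_sharp_mul_inv (q := q) ε₂
      have h1' := mul_eq_one_comm.1 h1
      set P₁ := (metricC N q)ᵀ * (matD N * ε₁.mat)
      set P₂ := (metricC N q)ᵀ * (matD N * ε₂.mat)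
      set Q₁ := matD N * ε₁.mat * (metricC N q)ᵀ
      set Q₂ := matD N * ε₂.mat * (metricC N q)ᵀ
      calc matA N * Q₁ = matA N * Q₁ * (matA N * (P₂ * Q₂) * matA N) := by
            rw [h2, mul_one, hA, mul_one]
        _ = matA N * Q₁ * ((matA N * P₂) * Q₂ * matA N) := by simp only [mul_assoc]
        _ = matA N * (Q₁ * P₁) * matA N * Q₂ * matA N := by rw [e]; simp only [mul_assoc]
        _ = Q₂ * matA N := by rw [h1', mul_one, hA, one_mul]
  have h1 := congrArg (fun f : SOq N q →ₗ⋆[ℂ] SOq N q => f (α.symm x)) key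
  have h2 : α (α.symm x) = x := α.right_inv x
  change α (s₁ (α.symm x)) = s₂ (α (α.symm x)) at h1
  rw [h1, h2]

end Middle

/-! ### Points at `q = 1` -/

section Classical

variable {N : ℕ}

/-- The off-diagonal entries carry the factor `q - q⁻¹`, and the diagonal ones are powers of `q`. -/
theorem matrixR_one : matrixR N 1 = 1 := by
  ext ⟨a, b⟩ ⟨c, d⟩
  rw [matrixR_apply]
  have h : rDiag N 1 a b = 1 := by
    unfold rDiag
    split_ifs <;> simp
  have h1 : ((1 : PosReal) : ℝ) = 1 := rfl
  unfold realR
  rw [h]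
  simp only [h1, inv_one, sub_self, zero_mul, ite_self, add_zero, sub_zero, Matrix.one_apply,
    Prod.mk.injEq, eq_comm (a := a), eq_comm (a := b)]
  split_ifs <;> simp

/-- The antisymmetric tensor given by the determinant. -/
def detTensor (N : ℕ) (j : Fin N → Fin N) : ℂ :=
  Matrix.detRowAlternating fun s t => if j s = t then (1 : ℂ) else 0

theorem detTensor_id : detTensor N id = 1 := by
  have : (fun s t : Fin N => if (id s) = t then (1 : ℂ) else 0) = (1 : Matrix (Fin N) (Fin N) ℂ) := by
    ext s t
    simp [Matrix.one_apply]
  rw [detTensor, this]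
  exact Matrix.det_one

/-- With `R = 1` the slot operator is the exchange of two neighbouring slots and the eigenvalue is
`-1`, so the condition is the alternating property of the determinant. -/
theorem detTensor_mem : detTensor N ∈ antisymTensors N 1 := by
  intro s hs i
  set a : Fin N := ⟨s, by omega⟩ with ha
  set b : Fin N := ⟨s + 1, hs⟩ with hb
  have hab : a ≠ b := by simp [ha, hb, Fin.ext_iff]
  rw [matrixR_one, Finset.sum_eq_single (i b), Finset.sum_eq_single (i a)]
  · rw [Matrix.one_apply_eq, one_mul]
    have e : Function.update (Function.update i a (i b)) b (i a) = i ∘ Equiv.swap a b := by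
      ext t
      simp only [Function.update_apply, Function.comp_apply, Equiv.swap_apply_def]
      by_cases h1 : t = b
      · subst h1; simp [Ne.symm hab]
      · by_cases h2 : t = a
        · simp [h2, hab]
        · simp [h1, h2]
    rw [e]
    have := Matrix.detRowAlternating.map_swap
      (fun s t => if i s = t then (1 : ℂ) else 0) hab
    have h1 : ((1 : PosReal) : ℝ) = 1 := rfl
    rw [h1, inv_one, Complex.ofReal_one, neg_one_mul]
    exact this
  · intro d _ hd
    rw [Matrix.one_apply_ne, zero_mul]
    simp [Ne.symm hd]
  · simp
  · intro c _ hc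
    refine Finset.sum_eq_zero fun d _ => ?_
    rw [Matrix.one_apply_ne, zero_mul]
    simp [Ne.symm hc]
  · simp

/-- Each row of `g` is a combination of basis vectors; expanding the determinant multilinearly in
the rows gives the sum on the left. -/
theorem legs_mulVec_detTensor_id (g : Matrix (Fin N) (Fin N) ℂ) :
    (legs N g *ᵥ detTensor N) id = g.det := by
  have h1 : g = fun s => ∑ t, g s t • fun u => if t = u then (1 : ℂ) else 0 := by
    ext s u
    simp
  have h2 : g.det = Matrix.detRowAlternating fun s =>
      ∑ t, g s t • fun u => if t = u then (1 : ℂ) else 0 := by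
    conv_lhs => rw [h1]
    rfl
  have h3 := Matrix.detRowAlternating.toMultilinearMap.map_sum
    (fun s t => g s t • fun u : Fin N => if t = u then (1 : ℂ) else 0)
  rw [h2]
  refine Eq.trans ?_ h3.symm
  simp only [Matrix.mulVec, dotProduct]
  refine Finset.sum_congr rfl fun j _ => ?_
  rw [MultilinearMap.map_smul_univ]
  simp only [legs, Matrix.of_apply, List.prod_ofFn, smul_eq_mul, id]
  rfl

theorem rtt_one (g : Matrix (Fin N) (Fin N) ℂ) :
    scal ℂ (matrixR N 1) * leg12 g = leg21 g * scal ℂ (matrixR N 1) := by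
  rw [scal_complex, matrixR_one, one_mul, mul_one, leg21_eq_leg12]

/-- By uniqueness every antisymmetric tensor at `q = 1` is a multiple of the determinant tensor.
Applying `g` in every slot gives another such tensor, whose component at `id` is read off from
`legs_mulVec_detTensor_id`. -/
theorem legs_mulVec_eq_det_smul (g : Matrix (Fin N) (Fin N) ℂ) {E : (Fin N → Fin N) → ℂ}
    (hE : E ∈ antisymTensors N 1) : legs N g *ᵥ E = g.det • E := by
  have h0 : E = E id • detTensor N := by
    refine IsAntisym.ext (q := 1) hE ?_ ?_
    · intro s hs i
      have := congrArg (fun z => E id * z) (detTensor_mem s hs i)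
      have h2 := congrFun (slotOp_smul (matrixR N 1) hs (E id) (detTensor N)) i
      refine h2.trans ?_
      refine this.trans ?_
      simp only [smul_eq_mul, Pi.smul_apply]
      ring
    · simp [detTensor_id]
  have h1 : legs N g *ᵥ detTensor N = g.det • detTensor N := by
    refine IsAntisym.ext (q := 1) (IsAntisym.legs (rtt_one g) detTensor_mem) ?_ ?_
    · intro s hs i
      have := congrArg (fun z => g.det * z) (detTensor_mem s hs i)
      have h2 := congrFun (slotOp_smul (matrixR N 1) hs g.det (detTensor N)) i
      refine h2.trans ?_
      refine this.trans ?_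
      simp only [smul_eq_mul, Pi.smul_apply]
      ring
    · rw [legs_mulVec_detTensor_id]
      simp [detTensor_id]
  rw [h0, Matrix.mulVec_smul, h1, smul_comm]

/-- The complex points of `SO_1(N)` are the special orthogonal matrices. -/
theorem isPoint_one_iff (g : Matrix (Fin N) (Fin N) ℂ) :
    IsPoint (matrixR N 1) (metricC N 1) (antisymTensors N 1) g ↔
      gᵀ * metricC N 1 * g = metricC N 1 ∧ g.det = 1 := by
  constructor
  · intro h
    refine ⟨by simpa [scal_complex] using h.orth₂, ?_⟩
    have h1 := h.det _ detTensor_mem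
    have h2 := congrFun (legs_mulVec_eq_det_smul g detTensor_mem) id
    have h3 := congrFun h1 id
    simp only [Algebra.algebraMap_self, RingHom.id_apply] at h3
    have h4 : (legs N g *ᵥ detTensor N) id = detTensor N id := h3
    rw [h4] at h2
    simpa [detTensor_id] using h2.symm
  · rintro ⟨h1, h2⟩
    refine ⟨rtt_one g, ?_, ?_, fun E hE => ?_⟩
    · rw [scal_complex]
      have h3 : metricC N 1 * gᵀ * metricC N 1 * g = 1 := by
        rw [mul_assoc, mul_assoc, ← mul_assoc gᵀ, h1, metricC_mul_self]
      have h4 : g * (metricC N 1 * gᵀ * metricC N 1) = 1 := mul_eq_one_comm.1 h3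
      calc g * metricC N 1 * gᵀ = g * (metricC N 1 * gᵀ * metricC N 1) * metricC N 1 := by
            rw [← mul_assoc g, mul_assoc (g * (_ * _)), metricC_mul_self, mul_one, mul_assoc]
        _ = metricC N 1 := by rw [h4, one_mul]
    · rw [scal_complex, h1]
    · have := legs_mulVec_eq_det_smul g hE
      rw [h2, one_smul] at this
      exact this

theorem metricC_one_transpose : (metricC N 1)ᵀ = metricC N 1 := by
  ext a b
  have h1 : ((1 : PosReal) : ℝ) = 1 := rfl
  rw [metricC_transpose_apply, metricC_apply, h1]
  simp

theorem signatureMatrix_mul_self (l : ℕ) : signatureMatrix N l * signatureMatrix N l = 1 := by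
  rw [signatureMatrix, Matrix.diagonal_mul_diagonal, ← Matrix.diagonal_one]
  congr 1
  ext a
  split_ifs <;> simp

theorem signatureMatrix_transpose (l : ℕ) : (signatureMatrix N l)ᵀ = signatureMatrix N l :=
  Matrix.diagonal_transpose _

theorem map_ofReal_mul {m n p : Type} [Fintype n] (X : Matrix m n ℝ) (Y : Matrix n p ℝ) :
    (X * Y).map Complex.ofReal = X.map Complex.ofReal * Y.map Complex.ofReal :=
  Matrix.map_mul (f := Complex.ofRealHom)

theorem map_ofReal_one {n : Type} [DecidableEq n] :
    (1 : Matrix n n ℝ).map Complex.ofReal = 1 := Matrix.map_one _ Complex.ofReal_zero Complex.ofReal_one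

theorem map_ofReal_injective {m n : Type} {X Y : Matrix m n ℝ}
    (h : X.map Complex.ofReal = Y.map Complex.ofReal) : X = Y := by
  ext a b
  exact Complex.ofReal_injective (congrFun (congrFun h a) b)

theorem det_map_ofReal {n : Type} [Fintype n] [DecidableEq n] (X : Matrix n n ℝ) :
    (X.map Complex.ofReal).det = (X.det : ℂ) := (RingHom.map_det Complex.ofRealHom X).symm

end Classical

/-! ### Real forms -/

section RealForm

variable {N : ℕ} {q : PosReal}

/-- The matrix `diag(q^{r ρ_a})`. -/
def rhoPow (N : ℕ) (r : ℝ) (q : PosReal) : Matrix (Fin N) (Fin N) ℂ :=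
  Matrix.diagonal fun a => (((q : ℝ) ^ (r * rho N a) : ℝ) : ℂ)

theorem rhoPow_mul (r r' : ℝ) : rhoPow N r q * rhoPow N r' q = rhoPow N (r + r') q := by
  rw [rhoPow, rhoPow, rhoPow, Matrix.diagonal_mul_diagonal]
  congr 1
  ext a
  rw [← Complex.ofReal_mul, ← Real.rpow_add q.2, add_mul]

theorem rhoPow_zero : rhoPow N 0 q = 1 := by
  simp [rhoPow]

theorem rhoPow_at_one (r : ℝ) : rhoPow N r 1 = 1 := by
  simp [rhoPow]

theorem rhoPow_conj (r : ℝ) : (rhoPow N r q).map conj = rhoPow N r q := by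
  rw [rhoPow, Matrix.diagonal_map (map_zero _)]
  congr 1
  ext a
  simp

theorem continuous_ofReal_rpow (r : ℝ) :
    Continuous fun q : PosReal => (((q : ℝ) ^ r : ℝ) : ℂ) :=
  Complex.continuous_ofReal.comp
    (continuous_subtype_val.rpow_const fun q => Or.inl q.2.ne')

theorem continuous_rhoPow (r : ℝ) : Continuous fun q => rhoPow N r q :=
  Continuous.matrix_diagonal (continuous_pi fun _ => continuous_ofReal_rpow _)

theorem continuous_metricC : Continuous fun q => metricC N q := by
  refine continuous_matrix fun a b => ?_
  simp only [metricC_apply]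
  by_cases h : b = a.rev
  · simp only [if_pos h]; exact continuous_ofReal_rpow _
  · simp only [if_neg h]; exact continuous_const

/-- The exponent `-1/2` splits `q^{ρ_a}` evenly: `q^{-ρ_a/2} q^{ρ_a} = q^{ρ_a/2} = q^{-ρ_{a'}/2}`. A
frame adapted to `J = C` at `q = 1` thus becomes adapted to every `q` after multiplication by this
diagonal matrix. -/
theorem rhoPow_mul_metricC_transpose : rhoPow N (-1 / 2) q * (metricC N q)ᵀ =
    metricC N 1 * rhoPow N (-1 / 2) q := by
  ext a b
  have h1 : ((1 : PosReal) : ℝ) = 1 := rfl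
  rw [rhoPow, Matrix.diagonal_mul, Matrix.mul_diagonal, metricC_transpose_apply, metricC_apply, h1]
  by_cases h : b = a.rev
  · rw [if_pos h, if_pos h, ← Complex.ofReal_mul, ← Complex.ofReal_mul, ← Real.rpow_add q.2, h,
      rho_rev, Real.one_rpow, one_mul]
    congr 2
    ring
  · simp [h]

theorem exists_frame_inverse {n : Type} [Fintype n] [DecidableEq n] {D J G M : Matrix n n ℂ}
    (hD : D * D = 1) (hJJ : J * J = 1) (hJt : Jᵀ = J) (hGG : G * G = 1) (hGt : Gᵀ = G)
    (hM : M.map conj * J * D = M) (hJ : M * J * Mᵀ = G) :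
    ∃ L, M * L = 1 ∧ M.map conj = M * D * J ∧ L.map conj = J * D * L ∧ Lᵀ * J * L = G ∧
      Mᵀ * G * M = J := by
  -- The inverse of a matrix carrying the metric `J` to `G` is written down directly, using `G² =
  -- 1`.
  have hML : M * (J * Mᵀ * G) = 1 := by
    calc M * (J * Mᵀ * G) = M * J * Mᵀ * G := by simp only [mul_assoc]
      _ = 1 := by rw [hJ, hGG]
  have hLt : (J * Mᵀ * G)ᵀ = G * M * J := by
    rw [Matrix.transpose_mul, Matrix.transpose_mul, Matrix.transpose_transpose, hGt, hJt, mul_assoc]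
  have hLJL : (J * Mᵀ * G)ᵀ * J * (J * Mᵀ * G) = G := by
    calc (J * Mᵀ * G)ᵀ * J * (J * Mᵀ * G) = G * (M * (J * J) * J * Mᵀ) * G := by
          rw [hLt]; simp only [mul_assoc]
      _ = G := by rw [hJJ, mul_one, hJ, hGG, one_mul]
  generalize J * Mᵀ * G = L at hML hLt hLJL
  have hLM : L * M = 1 := mul_eq_one_comm.1 hML
  have hMc : M.map conj = M * D * J := by
    calc M.map conj = M.map conj * J * (D * D) * J := by
          rw [hD, mul_one, mul_assoc, hJJ, mul_one]
      _ = (M.map conj * J * D) * D * J := by simp only [mul_assoc]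
      _ = M * D * J := by rw [hM]
  refine ⟨L, hML, hMc, ?_, hLJL, ?_⟩
  · have h1 : M.map conj * L.map conj = 1 := by
      rw [← Matrix.map_mul, hML]
      exact Matrix.map_one _ (map_zero _) (map_one _)
    rw [hMc] at h1
    calc L.map conj = J * (D * ((L * M) * D * (J * L.map conj))) := by
          rw [hLM, one_mul, ← mul_assoc D D, hD, one_mul, ← mul_assoc J J, hJJ, one_mul]
      _ = J * D * L * (M * D * J * L.map conj) := by simp only [mul_assoc]
      _ = J * D * L := by rw [h1, mul_one]
  · have h1 : Mᵀ * Lᵀ = 1 := by rw [← Matrix.transpose_mul, hLM, Matrix.transpose_one]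
    calc Mᵀ * G * M = (Mᵀ * Lᵀ) * J * (L * M) := by rw [← hLJL]; simp only [mul_assoc]
      _ = J := by rw [h1, hLM, one_mul, mul_one]

/-- `M`, with inverse `L`, transforms the conjugation `g ↦ J D g D J` of complex matrices, with
`J = C_{q = 1}`, to the entrywise conjugation, and the metric `J` to the metric of signature
`(l, N - l)`. -/
structure IsRealFrame (l : ℕ) (D M L : Matrix (Fin N) (Fin N) ℂ) : Prop where
  invol : D * D = 1
  mul : M * L = 1
  conj_left : M.map conj * metricC N 1 * D = M
  conj_left' : M.map conj = M * D * metricC N 1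
  conj_right : L.map conj = metricC N 1 * D * L
  metric : Lᵀ * metricC N 1 * L = (signatureMatrix N l).map Complex.ofReal
  metric' : Mᵀ * (signatureMatrix N l).map Complex.ofReal * M = metricC N 1

theorem isRealFrame_of_matrix {D M : Matrix (Fin N) (Fin N) ℂ} (hD : D * D = 1) {l : ℕ}
    (hM : M.map conj * metricC N 1 * D = M)
    (hJ : M * metricC N 1 * Mᵀ = (signatureMatrix N l).map Complex.ofReal) :
    ∃ L, IsRealFrame l D M L := by
  have hJJ : metricC N 1 * metricC N 1 = 1 := metricC_mul_self N 1
  have hJt : (metricC N 1)ᵀ = metricC N 1 := metricC_one_transpose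
  have hGG : (signatureMatrix N l).map Complex.ofReal * (signatureMatrix N l).map Complex.ofReal
      = 1 := by
    rw [← map_ofReal_mul, signatureMatrix_mul_self, map_ofReal_one]
  have hGt : ((signatureMatrix N l).map Complex.ofReal)ᵀ =
      (signatureMatrix N l).map Complex.ofReal := by
    rw [← Matrix.transpose_map, signatureMatrix_transpose]
  obtain ⟨L, h1, h2, h3, h4, h5⟩ := exists_frame_inverse hD hJJ hJt hGG hGt hM hJ
  exact ⟨L, hD, h1, hM, h2, h3, h4, h5⟩

theorem IsRealFrame.mul_rhoPow {l : ℕ} {D M L : Matrix (Fin N) (Fin N) ℂ}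
    (h : IsRealFrame l D M L) (q : PosReal) :
    (M * rhoPow N (-1 / 2) q) * (rhoPow N (1 / 2) q * L) = 1 := by
  have hρ : rhoPow N (-1 / 2) q * rhoPow N (1 / 2) q = 1 := by
    rw [rhoPow_mul]; norm_num; exact rhoPow_zero
  rw [mul_assoc, ← mul_assoc (rhoPow N (-1 / 2) q), hρ, one_mul, h.mul]

theorem IsRealFrame.inv_eq {l : ℕ} {D M L : Matrix (Fin N) (Fin N) ℂ}
    (h : IsRealFrame l D M L) (q : PosReal) :
    (M * rhoPow N (-1 / 2) q)⁻¹ = rhoPow N (1 / 2) q * L :=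
  Matrix.inv_eq_right_inv (h.mul_rhoPow q)

/-- The image of `X T Y` is `(conj X) P T Q (conj Y)`. The left factor is `X` by assumption, and the
right factor is inverse to it, hence equal to `Y`. -/
theorem map_sandwich_eq_self {s : SOq N q →ₗ⋆[ℂ] SOq N q} {P Q X Y : Matrix (Fin N) (Fin N) ℂ}
    (hT : (genT N q).map s = sandwich P Q) (hPQ : P * Q = 1) (hXY : X * Y = 1)
    (hX : X.map conj * P = X) : (sandwich X Y).map s = sandwich X Y := by
  have hYX : Y * X = 1 := mul_eq_one_comm.1 hXY
  have h1 : X.map conj * Y.map conj = 1 := by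
    rw [← Matrix.map_mul, hXY]
    exact Matrix.map_one _ (map_zero _) (map_one _)
  have h2 : X * (Q * Y.map conj) = 1 := by
    conv_lhs => rw [← hX]
    rw [mul_assoc, ← mul_assoc P, hPQ, one_mul, h1]
  have h3 : Q * Y.map conj = Y := by
    calc Q * Y.map conj = Y * (X * (Q * Y.map conj)) := by rw [← mul_assoc Y, hYX, one_mul]
      _ = Y := by rw [h2, mul_one]
  rw [antiMap_sandwich, hT, scal_sandwich, hX, h3]

theorem IsRealFrame.map_sandwich {l : ℕ} {D M L : Matrix (Fin N) (Fin N) ℂ}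
    (h : IsRealFrame l D M L) {s : SOq N q →ₗ⋆[ℂ] SOq N q}
    (hT : (genT N q).map s = sandwich ((metricC N q)ᵀ * D) (D * (metricC N q)ᵀ))
    (hDρ : rhoPow N (-1 / 2) q * D = D * rhoPow N (-1 / 2) q) :
    (sandwich (M * rhoPow N (-1 / 2) q) (M * rhoPow N (-1 / 2) q)⁻¹).map s =
      sandwich (M * rhoPow N (-1 / 2) q) (M * rhoPow N (-1 / 2) q)⁻¹ := by
  refine map_sandwich_eq_self hT ?_ ?_ ?_
  · rw [mul_assoc, ← mul_assoc D, h.invol, one_mul, metricC_transpose_mul_self]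
  · rw [h.inv_eq, h.mul_rhoPow]
  · calc (M * rhoPow N (-1 / 2) q).map conj * ((metricC N q)ᵀ * D)
        = M.map conj * (rhoPow N (-1 / 2) q * (metricC N q)ᵀ) * D := by
          rw [Matrix.map_mul, rhoPow_conj]; simp only [mul_assoc]
      _ = M.map conj * metricC N 1 * (rhoPow N (-1 / 2) q * D) := by
          rw [rhoPow_mul_metricC_transpose]; simp only [mul_assoc]
      _ = M.map conj * metricC N 1 * D * rhoPow N (-1 / 2) q := by rw [hDρ]; simp only [mul_assoc]
      _ = _ := by rw [h.conj_left]

theorem IsRealFrame.tendsto {l : ℕ} {D M L : Matrix (Fin N) (Fin N) ℂ}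
    (h : IsRealFrame l D M L) :
    Filter.Tendsto (fun q => ((M * rhoPow N (-1 / 2) q)⁻¹)ᵀ * metricC N q *
      (M * rhoPow N (-1 / 2) q)⁻¹) (nhds 1)
      (nhds ((signatureMatrix N l).map Complex.ofReal)) := by
  simp only [h.inv_eq]
  have hc : Continuous fun q => (rhoPow N (1 / 2) q * L)ᵀ * metricC N q *
      (rhoPow N (1 / 2) q * L) :=
    (((continuous_rhoPow _).mul continuous_const).matrix_transpose.mul continuous_metricC).mul
      ((continuous_rhoPow _).mul continuous_const)
  have := hc.tendsto 1
  simp only [rhoPow_at_one, one_mul] at this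
  rwa [h.metric] at this

/-- A real point satisfies `conj g = J D g D J`, and the frame turns this twisted conjugation into
the entrywise one. Hence `M g L` is a real matrix; it preserves the signature metric because `g`
preserves `J`. -/
theorem IsRealFrame.image_subset {l : ℕ} {D M L : Matrix (Fin N) (Fin N) ℂ}
    (h : IsRealFrame l D M L) {s : SOq N 1 →ₗ⋆[ℂ] SOq N 1}
    (hT : (genT N 1).map s = sandwich ((metricC N 1)ᵀ * D) (D * (metricC N 1)ᵀ))
    {g : Matrix (Fin N) (Fin N) ℂ} (hg : g ∈ realPoints s) :
    M * g * L ∈ (fun g => g.map Complex.ofReal) '' realSO N l := by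
  obtain ⟨χ, hχ, hgχ⟩ := hg
  have hpt : IsPoint (matrixR N 1) (metricC N 1) (antisymTensors N 1) g := by
    rw [hgχ]
    exact (isPoint_univMat _ _ _).map χ
  rw [isPoint_one_iff] at hpt
  have hgc : g.map conj = metricC N 1 * D * g * (D * metricC N 1) := by
    have e : g.map conj = ((genT N 1).map s).map χ := by
      rw [hgχ]
      ext a b
      exact (hχ _).symm
    rw [e, hT, map_sandwich_SOq, ← hgχ, scal_complex, scal_complex, metricC_one_transpose]
  have hJJ : metricC N 1 * metricC N 1 = 1 := metricC_mul_self N 1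
  have hreal : (M * g * L).map conj = M * g * L := by
    rw [Matrix.map_mul, Matrix.map_mul, h.conj_left', h.conj_right, hgc]
    calc M * D * metricC N 1 * (metricC N 1 * D * g * (D * metricC N 1)) * (metricC N 1 * D * L)
        = M * (D * (metricC N 1 * metricC N 1) * D) * g *
            (D * (metricC N 1 * metricC N 1) * D) * L := by simp only [mul_assoc]
      _ = M * g * L := by rw [hJJ, mul_one, h.invol, mul_one, mul_one]
  have hre : ((M * g * L).map Complex.re).map Complex.ofReal = M * g * L := by
    ext a b
    exact Complex.conj_eq_iff_re.1 (congrFun (congrFun hreal a) b)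
  refine ⟨(M * g * L).map Complex.re, ⟨?_, ?_⟩, hre⟩
  · apply map_ofReal_injective
    rw [map_ofReal_mul, map_ofReal_mul, Matrix.transpose_map, hre,
      Matrix.transpose_mul, Matrix.transpose_mul]
    calc Lᵀ * (gᵀ * Mᵀ) * (signatureMatrix N l).map Complex.ofReal * (M * g * L)
        = Lᵀ * (gᵀ * (Mᵀ * (signatureMatrix N l).map Complex.ofReal * M) * g) * L := by
          simp only [mul_assoc]
      _ = _ := by rw [h.metric', hpt.1, h.metric]
  · apply Complex.ofReal_injective
    have hdet : M.det * L.det = 1 := by rw [← Matrix.det_mul, h.mul, Matrix.det_one]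
    rw [← det_map_ofReal, hre, Matrix.det_mul, Matrix.det_mul, hpt.2, mul_one, hdet,
      Complex.ofReal_one]

/-- A character is real for a conjugation if it is real on the generators. -/
theorem char_real_of_map_genT {s : SOq N q →ₗ⋆[ℂ] SOq N q}
    (hs : ∀ x y, s (x * y) = s y * s x) (hs1 : s 1 = 1) {χ : SOq N q →ₐ[ℂ] ℂ}
    (h : ((genT N q).map s).map χ = ((genT N q).map χ).map conj) (f : SOq N q) :
    χ (s f) = conj (χ f) := by
  induction f using FRTAlgebra.induction with
  | hc c => simp [map_algebraMap_of_one hs1]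
  | hadd x y hx hy => simp only [map_add, hx, hy]
  | hmul x y hx hy => rw [hs, map_mul, map_mul, map_mul, hx, hy, mul_comm]
  | hT a b => exact congrFun (congrFun h a) b

/-- A real matrix carried back by the frame satisfies the orthogonality relation and has determinant
`1`, so it defines a character by `isPoint_one_iff`. Reality of this character need only be checked
on `T`. -/
theorem IsRealFrame.subset_image {l : ℕ} {D M L : Matrix (Fin N) (Fin N) ℂ}
    (h : IsRealFrame l D M L) {s : SOq N 1 →ₗ⋆[ℂ] SOq N 1}
    (hs : ∀ x y, s (x * y) = s y * s x) (hs1 : s 1 = 1)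
    (hT : (genT N 1).map s = sandwich ((metricC N 1)ᵀ * D) (D * (metricC N 1)ᵀ))
    {g : Matrix (Fin N) (Fin N) ℝ} (hg : g ∈ realSO N l) :
    L * g.map Complex.ofReal * M ∈ realPoints s := by
  obtain ⟨h1, h2⟩ := hg
  have hHc : (g.map Complex.ofReal).map conj = g.map Complex.ofReal := by
    ext a b
    exact Complex.conj_ofReal _
  have hHG : (g.map Complex.ofReal)ᵀ * (signatureMatrix N l).map Complex.ofReal *
      g.map Complex.ofReal = (signatureMatrix N l).map Complex.ofReal := by
    rw [← Matrix.transpose_map, ← map_ofReal_mul, ← map_ofReal_mul, h1]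
  have hdetg : (g.map Complex.ofReal).det = 1 := by rw [det_map_ofReal, h2, Complex.ofReal_one]
  generalize g.map Complex.ofReal = H at hHc hHG hdetg
  have hpt : IsPoint (matrixR N 1) (metricC N 1) (antisymTensors N 1) (L * H * M) := by
    rw [isPoint_one_iff]
    constructor
    · rw [Matrix.transpose_mul, Matrix.transpose_mul]
      calc Mᵀ * (Hᵀ * Lᵀ) * metricC N 1 * (L * H * M) =
            Mᵀ * (Hᵀ * (Lᵀ * metricC N 1 * L) * H) * M := by simp only [mul_assoc]
        _ = metricC N 1 := by rw [h.metric, hHG, h.metric']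
    · have hdet : M.det * L.det = 1 := by rw [← Matrix.det_mul, h.mul, Matrix.det_one]
      rw [Matrix.det_mul, Matrix.det_mul, hdetg, mul_one, mul_comm, hdet]
  have hgT : (genT N 1).map (liftFRT hpt) = L * H * M := by
    ext a b
    exact liftFRT_univMat hpt a b
  refine ⟨liftFRT hpt, char_real_of_map_genT hs hs1 ?_, hgT.symm⟩
  rw [hT, map_sandwich_SOq, hgT, scal_complex, scal_complex, metricC_one_transpose,
    Matrix.map_mul, Matrix.map_mul, hHc, h.conj_left', h.conj_right]
  simp only [mul_assoc]

/-- A sufficient condition for a family of conjugations to give a real form. -/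
theorem givesRealForm_of_matrix {s : ∀ q : PosReal, SOq N q →ₗ⋆[ℂ] SOq N q}
    (hs : ∀ q x y, s q (x * y) = s q y * s q x) (hs1 : ∀ q, s q 1 = 1)
    {D M : Matrix (Fin N) (Fin N) ℂ}
    (hT : ∀ q, (genT N q).map (s q) = sandwich ((metricC N q)ᵀ * D) (D * (metricC N q)ᵀ))
    (hD : D * D = 1) (hDρ : ∀ q, rhoPow N (-1 / 2) q * D = D * rhoPow N (-1 / 2) q)
    {l m : ℕ} (hlm : l + m = N) (hM : M.map conj * metricC N 1 * D = M)
    (hJ : M * metricC N 1 * Mᵀ = (signatureMatrix N l).map Complex.ofReal) :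
    GivesRealForm s l m := by
  obtain ⟨L, h⟩ := isRealFrame_of_matrix hD hM hJ
  refine ⟨hlm, fun q => M * rhoPow N (-1 / 2) q, continuous_const.mul (continuous_rhoPow _),
    fun q => IsUnit.of_mul_eq_one _ (h.mul_rhoPow q), fun q => h.map_sandwich (hT q) (hDρ q),
    h.tendsto, ?_⟩
  simp only [rhoPow_at_one, mul_one]
  rw [Matrix.inv_eq_right_inv h.mul]
  ext g
  constructor
  · rintro ⟨g, hg, rfl⟩
    exact h.image_subset (hT 1) hg
  · rintro ⟨g, hg, rfl⟩
    refine ⟨_, h.subset_image (hs 1) (hs1 1) (hT 1) hg, ?_⟩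
    change M * (L * g.map Complex.ofReal * M) * L = g.map Complex.ofReal
    calc M * (L * g.map Complex.ofReal * M) * L = (M * L) * g.map Complex.ofReal * (M * L) := by
          simp only [mul_assoc]
      _ = g.map Complex.ofReal := by rw [h.mul, one_mul, mul_one]

end RealForm

/-! ### Explicit frames, signatures, and the signatures that occur -/

section RealForms

variable {N : ℕ}

theorem metricC_one_apply (a b : Fin N) : metricC N 1 a b = if b = a.rev then 1 else 0 := by
  have h1 : ((1 : PosReal) : ℝ) = 1 := rfl
  rw [metricC_apply, h1]
  simp

theorem metricC_one_mul (X : Matrix (Fin N) (Fin N) ℂ) (a b : Fin N) :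
    (metricC N 1 * X) a b = X a.rev b := by
  simp [Matrix.mul_apply, metricC_one_apply]

theorem mul_metricC_one (X : Matrix (Fin N) (Fin N) ℂ) (a b : Fin N) :
    (X * metricC N 1) a b = X a b.rev := by
  have h : ∀ c : Fin N, b = c.rev ↔ c = b.rev := fun c =>
    ⟨fun h => by rw [h, Fin.rev_rev], fun h => by rw [h, Fin.rev_rev]⟩
  simp [Matrix.mul_apply, metricC_one_apply, h]

/-- The coefficients of `e_a` in the real basis. -/
def frameX (a : Fin N) : ℂ :=
  if a = a.rev then 1 else if a < a.rev then ((√2 : ℝ) : ℂ)⁻¹ else Complex.I * ((√2 : ℝ) : ℂ)⁻¹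

/-- The coefficients of `e_{a'}` in the real basis. -/
def frameY (a : Fin N) : ℂ :=
  if a = a.rev then 0 else if a < a.rev then ((√2 : ℝ) : ℂ)⁻¹ else -(Complex.I * ((√2 : ℝ) : ℂ)⁻¹)

/-- The matrix with rows `(e_a + e_{a'}) / √2`, `i (e_a - e_{a'}) / √2` and, for a fixed index `a`,
`e_a`. -/
def baseFrame (N : ℕ) : Matrix (Fin N) (Fin N) ℂ :=
  Matrix.of fun a b => (if b = a then frameX a else 0) + (if b = a.rev then frameY a else 0)

theorem baseFrame_mul (X : Matrix (Fin N) (Fin N) ℂ) (a b : Fin N) :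
    (baseFrame N * X) a b = frameX a * X a b + frameY a * X a.rev b := by
  simp [baseFrame, Matrix.mul_apply, add_mul, Finset.sum_add_distrib]

theorem sqrt_two_inv_mul : ((√2 : ℝ) : ℂ)⁻¹ * ((√2 : ℝ) : ℂ)⁻¹ = 1 / 2 := by
  rw [← mul_inv, ← Complex.ofReal_mul, Real.mul_self_sqrt (by norm_num)]
  norm_num

/-- The metric `J` pairs `e_a` with `e_{a'}`. The factor `i` in the rows with `a' < a` turns the
negative norm of `e_a - e_{a'}` into a positive one, so the frame itself has definite signature. -/
theorem baseFrame_orth : baseFrame N * metricC N 1 * (baseFrame N)ᵀ = 1 := by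
  ext a b
  rw [mul_assoc, baseFrame_mul, metricC_one_mul, metricC_one_mul, Fin.rev_rev,
    Matrix.transpose_apply, Matrix.transpose_apply, Matrix.one_apply]
  simp only [baseFrame, Matrix.of_apply, Fin.rev_inj]
  have h : a = b.rev ↔ b = a.rev :=
    ⟨fun h => by rw [h, Fin.rev_rev], fun h => by rw [h, Fin.rev_rev]⟩
  have h' : a.rev = b ↔ b = a.rev := eq_comm
  have hI : Complex.I * ((√2 : ℝ) : ℂ)⁻¹ * (Complex.I * ((√2 : ℝ) : ℂ)⁻¹) = -(1 / 2) := by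
    rw [mul_mul_mul_comm, sqrt_two_inv_mul, Complex.I_mul_I]; ring
  simp only [h, h']
  by_cases hab : a = b
  · subst hab
    by_cases ha : a = a.rev
    · rw [if_pos ha, if_pos rfl, if_pos rfl]
      simp only [frameX, frameY, if_pos ha]
      simp
    · rw [if_neg ha, if_pos rfl, if_pos rfl]
      simp only [frameX, frameY, if_neg ha]
      split_ifs
      · linear_combination 2 * sqrt_two_inv_mul
      · linear_combination (-2) * hI
  · rw [if_neg hab, if_neg hab]
    by_cases hb : b = a.rev
    · subst hb
      rw [if_pos rfl, if_pos rfl]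
      simp only [frameX, frameY, Fin.rev_rev, if_neg hab, if_neg (Ne.symm hab)]
      rcases lt_or_gt_of_ne hab with h | h
      · simp only [if_pos h, if_neg h.not_gt]; ring
      · simp only [if_pos h, if_neg h.not_gt]; ring
    · simpa [hb] using hab

/-- In each row the coefficients at `a` and `a'` are complex conjugates, so conjugation followed by
reversal of the indices changes nothing. -/
theorem baseFrame_conj : (baseFrame N).map conj * metricC N 1 = baseFrame N := by
  ext a b
  rw [mul_metricC_one]
  simp only [baseFrame, Matrix.map_apply, Matrix.of_apply, map_add, Fin.rev_inj]
  have h : b.rev = a ↔ b = a.rev :=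
    ⟨fun h => by rw [← h, Fin.rev_rev], fun h => by rw [h, Fin.rev_rev]⟩
  simp only [h]
  by_cases ha : a = a.rev
  · simp [frameX, frameY, ← ha]
  · have h1 : conj (frameX a) = frameY a := by
      simp only [frameX, frameY, if_neg ha]
      split_ifs <;> simp
    have h2 : conj (frameY a) = frameX a := by rw [← h1, Complex.conj_conj]
    simp only [apply_ite conj, h1, h2, map_zero]
    rw [add_comm]

/-- The signs of the middle index in the frame adapted to `𝒟`. -/
def midSign (a : Fin N) : ℤˣ := if (a : ℕ) = N / 2 then -1 else 1

/-- Exchanging the middle indices fixes the middle row `e_a + e_{a'}` and negates the middle row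
`e_a - e_{a'}`. The negated row has index `N / 2`, which for odd `N` is the single middle row. -/
theorem baseFrame_mul_matD : baseFrame N * matD N =
    Matrix.diagonal (fun a => ((midSign a : ℤ) : ℂ)) * baseFrame N := by
  classical
  ext a b
  rw [Matrix.diagonal_mul]
  rcases Nat.even_or_odd N with hN | hN
  · rw [matD_of_even hN, mul_midSwapMat]
    simp only [baseFrame, Matrix.of_apply, midSwap_eq_iff, midSwap_rev]
    by_cases ha : IsMiddle a
    · rw [midSwap_of_isMiddle ha, Fin.rev_rev]
      have hne := ne_rev_of_even hN a
      simp only [frameX, frameY, if_neg hne, midSign]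
      have h3 : a < a.rev ↔ ¬ (a : ℕ) = N / 2 := by
        unfold IsMiddle at ha
        obtain ⟨n, rfl⟩ := hN
        rw [Fin.lt_def, Fin.val_rev]
        have := a.2
        omega
      by_cases h4 : (a : ℕ) = N / 2
      · have h7 : ¬ a < a.rev := fun h => h3.1 h h4
        simp only [if_neg h7, if_pos h4]
        by_cases h5 : b = a
        · subst h5; simp [hne]
        · by_cases h6 : b = a.rev <;> simp [h5, h6, hne.symm]
      · simp only [if_pos (h3.2 h4), if_neg h4]
        simp [add_comm]
    · rw [midSwap_of_not_isMiddle ha, midSign, if_neg fun h => ha (Or.inr h)]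
      simp
  · rw [matD_of_odd hN, Matrix.mul_diagonal]
    simp only [baseFrame, Matrix.of_apply]
    have hm : IsMiddle a ↔ (a : ℕ) = N / 2 := by
      obtain ⟨n, rfl⟩ := hN
      unfold IsMiddle
      omega
    have hd : (if IsMiddle a then (-1 : ℂ) else 1) = ((midSign a : ℤ) : ℂ) := by
      simp only [midSign, hm]
      split_ifs <;> simp
    rw [← hd]
    by_cases h5 : b = a
    · subst h5; ring
    · by_cases h6 : b = a.rev
      · rw [h6, isMiddle_rev]; ring
      · simp [h5, h6]

theorem baseFrame_mul_mat (ε : SignVec N) : baseFrame N * ε.mat = ε.mat * baseFrame N := by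
  ext a b
  rw [SignVec.mat, Matrix.diagonal_mul, Matrix.mul_diagonal]
  simp only [baseFrame, Matrix.of_apply]
  by_cases h5 : b = a
  · subst h5; ring
  · by_cases h6 : b = a.rev
    · rw [h6, ε.val_rev]; ring
    · simp [h5, h6]

/-- A square root of a sign. -/
def signRoot (u : ℤˣ) : ℂ := if u = 1 then 1 else Complex.I

theorem signRoot_mul_self (u : ℤˣ) : signRoot u * signRoot u = ((u : ℤ) : ℂ) := by
  rcases Int.units_eq_one_or u with h | h <;> simp [signRoot, h]

theorem conj_signRoot_mul (u : ℤˣ) : conj (signRoot u) * ((u : ℤ) : ℂ) = signRoot u := by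
  rcases Int.units_eq_one_or u with h | h <;> simp [signRoot, h]

/-- A permutation that sorts signs. -/
theorem exists_perm_signature (σ : Fin N → ℤˣ) {l m : ℕ} (hlm : l + m = N)
    (hm : (Finset.univ.filter fun j => σ j = -1).card = m) :
    ∃ π : Equiv.Perm (Fin N), ∀ a, ((σ (π a) : ℤ) : ℝ) = if (a : ℕ) < l then 1 else -1 := by
  classical
  have h1 : (Finset.univ.filter fun j => σ j = 1).card = l := by
    have h := Finset.card_filter_add_card_filter_not (s := (Finset.univ : Finset (Fin N)))
      (fun j => σ j = -1)
    have h2 : (Finset.univ.filter fun j => ¬ σ j = -1) = Finset.univ.filter fun j => σ j = 1 := by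
      refine Finset.filter_congr fun j _ => ?_
      rcases Int.units_eq_one_or (σ j) with h | h <;> simp [h]
    rw [h2, hm, Finset.card_univ, Fintype.card_fin] at h
    omega
  have h2 : (Finset.univ.filter fun j : Fin N => (j : ℕ) < l).card = l := by
    rw [Fin.card_filter_val_lt]
    omega
  have h3 : Fintype.card {j : Fin N // (j : ℕ) < l} = Fintype.card {j // σ j = 1} := by
    rw [Fintype.card_subtype, Fintype.card_subtype, h1, h2]
  refine ⟨(Fintype.equivOfCardEq h3).extendSubtype, fun a => ?_⟩
  split_ifs with ha
  · rw [Equiv.extendSubtype_mem (Fintype.equivOfCardEq h3) a ha]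
    simp
  · have := Equiv.extendSubtype_not_mem (Fintype.equivOfCardEq h3) a ha
    rw [(Int.units_eq_one_or _).resolve_left this]
    simp

/-- Conjugations of the form `T ↦ Cᵗ D T D Cᵗ` give the real form determined by the signs of `D`. -/
theorem givesRealForm_of_signs {s : ∀ q : PosReal, SOq N q →ₗ⋆[ℂ] SOq N q}
    (hs : ∀ q x y, s q (x * y) = s q y * s q x) (hs1 : ∀ q, s q 1 = 1)
    {D : Matrix (Fin N) (Fin N) ℂ}
    (hT : ∀ q, (genT N q).map (s q) = sandwich ((metricC N q)ᵀ * D) (D * (metricC N q)ᵀ))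
    (hD : D * D = 1) (hDρ : ∀ q, rhoPow N (-1 / 2) q * D = D * rhoPow N (-1 / 2) q)
    {σ : Fin N → ℤˣ} (hσ : baseFrame N * D = Matrix.diagonal (fun a => ((σ a : ℤ) : ℂ)) * baseFrame N)
    {l m : ℕ} (hlm : l + m = N) (hm : (Finset.univ.filter fun j => σ j = -1).card = m) :
    GivesRealForm s l m := by
  obtain ⟨π, hπ⟩ := exists_perm_signature σ hlm hm
  -- Multiplying a row of sign `-1` by `i` restores its reality, since `conj √σ · σ = √σ`, and
  -- changes its norm from `1` to `-1`. The permutation then sorts the norms.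
  set M₀ := Matrix.diagonal (fun a => signRoot (σ a)) * baseFrame N with hM₀
  have h1 : M₀.map conj * metricC N 1 * D = M₀ := by
    have hd : (Matrix.diagonal fun a => signRoot (σ a)).map conj =
        Matrix.diagonal fun a => conj (signRoot (σ a)) := Matrix.diagonal_map (map_zero _)
    rw [hM₀, Matrix.map_mul, hd, mul_assoc (Matrix.diagonal _), baseFrame_conj, mul_assoc, hσ,
      ← mul_assoc, Matrix.diagonal_mul_diagonal]
    simp only [conj_signRoot_mul]
  have h2 : M₀ * metricC N 1 * M₀ᵀ = Matrix.diagonal fun a => ((σ a : ℤ) : ℂ) := by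
    rw [hM₀, Matrix.transpose_mul, Matrix.diagonal_transpose]
    calc Matrix.diagonal (fun a => signRoot (σ a)) * baseFrame N * metricC N 1 *
          ((baseFrame N)ᵀ * Matrix.diagonal fun a => signRoot (σ a))
        = Matrix.diagonal (fun a => signRoot (σ a)) * (baseFrame N * metricC N 1 *
          (baseFrame N)ᵀ) * Matrix.diagonal fun a => signRoot (σ a) := by simp only [mul_assoc]
      _ = _ := by
        rw [baseFrame_orth, mul_one, Matrix.diagonal_mul_diagonal]
        simp only [signRoot_mul_self]
  refine givesRealForm_of_matrix hs hs1 hT hD hDρ hlm (M := M₀.submatrix π id) ?_ ?_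
  · have : (M₀.submatrix π id).map conj * metricC N 1 * D =
        (M₀.map conj * metricC N 1 * D).submatrix π id := by
      ext a b
      simp [Matrix.mul_apply]
    rw [this, h1]
  · have : M₀.submatrix π id * metricC N 1 * (M₀.submatrix π id)ᵀ =
        (M₀ * metricC N 1 * M₀ᵀ).submatrix π π := by
      ext a b
      simp [Matrix.mul_apply]
    rw [this, h2, Matrix.submatrix_diagonal _ _ π.injective, signatureMatrix,
      Matrix.diagonal_map Complex.ofReal_zero]
    congr 1
    ext a
    simp only [Function.comp_apply]
    rw [← hπ]
    simp

theorem rhoPow_comm_matD (r : ℝ) (q : PosReal) : rhoPow N r q * matD N = matD N * rhoPow N r q := by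
  classical
  ext a b
  rw [rhoPow, Matrix.diagonal_mul, Matrix.mul_diagonal, mul_comm]
  rcases Nat.even_or_odd N with hN | hN
  · rw [matD_of_even hN, midSwapMat, Matrix.of_apply]
    split_ifs with h
    · rw [h, rho_midSwap]
    · simp
  · rw [matD_of_odd hN]
    by_cases h : a = b
    · rw [h]
    · rw [Matrix.diagonal_apply_ne _ h]; simp

theorem rhoPow_comm_mat (r : ℝ) (q : PosReal) (ε : SignVec N) :
    rhoPow N r q * ε.mat = ε.mat * rhoPow N r q := by
  rw [rhoPow, SignVec.mat, Matrix.diagonal_mul_diagonal, Matrix.diagonal_mul_diagonal]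
  simp only [mul_comm]

theorem negCount_lt (ε : SignVec N) (hN : 2 < N) : ε.negCount + 1 ≤ N := by
  have h : ε.negCount < (Finset.univ : Finset (Fin N)).card := by
    refine Finset.card_lt_card (Finset.filter_ssubset.2 ⟨⟨N / 2, by omega⟩, Finset.mem_univ _, ?_⟩)
    rw [ε.val_of_isMiddle (Or.inr rfl)]
    decide
  simpa using h

theorem givesRealForm_nat (ε : SignVec N) (hN : 2 < N) :
    GivesRealForm (fun q => twist (natAut q ε) (starConj N q)) (N - ε.negCount) ε.negCount := by
  refine givesRealForm_of_signs (fun q => twist_mul starConj_mul _)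
    (fun q => twist_one starConj_one _) (fun q => map_twist_natAut ε) ε.mat_mul_self
    (fun q => rhoPow_comm_mat _ q ε) (baseFrame_mul_mat ε) ?_ rfl
  have := negCount_lt ε hN
  omega

theorem givesRealForm_sharp_nat (ε : SignVec N) (hN : 2 < N) :
    GivesRealForm (fun q => twist ((sharpAut N q).trans (natAut q ε)) (starConj N q))
      (N - (ε.negCount + 1)) (ε.negCount + 1) := by
  have hlt := negCount_lt ε hN
  refine givesRealForm_of_signs (D := matD N * ε.mat) (fun q => twist_mul starConj_mul _)
    (fun q => twist_one starConj_one _) (fun q => map_twist_sharp_natAut ε) ?_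
    (fun q => ?_) (σ := fun a => midSign a * ε.1 a) ?_ (by omega) ?_
  · calc matD N * ε.mat * (matD N * ε.mat) = matD N * (ε.mat * matD N) * ε.mat := by
          simp only [mul_assoc]
      _ = (matD N * matD N) * (ε.mat * ε.mat) := by rw [← ε.matD_comm_mat]; simp only [mul_assoc]
      _ = 1 := by rw [matD_mul_self, ε.mat_mul_self, one_mul]
  · rw [← mul_assoc, rhoPow_comm_matD, mul_assoc, rhoPow_comm_mat, mul_assoc]
  · rw [← mul_assoc, baseFrame_mul_matD, mul_assoc, baseFrame_mul_mat, ← mul_assoc, SignVec.mat,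
      Matrix.diagonal_mul_diagonal]
    congr 2
    ext a
    push_cast
    rfl
  -- The matrix `𝒟` contributes exactly one further negative direction, at the index `N / 2`, where
  -- `ε` is `1`.
  · have h : (Finset.univ.filter fun j : Fin N => midSign j * ε.1 j = -1) =
        insert (⟨N / 2, by omega⟩ : Fin N) (Finset.univ.filter fun j => ε.1 j = -1) := by
      ext j
      simp only [Finset.mem_filter, Finset.mem_univ, true_and, Finset.mem_insert, Fin.ext_iff,
        midSign]
      by_cases hj : (j : ℕ) = N / 2
      · simp [hj, ε.val_of_isMiddle (Or.inr hj)]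
      · simp [hj]
    rw [h, Finset.card_insert_of_notMem, SignVec.negCount]
    simp only [Finset.mem_filter, Finset.mem_univ, true_and]
    rw [ε.val_of_isMiddle (Or.inr rfl)]
    decide

/-- The map `j ↦ j'` acts on the negative entries without fixed points, since a fixed index is a
middle one and carries the sign `1`. -/
theorem even_negCount (ε : SignVec N) : Even ε.negCount := by
  have h : ((ε.negCount : ℕ) : ZMod 2) = 0 := by
    have h1 : ((ε.negCount : ℕ) : ZMod 2) = ∑ j ∈ Finset.univ.filter (fun j => ε.1 j = -1), 1 := by
      simp [SignVec.negCount]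
    rw [h1]
    refine Finset.sum_involution (fun j _ => j.rev) (fun _ _ => by decide) ?_ ?_ (by simp)
    · intro j hj _ he
      rw [Finset.mem_filter, ε.val_of_isMiddle (isMiddle_of_eq_rev he.symm)] at hj
      exact absurd hj.2 (by decide)
    · intro j hj
      rw [Finset.mem_filter] at hj ⊢
      rw [ε.val_rev]
      exact ⟨Finset.mem_univ _, hj.2⟩
  exact (ZMod.natCast_eq_zero_iff_even).1 h

/-- The sign vector with the first `h` entries and the last `h` entries negative. -/
def outerSigns (N h : ℕ) (hh : h ≤ (N - 1) / 2) : SignVec N :=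
  ⟨fun j => if (j : ℕ) < h ∨ (j.rev : ℕ) < h then -1 else 1, fun j => by
    simp only [Fin.rev_rev, or_comm], fun j hj => by
    unfold IsMiddle at hj
    refine if_neg ?_
    rw [Fin.val_rev]
    have := j.2
    omega⟩

theorem negCount_outerSigns (N h : ℕ) (hh : h ≤ (N - 1) / 2) (hN : 0 < N) :
    (outerSigns N h hh).negCount = 2 * h := by
  have e : (Finset.univ.filter fun j : Fin N => (outerSigns N h hh).1 j = -1) =
      (Finset.univ.filter fun j : Fin N => (j : ℕ) < h) ∪
      (Finset.univ.filter fun j : Fin N => (j : ℕ) < h).map Fin.revPerm.toEmbedding := by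
    ext j
    have h1 : (∃ a : Fin N, (a : ℕ) < h ∧ a.rev = j) ↔ (j.rev : ℕ) < h :=
      ⟨by rintro ⟨a, ha, rfl⟩; simpa using ha, fun hj => ⟨j.rev, hj, by simp⟩⟩
    have h2 : (outerSigns N h hh).1 j = -1 ↔ ((j : ℕ) < h ∨ (j.rev : ℕ) < h) := by
      simp only [outerSigns]
      split_ifs with h2
      · exact iff_of_true rfl h2
      · simp only [h2, iff_false]; decide
    rw [Finset.mem_filter, h2]
    simp only [Finset.mem_filter, Finset.mem_univ, true_and, Finset.mem_union,
      Finset.mem_map, Equiv.toEmbedding_apply, Fin.revPerm_apply, h1]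
  rw [SignVec.negCount, e, Finset.card_union_of_disjoint, Finset.card_map, Fin.card_filter_val_lt]
  · omega
  · rw [Finset.disjoint_left]
    intro j hj
    simp only [Finset.mem_filter, Finset.mem_univ, true_and, Finset.mem_map,
      Equiv.toEmbedding_apply, Fin.revPerm_apply] at hj ⊢
    rintro ⟨a, ha, rfl⟩
    rw [Fin.val_rev] at hj
    omega

theorem signatureMatrix_rev {l m : ℕ} (hlm : l + m = N) :
    (signatureMatrix N l).submatrix Fin.rev Fin.rev = -signatureMatrix N m := by
  rw [signatureMatrix, signatureMatrix, Matrix.submatrix_diagonal _ _ Fin.rev_injective,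
    Matrix.diagonal_neg]
  congr 1
  ext a
  simp only [Function.comp_apply, Fin.val_rev]
  have := a.2
  by_cases h : (a : ℕ) < m
  · rw [if_pos h, if_neg (by omega)]
  · rw [if_neg h, if_pos (by omega), neg_neg]

theorem realSO_rev {l m : ℕ} (hlm : l + m = N) {g : Matrix (Fin N) (Fin N) ℝ}
    (hg : g ∈ realSO N l) : g.submatrix Fin.rev Fin.rev ∈ realSO N m := by
  obtain ⟨h1, h2⟩ := hg
  constructor
  · have e : signatureMatrix N m = -(signatureMatrix N l).submatrix Fin.rev Fin.rev := by
      rw [signatureMatrix_rev hlm, neg_neg]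
    rw [e, Matrix.mul_neg, Matrix.neg_mul, Matrix.transpose_submatrix,
      ← Matrix.submatrix_mul _ _ _ _ _ Fin.rev_bijective,
      ← Matrix.submatrix_mul _ _ _ _ _ Fin.rev_bijective, h1]
  · exact (Matrix.det_submatrix_equiv_self Fin.revPerm g).trans h2

/-- The real forms `SO_q(l, m)` and `SO_q(m, l)` are the same. -/
theorem GivesRealForm.swap {s : ∀ q : PosReal, SOq N q →ₗ⋆[ℂ] SOq N q} {l m : ℕ}
    (h : GivesRealForm s l m) : GivesRealForm s m l := by
  obtain ⟨hlm, M, hc, hu, hf, ht, hr⟩ := h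
  have hml : m + l = N := by omega
  have hM : ∀ q, M q * (M q)⁻¹ = 1 := fun q =>
    Matrix.mul_nonsing_inv _ ((Matrix.isUnit_iff_isUnit_det _).1 (hu q))
  -- The new frame is `i` times the old one with its rows reversed: the factor `i` negates the
  -- metric, and the reversal puts the positive directions first again.
  have hprod : ∀ q, (Complex.I • (M q).submatrix Fin.rev id) *
      ((-Complex.I) • ((M q)⁻¹).submatrix id Fin.rev) = 1 := by
    intro q
    rw [Matrix.smul_mul, Matrix.mul_smul, smul_smul,
      ← Matrix.submatrix_mul _ _ _ _ _ Function.bijective_id, hM]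
    have : Complex.I * -Complex.I = 1 := by rw [mul_neg, Complex.I_mul_I, neg_neg]
    rw [this, one_smul]
    exact Matrix.submatrix_one_equiv Fin.revPerm
  have hinv : ∀ q, (Complex.I • (M q).submatrix Fin.rev id)⁻¹ =
      (-Complex.I) • ((M q)⁻¹).submatrix id Fin.rev := fun q => Matrix.inv_eq_right_inv (hprod q)
  refine ⟨hml, fun q => Complex.I • (M q).submatrix Fin.rev id,
    (hc.matrix_submatrix Fin.rev id).const_smul Complex.I, fun q => IsUnit.of_mul_eq_one _ (hprod q),
    fun q => ?_, ?_, ?_⟩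
  · have e : sandwich (q := q) (Complex.I • (M q).submatrix Fin.rev id)
        (Complex.I • (M q).submatrix Fin.rev id)⁻¹ =
        (sandwich (M q) (M q)⁻¹).submatrix Fin.rev Fin.rev := by
      rw [hinv]
      have h1 : Complex.I * -Complex.I = 1 := by rw [mul_neg, Complex.I_mul_I, neg_neg]
      rw [sandwich, scal_smul, scal_smul, Matrix.smul_mul, Matrix.mul_smul, Matrix.smul_mul,
        smul_smul, mul_comm, h1, one_smul]
      ext a b
      simp [sandwich, Matrix.mul_apply, scal]
    rw [e]
    ext a b
    exact congrFun (congrFun (hf q) a.rev) b.rev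
  · simp only [hinv]
    have e : ∀ q, ((-Complex.I) • ((M q)⁻¹).submatrix id Fin.rev)ᵀ * metricC N q *
        ((-Complex.I) • ((M q)⁻¹).submatrix id Fin.rev) =
        -(((M q)⁻¹)ᵀ * metricC N q * (M q)⁻¹).submatrix Fin.rev Fin.rev := by
      intro q
      have h1 : -Complex.I * -Complex.I = -1 := by rw [neg_mul_neg, Complex.I_mul_I]
      rw [Matrix.transpose_smul, Matrix.smul_mul, Matrix.smul_mul, Matrix.mul_smul, smul_smul, h1,
        neg_one_smul]
      congr 1
    simp only [e]
    have h2 : (signatureMatrix N m).map Complex.ofReal =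
        -((signatureMatrix N l).map Complex.ofReal).submatrix Fin.rev Fin.rev := by
      have := signatureMatrix_rev hlm
      rw [Matrix.submatrix_map, this]
      ext a b
      simp
    rw [h2]
    have hcont : Continuous fun X : Matrix (Fin N) (Fin N) ℂ => -X.submatrix Fin.rev Fin.rev :=
      (continuous_id.matrix_submatrix _ _).neg
    exact (hcont.tendsto _).comp ht
  · simp only [hinv]
    have e : ∀ g : Matrix (Fin N) (Fin N) ℂ, (Complex.I • (M 1).submatrix Fin.rev id) * g *
        ((-Complex.I) • ((M 1)⁻¹).submatrix id Fin.rev) =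
        (M 1 * g * (M 1)⁻¹).submatrix Fin.rev Fin.rev := by
      intro g
      have h1 : Complex.I * -Complex.I = 1 := by rw [mul_neg, Complex.I_mul_I, neg_neg]
      rw [Matrix.smul_mul, Matrix.mul_smul, Matrix.smul_mul, smul_smul, mul_comm (-Complex.I), h1,
        one_smul]
      rfl
    simp only [e]
    have e2 : (fun g => (M 1 * g * (M 1)⁻¹).submatrix Fin.rev Fin.rev) '' realPoints (s 1) =
        (fun X : Matrix (Fin N) (Fin N) ℂ => X.submatrix Fin.rev Fin.rev) ''
          ((fun g => M 1 * g * (M 1)⁻¹) '' realPoints (s 1)) := by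
      rw [Set.image_image]
    rw [e2, hr]
    ext X
    constructor
    · rintro ⟨_, ⟨g, hg, rfl⟩, rfl⟩
      exact ⟨_, realSO_rev hlm hg, rfl⟩
    · rintro ⟨g, hg, rfl⟩
      refine ⟨_, ⟨_, realSO_rev hml hg, rfl⟩, ?_⟩
      ext a b
      simp

theorem exists_givesRealForm_nat (hN : 2 < N) {l m : ℕ} (hlm : l + m = N)
    (h : Odd N ∨ (Even l ∧ Even m)) :
    ∃ ε : SignVec N, GivesRealForm (fun q => twist (natAut q ε) (starConj N q)) l m := by
  -- The `(N - 1) / 2` off-middle pairs of indices allow `m` to be any even number up to `2 ((N - 1)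
  -- / 2)`. If `m` is odd, or equal to an even `N`, then `l` is within this range and the two
  -- signatures are swapped.
  have key : ∀ l m : ℕ, l + m = N → Even m → m ≤ 2 * ((N - 1) / 2) → ∃ ε : SignVec N,
      GivesRealForm (fun q => twist (natAut q ε) (starConj N q)) l m := by
    rintro l m hlm ⟨k, rfl⟩ hk
    refine ⟨outerSigns N k (by omega), ?_⟩
    have h1 := givesRealForm_nat (outerSigns N k (by omega)) hN
    rw [negCount_outerSigns N k (by omega) (by omega)] at h1
    convert h1 using 1 <;> omega
  by_cases hm : Even m ∧ m ≤ 2 * ((N - 1) / 2)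
  · exact key l m hlm hm.1 hm.2
  · have : Even l ∧ l ≤ 2 * ((N - 1) / 2) := by
      rw [Nat.even_iff, Nat.even_iff, Nat.odd_iff] at h
      rw [Nat.even_iff] at hm ⊢
      omega
    obtain ⟨ε, hε⟩ := key m l (by omega) this.1 this.2
    exact ⟨ε, hε.swap⟩

theorem exists_givesRealForm_sharp_nat (hN : 2 < N) {l m : ℕ} (hlm : l + m = N)
    (hl : Odd l) (hm : Odd m) :
    ∃ ε : SignVec N, GivesRealForm
      (fun q => twist ((sharpAut N q).trans (natAut q ε)) (starConj N q)) l m := by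
  obtain ⟨k, rfl⟩ := hm
  obtain ⟨j, rfl⟩ := hl
  refine ⟨outerSigns N k (by omega), ?_⟩
  have h1 := givesRealForm_sharp_nat (outerSigns N k (by omega)) hN
  rw [negCount_outerSigns N k (by omega) (by omega)] at h1
  convert h1 using 1
  omega

end RealForms

/-! ### Counting the classes of `⋆^{♯♮}` for `N = 2n` -/

section Counting

variable {N n : ℕ} {q : PosReal}

theorem isMiddle_iff_min (hN : N = 2 * n) (j : Fin N) :
    IsMiddle j ↔ n - 1 ≤ min (j : ℕ) (j.rev : ℕ) := by
  unfold IsMiddle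
  rw [Fin.val_rev]
  have := j.2
  omega

/-- The normal form of a sign vector with first entry `1`. -/
def normalSigns (hN : N = 2 * n) (w : Fin (n - 2) → ℤˣ) : SignVec N :=
  ⟨fun j => if h : 0 < min (j : ℕ) (j.rev : ℕ) ∧ min (j : ℕ) (j.rev : ℕ) < n - 1 then
      w ⟨min (j : ℕ) (j.rev : ℕ) - 1, by omega⟩ else 1,
    fun j => by simp only [Fin.rev_rev, min_comm], fun j hj => by
      rw [isMiddle_iff_min hN] at hj
      exact dif_neg (by omega)⟩

theorem normalSigns_apply (hN : N = 2 * n) (w : Fin (n - 2) → ℤˣ) (i : Fin (n - 2)) :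
    (normalSigns hN w).1 ⟨i + 1, by omega⟩ = w i := by
  have h : min ((i : ℕ) + 1) (N - ((i : ℕ) + 1 + 1)) = i + 1 := by omega
  simp only [normalSigns, Fin.val_rev, h]
  rw [dif_pos (by omega)]
  congr

theorem normalSigns_zero (hN : N = 2 * n) (w : Fin (n - 2) → ℤˣ) (h : 0 < N) :
    (normalSigns hN w).1 ⟨0, h⟩ = 1 := by
  simp [normalSigns]

/-- A sign vector is determined by its values at `0, …, n - 2`. With the value at `0` normalised, `n
- 2` signs remain, at the positions `1, …, n - 2`. -/
theorem eq_normalSigns (hN : N = 2 * n) (h : 0 < N) (ε : SignVec N) (hε : ε.1 ⟨0, h⟩ = 1) :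
    ε = normalSigns hN fun i => ε.1 ⟨i + 1, by omega⟩ := by
  have hmin : ∀ j : Fin N, ε.1 j = ε.1 ⟨min (j : ℕ) (j.rev : ℕ), by omega⟩ := by
    intro j
    rcases le_total (j : ℕ) (j.rev : ℕ) with hj | hj
    · exact congrArg ε.1 (Fin.ext (min_eq_left hj).symm)
    · rw [← ε.val_rev j]
      exact congrArg ε.1 (Fin.ext (min_eq_right hj).symm)
  refine Subtype.ext (funext fun j => ?_)
  simp only [normalSigns]
  split_ifs with hj
  · rw [hmin j]
    exact congrArg ε.1 (Fin.ext (by simp only; omega))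
  · by_cases h0 : min (j : ℕ) (j.rev : ℕ) = 0
    · rw [hmin j]
      refine (congrArg ε.1 (Fin.ext ?_)).trans hε
      exact h0
    · exact ε.val_of_isMiddle ((isMiddle_iff_min hN j).2 (by omega))

open Classical in
/-- The sign vector `-ε` off the middle. -/
def SignVec.flip (ε : SignVec N) : SignVec N :=
  ⟨fun j => if IsMiddle j then 1 else -ε.1 j, fun j => by simp only [isMiddle_rev, ε.val_rev],
    fun j hj => if_pos hj⟩

/-- The class of `⋆^{♯♮}`. -/
def sharpClass (q : PosReal) (ε : SignVec N) : Quotient (starSetoid (SOq N q)) :=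
  Quotient.mk (starSetoid (SOq N q)) (twist ((sharpAut N q).trans (natAut q ε)) (starConj N q))

/-- The equivalence is conjugation by `A`; the flip leaves the middle signs at `1`, as the
intertwining relation requires. -/
theorem sharpClass_flip (hN : Even N) (ε : SignVec N) :
    sharpClass q ε.flip = sharpClass q ε := by
  obtain ⟨α, -, h⟩ := exists_conjAut_matA (q := q) hN ε ε.flip fun j hj => if_neg hj
  exact (Quotient.sound (s := starSetoid (SOq N q)) ⟨α, h⟩).symm

theorem range_sharpClass (hN : N = 2 * n) (hn : 2 ≤ n) :
    Set.range (sharpClass (N := N) q) = Set.range fun w => sharpClass q (normalSigns hN w) := by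
  refine Set.Subset.antisymm ?_ (by rintro _ ⟨w, rfl⟩; exact ⟨_, rfl⟩)
  rintro _ ⟨ε, rfl⟩
  have h0 : 0 < N := by omega
  have hm : ¬ IsMiddle (⟨0, h0⟩ : Fin N) := by unfold IsMiddle; simp only; omega
  rcases Int.units_eq_one_or (ε.1 ⟨0, h0⟩) with h | h
  · exact ⟨_, by simp only; rw [← eq_normalSigns hN h0 ε h]⟩
  · rw [← sharpClass_flip (by rw [hN]; exact even_two_mul n) ε]
    have hf : ε.flip.1 ⟨0, h0⟩ = 1 := by simp [SignVec.flip, hm, h]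
    exact ⟨_, by simp only; rw [← eq_normalSigns hN h0 ε.flip hf]⟩

theorem ncard_range_sharpClass_le (hN : N = 2 * n) (hn : 2 ≤ n) :
    (Set.range (sharpClass (N := N) q)).ncard ≤ 2 ^ (n - 2) := by
  rw [range_sharpClass hN hn, ← Set.image_univ]
  refine (Set.ncard_image_le Set.finite_univ).trans ?_
  rw [Set.ncard_univ, Nat.card_eq_fintype_card, Fintype.card_fun, Fintype.card_units_int,
    Fintype.card_fin]

/-- If the class determines the products of neighbouring off-middle signs, then it determines all
off-middle signs up to a common factor. The normalisation of the first sign removes that factor, so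
distinct normal forms lie in distinct classes. -/
theorem ncard_range_sharpClass (hN : N = 2 * n) (hn : 2 ≤ n)
    (hsep : ∀ ε₁ ε₂ : SignVec N, sharpClass q ε₁ = sharpClass q ε₂ → ∀ (j : ℕ) (hj : j + 3 ≤ n),
      ε₁.1 ⟨j, by omega⟩ * ε₁.1 ⟨j + 1, by omega⟩ = ε₂.1 ⟨j, by omega⟩ * ε₂.1 ⟨j + 1, by omega⟩) :
    (Set.range (sharpClass (N := N) q)).ncard = 2 ^ (n - 2) := by
  have hinj : Function.Injective fun w => sharpClass q (normalSigns hN w) := by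
    intro w w' h
    have key : ∀ (j : ℕ) (hj : j + 2 ≤ n),
        (normalSigns hN w).1 ⟨j, by omega⟩ = (normalSigns hN w').1 ⟨j, by omega⟩ := by
      intro j
      induction j with
      | zero => intro _; rw [normalSigns_zero, normalSigns_zero]
      | succ j ih =>
        intro hj
        have h1 := hsep _ _ h j hj
        rw [ih (by omega)] at h1
        exact mul_left_cancel h1
    funext i
    rw [← normalSigns_apply hN w i, ← normalSigns_apply hN w' i]
    exact key (i + 1) (by omega)
  rw [range_sharpClass hN hn, ← Set.image_univ, Set.ncard_image_of_injective _ hinj,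
    Set.ncard_univ, Nat.card_eq_fintype_card, Fintype.card_fun, Fintype.card_units_int,
    Fintype.card_fin]

end Counting

/-! ### Compatibility of `♯`, `♮` and `⋆` -/

section Summary

variable {N n : ℕ} {q : PosReal}

theorem sharpAut_starConj (x : SOq N q) :
    sharpAut N q (starConj N q x) = starConj N q (sharpAut N q x) :=
  conjAut_starConj _ matD_conj matD_comm_metricC x

theorem natAut_starConj (ε : SignVec N) (x : SOq N q) :
    natAut q ε (starConj N q x) = starConj N q (natAut q ε x) :=
  conjAut_starConj _ ε.mat_conj ε.mat_comm_metricC x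

theorem natAut_sharpAut (ε : SignVec N) (x : SOq N q) :
    natAut q ε (sharpAut N q x) = sharpAut N q (natAut q ε x) :=
  conjAut_comm _ _ ε.matD_comm_mat.symm x

theorem sharp_natAut_involutive (ε : SignVec N) (x : SOq N q) :
    ((sharpAut N q).trans (natAut q ε)) (((sharpAut N q).trans (natAut q ε)) x) = x := by
  change natAut q ε (sharpAut N q (natAut q ε (sharpAut N q x))) = x
  rw [← natAut_sharpAut, natAut, sharpAut, conjAut_conjAut _ ε.mat_mul_self,
    conjAut_conjAut _ matD_mul_self]

theorem sharp_natAut_starConj (ε : SignVec N) (x : SOq N q) :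
    ((sharpAut N q).trans (natAut q ε)) (starConj N q x) =
      starConj N q (((sharpAut N q).trans (natAut q ε)) x) := by
  change natAut q ε (sharpAut N q (starConj N q x)) = starConj N q (natAut q ε (sharpAut N q x))
  rw [sharpAut_starConj, natAut_starConj]

end Summary

/-! ### Characters and skew derivations -/

section Convolution

variable {H : Type} [Ring H] [HopfAlgebra ℂ H]

/-- `E ⊗ F` as a functional. -/
def tensorEval (E F : H →ₗ[ℂ] ℂ) : H ⊗[ℂ] H →ₗ[ℂ] ℂ :=
  LinearMap.mul' ℂ ℂ ∘ₗ TensorProduct.map E F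

theorem tensorEval_tmul (E F : H →ₗ[ℂ] ℂ) (x y : H) : tensorEval E F (x ⊗ₜ y) = E x * F y := rfl

/-- The convolution product of functionals. -/
def conv (E F : H →ₗ[ℂ] ℂ) : H →ₗ[ℂ] ℂ := tensorEval E F ∘ₗ Coalgebra.comul

/-- The product rules are taken in the common form `a x * b y + c x * d y`, which covers characters
(with `c = d = 0`) as well as skew derivations. All convolution rules below are instances. -/
theorem tensorEval_mul {E F a b c d a' b' c' d' : H →ₗ[ℂ] ℂ}
    (hE : ∀ x y, E (x * y) = a x * b y + c x * d y)
    (hF : ∀ x y, F (x * y) = a' x * b' y + c' x * d' y) (u v : H ⊗[ℂ] H) :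
    tensorEval E F (u * v) = tensorEval a a' u * tensorEval b b' v +
      tensorEval a c' u * tensorEval b d' v + tensorEval c a' u * tensorEval d b' v +
      tensorEval c c' u * tensorEval d d' v := by
  induction u using TensorProduct.induction_on with
  | zero => simp
  | add u w hu hw => simp only [add_mul, map_add, hu, hw]; ring
  | tmul x y =>
    induction v using TensorProduct.induction_on with
    | zero => simp
    | add u w hu hw => simp only [mul_add, map_add, hu, hw]; ring
    | tmul z w =>
      simp only [Algebra.TensorProduct.tmul_mul_tmul, tensorEval_tmul, hE, hF]
      ring

theorem conv_mul {E F a b c d a' b' c' d' : H →ₗ[ℂ] ℂ}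
    (hE : ∀ x y, E (x * y) = a x * b y + c x * d y)
    (hF : ∀ x y, F (x * y) = a' x * b' y + c' x * d' y) (x y : H) :
    conv E F (x * y) = conv a a' x * conv b b' y + conv a c' x * conv b d' y +
      conv c a' x * conv d b' y + conv c c' x * conv d d' y := by
  simp only [conv, LinearMap.comp_apply, Bialgebra.comul_mul]
  exact tensorEval_mul hE hF _ _

theorem conv_zero_left (F : H →ₗ[ℂ] ℂ) : conv 0 F = 0 := by
  ext x; simp [conv, tensorEval]

theorem conv_zero_right (F : H →ₗ[ℂ] ℂ) : conv F 0 = 0 := by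
  ext x; simp [conv, tensorEval]

theorem conv_smul_left (z : ℂ) (E F : H →ₗ[ℂ] ℂ) : conv (z • E) F = z • conv E F := by
  ext x; simp [conv, tensorEval, TensorProduct.map_smul_left]

theorem conv_smul_right (z : ℂ) (E F : H →ₗ[ℂ] ℂ) : conv E (z • F) = z • conv E F := by
  ext x; simp [conv, tensorEval, TensorProduct.map_smul_right]

theorem conv_one (E F : H →ₗ[ℂ] ℂ) : conv E F 1 = E 1 * F 1 := by
  simp [conv, Algebra.TensorProduct.one_def, tensorEval_tmul]

theorem conv_counit_left (F : H →ₗ[ℂ] ℂ) : conv Coalgebra.counit F = F := by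
  have h : tensorEval (Coalgebra.counit (R := ℂ) (A := H)) F =
      (LinearMap.mul' ℂ ℂ ∘ₗ TensorProduct.map LinearMap.id F) ∘ₗ
        (Coalgebra.counit (R := ℂ) (A := H)).rTensor H := by
    refine TensorProduct.ext' fun x y => ?_
    simp [tensorEval_tmul]
  ext x
  rw [conv, h, LinearMap.comp_apply, LinearMap.comp_apply, Coalgebra.rTensor_counit_comul]
  simp

theorem conv_counit_right (F : H →ₗ[ℂ] ℂ) : conv F Coalgebra.counit = F := by
  have h : tensorEval F (Coalgebra.counit (R := ℂ) (A := H)) =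
      (LinearMap.mul' ℂ ℂ ∘ₗ TensorProduct.map F LinearMap.id) ∘ₗ
        (Coalgebra.counit (R := ℂ) (A := H)).lTensor H := by
    refine TensorProduct.ext' fun x y => ?_
    simp [tensorEval_tmul]
  ext x
  rw [conv, h, LinearMap.comp_apply, LinearMap.comp_apply, Coalgebra.lTensor_counit_comul]
  simp

/-- The pullback of a functional along a Hopf algebra automorphism. -/
def pull (α : H ≃ₐc[ℂ] H) (E : H →ₗ[ℂ] ℂ) : H →ₗ[ℂ] ℂ where
  toFun x := E (α x)
  map_add' x y := by simp
  map_smul' z x := by simp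

theorem pull_apply (α : H ≃ₐc[ℂ] H) (E : H →ₗ[ℂ] ℂ) (x : H) : pull α E x = E (α x) := rfl

theorem pull_smul (α : H ≃ₐc[ℂ] H) (z : ℂ) (E : H →ₗ[ℂ] ℂ) : pull α (z • E) = z • pull α E := rfl

theorem pull_injective (α : H ≃ₐc[ℂ] H) {E F : H →ₗ[ℂ] ℂ} (h : pull α E = pull α F) : E = F := by
  ext x
  obtain ⟨y, rfl⟩ : ∃ y, α y = x := ⟨α.symm x, α.right_inv x⟩
  exact LinearMap.congr_fun h y

theorem pull_symm_pull (α : H ≃ₐc[ℂ] H) (E : H →ₗ[ℂ] ℂ) : pull α (pull α.symm E) = E := by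
  ext x
  exact congrArg E (α.left_inv x)

theorem pull_counit (α : H ≃ₐc[ℂ] H) : pull α Coalgebra.counit = Coalgebra.counit := by
  ext x
  exact CoalgHomClass.counit_comp_apply α x

theorem pull_conv (α : H ≃ₐc[ℂ] H) (E F : H →ₗ[ℂ] ℂ) :
    pull α (conv E F) = conv (pull α E) (pull α F) := by
  ext x
  have h1 := CoalgHomClass.map_comp_comul_apply α x
  rw [pull_apply, conv, conv, LinearMap.comp_apply, ← h1, LinearMap.comp_apply]
  generalize Coalgebra.comul (R := ℂ) x = u
  induction u using TensorProduct.induction_on with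
  | zero => simp
  | add u v hu hv => simp only [map_add, hu, hv]
  | tmul x y => rfl

/-- A character. -/
structure IsChar (χ : H →ₗ[ℂ] ℂ) : Prop where
  map_one : χ 1 = 1
  map_mul : ∀ x y, χ (x * y) = χ x * χ y

/-- A skew derivation with respect to two characters. -/
def IsSkew (χ ψ δ : H →ₗ[ℂ] ℂ) : Prop := ∀ x y, δ (x * y) = χ x * δ y + δ x * ψ y

theorem isChar_counit : IsChar (Coalgebra.counit : H →ₗ[ℂ] ℂ) :=
  ⟨Bialgebra.counit_one, Bialgebra.counit_mul⟩

theorem IsChar.conv {χ ψ : H →ₗ[ℂ] ℂ} (hχ : IsChar χ) (hψ : IsChar ψ) : IsChar (conv χ ψ) := by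
  refine ⟨by rw [conv_one, hχ.map_one, hψ.map_one, mul_one], fun x y => ?_⟩
  rw [conv_mul (a := χ) (b := χ) (c := 0) (d := 0) (a' := ψ) (b' := ψ) (c' := 0) (d' := 0)]
  · simp [conv_zero_left]
    simp [conv_zero_right]
  · simpa using hχ.map_mul
  · simpa using hψ.map_mul

theorem IsChar.pull {χ : H →ₗ[ℂ] ℂ} (hχ : IsChar χ) (α : H ≃ₐc[ℂ] H) : IsChar (pull α χ) :=
  ⟨by rw [pull_apply, _root_.map_one, hχ.map_one], fun x y => by
    simp only [pull_apply, _root_.map_mul, hχ.map_mul]⟩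

theorem IsSkew.pull {χ ψ δ : H →ₗ[ℂ] ℂ} (h : IsSkew χ ψ δ) (α : H ≃ₐc[ℂ] H) :
    IsSkew (pull α χ) (pull α ψ) (pull α δ) := fun x y => by
  simp only [pull_apply, map_mul, h _ _]

theorem IsSkew.smul {χ ψ δ : H →ₗ[ℂ] ℂ} (h : IsSkew χ ψ δ) (z : ℂ) : IsSkew χ ψ (z • δ) :=
  fun x y => by simp only [LinearMap.smul_apply, h x y, smul_eq_mul]; ring

/-- Multiplication by a group-like functional shifts both characters of a skew derivation. This
brings products such as `χ E` and `E χ` to the same pair of characters, so that they can be compared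
on `T` alone. -/
theorem IsSkew.conv_char_left {κ χ ψ δ : H →ₗ[ℂ] ℂ} (h : IsSkew χ ψ δ) (hκ : IsChar κ) :
    IsSkew (conv κ χ) (conv κ ψ) (conv κ δ) := fun x y => by
  rw [conv_mul (a := κ) (b := κ) (c := 0) (d := 0) (by simpa using hκ.map_mul) h]
  simp [conv_zero_left]

theorem IsSkew.conv_char_right {κ χ ψ δ : H →ₗ[ℂ] ℂ} (h : IsSkew χ ψ δ) (hκ : IsChar κ) :
    IsSkew (conv χ κ) (conv ψ κ) (conv δ κ) := fun x y => by
  rw [conv_mul (a' := κ) (b' := κ) (c' := 0) (d' := 0) h (by simpa using hκ.map_mul)]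
  simp [conv_zero_right]

theorem IsSkew.map_one {χ ψ δ : H →ₗ[ℂ] ℂ} (h : IsSkew χ ψ δ) (hχ : χ 1 = 1) (hψ : ψ 1 = 1) :
    δ 1 = 0 := by
  have := h 1 1
  rw [mul_one, hχ, hψ, one_mul, mul_one] at this
  exact left_eq_add.1 this

/-- The commutator of skew derivations. -/
theorem IsSkew.commutator {κ κ' E F : H →ₗ[ℂ] ℂ} (hE : IsSkew κ Coalgebra.counit E)
    (hF : IsSkew Coalgebra.counit κ' F) {w w' : ℂ} (hw : w * w' = 1)
    (h1 : QuantumOrthogonal.conv κ F = w • QuantumOrthogonal.conv F κ)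
    (h2 : QuantumOrthogonal.conv E κ' = w' • QuantumOrthogonal.conv κ' E) :
    IsSkew κ κ' (QuantumOrthogonal.conv E F - QuantumOrthogonal.conv F E) := fun x y => by
  rw [LinearMap.sub_apply, LinearMap.sub_apply, LinearMap.sub_apply, conv_mul hE hF,
    conv_mul hF hE, h1, h2]
  simp only [conv_counit_left, conv_counit_right, LinearMap.smul_apply, smul_eq_mul]
  -- The mixed terms of the two products cancel exactly because `w w' = 1`.
  linear_combination (QuantumOrthogonal.conv F κ x * QuantumOrthogonal.conv κ' E y) * hw

/-- This is the trivial skew derivation for two given characters; the commutator of a root vector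
with its conjugate turns out to be a multiple of it. -/
theorem IsChar.isSkew_sub {χ ψ : H →ₗ[ℂ] ℂ} (hχ : IsChar χ) (hψ : IsChar ψ) :
    IsSkew χ ψ (χ - ψ) := fun x y => by
  simp only [LinearMap.sub_apply, hχ.map_mul, hψ.map_mul]
  ring

/-- The functional `x ↦ conj (E (s x))`. -/
def starPull (s : H →ₗ⋆[ℂ] H) (E : H →ₗ[ℂ] ℂ) : H →ₗ[ℂ] ℂ where
  toFun x := conj (E (s x))
  map_add' x y := by simp
  map_smul' z x := by simp

theorem starPull_apply (s : H →ₗ⋆[ℂ] H) (E : H →ₗ[ℂ] ℂ) (x : H) :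
    starPull s E x = conj (E (s x)) := rfl

theorem IsStarStructure.starPull_counit {s : H →ₗ⋆[ℂ] H} (hs : IsStarStructure s) :
    starPull s Coalgebra.counit = Coalgebra.counit := by
  ext x
  rw [starPull_apply, hs.counit, Complex.conj_conj]

theorem IsChar.starPull {s : H →ₗ⋆[ℂ] H} (hs : IsStarStructure s) {χ : H →ₗ[ℂ] ℂ}
    (hχ : IsChar χ) : IsChar (starPull s χ) :=
  ⟨by rw [starPull_apply, hs.map_one, hχ.map_one, _root_.map_one], fun x y => by
    simp only [starPull_apply, hs.map_mul, hχ.map_mul, _root_.map_mul]; ring⟩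

/-- The conjugation is antimultiplicative, so the left and right characters change places. -/
theorem IsSkew.starPull {s : H →ₗ⋆[ℂ] H} (hs : IsStarStructure s) {χ ψ δ : H →ₗ[ℂ] ℂ}
    (h : IsSkew χ ψ δ) :
    IsSkew (QuantumOrthogonal.starPull s ψ) (QuantumOrthogonal.starPull s χ)
      (QuantumOrthogonal.starPull s δ) := fun x y => by
  simp only [starPull_apply, hs.map_mul, h _ _, map_add, map_mul]
  ring

end Convolution

/-! ### Functionals determined by their values on `T` -/

section Values

variable {N : ℕ} {q : PosReal}

theorem map_conv (E F : SOq N q →ₗ[ℂ] ℂ) :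
    (genT N q).map (conv E F) = (genT N q).map E * (genT N q).map F := by
  ext a b
  simp only [Matrix.map_apply, conv, LinearMap.comp_apply, comul_univMat, map_sum,
    tensorEval_tmul, Matrix.mul_apply]

theorem map_counit : (genT N q).map (Coalgebra.counit : SOq N q →ₗ[ℂ] ℂ) = 1 := by
  ext a b
  rw [Matrix.map_apply, counit_univMat]

/-- A skew derivation vanishes on scalars, and its product rule reduces every product to its
factors; hence the entries of `T` suffice once the two characters are given. -/
theorem IsSkew.ext {χ ψ δ δ' : SOq N q →ₗ[ℂ] ℂ} (h : IsSkew χ ψ δ) (h' : IsSkew χ ψ δ')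
    (hχ : χ 1 = 1) (hψ : ψ 1 = 1) (hT : (genT N q).map δ = (genT N q).map δ') : δ = δ' := by
  ext x
  induction x using FRTAlgebra.induction with
  | hc c =>
    rw [Algebra.algebraMap_eq_smul_one, map_smul, map_smul, h.map_one hχ hψ, h'.map_one hχ hψ]
  | hT a b => exact congrFun (congrFun hT a) b
  | hadd x y hx hy => rw [map_add, map_add, hx, hy]
  | hmul x y hx hy => rw [h, h', hx, hy]

theorem IsChar.ext {χ ψ : SOq N q →ₗ[ℂ] ℂ} (hχ : IsChar χ) (hψ : IsChar ψ)
    (hT : (genT N q).map χ = (genT N q).map ψ) : χ = ψ := by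
  ext x
  induction x using FRTAlgebra.induction with
  | hc c => rw [Algebra.algebraMap_eq_smul_one, map_smul, map_smul, hχ.map_one, hψ.map_one]
  | hT a b => exact congrFun (congrFun hT a) b
  | hadd x y hx hy => rw [map_add, map_add, hx, hy]
  | hmul x y hx hy => rw [hχ.map_mul, hψ.map_mul, hx, hy]

theorem IsChar.isPoint {χ : SOq N q →ₗ[ℂ] ℂ} (hχ : IsChar χ) :
    IsPoint (matrixR N q) (metricC N q) (antisymTensors N q) ((genT N q).map χ) :=
  (isPoint_univMat _ _ _).map (AlgHom.ofLinearMap χ hχ.map_one hχ.map_mul)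

end Values

/-! ### The quadratic relation for the matrix of a skew derivation -/

section SkewRelations

variable {N : ℕ} {q : PosReal}

/-- The parameter `q` as a complex number. -/
def cq (q : PosReal) : ℂ := ((q : ℝ) : ℂ)

/-- The complex number `q ^ ρ_a`. -/
def qRho (q : PosReal) (a : Fin N) : ℂ := (((q : ℝ) ^ rho N a : ℝ) : ℂ)

/-- The diagonal entries `R^{ab}_{ab}` as complex numbers. -/
def cDiag (q : PosReal) (a b : Fin N) : ℂ := (rDiag N q a b : ℂ)

theorem cq_ne_zero (q : PosReal) : cq q ≠ 0 := Complex.ofReal_ne_zero.2 q.2.ne'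

theorem qRho_ne_zero (q : PosReal) (a : Fin N) : qRho q a ≠ 0 :=
  Complex.ofReal_ne_zero.2 (Real.rpow_pos_of_pos q.2 _).ne'

theorem qRho_rev (q : PosReal) (a : Fin N) : qRho q a.rev = (qRho q a)⁻¹ := by
  rw [qRho, qRho, rho_rev, Real.rpow_neg q.2.le, Complex.ofReal_inv]

theorem cq_pow_ne_one (hq : q ≠ 1) {k : ℕ} (hk : k ≠ 0) : cq q ^ k ≠ 1 := by
  rw [cq, ← Complex.ofReal_pow]
  intro h
  have h1 : (q : ℝ) ^ k = 1 := by exact_mod_cast h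
  rw [pow_eq_one_iff_of_nonneg q.2.le hk] at h1
  exact hq (Subtype.ext h1)

theorem cq_sub_inv_ne_zero (hq : q ≠ 1) : cq q - (cq q)⁻¹ ≠ 0 := by
  have h0 := cq_ne_zero q
  intro h
  refine cq_pow_ne_one hq two_ne_zero ?_
  field_simp at h
  linear_combination h

theorem matrixR_eq (a b c d : Fin N) : matrixR N q (a, b) (c, d) =
    (if c = a ∧ d = b then cDiag q a b else 0) +
    (if c = b ∧ d = a ∧ b < a then cq q - (cq q)⁻¹ else 0) -
    (if b = a.rev ∧ d = c.rev ∧ c < a then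
      (cq q - (cq q)⁻¹) * (qRho q a / qRho q c) else 0) := by
  rw [matrixR_apply, realR]
  simp only [Real.rpow_sub q.2, cDiag, cq, qRho, Complex.ofReal_add, Complex.ofReal_sub,
    apply_ite Complex.ofReal, Complex.ofReal_mul, Complex.ofReal_inv, Complex.ofReal_div,
    Complex.ofReal_zero]

theorem rev_eq_iff {a b : Fin N} : a.rev = b ↔ a = b.rev :=
  ⟨fun h => by rw [← h, Fin.rev_rev], fun h => by rw [h, Fin.rev_rev]⟩

/-- Each of the three terms of `R` has a single nonzero entry once three of the indices are fixed,
so this contraction and the next three have closed forms. -/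
theorem sum_matrixR_mul_right (a b c : Fin N) (g : Fin N → ℂ) :
    ∑ f, matrixR N q (a, b) (c, f) * g f =
      (if c = a then cDiag q a b * g b else 0) +
      (if c = b ∧ b < a then (cq q - (cq q)⁻¹) * g a else 0) -
      (if b = a.rev ∧ c < a then (cq q - (cq q)⁻¹) * (qRho q a / qRho q c) * g c.rev else 0) := by
  simp only [matrixR_eq, sub_mul, add_mul, Finset.sum_add_distrib, Finset.sum_sub_distrib,
    ite_and, ite_mul, zero_mul, Finset.sum_ite_irrel, Finset.sum_ite_eq', Finset.mem_univ, if_true,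
    Finset.sum_const_zero]

theorem sum_matrixR_mul_left (a b d : Fin N) (g : Fin N → ℂ) :
    ∑ e, matrixR N q (a, b) (e, d) * g e =
      (if d = b then cDiag q a b * g a else 0) +
      (if d = a ∧ b < a then (cq q - (cq q)⁻¹) * g b else 0) -
      (if b = a.rev ∧ d.rev < a then
        (cq q - (cq q)⁻¹) * (qRho q a / qRho q d.rev) * g d.rev else 0) := by
  have h : ∀ e : Fin N, d = e.rev ↔ e = d.rev := fun e => by rw [← rev_eq_iff, eq_comm]
  simp only [matrixR_eq, sub_mul, add_mul, Finset.sum_add_distrib, Finset.sum_sub_distrib,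
    ite_and, ite_mul, zero_mul, Finset.sum_ite_irrel, Finset.sum_ite_eq', Finset.mem_univ, if_true,
    Finset.sum_const_zero, h]

theorem sum_mul_matrixR_left (b c d : Fin N) (g : Fin N → ℂ) :
    ∑ e, g e * matrixR N q (e, b) (c, d) =
      (if d = b then cDiag q c b * g c else 0) +
      (if c = b ∧ b < d then (cq q - (cq q)⁻¹) * g d else 0) -
      (if d = c.rev ∧ c < b.rev then
        (cq q - (cq q)⁻¹) * (qRho q b.rev / qRho q c) * g b.rev else 0) := by
  have h : ∀ e : Fin N, b = e.rev ↔ b.rev = e := fun e => rev_eq_iff.symm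
  have e1 : ∀ e : Fin N, g e * matrixR N q (e, b) (c, d) =
      (if c = e then (if d = b then cDiag q e b * g e else 0) else 0) +
      (if d = e then (if c = b ∧ b < e then (cq q - (cq q)⁻¹) * g e else 0) else 0) -
      (if b.rev = e then (if d = c.rev ∧ c < e then
        (cq q - (cq q)⁻¹) * (qRho q e / qRho q c) * g e else 0) else 0) := by
    intro e
    rw [mul_comm, matrixR_eq, sub_mul, add_mul]
    simp only [ite_mul, zero_mul, ite_and, h]
    congr 2
    by_cases h1 : c = b <;> simp [h1]
  simp only [e1, Finset.sum_add_distrib, Finset.sum_sub_distrib, Finset.sum_ite_eq,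
    Finset.mem_univ, if_true]

theorem sum_mul_matrixR_right (a c d : Fin N) (g : Fin N → ℂ) :
    ∑ f, g f * matrixR N q (a, f) (c, d) =
      (if c = a then cDiag q a d * g d else 0) +
      (if d = a ∧ c < a then (cq q - (cq q)⁻¹) * g c else 0) -
      (if d = c.rev ∧ c < a then (cq q - (cq q)⁻¹) * (qRho q a / qRho q c) * g a.rev else 0) := by
  have e1 : ∀ f : Fin N, g f * matrixR N q (a, f) (c, d) =
      (if d = f then (if c = a then cDiag q a f * g f else 0) else 0) +
      (if c = f then (if d = a ∧ f < a then (cq q - (cq q)⁻¹) * g f else 0) else 0) -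
      (if a.rev = f then (if d = c.rev ∧ c < a then
        (cq q - (cq q)⁻¹) * (qRho q a / qRho q c) * g f else 0) else 0) := by
    intro f
    rw [mul_comm, matrixR_eq, sub_mul, add_mul]
    simp only [ite_mul, zero_mul, ite_and, eq_comm (a := f) (b := a.rev)]
    congr 2
    by_cases h1 : c = a <;> simp [h1]
  simp only [e1, Finset.sum_add_distrib, Finset.sum_sub_distrib, Finset.sum_ite_eq,
    Finset.mem_univ, if_true]

/-- The relation `R (t ⊗ Y + Y ⊗ 1) = (Y ⊗ t + 1 ⊗ Y) R`, satisfied by the matrices of a skew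
derivation. -/
def SkewRTT (q : PosReal) (t : Fin N → ℂ) (Y : Matrix (Fin N) (Fin N) ℂ) : Prop :=
  ∀ a b c d, ∑ e, ∑ f, matrixR N q (a, b) (e, f) *
      (Matrix.diagonal t e c * Y f d + Y e c * (1 : Matrix (Fin N) (Fin N) ℂ) f d) =
    ∑ e, ∑ f, (Matrix.diagonal t b f * Y a e + Y b f * (1 : Matrix (Fin N) (Fin N) ℂ) a e) *
      matrixR N q (e, f) (c, d)

/-- The first half of each side comes from the diagonal character, the second from the counit. In
this form the relation can be tested one quadruple of indices at a time, both to verify solutions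
and to restrict them. -/
theorem skewRTT_iff {t : Fin N → ℂ} {Y : Matrix (Fin N) (Fin N) ℂ} :
    SkewRTT q t Y ↔ ∀ a b c d,
      t c * ((if c = a then cDiag q a b * Y b d else 0) +
        (if c = b ∧ b < a then (cq q - (cq q)⁻¹) * Y a d else 0) -
        (if b = a.rev ∧ c < a then
          (cq q - (cq q)⁻¹) * (qRho q a / qRho q c) * Y c.rev d else 0)) +
      ((if d = b then cDiag q a b * Y a c else 0) +
        (if d = a ∧ b < a then (cq q - (cq q)⁻¹) * Y b c else 0) -
        (if b = a.rev ∧ d.rev < a then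
          (cq q - (cq q)⁻¹) * (qRho q a / qRho q d.rev) * Y d.rev c else 0)) =
      t b * ((if d = b then cDiag q c b * Y a c else 0) +
        (if c = b ∧ b < d then (cq q - (cq q)⁻¹) * Y a d else 0) -
        (if d = c.rev ∧ c < b.rev then
          (cq q - (cq q)⁻¹) * (qRho q b.rev / qRho q c) * Y a b.rev else 0)) +
      ((if c = a then cDiag q a d * Y b d else 0) +
        (if d = a ∧ c < a then (cq q - (cq q)⁻¹) * Y b c else 0) -
        (if d = c.rev ∧ c < a then
          (cq q - (cq q)⁻¹) * (qRho q a / qRho q c) * Y b a.rev else 0)) := by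
  refine forall_congr' fun a => forall_congr' fun b => forall_congr' fun c =>
    forall_congr' fun d => ?_
  rw [← sum_matrixR_mul_right a b c fun f => Y f d, ← sum_matrixR_mul_left a b d fun e => Y e c,
    ← sum_mul_matrixR_left b c d fun e => Y a e, ← sum_mul_matrixR_right a c d fun f => Y b f]
  have h1 : ∑ e, ∑ f, matrixR N q (a, b) (e, f) *
      (Matrix.diagonal t e c * Y f d + Y e c * (1 : Matrix (Fin N) (Fin N) ℂ) f d) =
      t c * ∑ f, matrixR N q (a, b) (c, f) * Y f d + ∑ e, matrixR N q (a, b) (e, d) * Y e c := by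
    simp only [mul_add, Finset.sum_add_distrib]
    congr 1
    · rw [Finset.sum_eq_single c]
      · rw [Finset.mul_sum]
        exact Finset.sum_congr rfl fun f _ => by rw [Matrix.diagonal_apply_eq]; ring
      · intro e _ he
        exact Finset.sum_eq_zero fun f _ => by rw [Matrix.diagonal_apply_ne _ he]; ring
      · simp
    · refine Finset.sum_congr rfl fun e _ => ?_
      rw [Finset.sum_eq_single d]
      · rw [Matrix.one_apply_eq, mul_one]
      · intro f _ hf
        rw [Matrix.one_apply_ne hf, mul_zero, mul_zero]
      · simp
  have h2 : ∑ e, ∑ f, (Matrix.diagonal t b f * Y a e +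
      Y b f * (1 : Matrix (Fin N) (Fin N) ℂ) a e) * matrixR N q (e, f) (c, d) =
      t b * ∑ e, Y a e * matrixR N q (e, b) (c, d) + ∑ f, Y b f * matrixR N q (a, f) (c, d) := by
    simp only [add_mul, Finset.sum_add_distrib]
    congr 1
    · rw [Finset.mul_sum]
      refine Finset.sum_congr rfl fun e _ => ?_
      rw [Finset.sum_eq_single b]
      · rw [Matrix.diagonal_apply_eq]; ring
      · intro f _ hf
        rw [Matrix.diagonal_apply_ne _ hf.symm]; ring
      · simp
    · rw [Finset.sum_eq_single a]
      · exact Finset.sum_congr rfl fun f _ => by rw [Matrix.one_apply_eq, mul_one]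
      · intro e _ he
        exact Finset.sum_eq_zero fun f _ => by rw [Matrix.one_apply_ne he.symm]; ring
      · simp
  rw [h1, h2]

end SkewRelations

/-! ### Simple root vectors solve the quadratic relation -/

section SimpleRoots

variable {N : ℕ} {q : PosReal}

theorem cDiag_eq (hN : Even N) (a b : Fin N) :
    cDiag q a b = if a = b then cq q else if b = a.rev then (cq q)⁻¹ else 1 := by
  simp only [cDiag, rDiag, if_neg (ne_rev_of_even hN a), cq]
  split_ifs <;> simp

/-- `e_u - e_v` is a simple root or the negative of the weight-reversed one. -/
structure IsSimplePair (u v : Fin N) : Prop where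
  lt : u < v
  ne : v ≠ u.rev
  between : ∀ c, u < c → c < v → c = u.rev ∨ c = v.rev
  rho_eq : rho N u = rho N v + 1

theorem IsSimplePair.mirror {u v : Fin N} (h : IsSimplePair u v) : IsSimplePair v.rev u.rev where
  lt := Fin.rev_lt_rev.2 h.lt
  ne := fun e => h.ne (by rw [Fin.rev_rev] at e; exact e.symm)
  between c h1 h2 := by
    rw [Fin.rev_rev, Fin.rev_rev]
    have h3 := h.between c.rev (by rwa [Fin.lt_rev_iff]) (by rwa [Fin.rev_lt_iff])
    rw [Fin.rev_inj, Fin.rev_inj] at h3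
    exact h3.symm
  rho_eq := by rw [rho_rev, rho_rev, h.rho_eq]; ring

theorem IsSimplePair.qRho_eq {u v : Fin N} (h : IsSimplePair u v) : qRho q u = cq q * qRho q v := by
  rw [qRho, qRho, cq, h.rho_eq, Real.rpow_add q.2, Real.rpow_one]
  push_cast
  ring

/-- The weights of the group-like element attached to the simple root `e_u - e_v`. -/
def rootWeight (q : PosReal) (u v a : Fin N) : ℂ :=
  if a = u ∨ a = v.rev then cq q else if a = v ∨ a = u.rev then (cq q)⁻¹ else 1

/-- The matrix unit `e_{uv}`. -/
def unitMat (u v a b : Fin N) : ℂ := if a = u ∧ b = v then 1 else 0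

/-- The root vector `e_{uv} - e_{v'u'}`. -/
def rootMat (u v : Fin N) : Matrix (Fin N) (Fin N) ℂ :=
  Matrix.of fun a b => unitMat u v a b - unitMat v.rev u.rev a b

theorem rootWeight_mirror (u v : Fin N) : rootWeight q v.rev u.rev = rootWeight q u v := by
  ext a
  simp only [rootWeight, Fin.rev_rev, or_comm]

/-- The indicator of a tuple of indices. -/
def ind (x y z w a b c d : Fin N) : ℂ := if a = x ∧ b = y ∧ c = z ∧ d = w then 1 else 0

/-- `1` if `x` lies strictly between `u` and `v`. -/
def btw (u v x : Fin N) : ℂ := if u < x ∧ x < v then 1 else 0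

theorem btw_mirror (u v x : Fin N) : btw v.rev u.rev x.rev = btw u v x := by
  simp only [btw, Fin.rev_lt_rev, and_comm]

variable {u v : Fin N}

/-- If `u` were not a middle index, then `u + 1` would lie between `u` and `v` without being `u'` or
`v'`. So `u` is a middle index and `ρ` vanishes there. The situation occurs for the mirrored fork
root, where an index between `u` and `v` is unavoidable. -/
theorem IsSimplePair.qRho_left_of_btw (h : IsSimplePair u v) (h1 : u < u.rev) (h2 : u.rev < v) :
    qRho q u = 1 := by
  have hm : IsMiddle u := by
    by_contra hm
    have h3 : u.1 + 1 < u.rev.1 := by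
      unfold IsMiddle at hm
      rw [Fin.lt_def, Fin.val_rev] at h1
      rw [Fin.val_rev]
      omega
    have h4 := h.between ⟨u.1 + 1, by have := u.rev.2; omega⟩ (by simp [Fin.lt_def])
      (by rw [Fin.lt_def] at h2 ⊢; simp only; omega)
    rcases h4 with h4 | h4
    · rw [Fin.ext_iff] at h4; simp only at h4; omega
    · have h5 : v.rev < u := Fin.rev_lt_iff.1 h2
      rw [Fin.ext_iff] at h4; rw [Fin.lt_def] at h5; simp only at h4; omega
  rw [qRho, rho_eq_zero_of_isMiddle hm]
  simp

theorem IsSimplePair.qRho_right_of_btw (h : IsSimplePair u v) (h1 : u < v.rev) (h2 : v.rev < v) :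
    qRho q v = 1 := by
  have := h.mirror.qRho_left_of_btw (q := q) (by rwa [Fin.rev_rev])
    (by rw [Fin.rev_rev]; exact Fin.lt_rev_iff.1 h1)
  rw [qRho_rev] at this
  simpa using this

/-- The weights of `κ` are the ratios of the diagonal entries of `R` in the rows `u` and `v`; this
is what singles out the group-like element attached to the root. -/
theorem cDiag_eq_rootWeight_mul (hN : Even N) (h : IsSimplePair u v) (b : Fin N) :
    cDiag q u b = rootWeight q u v b * cDiag q v b := by
  have := cq_ne_zero q
  have h1 := h.lt.ne
  have h2 := ne_rev_of_even hN u
  have h3 := ne_rev_of_even hN v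
  have h4 := h.ne
  have h5 : u ≠ v.rev := fun e => h4 (by rw [e, Fin.rev_rev])
  rw [cDiag_eq hN, cDiag_eq hN, rootWeight]
  grind

/-- The five lemmas `root_term_*` write the terms of the quadratic relation on a matrix unit as
combinations of indicators. Some indicators cancel among the terms for `e_{uv}`; the others cancel
against the terms for the mirrored unit `e_{v'u'}`, which explains the shape of the root vector. -/
theorem root_term_diag (hN : Even N) (h : IsSimplePair u v) (a b c d : Fin N) :
    rootWeight q u v c * (if c = a then cDiag q a b * unitMat u v b d else 0) -
      (if c = a then cDiag q a d * unitMat u v b d else 0) =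
    (cq q - (cq q)⁻¹) * (cq q * ind u u u v a b c d - ind v u v v a b c d -
      (cq q)⁻¹ * ind u.rev u u.rev v a b c d + ind v.rev u v.rev v a b c d) := by
  have := cq_ne_zero q
  have h1 := h.lt.ne
  have h2 := ne_rev_of_even hN u
  have h3 := ne_rev_of_even hN v
  have h4 := h.ne
  have h5 : u ≠ v.rev := fun e => h4 (by rw [e, Fin.rev_rev])
  simp only [cDiag_eq hN, rootWeight, unitMat, ind]
  by_cases e1 : c = a
  · subst e1
    by_cases e2 : b = u ∧ d = v
    · obtain ⟨rfl, rfl⟩ := e2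
      grind [Fin.rev_inj, Fin.rev_rev]
    · rcases not_and_or.1 e2 with e | e <;> simp [e]
  · grind

theorem root_term_swap_left (hN : Even N) (h : IsSimplePair u v) (a b c d : Fin N) :
    rootWeight q u v c *
        (if c = b ∧ b < a then (cq q - (cq q)⁻¹) * unitMat u v a d else 0) -
      rootWeight q u v b *
        (if c = b ∧ b < d then (cq q - (cq q)⁻¹) * unitMat u v a d else 0) =
    -((cq q - (cq q)⁻¹) * (cq q * ind u u u v a b c d +
      btw u v u.rev * (cq q)⁻¹ * ind u u.rev u.rev v a b c d +
      btw u v v.rev * cq q * ind u v.rev v.rev v a b c d)) := by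
  have := cq_ne_zero q
  have h1 := h.lt.ne
  have h2 := ne_rev_of_even hN u
  have h3 := ne_rev_of_even hN v
  have h4 := h.ne
  have h5 : u ≠ v.rev := fun e => h4 (by rw [e, Fin.rev_rev])
  have h6 := h.lt
  have h7 := h.between
  simp only [rootWeight, unitMat, ind, btw]
  by_cases e1 : c = b
  · subst e1
    by_cases e2 : a = u ∧ d = v
    · obtain ⟨rfl, rfl⟩ := e2
      have h8 := h7 c
      have h9 := lt_trichotomy c d
      grind [Fin.rev_inj, Fin.rev_rev]
    · rcases not_and_or.1 e2 with e | e <;> simp [e]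
  · grind

theorem root_term_swap_right (hN : Even N) (h : IsSimplePair u v) (a b c d : Fin N) :
    (if d = a ∧ b < a then (cq q - (cq q)⁻¹) * unitMat u v b c else 0) -
      (if d = a ∧ c < a then (cq q - (cq q)⁻¹) * unitMat u v b c else 0) =
    (cq q - (cq q)⁻¹) * (ind v u v v a b c d +
      btw u v u.rev * ind u.rev u v u.rev a b c d +
      btw u v v.rev * ind v.rev u v v.rev a b c d) := by
  have h1 := h.lt.ne
  have h2 := ne_rev_of_even hN u
  have h3 := ne_rev_of_even hN v
  have h4 := h.ne
  have h5 : u ≠ v.rev := fun e => h4 (by rw [e, Fin.rev_rev])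
  have h6 := h.lt
  have h7 := h.between
  simp only [unitMat, ind, btw]
  by_cases e1 : d = a
  · subst e1
    by_cases e2 : b = u ∧ c = v
    · obtain ⟨rfl, rfl⟩ := e2
      have h8 := h7 d
      have h9 := lt_trichotomy d c
      grind [Fin.rev_inj, Fin.rev_rev]
    · rcases not_and_or.1 e2 with e | e <;> simp [e]
  · grind

/-- Within the metric terms the two units must be treated together: the contributions to the entry
indexed by `c = u'`, `d = v` cancel except for `a` in the range `v' < a ≤ u'`, which contains only
`u'` and possibly `u` or `v`. -/
theorem root_term_rev_left (hN : Even N) (h : IsSimplePair u v) (a b c d : Fin N) :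
    -(rootWeight q u v c * (if b = a.rev ∧ c < a then
        (cq q - (cq q)⁻¹) * (qRho q a / qRho q c) * unitMat u v c.rev d else 0)) +
      (if b = a.rev ∧ d.rev < a then (cq q - (cq q)⁻¹) * (qRho q a / qRho q d.rev) *
        unitMat v.rev u.rev d.rev c else 0) =
    (cq q - (cq q)⁻¹) * ((cq q)⁻¹ * ind u.rev u u.rev v a b c d +
      btw u v u.rev * (cq q)⁻¹ * ind u u.rev u.rev v a b c d +
      btw u v v.rev * ind v v.rev u.rev v a b c d) := by
  have hq := cq_ne_zero q
  have hv := qRho_ne_zero q v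
  have h1 := h.lt.ne
  have h2 := ne_rev_of_even hN u
  have h3 := ne_rev_of_even hN v
  have h4 := h.ne
  have h5 : u ≠ v.rev := fun e => h4 (by rw [e, Fin.rev_rev])
  by_cases e1 : c = u.rev ∧ d = v
  · obtain ⟨rfl, rfl⟩ := e1
    have ht : rootWeight q u d u.rev = (cq q)⁻¹ := by
      rw [rootWeight, if_neg, if_pos (Or.inr rfl)]
      rintro (e | e)
      · exact h2 e.symm
      · exact h1 (Fin.rev_injective e)
    have hu : qRho q u.rev = (cq q * qRho q d)⁻¹ := by rw [qRho_rev, h.qRho_eq]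
    have hd : qRho q d.rev = (qRho q d)⁻¹ := qRho_rev q d
    by_cases e2 : b = a.rev
    · subst e2
      have hL : -(rootWeight q u d u.rev * (if a.rev = a.rev ∧ u.rev < a then
          (cq q - (cq q)⁻¹) * (qRho q a / qRho q u.rev) * unitMat u d u.rev.rev d else 0)) +
        (if a.rev = a.rev ∧ d.rev < a then (cq q - (cq q)⁻¹) * (qRho q a / qRho q d.rev) *
          unitMat d.rev u.rev d.rev u.rev else 0) =
          (cq q - (cq q)⁻¹) * (qRho q a * qRho q d *
            (if d.rev < a ∧ a ≤ u.rev then 1 else 0)) := by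
        have hlt : d.rev < u.rev := Fin.rev_lt_rev.2 h.lt
        rw [ht, hu, hd]
        simp only [unitMat, Fin.rev_rev, and_self, if_true, true_and, mul_one]
        by_cases e3 : u.rev < a
        · rw [if_pos e3, if_pos (hlt.trans e3), if_neg fun e => e.2.not_gt e3]
          field_simp
          ring
        · rw [if_neg e3]
          by_cases e4 : d.rev < a
          · rw [if_pos e4, if_pos ⟨e4, not_lt.1 e3⟩]
            field_simp
            ring
          · rw [if_neg e4, if_neg fun e => e4 e.1]
            ring
      rw [hL]
      congr 1
      have hb : ∀ a, d.rev < a → a < u.rev → a = u ∨ a = d := fun a ha ha' => by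
        have := h.mirror.between a ha ha'
        rw [Fin.rev_rev, Fin.rev_rev] at this
        exact this.symm
      have g1 : d.rev < u ∧ u ≤ u.rev ↔ u < u.rev ∧ u.rev < d := by
        rw [Fin.rev_lt_iff (i := d), and_comm, le_iff_lt_or_eq, or_iff_left h2]
      have g2 : d.rev < d ∧ d ≤ u.rev ↔ u < d.rev ∧ d.rev < d := by
        rw [Fin.lt_rev_iff (i := u), and_comm, le_iff_lt_or_eq, or_iff_left h4]
      have hlt : d.rev < u.rev := Fin.rev_lt_rev.2 h.lt
      by_cases a1 : a = u
      · subst a1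
        simp only [g1, ind, btw]
        -- When an index lies strictly between `u` and `v`, the corresponding power `q^ρ` is `1` or
        -- `q^{±1}`, and the coefficient agrees with that of the exchange term.
        by_cases e : a < a.rev ∧ a.rev < d
        · have := h.qRho_left_of_btw (q := q) e.1 e.2
          have h' := h.qRho_eq (q := q)
          rw [this] at h'
          simp [e, h1, h2, this, eq_inv_of_mul_eq_one_right h'.symm]
        · simp [e, h1, h2]
      by_cases a2 : a = d
      · subst a2
        simp only [g2, ind, btw]
        by_cases e : u < a.rev ∧ a.rev < a
        · have := h.qRho_right_of_btw (q := q) e.1 e.2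
          simp [e, h4, a1, this]
        · simp [e, h4, a1]
      by_cases a3 : a = u.rev
      · subst a3
        rw [hu]
        simp only [ind]
        simp [hlt, a1, a2]
        field_simp
      · have : ¬ (d.rev < a ∧ a ≤ u.rev) := fun e => by
          rcases hb a e.1 (lt_of_le_of_ne e.2 a3) with e | e
          · exact a1 e
          · exact a2 e
        simp [this, ind, a1, a2, a3]
    · simp only [ind]
      grind
  · have e4 : ¬ (c.rev = u ∧ d = v) := fun e => e1 ⟨by rw [← e.1, Fin.rev_rev], e.2⟩
    rcases not_and_or.1 e1 with e | e <;> simp [ind, unitMat, e, e4]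

theorem root_term_rev_right (hN : Even N) (h : IsSimplePair u v) (a b c d : Fin N) :
    rootWeight q u v b * (if d = c.rev ∧ c < b.rev then
        (cq q - (cq q)⁻¹) * (qRho q b.rev / qRho q c) * unitMat u v a b.rev else 0) -
      (if d = c.rev ∧ c < a then (cq q - (cq q)⁻¹) * (qRho q a / qRho q c) *
        unitMat v.rev u.rev b a.rev else 0) =
    (cq q - (cq q)⁻¹) * (ind u v.rev u u.rev a b c d +
      btw u v u.rev * ind u v.rev u.rev u a b c d +
      btw u v v.rev * cq q * ind u v.rev v.rev v a b c d) := by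
  have hq := cq_ne_zero q
  have hv := qRho_ne_zero q v
  have h1 := h.lt.ne
  have h2 := ne_rev_of_even hN u
  have h3 := ne_rev_of_even hN v
  have h4 := h.ne
  have h5 : u ≠ v.rev := fun e => h4 (by rw [e, Fin.rev_rev])
  by_cases e1 : a = u ∧ b = v.rev
  · obtain ⟨rfl, rfl⟩ := e1
    have ht : rootWeight q a v v.rev = cq q := by rw [rootWeight, if_pos (Or.inr rfl)]
    by_cases e2 : d = c.rev
    · subst e2
      have hL : rootWeight q a v v.rev * (if c.rev = c.rev ∧ c < v.rev.rev then
          (cq q - (cq q)⁻¹) * (qRho q v.rev.rev / qRho q c) * unitMat a v a v.rev.rev else 0) -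
        (if c.rev = c.rev ∧ c < a then (cq q - (cq q)⁻¹) * (qRho q a / qRho q c) *
          unitMat v.rev a.rev v.rev a.rev else 0) =
          (cq q - (cq q)⁻¹) * (qRho q a / qRho q c * (if a ≤ c ∧ c < v then 1 else 0)) := by
        rw [ht, h.qRho_eq]
        simp only [unitMat, Fin.rev_rev, and_self, if_true, true_and, mul_one]
        by_cases e3 : c < a
        · rw [if_pos e3, if_pos (e3.trans h.lt), if_neg fun e => e.1.not_gt e3]
          ring
        · rw [if_neg e3]
          by_cases e4 : c < v
          · rw [if_pos e4, if_pos ⟨not_lt.1 e3, e4⟩]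
            ring
          · rw [if_neg e4, if_neg fun e => e4 e.2]
            ring
      rw [hL]
      congr 1
      have g1 : a ≤ a.rev ∧ a.rev < v ↔ a < a.rev ∧ a.rev < v := by
        rw [le_iff_lt_or_eq, or_iff_left h2]
      have g2 : a ≤ v.rev ∧ v.rev < v ↔ a < v.rev ∧ v.rev < v := by
        rw [le_iff_lt_or_eq, or_iff_left h5]
      by_cases a1 : c = a
      · subst a1
        have := qRho_ne_zero q c
        simp [ind, h.lt, h2, h5, this]
      by_cases a2 : c = a.rev
      · subst a2
        simp only [g1, ind, btw]
        by_cases e : a < a.rev ∧ a.rev < v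
        · have := h.qRho_left_of_btw (q := q) e.1 e.2
          simp [e, h1, h2.symm, this, qRho_rev]
        · simp [e, h1, h2.symm]
      by_cases a3 : c = v.rev
      · subst a3
        simp only [g2, ind, btw]
        by_cases e : a < v.rev ∧ v.rev < v
        · have := h.qRho_right_of_btw (q := q) e.1 e.2
          have h' := h.qRho_eq (q := q)
          rw [this, mul_one] at h'
          simp [e, h1.symm, h5.symm, h', this, qRho_rev]
        · simp [e, h1.symm, h5.symm]
      · have : ¬ (a ≤ c ∧ c < v) := fun e => by
          rcases h.between c (lt_of_le_of_ne e.1 (Ne.symm a1)) e.2 with e | e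
          · exact a2 e
          · exact a3 e
        simp [this, ind, a1, a2, a3]
    · have e3 : ¬ (c = a ∧ d = a.rev) := fun e => e2 (by rw [e.1, e.2])
      have e4 : ¬ (c = a.rev ∧ d = a) := fun e => e2 (by rw [e.1, e.2, Fin.rev_rev])
      have e5 : ¬ (c = v.rev ∧ d = v) := fun e => e2 (by rw [e.1, e.2, Fin.rev_rev])
      simp [ind, e2, e3, e4, e5]
  · have e4 : ¬ (a = u ∧ b.rev = v) := fun e => e1 ⟨e.1, by rw [← e.2, Fin.rev_rev]⟩
    rcases not_and_or.1 e1 with e | e <;> simp [ind, unitMat, e, e4]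

theorem rootMat_apply (u v a b : Fin N) :
    rootMat u v a b = unitMat u v a b - unitMat v.rev u.rev a b := rfl

theorem ite_mul_sub {P : Prop} [Decidable P] (k x y : ℂ) :
    (if P then k * (x - y) else 0) = (if P then k * x else 0) - (if P then k * y else 0) := by
  split_ifs <;> ring

/-- The relation is the sum of the term identities for `(u, v)` minus those for the mirrored pair
`(v', u')`, which has the same weights. -/
theorem skewRTT_rootMat (hN : Even N) (h : IsSimplePair u v) :
    SkewRTT q (rootWeight q u v) (rootMat u v) := by
  rw [skewRTT_iff]
  intro a b c d
  have h' := h.mirror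
  have t1 : (if d = b then cDiag q a b * unitMat u v a c else 0) =
      rootWeight q u v b * (if d = b then cDiag q c b * unitMat u v a c else 0) := by
    unfold unitMat
    by_cases e : a = u ∧ c = v
    · rw [e.1, e.2, cDiag_eq_rootWeight_mul hN h b]; split_ifs <;> ring
    · simp [e]
  have t1' : (if d = b then cDiag q a b * unitMat v.rev u.rev a c else 0) =
      rootWeight q u v b * (if d = b then cDiag q c b * unitMat v.rev u.rev a c else 0) := by
    unfold unitMat
    by_cases e : a = v.rev ∧ c = u.rev
    · rw [e.1, e.2, cDiag_eq_rootWeight_mul hN h' b, rootWeight_mirror]; split_ifs <;> ring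
    · simp [e]
  have t2 := root_term_diag (q := q) hN h a b c d
  have t3 := root_term_swap_left (q := q) hN h a b c d
  have t4 := root_term_swap_right (q := q) hN h a b c d
  have t5 := root_term_rev_left (q := q) hN h a b c d
  have t6 := root_term_rev_right (q := q) hN h a b c d
  have s2 := root_term_diag (q := q) hN h' a b c d
  have s3 := root_term_swap_left (q := q) hN h' a b c d
  have s4 := root_term_swap_right (q := q) hN h' a b c d
  have s5 := root_term_rev_left (q := q) hN h' a b c d
  have s6 := root_term_rev_right (q := q) hN h' a b c d
  simp only [rootWeight_mirror, Fin.rev_rev] at s2 s3 s4 s5 s6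
  have b1 : btw v.rev u.rev u = btw u v u.rev := by
    have := btw_mirror u v u.rev
    rwa [Fin.rev_rev] at this
  have b2 : btw v.rev u.rev v = btw u v v.rev := by
    have := btw_mirror u v v.rev
    rwa [Fin.rev_rev] at this
  rw [b1, b2] at s3 s4 s5 s6
  simp only [rootMat_apply, ite_mul_sub]
  linear_combination t1 - t1' + t2 + t3 + t4 + t5 + t6 - s2 - s3 - s4 - s5 - s6

end SimpleRoots

/-! ### Skew derivations as upper triangular points -/

section UpperTriangular

variable {N : ℕ} {q : PosReal}

/-- The matrix with upper triangular entries `[[t, Y], [0, 1]]`. -/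
def upMat (t : Fin N → ℂ) (Y : Matrix (Fin N) (Fin N) ℂ) :
    Matrix (Fin N) (Fin N) (Matrix (Fin 2) (Fin 2) ℂ) :=
  Matrix.of fun a b => !![Matrix.diagonal t a b, Y a b; 0, (1 : Matrix (Fin N) (Fin N) ℂ) a b]

theorem scal_mul_apply {B : Type*} [Ring B] [Algebra ℂ B] {m n p : Type} [Fintype n]
    (M : Matrix m n ℂ) (X : Matrix n p B) (i : m) (j : p) :
    (scal B M * X) i j = ∑ k, M i k • X k j := by
  simp only [Matrix.mul_apply, scal, Matrix.map_apply, Algebra.smul_def]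

theorem mul_scal_apply {B : Type*} [Ring B] [Algebra ℂ B] {m n p : Type} [Fintype n]
    (X : Matrix m n B) (M : Matrix n p ℂ) (i : m) (j : p) :
    (X * scal B M) i j = ∑ k, M k j • X i k := by
  simp only [Matrix.mul_apply, scal, Matrix.map_apply, Algebra.smul_def, Algebra.commutes]

theorem upMat_mul (t : Fin N → ℂ) (Y : Matrix (Fin N) (Fin N) ℂ) (a b c d : Fin N) :
    upMat t Y a b * upMat t Y c d =
      !![Matrix.diagonal t a b * Matrix.diagonal t c d,
        Matrix.diagonal t a b * Y c d + Y a b * (1 : Matrix (Fin N) (Fin N) ℂ) c d;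
        0, (1 : Matrix (Fin N) (Fin N) ℂ) a b * (1 : Matrix (Fin N) (Fin N) ℂ) c d] := by
  ext i j
  fin_cases i <;> fin_cases j <;> simp [upMat, Matrix.mul_apply, Fin.sum_univ_two]

/-- The relation splits into entries: the diagonal ones are the RTT relations for the character and
for the counit, and the upper right one is exactly `SkewRTT`. -/
theorem upMat_rtt {t : Fin N → ℂ} {Y : Matrix (Fin N) (Fin N) ℂ} (ht : ∀ a, t a * t a.rev = 1)
    (hY : SkewRTT q t Y) : scal _ (matrixR N q) * leg12 (upMat t Y) =
      leg21 (upMat t Y) * scal _ (matrixR N q) := by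
  have h1 := scal_matrixR_mul_leg12_diagonal (q := q) ht
  have h0 := scal_matrixR_mul_leg12_diagonal (N := N) (q := q) (τ := fun _ => (1 : ℂ)) (z := 1)
    (fun _ => mul_one 1)
  rw [Matrix.diagonal_one] at h0
  ext ⟨a, b⟩ ⟨c, d⟩ i j
  rw [scal_mul_apply, mul_scal_apply, Matrix.sum_apply, Matrix.sum_apply]
  have h1' := congrFun (congrFun h1 (a, b)) (c, d)
  have h0' := congrFun (congrFun h0 (a, b)) (c, d)
  rw [scal_mul_apply, mul_scal_apply] at h1' h0'
  simp only [leg12, leg21, Matrix.of_apply, smul_eq_mul] at h1' h0'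
  simp only [leg12, leg21, Matrix.of_apply, upMat_mul, Matrix.smul_apply]
  fin_cases i <;> fin_cases j
  · exact h1'
  · have := hY a b c d
    rw [← Fintype.sum_prod_type', ← Fintype.sum_prod_type'] at this
    refine (this : _).trans (Finset.sum_congr rfl fun x _ => mul_comm _ _)
  · simp
  · exact h0'

/-- The matrix `M ⊗ e`. -/
def tens {B : Type*} [Ring B] [Algebra ℂ B] (M : Matrix (Fin N) (Fin N) ℂ) (e : B) :
    Matrix (Fin N) (Fin N) B :=
  Matrix.of fun a b => M a b • e

theorem tens_mul_scal {B : Type*} [Ring B] [Algebra ℂ B] (M P : Matrix (Fin N) (Fin N) ℂ) (e : B) :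
    tens M e * scal B P = tens (M * P) e := by
  ext a b
  rw [mul_scal_apply, tens, tens, Matrix.of_apply, Matrix.mul_apply, Finset.sum_smul]
  exact Finset.sum_congr rfl fun c _ => by rw [Matrix.of_apply, smul_smul, mul_comm]

theorem tens_mul_tens {B : Type*} [Ring B] [Algebra ℂ B] (M P : Matrix (Fin N) (Fin N) ℂ)
    (e f : B) : tens M e * tens P f = tens (M * P) (e * f) := by
  ext a b
  simp only [tens, Matrix.of_apply, Matrix.mul_apply, Finset.sum_smul, smul_mul_smul_comm]

theorem tens_transpose {B : Type*} [Ring B] [Algebra ℂ B] (M : Matrix (Fin N) (Fin N) ℂ) (e : B) :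
    (tens M e)ᵀ = tens Mᵀ e := rfl

theorem tens_zero {B : Type*} [Ring B] [Algebra ℂ B] (M : Matrix (Fin N) (Fin N) ℂ) :
    tens M (0 : B) = 0 := by
  ext a b; simp [tens]

theorem zero_tens {B : Type*} [Ring B] [Algebra ℂ B] (e : B) :
    tens (0 : Matrix (Fin N) (Fin N) ℂ) e = 0 := by
  ext a b; simp [tens]

theorem add_tens {B : Type*} [Ring B] [Algebra ℂ B] (M P : Matrix (Fin N) (Fin N) ℂ) (e : B) :
    tens (M + P) e = tens M e + tens P e := by
  ext a b; simp [tens, add_smul]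

theorem tens_add {B : Type*} [Ring B] [Algebra ℂ B] (M : Matrix (Fin N) (Fin N) ℂ) (e f : B) :
    tens M (e + f) = tens M e + tens M f := by
  ext a b; simp [tens]

theorem tens_one {B : Type*} [Ring B] [Algebra ℂ B] (M : Matrix (Fin N) (Fin N) ℂ) :
    tens M (1 : B) = scal B M := by
  ext a b; simp [tens, scal, Algebra.algebraMap_eq_smul_one]

theorem upMat_eq (t : Fin N → ℂ) (Y : Matrix (Fin N) (Fin N) ℂ) :
    upMat t Y = tens (Matrix.diagonal t) (Matrix.single 0 0 1) + tens Y (Matrix.single 0 1 1) +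
      tens 1 (Matrix.single 1 1 1) := by
  ext a b i j
  fin_cases i <;> fin_cases j <;> simp [upMat, tens]

/-- The upper right entry of the product is `Y P + t P Q`, which is the infinitesimal form of the
orthogonality relation. -/
theorem upMat_mul_scal_mul_upMat {t : Fin N → ℂ} {Y P Q : Matrix (Fin N) (Fin N) ℂ}
    (hP : Matrix.diagonal t * P * Matrix.diagonal t = P)
    (hY : Y * P + Matrix.diagonal t * P * Q = 0) :
    upMat t Y * scal _ P * upMat t Q = scal _ P := by
  have e0 : (Matrix.single 0 0 1 : Matrix (Fin 2) (Fin 2) ℂ) + Matrix.single 1 1 1 = 1 := by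
    ext i j; fin_cases i <;> fin_cases j <;> simp
  rw [upMat_eq, upMat_eq]
  simp only [add_mul, mul_add, tens_mul_scal, tens_mul_tens, Matrix.single_mul_single_same,
    Matrix.single_mul_single_of_ne _ _ _ _ (zero_ne_one' (Fin 2)),
    Matrix.single_mul_single_of_ne _ _ _ _ (one_ne_zero' (Fin 2)), tens_zero, add_zero, zero_add, mul_one, one_mul, hP]
  rw [← tens_one P, ← e0]
  have : tens (Matrix.diagonal t * P * Q) (Matrix.single 0 1 1 : Matrix (Fin 2) (Fin 2) ℂ) +
      tens (Y * P) (Matrix.single 0 1 1 : Matrix (Fin 2) (Fin 2) ℂ) = 0 := by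
    rw [← add_tens, add_comm, hY, zero_tens]
  rw [tens_add, ← sub_eq_zero]
  rw [← this]
  abel

theorem upMat_transpose (t : Fin N → ℂ) (Y : Matrix (Fin N) (Fin N) ℂ) :
    (upMat t Y)ᵀ = upMat t Yᵀ := by
  rw [upMat_eq, upMat_eq, Matrix.transpose_add, Matrix.transpose_add, tens_transpose,
    tens_transpose, tens_transpose, Matrix.diagonal_transpose, Matrix.transpose_one]

/-- The powers of an upper triangular matrix, entry by entry. -/
theorem legs_upMat (t : Fin N → ℂ) (Y : Matrix (Fin N) (Fin N) ℂ) {z : ℂ}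
    (hw : ∀ a b, t a * Y a b = z * (Y a b * t b)) (k : ℕ) (i j : Fin k → Fin N) :
    legs k (upMat t Y) i j 1 0 = 0 ∧
    legs k (upMat t Y) i j 0 0 = legs k (Matrix.diagonal t) i j ∧
    legs k (upMat t Y) i j 1 1 = legs k (1 : Matrix (Fin N) (Fin N) ℂ) i j ∧
    (∏ s, t (i s)) * legs k (upMat t Y) i j 0 1 =
      z * (legs k (upMat t Y) i j 0 1 * ∏ s, t (j s)) := by
  induction k with
  | zero =>
    have hij : i = j := Subsingleton.elim _ _
    subst hij
    simp [legs_zero]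
  | succ k ih =>
    obtain ⟨h1, h2, h3, h4⟩ := ih (Fin.tail i) (Fin.tail j)
    simp only [legs_succ_apply, Matrix.mul_apply, Fin.sum_univ_two, h1, h2, h3]
    refine ⟨by simp [upMat], by simp [upMat], by simp [upMat], ?_⟩
    have e1 : upMat t Y (i 0) (j 0) 0 0 = Matrix.diagonal t (i 0) (j 0) := rfl
    have e2 : upMat t Y (i 0) (j 0) 0 1 = Y (i 0) (j 0) := rfl
    have p1 : ∏ s, t (i s) = t (i 0) * ∏ s, t (Fin.tail i s) := Fin.prod_univ_succ _
    have p2 : ∏ s, t (j s) = t (j 0) * ∏ s, t (Fin.tail j s) := Fin.prod_univ_succ _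
    rw [e1, e2, p1, p2]
    have e3 : (∏ s, t (Fin.tail i s)) * legs k (1 : Matrix (Fin N) (Fin N) ℂ) (Fin.tail i)
        (Fin.tail j) = (∏ s, t (Fin.tail j s)) * legs k (1 : Matrix (Fin N) (Fin N) ℂ) (Fin.tail i)
        (Fin.tail j) := by
      rw [legs_one, Matrix.one_apply]
      split_ifs with h
      · rw [h]
      · ring
    have e4 : t (i 0) * Matrix.diagonal t (i 0) (j 0) = t (j 0) * Matrix.diagonal t (i 0) (j 0) := by
      by_cases h : i 0 = j 0
      · rw [h]
      · rw [Matrix.diagonal_apply_ne _ h]; ring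
    linear_combination Matrix.diagonal t (i 0) (j 0) * t (i 0) * h4 +
      z * legs k (upMat t Y) (Fin.tail i) (Fin.tail j) 0 1 * (∏ s, t (Fin.tail j s)) * e4 +
      t (i 0) * Y (i 0) (j 0) * e3 + (∏ s, t (Fin.tail j s)) *
      legs k (1 : Matrix (Fin N) (Fin N) ℂ) (Fin.tail i) (Fin.tail j) * hw (i 0) (j 0)

theorem isPoint_diagonal {t : Fin N → ℂ} (ht : ∀ a, t a * t a.rev = 1)
    (hm : ∀ a : Fin N, a = a.rev → t a = 1) :
    IsPoint (matrixR N q) (metricC N q) (antisymTensors N q) (Matrix.diagonal t) := by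
  have h := isSymmetry_diagonal (q := q) ht (one_mul 1)
  have h1 := scal_matrixR_mul_leg12_diagonal (q := q) ht
  refine ⟨h1, ?_, ?_, fun E hE => ?_⟩
  · rw [scal_complex, h.orth, one_smul]
  · rw [scal_complex, h.orth' (metricC_mul_self N q), one_smul]
  · have h2 : IsAntisym q (legs N (Matrix.diagonal t) *ᵥ E) :=
      IsAntisym.legs h1 (mem_antisymTensors.1 hE)
    refine h2.ext (mem_antisymTensors.1 hE) ?_
    rw [legs_diagonal, Matrix.mulVec_diagonal, List.prod_ofFn]
    simp [prod_eq_one_of_mul_rev ht hm]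

/-- Only the determinant relation needs an idea. The upper right entry of `X₁ ⋯ X_N` shifts weights
by `z ≠ 1`, whereas the nonzero components of a `q`-antisymmetric tensor all have weight zero, so
that entry contributes nothing. -/
theorem isPoint_upMat {t : Fin N → ℂ} {Y : Matrix (Fin N) (Fin N) ℂ}
    (ht : ∀ a, t a * t a.rev = 1) (hm : ∀ a : Fin N, a = a.rev → t a = 1) (hY : SkewRTT q t Y)
    (h1 : Y * metricC N q + Matrix.diagonal t * metricC N q * Yᵀ = 0)
    (h2 : Yᵀ * metricC N q + Matrix.diagonal t * metricC N q * Y = 0) {z : ℂ} (hz : z ≠ 1)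
    (hw : ∀ a b, t a * Y a b = z * (Y a b * t b)) :
    IsPoint (matrixR N q) (metricC N q) (antisymTensors N q) (upMat t Y) := by
  have hP := isPoint_diagonal (q := q) ht hm
  have hC : Matrix.diagonal t * metricC N q * Matrix.diagonal t = metricC N q := by
    have := hP.orth₁
    rwa [Matrix.diagonal_transpose, scal_complex] at this
  have hr := upMat_rtt ht hY
  refine ⟨hr, ?_, ?_, fun E hE => ?_⟩
  · rw [upMat_transpose]
    exact upMat_mul_scal_mul_upMat hC h1
  · rw [upMat_transpose]
    exact upMat_mul_scal_mul_upMat hC h2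
  · have a1 : IsAntisym q fun i => algebraMap ℂ (Matrix (Fin 2) (Fin 2) ℂ) (E i) :=
      isAntisym_algebraMap hE
    -- Both sides are `q`-antisymmetric with values in the `2 × 2` matrices, so only the component
    -- at `id` has to be compared.
    refine (a1.legs hr).ext a1 ?_
    have hd : ∀ (A : Matrix (Fin N → Fin N) (Fin N → Fin N) ℂ), A *ᵥ E = E →
        ∑ j, A id j * E j = E id := fun A hA => congrFun hA id
    ext x y
    have e : (legs N (upMat t Y) *ᵥ fun i => algebraMap ℂ (Matrix (Fin 2) (Fin 2) ℂ) (E i)) id x y =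
        ∑ j, legs N (upMat t Y) id j x y * E j := by
      simp only [Matrix.mulVec, dotProduct, Matrix.sum_apply]
      refine Finset.sum_congr rfl fun j _ => ?_
      rw [Algebra.algebraMap_eq_smul_one, mul_smul_comm, mul_one, Matrix.smul_apply, smul_eq_mul,
        mul_comm]
    rw [e, Matrix.algebraMap_matrix_apply]
    fin_cases x <;> fin_cases y
    · simp only [Fin.zero_eta, Fin.isValue, (legs_upMat t Y hw N _ _).2.1, if_true]
      exact hd _ (hP.det E hE)
    -- For `E j ≠ 0` the tuples `id` and `j` have total weight `1`, and the weight relation becomes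
    -- `(1 - z) · entry = 0`.
    · simp only [Fin.zero_eta, Fin.mk_one, Fin.isValue, zero_ne_one, if_false]
      refine Finset.sum_eq_zero fun j _ => ?_
      by_cases hj : E j = 0
      · rw [hj, mul_zero]
      · have b1 := (legs_upMat t Y hw N id j).2.2.2
        rw [prod_eq_one_of_antisym_ne_zero hE ht hm hj] at b1
        rw [show ∏ s, t (id s) = 1 from prod_eq_one_of_mul_rev ht hm, one_mul, mul_one] at b1
        have b2 : (1 - z) * legs N (upMat t Y) id j 0 1 = 0 := by linear_combination b1
        rw [(mul_eq_zero.1 b2).resolve_left (sub_ne_zero.2 hz.symm), zero_mul]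
    · simp only [Fin.zero_eta, Fin.mk_one, Fin.isValue, one_ne_zero, if_false,
        (legs_upMat t Y hw N _ _).1, zero_mul, Finset.sum_const_zero]
    · simp only [Fin.mk_one, Fin.isValue, (legs_upMat t Y hw N _ _).2.2.1, if_true, legs_one]
      exact hd _ (Matrix.one_mulVec E)

end UpperTriangular

/-! ### Construction of the root functionals, and relations satisfied by skew derivations -/

section SkewFunctionals

variable {N : ℕ} {q : PosReal}

theorem metricC_eq (a b : Fin N) : metricC N q a b = if b = a.rev then (qRho q a)⁻¹ else 0 := by
  rw [metricC_apply]
  split_ifs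
  · rw [qRho, Real.rpow_neg q.2.le, Complex.ofReal_inv]
  · rfl

theorem mul_metricC_apply (Y : Matrix (Fin N) (Fin N) ℂ) (a b : Fin N) :
    (Y * metricC N q) a b = Y a b.rev * qRho q b := by
  rw [Matrix.mul_apply, Finset.sum_eq_single b.rev]
  · rw [metricC_eq, if_pos (Fin.rev_rev b).symm, qRho_rev, inv_inv]
  · intro c _ hc
    rw [metricC_eq, if_neg fun e => hc (by rw [e, Fin.rev_rev]), mul_zero]
  · simp

theorem diagonal_mul_metricC_mul_apply (t : Fin N → ℂ) (Y : Matrix (Fin N) (Fin N) ℂ)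
    (a b : Fin N) :
    (Matrix.diagonal t * metricC N q * Y) a b = t a * (qRho q a)⁻¹ * Y a.rev b := by
  rw [Matrix.mul_apply, Finset.sum_eq_single a.rev]
  · rw [Matrix.diagonal_mul, metricC_eq, if_pos rfl]
  · intro c _ hc
    rw [Matrix.diagonal_mul, metricC_eq, if_neg hc, mul_zero, zero_mul]
  · simp

theorem exists_isChar {t : Fin N → ℂ} (ht : ∀ a, t a * t a.rev = 1)
    (hm : ∀ a : Fin N, a = a.rev → t a = 1) :
    ∃ κ : SOq N q →ₗ[ℂ] ℂ, IsChar κ ∧ (genT N q).map κ = Matrix.diagonal t := by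
  refine ⟨(liftFRT (isPoint_diagonal (q := q) ht hm)).toLinearMap,
    ⟨map_one (liftFRT (isPoint_diagonal (q := q) ht hm)),
      map_mul (liftFRT (isPoint_diagonal (q := q) ht hm))⟩, ?_⟩
  ext a b
  exact liftFRT_univMat (isPoint_diagonal (q := q) ht hm) a b

/-- The algebra map given by an upper triangular point takes upper triangular values with the
character and the counit on the diagonal. Multiplicativity in the upper right corner is the skew
product rule. -/
theorem exists_isSkew {t : Fin N → ℂ} {Y : Matrix (Fin N) (Fin N) ℂ}
    (hX : IsPoint (matrixR N q) (metricC N q) (antisymTensors N q) (upMat t Y))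
    {κ : SOq N q →ₗ[ℂ] ℂ} (hκ : IsChar κ) (ht : (genT N q).map κ = Matrix.diagonal t) :
    ∃ E : SOq N q →ₗ[ℂ] ℂ, IsSkew κ Coalgebra.counit E ∧ (genT N q).map E = Y := by
  have hT : ∀ a b, liftFRT hX (genT N q a b) = upMat t Y a b := liftFRT_univMat hX
  have key : ∀ x, liftFRT hX x 1 0 = 0 ∧ liftFRT hX x 0 0 = κ x ∧
      liftFRT hX x 1 1 = Coalgebra.counit (R := ℂ) x := by
    intro x
    induction x using FRTAlgebra.induction with
    | hc c =>
      rw [AlgHom.commutes, Matrix.algebraMap_matrix_apply, Matrix.algebraMap_matrix_apply,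
        Matrix.algebraMap_matrix_apply, Algebra.algebraMap_eq_smul_one (A := FRTAlgebra _ _ _),
        map_smul, map_smul, hκ.map_one, Bialgebra.counit_one]
      simp
    | hT a b =>
      have h1 : liftFRT hX (univMat (matrixR N q) (metricC N q) (antisymTensors N q) a b) = _ :=
        hT a b
      rw [h1, counit_univMat]
      exact ⟨rfl, (congrFun (congrFun ht a) b).symm, rfl⟩
    | hadd x y hx hy =>
      simp only [map_add, Matrix.add_apply, hx, hy, add_zero, and_self]
    | hmul x y hx hy =>
      simp only [map_mul, Matrix.mul_apply, Fin.sum_univ_two, hx, hy, hκ.map_mul,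
        Bialgebra.counit_mul, mul_zero, zero_mul, add_zero, zero_add, and_self]
  refine ⟨{ toFun := fun x => liftFRT hX x 0 1
            map_add' := fun x y => by rw [map_add, Matrix.add_apply]
            map_smul' := fun z x => by rw [map_smul, Matrix.smul_apply]; rfl }, fun x y => ?_, ?_⟩
  · change liftFRT hX (x * y) 0 1 = _
    rw [map_mul, Matrix.mul_apply, Fin.sum_univ_two, (key x).2.1, (key y).2.2]
    rfl
  · ext a b
    exact congrFun (congrFun (hT a b) 0) 1

/-- Applying the functional to both sides of the RTT relation for `T` gives the same relation that
makes a matrix into a skew derivation; constructed and arbitrary functionals can therefore be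
compared. -/
theorem IsSkew.skewRTT {χ δ : SOq N q →ₗ[ℂ] ℂ} (h : IsSkew χ Coalgebra.counit δ) {t : Fin N → ℂ}
    (ht : (genT N q).map χ = Matrix.diagonal t) : SkewRTT q t ((genT N q).map δ) := by
  intro a b c d
  have h1 := congrFun (congrFun (isPoint_univMat (matrixR N q) (metricC N q)
    (antisymTensors N q)).rtt (a, b)) (c, d)
  rw [scal_mul_apply, mul_scal_apply] at h1
  have h2 := congrArg δ h1
  have ht' : ∀ a b, χ (genT N q a b) = Matrix.diagonal t a b := fun a b =>
    congrFun (congrFun ht a) b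
  simp only [map_sum, map_smul, leg12, leg21, Matrix.of_apply, h _ _, ht', counit_univMat,
    smul_eq_mul, Fintype.sum_prod_type] at h2
  simp only [Matrix.map_apply]
  rw [h2]
  simp only [mul_comm (matrixR N q _ _)]

theorem IsSkew.orth {χ δ : SOq N q →ₗ[ℂ] ℂ} (h : IsSkew χ Coalgebra.counit δ) (hχ : IsChar χ)
    {t : Fin N → ℂ} (ht : (genT N q).map χ = Matrix.diagonal t) (a b : Fin N) :
    (genT N q).map δ a b.rev * qRho q b +
      t a * (qRho q a)⁻¹ * (genT N q).map δ b a.rev = 0 := by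
  have h1 := congrFun (congrFun (isPoint_univMat (matrixR N q) (metricC N q)
    (antisymTensors N q)).orth₁ a) b
  rw [Matrix.mul_apply] at h1
  simp only [mul_scal_apply, Finset.sum_mul, smul_mul_assoc] at h1
  have h2 := congrArg δ h1
  have ht' : ∀ a b, χ (genT N q a b) = Matrix.diagonal t a b := fun a b =>
    congrFun (congrFun ht a) b
  have h3 : δ (scal (SOq N q) (metricC N q) a b) = 0 := by
    rw [scal, Matrix.map_apply, Algebra.algebraMap_eq_smul_one, map_smul,
      h.map_one hχ.map_one Bialgebra.counit_one, smul_zero]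
  rw [h3] at h2
  rw [← mul_metricC_apply, ← Matrix.transpose_apply ((genT N q).map δ),
    ← diagonal_mul_metricC_mul_apply, ← h2]
  simp only [map_sum, map_smul, Matrix.transpose_apply, h _ _, ht', counit_univMat, smul_eq_mul,
    mul_add, Finset.sum_add_distrib]
  rw [add_comm]
  congr 1
  · rw [Matrix.mul_apply]
    refine Finset.sum_congr rfl fun c _ => ?_
    rw [Matrix.mul_apply, Finset.sum_mul]
    refine Finset.sum_congr rfl fun d _ => ?_
    rw [Matrix.transpose_apply, Matrix.map_apply]
    ring
  · rw [Finset.sum_eq_single b]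
    · rw [Matrix.mul_apply]
      refine Finset.sum_congr rfl fun c _ => ?_
      rw [Matrix.map_apply, Matrix.one_apply_eq]
      ring
    · intro c _ hc
      exact Finset.sum_eq_zero fun d _ => by rw [Matrix.one_apply_ne hc.symm]; ring
    · simp

variable {u v : Fin N}

/-- The group-like functional `κ` and the skew derivation `E` of a simple root. -/
structure IsRootPair (u v : Fin N) (κ E : SOq N q →ₗ[ℂ] ℂ) : Prop where
  isChar : IsChar κ
  isSkew : IsSkew κ Coalgebra.counit E
  map_char : (genT N q).map κ = Matrix.diagonal (rootWeight q u v)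
  map_skew : (genT N q).map E = rootMat u v

theorem rootWeight_mul_rev (hN : Even N) (h : IsSimplePair u v) (a : Fin N) :
    rootWeight q u v a * rootWeight q u v a.rev = 1 := by
  have := cq_ne_zero q
  have h1 := h.lt.ne
  have h2 := ne_rev_of_even hN u
  have h3 := ne_rev_of_even hN v
  have h4 := h.ne
  have h5 : u ≠ v.rev := fun e => h4 (by rw [e, Fin.rev_rev])
  have h6 : a.rev = u ↔ a = u.rev := rev_eq_iff
  have h7 : a.rev = v ↔ a = v.rev := rev_eq_iff
  simp only [rootWeight, Fin.rev_inj, h6, h7]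
  grind

/-- This is the relation `κ E = q² E κ`. The factor `q²` is what the classification uses to
recognise simple roots, and `q² ≠ 1` is needed for the determinant relation. -/
theorem rootWeight_mul_rootMat (hN : Even N) (h : IsSimplePair u v) (a b : Fin N) :
    rootWeight q u v a * rootMat u v a b = cq q ^ 2 * (rootMat u v a b * rootWeight q u v b) := by
  have := cq_ne_zero q
  have h1 := h.lt.ne
  have h2 := ne_rev_of_even hN u
  have h3 := ne_rev_of_even hN v
  have h4 := h.ne
  have h5 : u ≠ v.rev := fun e => h4 (by rw [e, Fin.rev_rev])
  simp only [rootMat_apply, unitMat, rootWeight]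
  by_cases e1 : a = u ∧ b = v
  · grind
  by_cases e2 : a = v.rev ∧ b = u.rev
  · grind
  · simp [e1, e2]

theorem rootMat_orth (h : IsSimplePair u v) (a b : Fin N) :
    rootMat u v a b.rev * qRho q b +
      rootWeight q u v a * (qRho q a)⁻¹ * rootMat u v b a.rev = 0 := by
  have h0 := cq_ne_zero q
  have hv := qRho_ne_zero q v
  have h1 := h.lt.ne
  have h4 := h.ne
  have h5 : u ≠ v.rev := fun e => h4 (by rw [e, Fin.rev_rev])
  have e3 : b.rev = v ↔ b = v.rev := rev_eq_iff
  have e4 : a.rev = v ↔ a = v.rev := rev_eq_iff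
  simp only [rootMat_apply, unitMat, rootWeight, e3, e4, Fin.rev_inj]
  by_cases e1 : a = u ∧ b = v.rev
  · obtain ⟨rfl, rfl⟩ := e1
    simp [h5, qRho_rev, h.qRho_eq]
    field_simp
    ring
  by_cases e2 : a = v.rev ∧ b = u
  · obtain ⟨rfl, rfl⟩ := e2
    simp [h5.symm, qRho_rev, h.qRho_eq]
  · have e5 : ¬ (b = u ∧ a = v.rev) := fun e => e2 e.symm
    have e6 : ¬ (b = v.rev ∧ a = u) := fun e => e1 e.symm
    simp [e1, e2, e5, e6]

theorem rootMat_orth' (hN : Even N) (h : IsSimplePair u v) (a b : Fin N) :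
    rootMat u v b.rev a * qRho q b +
      rootWeight q u v a * (qRho q a)⁻¹ * rootMat u v a.rev b = 0 := by
  have h0 := cq_ne_zero q
  have hv := qRho_ne_zero q v
  have h1 := h.lt.ne
  have h2 := ne_rev_of_even hN u
  have h3 := ne_rev_of_even hN v
  have h4 := h.ne
  have h5 : u ≠ v.rev := fun e => h4 (by rw [e, Fin.rev_rev])
  have e3 : b.rev = u ↔ b = u.rev := rev_eq_iff
  have e4 : a.rev = u ↔ a = u.rev := rev_eq_iff
  simp only [rootMat_apply, unitMat, rootWeight, e3, e4, Fin.rev_inj]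
  by_cases e1 : a = v ∧ b = u.rev
  · obtain ⟨rfl, rfl⟩ := e1
    simp [h4, h1.symm, h3, qRho_rev, h.qRho_eq]
    field_simp
    ring
  by_cases e2 : a = u.rev ∧ b = v
  · obtain ⟨rfl, rfl⟩ := e2
    simp [h4.symm, h1, h2.symm, qRho_rev, h.qRho_eq]
    field_simp
    ring
  · have e5 : ¬ (b = v ∧ a = u.rev) := fun e => e2 e.symm
    simp [and_comm, e1, e5]

theorem exists_isRootPair (hN : Even N) (hq : q ≠ 1) (h : IsSimplePair u v) :
    ∃ κ E : SOq N q →ₗ[ℂ] ℂ, IsRootPair u v κ E := by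
  have hm : ∀ a : Fin N, a = a.rev → rootWeight q u v a = 1 :=
    fun a ha => absurd ha (ne_rev_of_even hN a)
  obtain ⟨κ, hκ, hκT⟩ := exists_isChar (q := q) (rootWeight_mul_rev hN h) hm
  obtain ⟨E, hE, hET⟩ := exists_isSkew (isPoint_upMat (rootWeight_mul_rev hN h) hm
    (skewRTT_rootMat hN h) (by
      ext a b
      rw [Matrix.add_apply, mul_metricC_apply, diagonal_mul_metricC_mul_apply,
        Matrix.transpose_apply, rootMat_orth h, Matrix.zero_apply]) (by
      ext a b
      rw [Matrix.add_apply, mul_metricC_apply, diagonal_mul_metricC_mul_apply,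
        Matrix.transpose_apply, rootMat_orth' hN h, Matrix.zero_apply])
    (cq_pow_ne_one hq two_ne_zero) (rootWeight_mul_rootMat hN h)) hκ hκT
  exact ⟨κ, E, hκ, hE, hκT, hET⟩

end SkewFunctionals

/-! ### Skew derivations of weight `q²` are supported on simple pairs -/

section Classification

variable {N : ℕ} {q : PosReal} {t : Fin N → ℂ} {Y : Matrix (Fin N) (Fin N) ℂ} {x y : Fin N}

/-- The entry `(x, c; y, c)` of the quadratic relation involves only the two diagonal terms and
reads `Y x y = t c * Y x y`. -/
theorem weight_eq_one_of_skewRTT (hN : Even N) (hY : SkewRTT q t Y) (hne : x ≠ y) (h : Y x y ≠ 0)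
    {c : Fin N} (h1 : c ≠ x) (h2 : c ≠ y) (h3 : c ≠ x.rev) (h4 : c ≠ y.rev) : t c = 1 := by
  have e := skewRTT_iff.1 hY x c y c
  have d1 : cDiag q x c = 1 := by rw [cDiag_eq hN, if_neg h1.symm, if_neg h3]
  have d2 : cDiag q y c = 1 := by rw [cDiag_eq hN, if_neg h2.symm, if_neg h4]
  simp only [hne.symm, h2.symm, h1, h3, h4, d1, d2, if_true, if_false, false_and, one_mul, mul_zero,
    add_zero, sub_zero, zero_add] at e
  exact mul_right_cancel₀ h (by rw [← e, one_mul])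

/-- In the entry `(c, x; y, c)` only the exchange terms survive, and `q ≠ 1` makes their coefficient
nonzero. Hence no generic index lies between `x` and `y`, which is the simplicity of the root. -/
theorem lt_iff_lt_of_skewRTT (hq : q ≠ 1) (hY : SkewRTT q t Y) (hne : x ≠ y)
    (h : Y x y ≠ 0) {c : Fin N} (h1 : c ≠ x) (h2 : c ≠ y) (h3 : c ≠ x.rev) (h4 : c ≠ y.rev) :
    x < c ↔ y < c := by
  have e := skewRTT_iff.1 hY c x y c
  have hl := cq_sub_inv_ne_zero hq
  have h5 : x ≠ c.rev := fun e => h3 (by rw [e, Fin.rev_rev])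
  simp only [hne.symm, h2.symm, h1, h4, h5, if_false, false_and, mul_zero,
    add_zero, sub_zero, zero_add, true_and] at e
  by_cases e1 : x < c <;> by_cases e2 : y < c <;> simp [e1, e2, hl, h] at e ⊢

/-- The entries `(x, x; x, y)` and `(y, x; y, y)` determine `t x` and `t y` up to the order of `x`
and `y`. The wrong order, combined with the weight `q²`, would give `q⁴ = 1`. -/
theorem weight_of_skewRTT (hN : Even N) (hq : q ≠ 1) (hY : SkewRTT q t Y)
    (hw : t x * Y x y = cq q ^ 2 * (Y x y * t y)) (hne : x ≠ y) (hr : y ≠ x.rev) (h : Y x y ≠ 0) :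
    x < y ∧ t x = cq q ∧ t y = (cq q)⁻¹ := by
  have h0 := cq_ne_zero q
  have hx := ne_rev_of_even hN x
  have hy := ne_rev_of_even hN y
  have hr' : x ≠ y.rev := fun e => hr (by rw [e, Fin.rev_rev])
  have e1 := skewRTT_iff.1 hY x x x y
  have d1 : cDiag q x x = cq q := by rw [cDiag_eq hN, if_pos rfl]
  have d2 : cDiag q y y = cq q := by rw [cDiag_eq hN, if_pos rfl]
  have d3 : cDiag q x y = 1 := by rw [cDiag_eq hN, if_neg hne, if_neg hr]
  have d4 : cDiag q y x = 1 := by rw [cDiag_eq hN, if_neg hne.symm, if_neg hr']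
  simp only [hne.symm, hx, hr, d1, d3, lt_irrefl, if_true, if_false, false_and, and_false, true_and,
    one_mul, add_zero, sub_zero, zero_add] at e1
  have e2 := skewRTT_iff.1 hY y x y y
  simp only [hne.symm, hy, hr', d2, d4, lt_irrefl, if_true, if_false, false_and, and_false, true_and,
    one_mul, mul_zero, add_zero, sub_zero, zero_add] at e2
  rw [mul_left_comm] at hw
  have hw' : t x = cq q ^ 2 * t y := mul_right_cancel₀ h (by linear_combination hw)
  by_cases hlt : x < y
  · rw [if_pos hlt] at e1 e2
    have f1 : t y = (cq q)⁻¹ := mul_right_cancel₀ h (by linear_combination e2)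
    refine ⟨hlt, ?_, f1⟩
    rw [hw', f1]
    field_simp
  · exfalso
    rw [if_neg hlt] at e1 e2
    have f1 : t y = cq q := mul_right_cancel₀ h (by linear_combination e2)
    have f2 : t x * cq q = 1 := mul_right_cancel₀ h (by linear_combination e1)
    rw [hw', f1] at f2
    exact cq_pow_ne_one hq four_ne_zero (by linear_combination f2)

/-- A root of the form `2 e_x` is impossible. The entry `(x, x; x, x')` gives `t x = q⁻²`, while the
weight condition gives `(t x)² = q²`; together they force `q⁶ = 1`. -/
theorem ne_rev_of_skewRTT (hN : Even N) (hq : q ≠ 1) (hY : SkewRTT q t Y)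
    (ht : t x * t x.rev = 1) (hw : t x * Y x x.rev = cq q ^ 2 * (Y x x.rev * t x.rev)) :
    Y x x.rev = 0 := by
  by_contra h
  have h0 := cq_ne_zero q
  have hx := ne_rev_of_even hN x
  have d1 : cDiag q x x = cq q := by rw [cDiag_eq hN, if_pos rfl]
  have d2 : cDiag q x x.rev = (cq q)⁻¹ := by rw [cDiag_eq hN, if_neg hx, if_pos rfl]
  -- If `x < x'` then `x` must be a middle index, for otherwise `x + 1` would lie between them. With
  -- `ρ = 0` the exchange and metric contributions below cancel.
  have hρ : x < x.rev → qRho q x = 1 := by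
    intro hlt
    have hm : IsMiddle x := by
      by_contra hm
      have h3 : x.1 + 1 < x.rev.1 := by
        unfold IsMiddle at hm
        rw [Fin.lt_def, Fin.val_rev] at hlt
        rw [Fin.val_rev]
        omega
      set c : Fin N := ⟨x.1 + 1, by have := x.rev.2; omega⟩ with hc
      have c1 : x < c := by simp [hc, Fin.lt_def]
      have c2 : c < x.rev := by rw [Fin.lt_def]; exact h3
      have := lt_iff_lt_of_skewRTT hq hY hx h c1.ne' c2.ne c2.ne (by rw [Fin.rev_rev]; exact c1.ne')
      exact (this.1 c1).not_gt c2
    rw [qRho, rho_eq_zero_of_isMiddle hm]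
    simp
  have e1 := skewRTT_iff.1 hY x x x x.rev
  simp only [hx, hx.symm, d1, d2, lt_irrefl, if_true, if_false, false_and, and_false, true_and,
    add_zero, sub_zero, zero_add] at e1
  have e3 : t x * cq q = (cq q)⁻¹ := by
    refine mul_right_cancel₀ h ?_
    by_cases hlt : x < x.rev
    · rw [if_pos hlt, if_pos hlt, qRho_rev, hρ hlt] at e1
      linear_combination e1
    · rw [if_neg hlt, if_neg hlt] at e1
      linear_combination e1
  have hw' : t x = cq q ^ 2 * t x.rev := mul_right_cancel₀ h (by linear_combination hw)
  have e4 : t x ^ 2 = cq q ^ 2 := by linear_combination t x * hw' + cq q ^ 2 * ht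
  have e5 : (t x * cq q) ^ 2 * cq q ^ 2 = 1 := by rw [e3]; field_simp
  exact cq_pow_ne_one hq (by norm_num : 6 ≠ 0)
    (by linear_combination e5 - cq q ^ 4 * e4)

/-- The support of a skew derivation of weight `q²` consists of simple pairs. -/
theorem rootWeight_of_skewRTT (hN : Even N) (hq : q ≠ 1) (hY : SkewRTT q t Y)
    (ht : ∀ a, t a * t a.rev = 1) (hw : ∀ a b, t a * Y a b = cq q ^ 2 * (Y a b * t b))
    (h : Y x y ≠ 0) : x < y ∧ y ≠ x.rev ∧ (∀ c, x < c → c < y → c = x.rev ∨ c = y.rev) ∧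
      t = rootWeight q x y := by
  have hne : x ≠ y := by
    rintro rfl
    have h1 := hw x x
    have h2 : t x ≠ 0 := left_ne_zero_of_mul_eq_one (ht x)
    have h3 : t x * Y x x ≠ 0 := mul_ne_zero h2 h
    exact cq_pow_ne_one hq two_ne_zero (mul_right_cancel₀ h3 (by linear_combination -h1))
  have hr : y ≠ x.rev := by
    rintro rfl
    exact h (ne_rev_of_skewRTT hN hq hY (ht x) (hw _ _))
  obtain ⟨hlt, hx, hy⟩ := weight_of_skewRTT hN hq hY (hw x y) hne hr h
  refine ⟨hlt, hr, fun c h1 h2 => ?_, funext fun c => ?_⟩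
  · by_contra! h3
    exact ((lt_iff_lt_of_skewRTT hq hY hne h h1.ne' h2.ne h3.1 h3.2).1 h1).not_gt h2
  · have h0 := cq_ne_zero q
    have hx' : t x.rev = (cq q)⁻¹ := by
      have := ht x; rw [hx] at this; exact eq_inv_of_mul_eq_one_right this
    have hy' : t y.rev = cq q := by
      have := ht y; rw [hy] at this; rw [eq_inv_of_mul_eq_one_right this, inv_inv]
    have h5 : x ≠ y.rev := fun e => hr (by rw [e, Fin.rev_rev])
    have h6 := ne_rev_of_even hN x
    have h7 := ne_rev_of_even hN y
    unfold rootWeight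
    by_cases c1 : c = x
    · rw [c1, hx, if_pos (Or.inl rfl)]
    by_cases c2 : c = y.rev
    · rw [c2, hy', if_pos (Or.inr rfl)]
    rw [if_neg (by simp [c1, c2])]
    by_cases c3 : c = y
    · rw [c3, hy, if_pos (Or.inl rfl)]
    by_cases c4 : c = x.rev
    · rw [c4, hx', if_pos (Or.inr rfl)]
    rw [if_neg (by simp [c3, c4])]
    exact weight_eq_one_of_skewRTT hN hY hne h c1 c3 c4 c2

end Classification

/-! ### Enumeration of the simple roots -/

section Enumeration

variable {N n : ℕ} {q : PosReal}

/-- The first index of the simple root `j`. -/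
def rootFst (hN : N = 2 * n) (j : Fin n) : Fin N := ⟨min j (n - 2), by omega⟩

/-- The second index of the simple root `j`. -/
def rootSnd (hN : N = 2 * n) (j : Fin n) : Fin N := ⟨j + 1, by omega⟩

theorem rho_of_lt (hN : N = 2 * n) {a : Fin N} (h : (a : ℕ) < n) : rho N a = n - 1 - (a : ℕ) := by
  have h2 : (N : ℝ) = 2 * n := by rw [hN]; push_cast; ring
  rw [rho, if_pos (by rw [Fin.lt_def, Fin.val_rev]; omega), h2]
  ring

/-- For `j ≤ n - 2` the pair is `(j, j + 1)`. The last root `j = n - 1` is `(n - 2, n)`, that is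
`e_{n-2} + e_{n-1}` since `n` is the primed index of `n - 1`; this is the second fork node, and `n -
1` is the one index in between. -/
theorem isSimplePair_root (hN : N = 2 * n) (hn : 2 ≤ n) (j : Fin n) :
    IsSimplePair (rootFst hN j) (rootSnd hN j) where
  lt := by rw [Fin.lt_def]; simp only [rootFst, rootSnd]; omega
  ne := by rw [Ne, Fin.ext_iff, Fin.val_rev]; simp only [rootFst, rootSnd]; omega
  between c h1 h2 := by
    rw [Fin.lt_def] at h1 h2
    rw [Fin.ext_iff, Fin.ext_iff, Fin.val_rev, Fin.val_rev]
    simp only [rootFst, rootSnd] at h1 h2 ⊢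
    omega
  rho_eq := by
    have h1 : ((rootFst hN j : Fin N) : ℕ) = min (j : ℕ) (n - 2) := rfl
    have h2 : ((rootSnd hN j : Fin N) : ℕ) = (j : ℕ) + 1 := rfl
    rw [rho_of_lt hN (by omega), h1]
    by_cases h3 : (j : ℕ) + 1 < n
    · rw [rho_of_lt hN (by omega), h2, min_eq_left (by omega)]
      push_cast
      ring
    · rw [rho_eq_zero_of_isMiddle (a := rootSnd hN j) (by unfold IsMiddle; omega),
        min_eq_right (by omega), Nat.cast_sub hn]
      push_cast
      ring

theorem exists_root (hN : N = 2 * n) (hn : 2 ≤ n) {x y : Fin N} (h1 : x < y) (h2 : y ≠ x.rev)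
    (h3 : ∀ c, x < c → c < y → c = x.rev ∨ c = y.rev) :
    ∃ j : Fin n, (x = rootFst hN j ∧ y = rootSnd hN j) ∨
      (x = (rootSnd hN j).rev ∧ y = (rootFst hN j).rev) := by
  have h4 : ∀ c : ℕ, (x : ℕ) < c → c < (y : ℕ) → c = N - (x + 1) ∨ c = N - (y + 1) := by
    intro c hc hc'
    have := h3 ⟨c, by omega⟩ hc hc'
    rwa [Fin.ext_iff, Fin.ext_iff, Fin.val_rev, Fin.val_rev] at this
  rw [Fin.lt_def] at h1
  rw [Ne, Fin.ext_iff, Fin.val_rev] at h2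
  simp only [Fin.ext_iff, Fin.val_rev, rootFst, rootSnd]
  have h5 := h4 (x + 1)
  have h6 := h4 (x + 2)
  have h7 := x.2
  have h8 := y.2
  by_cases c1 : (y : ℕ) = x + 1
  · by_cases c2 : (x : ℕ) + 1 < n
    · exact ⟨⟨x, by omega⟩, by simp only; omega⟩
    · exact ⟨⟨N - (y + 1), by omega⟩, by simp only; omega⟩
  · exact ⟨⟨n - 1, by omega⟩, by simp only; omega⟩

/-- The weight takes the value `q` exactly on `{u, v'}`, and this set determines the root because
`q`, `q⁻¹` and `1` are distinct. -/
theorem rootWeight_injective (hN : N = 2 * n) (hq : q ≠ 1) {i j : Fin n}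
    (h : rootWeight q (rootFst hN i) (rootSnd hN i) = rootWeight q (rootFst hN j) (rootSnd hN j)) :
    i = j := by
  have h0 := cq_ne_zero q
  have h1 : cq q ≠ 1 := by simpa using cq_pow_ne_one hq one_ne_zero
  have h2 : (cq q)⁻¹ ≠ cq q := by
    intro e
    refine cq_pow_ne_one hq two_ne_zero ?_
    field_simp at e
    exact e.symm
  have key : ∀ (u v a : Fin N), rootWeight q u v a = cq q ↔ a = u ∨ a = v.rev := by
    intro u v a
    unfold rootWeight
    split_ifs with c1 c2
    · exact iff_of_true rfl c1
    · exact iff_of_false h2 c1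
    · exact iff_of_false (Ne.symm h1) c1
  have e1 := (key _ _ _).1 ((congrFun h (rootFst hN i)).symm.trans ((key _ _ _).2 (Or.inl rfl)))
  have e2 := (key _ _ _).1 ((congrFun h (rootSnd hN i).rev).symm.trans
    ((key _ _ _).2 (Or.inr rfl)))
  simp only [Fin.ext_iff, Fin.val_rev, rootFst, rootSnd] at e1 e2
  ext
  omega

theorem IsChar.diagonal_mul_rev {χ : SOq N q →ₗ[ℂ] ℂ} (hχ : IsChar χ) {t : Fin N → ℂ}
    (ht : (genT N q).map χ = Matrix.diagonal t) (a : Fin N) : t a * t a.rev = 1 := by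
  have h1 := congrFun (congrFun hχ.isPoint.orth₁ a) a.rev
  rw [ht, scal_complex, diagonal_mul_metricC_mul_apply, Matrix.diagonal_transpose,
    Matrix.diagonal_apply_eq, metricC_eq, if_pos rfl, mul_right_comm] at h1
  exact mul_right_cancel₀ (inv_ne_zero (qRho_ne_zero q a)) (by rw [h1, one_mul])

theorem map_smul_matrix {H : Type} [AddCommGroup H] [Module ℂ H] (X : Matrix (Fin N) (Fin N) H)
    (z : ℂ) (E : H →ₗ[ℂ] ℂ) : X.map (z • E) = z • X.map E := rfl

/-- A skew derivation of weight `q²` is a multiple of a simple root vector. -/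
theorem IsSkew.exists_root (hN : N = 2 * n) (hn : 2 ≤ n) (hq : q ≠ 1)
    {κ E : Fin n → SOq N q →ₗ[ℂ] ℂ}
    (hE : ∀ j, IsRootPair (rootFst hN j) (rootSnd hN j) (κ j) (E j))
    {χ δ : SOq N q →ₗ[ℂ] ℂ} (hχ : IsChar χ) (hδ : IsSkew χ Coalgebra.counit δ) (h0 : δ ≠ 0)
    {t : Fin N → ℂ} (ht : (genT N q).map χ = Matrix.diagonal t)
    (hc : conv χ δ = cq q ^ 2 • conv δ χ) :
    ∃ j, χ = κ j ∧ ∃ z : ℂ, z ≠ 0 ∧ δ = z • E j := by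
  have hev : Even N := by rw [hN]; exact even_two_mul n
  set Y := (genT N q).map δ with hYdef
  have hY : SkewRTT q t Y := hδ.skewRTT ht
  have horth := hδ.orth hχ ht
  have htt := hχ.diagonal_mul_rev ht
  have hw : ∀ a b, t a * Y a b = cq q ^ 2 * (Y a b * t b) := by
    intro a b
    have h1 := congrArg (fun F : SOq N q →ₗ[ℂ] ℂ => (genT N q).map F a b) hc
    simp only [map_smul_matrix, map_conv, ht, Matrix.diagonal_mul, Matrix.smul_apply,
      Matrix.mul_diagonal, smul_eq_mul] at h1
    exact h1
  have hsupp : ∀ a b, Y a b ≠ 0 → ∃ j : Fin n, t = rootWeight q (rootFst hN j) (rootSnd hN j) ∧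
      ((a = rootFst hN j ∧ b = rootSnd hN j) ∨
        (a = (rootSnd hN j).rev ∧ b = (rootFst hN j).rev)) := by
    intro a b hab
    obtain ⟨h1, h2, h3, h4⟩ := rootWeight_of_skewRTT hev hq hY htt hw hab
    obtain ⟨j, hj⟩ := QuantumOrthogonal.exists_root hN hn h1 h2 h3
    refine ⟨j, ?_, hj⟩
    rw [h4]
    rcases hj with ⟨rfl, rfl⟩ | ⟨rfl, rfl⟩
    · rfl
    · rw [rootWeight_mirror]
  obtain ⟨a, b, hab⟩ : ∃ a b, Y a b ≠ 0 := by
    by_contra! hz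
    refine h0 (hδ.ext (δ' := 0) (fun x y => by simp) hχ.map_one Bialgebra.counit_one ?_)
    ext a b
    rw [hYdef] at hz
    rw [hz]
    rfl
  obtain ⟨j, hj, -⟩ := hsupp a b hab
  have hpair := isSimplePair_root hN hn j
  have hs : ∀ a b, Y a b ≠ 0 → (a = rootFst hN j ∧ b = rootSnd hN j) ∨
        (a = (rootSnd hN j).rev ∧ b = (rootFst hN j).rev) := by
    intro a b hab
    obtain ⟨i, hi, h⟩ := hsupp a b hab
    obtain rfl : i = j := rootWeight_injective hN hq (hi.symm.trans hj)
    exact h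
  set u := rootFst hN j
  set v := rootSnd hN j
  have huv : u ≠ v.rev := fun e => hpair.ne (by rw [e, Fin.rev_rev])
  have hY' : Y = Y u v • rootMat u v := by
    -- All nonzero entries belong to the same root, since the character determines it. The
    -- orthogonality relation at `(u, v')` then ties the two remaining entries together, leaving one
    -- free scalar.
    have h2 : Y v.rev u.rev = -Y u v := by
      have h1 := horth u v.rev
      have hv := qRho_ne_zero q v
      have hq0 := cq_ne_zero q
      rw [← hYdef, Fin.rev_rev, qRho_rev, hj, rootWeight, if_pos (Or.inl rfl), hpair.qRho_eq] at h1
      field_simp at h1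
      linear_combination h1
    ext c d
    rw [Matrix.smul_apply, rootMat_apply, unitMat, unitMat, smul_eq_mul]
    by_cases c1 : c = u ∧ d = v
    · obtain ⟨rfl, rfl⟩ := c1
      simp [huv]
    by_cases c2 : c = v.rev ∧ d = u.rev
    · obtain ⟨rfl, rfl⟩ := c2
      simp [huv.symm, h2]
    · rw [if_neg c1, if_neg c2]
      by_contra h
      rcases hs c d (by simpa using h) with h | h
      · exact c1 h
      · exact c2 h
  have hκ : χ = κ j := hχ.ext (hE j).isChar (by rw [ht, hj, (hE j).map_char])
  refine ⟨j, hκ, Y u v, fun hz => ?_, ?_⟩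
  · rw [hz, zero_smul] at hY'
    exact hab (by rw [hY']; rfl)
  · refine hδ.ext (hκ ▸ (hE j).isSkew.smul _) hχ.map_one Bialgebra.counit_one ?_
    rw [map_smul_matrix, (hE j).map_skew, ← hYdef]
    exact hY'

end Enumeration

/-! ### Characters and the action of automorphisms on them -/

section Characters

variable {N : ℕ} {q : PosReal}

theorem eq_or_isMiddle_of_rho_eq (hN : Even N) {a b : Fin N} (h : rho N a = rho N b) :
    a = b ∨ (IsMiddle a ∧ b = a.rev) := by
  obtain ⟨n, hn⟩ := hN
  have hN : N = 2 * n := by omega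
  have h2 := a.2
  have h3 := b.2
  have key : ∀ c : Fin N, n ≤ (c : ℕ) → rho N c = n - (c : ℕ) := by
    intro c hc
    have h1 := c.2
    have h4 : rho N c = -rho N c.rev := by rw [rho_rev, neg_neg]
    have h5 : (((c.rev : Fin N) : ℕ) : ℝ) = 2 * n - 1 - (c : ℕ) := by
      have h6 : (N : ℝ) = 2 * n := by rw [hN]; push_cast; ring
      rw [Fin.val_rev, Nat.cast_sub (by omega), h6]
      push_cast
      ring
    rw [h4, rho_of_lt hN (by rw [Fin.val_rev]; omega), h5]
    ring
  have e : a = b ∨ (IsMiddle a ∧ IsMiddle b) := by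
    unfold IsMiddle
    rw [Fin.ext_iff]
    by_cases ha : (a : ℕ) < n <;> by_cases hb : (b : ℕ) < n
    · rw [rho_of_lt hN ha, rho_of_lt hN hb] at h
      left
      have : ((a : ℕ) : ℝ) = (b : ℕ) := by linarith
      exact_mod_cast this
    · rw [rho_of_lt hN ha, key b (by omega)] at h
      have : ((b : ℕ) : ℝ) = (a : ℕ) + 1 := by linarith
      have : (b : ℕ) = a + 1 := by exact_mod_cast this
      omega
    · rw [rho_of_lt hN hb, key a (by omega)] at h
      have : ((a : ℕ) : ℝ) = (b : ℕ) + 1 := by linarith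
      have : (a : ℕ) = b + 1 := by exact_mod_cast this
      omega
    · rw [key a (by omega), key b (by omega)] at h
      left
      have : ((a : ℕ) : ℝ) = (b : ℕ) := by linarith
      exact_mod_cast this
  rcases e with e | ⟨e1, e2⟩
  · exact Or.inl e
  · rcases eq_or_eq_rev_of_isMiddle e1 e2 with e | e
    · exact Or.inl e.symm
    · exact Or.inr ⟨e1, e⟩

theorem metricC_mul_transpose : metricC N q * (metricC N q)ᵀ =
    Matrix.diagonal fun a => (qRho q a)⁻¹ ^ 2 := by
  ext a b
  have h := diagonal_mul_metricC_mul_apply (q := q) (fun _ => 1) (metricC N q)ᵀ a b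
  rw [Matrix.diagonal_one, one_mul] at h
  rw [h, Matrix.transpose_apply, metricC_eq, Matrix.diagonal_apply]
  simp only [Fin.rev_inj]
  split_ifs with h1
  · rw [h1, one_mul, sq]
  · rw [mul_zero]

/-- The two orthogonality relations make the matrix of a character commute with `C Cᵗ =
diag(q^{-2ρ})`, so for `q ≠ 1` it is block diagonal along the level sets of `ρ`. -/
theorem IsChar.rho_eq (hq : q ≠ 1) {χ : SOq N q →ₗ[ℂ] ℂ} (hχ : IsChar χ) {a b : Fin N}
    (h : χ (genT N q a b) ≠ 0) : rho N a = rho N b := by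
  set g := (genT N q).map χ with hg
  have h1 : g * metricC N q * gᵀ = metricC N q := by simpa [scal_complex] using hχ.isPoint.orth₁
  have h2 : gᵀ * metricC N q * g = metricC N q := by simpa [scal_complex] using hχ.isPoint.orth₂
  have h3 : gᵀ * (metricC N q)ᵀ * g = (metricC N q)ᵀ := by
    have := congrArg Matrix.transpose h2
    simpa [Matrix.transpose_mul, mul_assoc] using this
  have h4 : g * (metricC N q * (metricC N q)ᵀ) = metricC N q * (metricC N q)ᵀ * g := by
    calc g * (metricC N q * (metricC N q)ᵀ) = g * metricC N q * (gᵀ * (metricC N q)ᵀ * g) := by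
          rw [h3, mul_assoc]
      _ = g * metricC N q * gᵀ * ((metricC N q)ᵀ * g) := by simp only [mul_assoc]
      _ = metricC N q * (metricC N q)ᵀ * g := by rw [h1, mul_assoc]
  rw [metricC_mul_transpose] at h4
  have h5 := congrFun (congrFun h4 a) b
  rw [Matrix.mul_diagonal, Matrix.diagonal_mul, mul_comm] at h5
  have h6 := mul_right_cancel₀ (show g a b ≠ 0 from h) h5
  rw [inv_pow, inv_pow, inv_inj, qRho, qRho, ← Complex.ofReal_pow, ← Complex.ofReal_pow,
    Complex.ofReal_inj, pow_left_inj₀ (Real.rpow_nonneg q.2.le _) (Real.rpow_nonneg q.2.le _)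
    two_ne_zero, Real.rpow_right_inj q.2 fun e => hq (Subtype.ext e)] at h6
  exact h6.symm

/-- The only block larger than `1 × 1` is the middle one, which is orthogonal of size two and hence
diagonal or antidiagonal. In both cases its square is diagonal. -/
theorem IsChar.isDiag_conv_self (hN : Even N) (hq : q ≠ 1) {χ : SOq N q →ₗ[ℂ] ℂ} (hχ : IsChar χ) :
    ∃ t, (genT N q).map (QuantumOrthogonal.conv χ χ) = Matrix.diagonal t := by
  set g := (genT N q).map χ with hg
  -- The values of `ρ` are distinct except at the two middle indices.
  have h0 : ∀ a b, a ≠ b → (¬ IsMiddle a ∨ b ≠ a.rev) → g a b = 0 := by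
    intro a b hab h
    by_contra h'
    rcases eq_or_isMiddle_of_rho_eq hN (hχ.rho_eq hq h') with e | ⟨e1, e2⟩
    · exact hab e
    · exact h.elim (fun h => h e1) (fun h => h e2)
  have h1 : g * metricC N q * gᵀ = metricC N q := by simpa [scal_complex] using hχ.isPoint.orth₁
  have h2 : ∀ a b, ∑ c, g a c.rev * qRho q c * g b c = metricC N q a b := by
    intro a b
    rw [← h1, Matrix.mul_apply]
    simp only [mul_metricC_apply, Matrix.transpose_apply]
  have h3 : ∀ a, IsMiddle a → g a a.rev ≠ 0 → g a a = 0 ∧ g a.rev a.rev = 0 := by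
    intro a ha hne
    have hr := ne_rev_of_even hN a
    have hz : ∀ c, c ≠ a ∧ c ≠ a.rev → g a c = 0 := fun c hc => h0 a c hc.1.symm (Or.inr hc.2)
    have q1 : ∀ c : Fin N, IsMiddle c → qRho q c = 1 := fun c hc => by
      rw [qRho, rho_eq_zero_of_isMiddle hc]; simp
    have e1 := h2 a a
    rw [Fintype.sum_eq_add a a.rev hr (fun c hc => by rw [hz c hc, mul_zero]), Fin.rev_rev,
      q1 _ ha, q1 _ ha.rev, metricC_eq, if_neg hr] at e1
    have e2 := h2 a a.rev
    rw [Fintype.sum_eq_add a a.rev hr (fun c hc => by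
      rw [h0 a.rev c hc.2.symm (Or.inr (by rw [Fin.rev_rev]; exact hc.1)), mul_zero]), Fin.rev_rev,
      q1 _ ha, q1 _ ha.rev, metricC_eq, if_pos rfl, q1 _ ha] at e2
    have e3 : g a a = 0 := by
      have : g a a.rev * g a a = 0 := by linear_combination e1 / 2
      exact (mul_eq_zero.1 this).resolve_left hne
    have e4 := h2 a.rev a.rev
    rw [Fintype.sum_eq_add a a.rev hr (fun c hc => by
      rw [h0 a.rev c hc.2.symm (Or.inr (by rw [Fin.rev_rev]; exact hc.1)), mul_zero]), Fin.rev_rev,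
      q1 _ ha, q1 _ ha.rev, metricC_eq, if_neg (by rw [Fin.rev_rev]; exact hr.symm)] at e4
    rw [e3] at e2
    have e5 : g a.rev a ≠ 0 := fun e => by rw [e] at e2; simp at e2
    have : g a.rev a * g a.rev a.rev = 0 := by linear_combination e4 / 2
    exact ⟨e3, (mul_eq_zero.1 this).resolve_left e5⟩
  refine ⟨fun a => (g * g) a a, ?_⟩
  rw [map_conv]
  ext a b
  rw [Matrix.diagonal_apply]
  split_ifs with hab
  · rw [hab]
  rw [Matrix.mul_apply]
  by_cases hb : IsMiddle a ∧ b = a.rev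
  · obtain ⟨ha, rfl⟩ := hb
    rw [Fintype.sum_eq_add a a.rev hab (fun c hc => by
      rw [← hg, h0 a c hc.1.symm (Or.inr hc.2), zero_mul]), ← hg]
    by_cases h : g a a.rev = 0
    · rw [h]; ring
    · rw [(h3 a ha h).1, (h3 a ha h).2]; ring
  · refine Finset.sum_eq_zero fun c _ => ?_
    rw [← hg]
    by_cases hc : a = c
    · rw [← hc, h0 a b hab (not_and_or.1 hb), mul_zero]
    · by_cases hc' : IsMiddle a ∧ c = a.rev
      · rw [h0 c b ?_ ?_, mul_zero]
        · rintro rfl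
          exact hb hc'
        · refine Or.inr ?_
          rw [hc'.2, Fin.rev_rev]
          exact Ne.symm hab
      · rw [h0 a c hc (not_and_or.1 hc'), zero_mul]

/-- A root is chosen on one half of the indices and its inverse on the primed half, so that the root
again satisfies the torus condition. -/
theorem exists_sqrt_weight (hN : Even N) {t : Fin N → ℂ} (ht : ∀ a, t a * t a.rev = 1) :
    ∃ θ : Fin N → ℂ, (∀ a, θ a * θ a = t a) ∧ ∀ a, θ a * θ a.rev = 1 := by
  have h1 : ∀ a, ∃ z : ℂ, z * z = t a := fun a => by
    obtain ⟨z, hz⟩ := IsAlgClosed.exists_pow_nat_eq (t a) (n := 2) two_pos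
    exact ⟨z, by rw [← sq, hz]⟩
  choose r hr using h1
  have hr0 : ∀ a, r a ≠ 0 := fun a h => by
    have h2 := hr a
    have h3 := ht a
    rw [← h2, h] at h3
    simp at h3
  refine ⟨fun a => if a < a.rev then r a else (r a.rev)⁻¹, fun a => ?_, fun a => ?_⟩
  · simp only
    split_ifs with h
    · exact hr a
    · rw [← mul_inv, hr]
      exact inv_eq_of_mul_eq_one_left (ht a)
  · have hne := ne_rev_of_even hN a
    simp only [Fin.rev_rev]
    rcases lt_or_gt_of_ne hne with h | h
    · rw [if_pos h, if_neg h.not_gt, mul_inv_cancel₀ (hr0 a)]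
    · rw [if_neg h.not_gt, if_pos h, inv_mul_cancel₀ (hr0 _)]

/-- An automorphism could carry a diagonal character to one with an antidiagonal middle block. But a
diagonal character is a square, and squares of characters are diagonal. -/
theorem IsChar.isDiag_pull (hN : Even N) (hq : q ≠ 1) (α : SOq N q ≃ₐc[ℂ] SOq N q)
    {χ : SOq N q →ₗ[ℂ] ℂ} (hχ : IsChar χ) {t : Fin N → ℂ}
    (ht : (genT N q).map χ = Matrix.diagonal t) :
    ∃ t', (genT N q).map (QuantumOrthogonal.pull α χ) = Matrix.diagonal t' := by
  obtain ⟨θ, hθ, hθ'⟩ := exists_sqrt_weight hN (hχ.diagonal_mul_rev ht)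
  obtain ⟨ψ, hψ, hψT⟩ := exists_isChar (q := q) hθ' fun a ha => absurd ha (ne_rev_of_even hN a)
  obtain rfl : χ = QuantumOrthogonal.conv ψ ψ := by
    refine hχ.ext (hψ.conv hψ) ?_
    rw [map_conv, hψT, ht, Matrix.diagonal_mul_diagonal]
    simp only [hθ]
  rw [pull_conv]
  exact (hψ.pull α).isDiag_conv_self hN hq

variable {u v : Fin N} {κ E χ : SOq N q →ₗ[ℂ] ℂ} {t : Fin N → ℂ}

theorem IsRootPair.map_skew_apply_self (hE : IsRootPair u v κ E) (h : v ≠ u.rev) :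
    E (genT N q u v) = 1 := by
  have h1 := congrFun (congrFun hE.map_skew u) v
  rw [Matrix.map_apply, rootMat_apply, unitMat, unitMat, if_pos ⟨rfl, rfl⟩,
    if_neg fun e => h e.2, sub_zero] at h1
  exact h1

/-- Both products are skew derivations for the pair `χ κ`, `χ`, so the comparison takes place on
`T`, where `t_u t_{v'}` is the value of the root on the torus element `t`. -/
theorem IsRootPair.conv_char (hE : IsRootPair u v κ E) (hχ : IsChar χ)
    (ht : (genT N q).map χ = Matrix.diagonal t) : conv χ E = (t u * t v.rev) • conv E χ := by
  have h1 : conv χ κ = conv κ χ := (hχ.conv hE.isChar).ext (hE.isChar.conv hχ) (by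
    rw [map_conv, map_conv, ht, hE.map_char, Matrix.diagonal_mul_diagonal,
      Matrix.diagonal_mul_diagonal]
    simp only [mul_comm])
  have h2 := hE.isSkew.conv_char_left hχ
  have h3 := (hE.isSkew.conv_char_right hχ).smul (t u * t v.rev)
  rw [conv_counit_right] at h2
  rw [conv_counit_left, ← h1] at h3
  refine h2.ext h3 (hχ.conv hE.isChar).map_one hχ.map_one ?_
  rw [map_smul_matrix, map_conv, map_conv, ht, hE.map_skew]
  ext a b
  rw [Matrix.diagonal_mul, Matrix.smul_apply, Matrix.mul_diagonal, rootMat_apply, unitMat, unitMat,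
    smul_eq_mul]
  have e1 := hχ.diagonal_mul_rev ht u
  have e2 := hχ.diagonal_mul_rev ht v
  by_cases c1 : a = u ∧ b = v
  · by_cases c2 : a = v.rev ∧ b = u.rev
    · rw [if_pos c1, if_pos c2]; ring
    · rw [if_pos c1, if_neg c2, c1.1, c1.2]
      linear_combination -t u * e2
  · by_cases c2 : a = v.rev ∧ b = u.rev
    · rw [if_neg c1, if_pos c2, c2.1, c2.2]
      linear_combination t v.rev * e1
    · rw [if_neg c1, if_neg c2]; ring

theorem IsRootPair.conv_ne_zero (hE : IsRootPair u v κ E) (h : v ≠ u.rev) (hχ : IsChar χ)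
    (ht : (genT N q).map χ = Matrix.diagonal t) : conv E χ ≠ 0 := by
  intro h0
  have h1 := congrFun (congrFun (map_conv E χ) u) v
  rw [h0, ht, Matrix.mul_diagonal, Matrix.map_apply, Matrix.map_apply,
    hE.map_skew_apply_self h, one_mul, LinearMap.zero_apply] at h1
  have h2 := hχ.diagonal_mul_rev ht v
  rw [← h1, zero_mul] at h2
  exact zero_ne_one h2

end Characters

/-! ### Automorphisms act on the simple roots by diagram automorphisms -/

section DiagramAutomorphism

variable {N n : ℕ} {q : PosReal}

/-- The pairing of a weight with the simple root `j`. -/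
def rootPairing (hN : N = 2 * n) (t : Fin N → ℂ) (j : Fin n) : ℂ :=
  t (rootFst hN j) * t (rootSnd hN j).rev

theorem rootPairing_succ (hN : N = 2 * n) {i j : Fin n} (hij : (i : ℕ) = j + 1)
    (hj : (j : ℕ) + 3 ≤ n) :
    rootPairing hN (rootWeight q (rootFst hN i) (rootSnd hN i)) j = (cq q)⁻¹ := by
  rw [rootPairing, rootWeight, rootWeight, if_neg, if_neg, if_neg, if_pos, one_mul]
  all_goals
    simp only [Fin.ext_iff, Fin.val_rev, rootFst, rootSnd]
    omega

theorem rootPairing_of_lt (hN : N = 2 * n) {i j : Fin n} (hij : (j : ℕ) + 1 < min (i : ℕ) (n - 2)) :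
    rootPairing hN (rootWeight q (rootFst hN i) (rootSnd hN i)) j = 1 := by
  rw [rootPairing, rootWeight, rootWeight, if_neg, if_neg, if_neg, if_neg, one_mul]
  all_goals
    simp only [Fin.ext_iff, Fin.val_rev, rootFst, rootSnd]
    omega

/-- An automorphism of the Dynkin diagram that preserves the fork is trivial off the fork. -/
theorem eq_of_rootPairing (hN : N = 2 * n) (hq : q ≠ 1) {σ : Fin n → Fin n}
    (hσ : Function.Injective σ)
    (hp : ∀ i j, rootPairing hN (rootWeight q (rootFst hN (σ i)) (rootSnd hN (σ i))) (σ j) =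
      rootPairing hN (rootWeight q (rootFst hN i) (rootSnd hN i)) j)
    (hf : ∀ i : Fin n, n - 2 ≤ (i : ℕ) → n - 2 ≤ (σ i : ℕ)) (j : Fin n) (hj : (j : ℕ) + 3 ≤ n) :
    σ j = j := by
  have key : ∀ k : ℕ, ∀ j : Fin n, (j : ℕ) + 3 + k = n → σ j = j := by
    intro k
    induction k using Nat.strong_induction_on with
    | _ k ih =>
      intro j hj
      have ih' : ∀ i : Fin n, j < i → (i : ℕ) + 3 ≤ n → σ i = i := fun i h1 h2 => by
        rw [Fin.lt_def] at h1
        exact ih (n - 3 - i) (by omega) i (by omega)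
      -- The nodes beyond `j` outside the fork are already fixed and the fork is preserved, so by
      -- injectivity `σ j` is none of them.
      have hle : σ j ≤ j := by
        by_contra! h
        rw [Fin.lt_def] at h
        by_cases h1 : (σ j : ℕ) + 3 ≤ n
        · have := hσ (ih' _ (Fin.lt_def.2 h) h1)
          rw [this] at h
          exact lt_irrefl _ h
        · have e1 := hf ⟨n - 2, by omega⟩ le_rfl
          have e2 := hf ⟨n - 1, by omega⟩ (by simp only; omega)
          have n1 : σ ⟨n - 2, by omega⟩ ≠ σ ⟨n - 1, by omega⟩ := fun e => by
            have := hσ e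
            rw [Fin.ext_iff] at this
            simp only at this
            omega
          have n2 : σ j ≠ σ ⟨n - 2, by omega⟩ := fun e => by
            have := hσ e
            rw [Fin.ext_iff] at this
            simp only at this
            omega
          have n3 : σ j ≠ σ ⟨n - 1, by omega⟩ := fun e => by
            have := hσ e
            rw [Fin.ext_iff] at this
            simp only at this
            omega
          rw [Ne, Fin.ext_iff] at n1 n2 n3
          omega
      by_contra hne
      have hlt : (σ j : ℕ) < j := Fin.lt_def.1 (lt_of_le_of_ne hle hne)
      have hi : (j : ℕ) + 1 < n := by omega
      -- If `σ j < j`, then `σ (j + 1)`, which is at least `j + 1`, is no longer adjacent to `σ j`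
      -- although `j + 1` is adjacent to `j`: the pairing would be both `1` and `q⁻¹`.
      have e := hp ⟨j + 1, hi⟩ j
      have hmin : (j : ℕ) + 1 ≤ min (σ ⟨j + 1, hi⟩ : ℕ) (n - 2) := by
        by_cases h1 : (j : ℕ) + 1 + 3 ≤ n
        · rw [ih' ⟨j + 1, hi⟩ (Fin.lt_def.2 (Nat.lt_succ_self _)) h1]
          simp only
          omega
        · have := hf ⟨j + 1, hi⟩ (by simp only; omega)
          omega
      rw [rootPairing_of_lt hN (by omega), rootPairing_succ hN rfl (by omega)] at e
      exact cq_pow_ne_one hq one_ne_zero (by rw [pow_one]; exact inv_eq_one.1 e.symm)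
  exact key (n - 3 - j) j (by omega)

variable {κ E : Fin n → SOq N q →ₗ[ℂ] ℂ}

/-- The pullback of `E_j` is a nonzero skew derivation whose character is diagonal by
`IsChar.isDiag_pull` and which satisfies the same `q²` relation. The classification therefore
identifies it. -/
theorem exists_root_pull (hN : N = 2 * n) (hn : 2 ≤ n) (hq : q ≠ 1)
    (hE : ∀ j, IsRootPair (rootFst hN j) (rootSnd hN j) (κ j) (E j))
    (α : SOq N q ≃ₐc[ℂ] SOq N q) (j : Fin n) :
    ∃ i, pull α (κ j) = κ i ∧ ∃ z : ℂ, z ≠ 0 ∧ pull α (E j) = z • E i := by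
  have hev : Even N := by rw [hN]; exact even_two_mul n
  have hp := isSimplePair_root hN hn j
  obtain ⟨t, ht⟩ := (hE j).isChar.isDiag_pull hev hq α (hE j).map_char
  have hs := (hE j).isSkew.pull α
  rw [pull_counit] at hs
  refine hs.exists_root hN hn hq hE ((hE j).isChar.pull α) (fun h => ?_) ht ?_
  · have h1 : E j = 0 := pull_injective α (h.trans rfl)
    have h2 := (hE j).map_skew_apply_self hp.ne
    rw [h1] at h2
    exact zero_ne_one h2
  · rw [← pull_conv, ← pull_conv, (hE j).conv_char (hE j).isChar (hE j).map_char, pull_smul,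
      rootWeight, rootWeight, if_pos (Or.inl rfl), if_pos (Or.inr rfl), sq]

/-- Pulling back `χ E_j = ⟨χ, j⟩ E_j χ` and comparing with the same relation for `E_i` shows that
automorphisms preserve the pairing of characters with roots; the scalar `z` cancels. -/
theorem rootPairing_pull (hN : N = 2 * n) (hn : 2 ≤ n)
    (hE : ∀ j, IsRootPair (rootFst hN j) (rootSnd hN j) (κ j) (E j))
    (α : SOq N q ≃ₐc[ℂ] SOq N q) {i j : Fin n} {z : ℂ} (hz : z ≠ 0) (h : pull α (E j) = z • E i)
    {χ : SOq N q →ₗ[ℂ] ℂ} (hχ : IsChar χ) {t t' : Fin N → ℂ}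
    (ht : (genT N q).map χ = Matrix.diagonal t)
    (ht' : (genT N q).map (pull α χ) = Matrix.diagonal t') :
    rootPairing hN t' i = rootPairing hN t j := by
  have h1 := congrArg (pull α) ((hE j).conv_char hχ ht)
  rw [pull_smul, pull_conv, pull_conv, h, conv_smul_left, conv_smul_right,
    (hE i).conv_char (hχ.pull α) ht', smul_smul, smul_smul] at h1
  have h2 := smul_left_injective ℂ
    ((hE i).conv_ne_zero (isSimplePair_root hN hn i).ne (hχ.pull α) ht') h1
  exact mul_left_cancel₀ hz (by rw [rootPairing, rootPairing]; linear_combination h2)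

/-- The sign weight `-1` on the `k + 1` outermost pairs of indices. -/
def outerWeight (k : ℕ) (a : Fin N) : ℂ := if min (a : ℕ) (a.rev : ℕ) ≤ k then -1 else 1

/-- The sign changes between the positions `k` and `k + 1`, so only the root crossing that gap sees
it. For `k = n - 2` both fork roots do. -/
theorem rootPairing_outerWeight (hN : N = 2 * n) (hn : 2 ≤ n) (k : ℕ) (j : Fin n) :
    rootPairing hN (outerWeight k) j = if min (j : ℕ) (n - 2) = k then -1 else 1 := by
  have e1 : min ((rootFst hN j : Fin N) : ℕ) ((rootFst hN j).rev : ℕ) = min (j : ℕ) (n - 2) := by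
    simp only [Fin.val_rev, rootFst]
    omega
  have e2 : min (((rootSnd hN j).rev : Fin N) : ℕ) ((rootSnd hN j).rev.rev : ℕ) =
      min (j : ℕ) (n - 2) + 1 := by
    simp only [Fin.rev_rev, Fin.val_rev, rootSnd]
    omega
  rw [rootPairing, outerWeight, outerWeight, e1, e2]
  rcases lt_trichotomy (min (j : ℕ) (n - 2)) k with h | h | h
  · rw [if_pos h.le, if_pos (Nat.succ_le_of_lt h), if_neg h.ne]; ring
  · rw [if_pos h.le, if_neg (by omega), if_pos h]; ring
  · rw [if_neg (by omega), if_neg (by omega), if_neg h.ne']; ring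

/-- A diagram automorphism alone could move the end node of the chain, by triality for `n = 4` or
inside the diagram `D_3 = A_3`. What excludes this is that characters of order two of `SO(2n)`
cannot distinguish the two fork roots. -/
theorem exists_root_pull_fixed (hN : N = 2 * n) (hq : q ≠ 1)
    (hE : ∀ j, IsRootPair (rootFst hN j) (rootSnd hN j) (κ j) (E j))
    (α : SOq N q ≃ₐc[ℂ] SOq N q) (j : Fin n) (hj : (j : ℕ) + 3 ≤ n) :
    pull α (κ j) = κ j ∧ ∃ z : ℂ, z ≠ 0 ∧ pull α (E j) = z • E j := by
  have hev : Even N := by rw [hN]; exact even_two_mul n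
  have hn : 2 ≤ n := by omega
  choose σ hσ z hz hσE using exists_root_pull hN hn hq hE α
  have hinj : Function.Injective σ := fun i i' h => by
    have h1 : κ i = κ i' := pull_injective α (by rw [hσ, hσ, h])
    have h2 := (hE i).map_char
    rw [h1, (hE i').map_char] at h2
    exact (rootWeight_injective hN hq (Matrix.diagonal_injective h2)).symm
  -- The pullback of this sign character along `α⁻¹` is again diagonal of order two, so its weights
  -- are signs with `t_{a'} = t_a`. The two fork roots differ only in replacing `n - 1` by its
  -- primed index, hence have equal pairings.
  have hsign : ∀ k ≤ n - 2, rootPairing hN (outerWeight k) (σ ⟨n - 2, by omega⟩) =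
      rootPairing hN (outerWeight k) (σ ⟨n - 1, by omega⟩) := by
    intro k hk
    have hτ : ∀ a : Fin N, outerWeight k a * outerWeight k a.rev = 1 := fun a => by
      rw [outerWeight, outerWeight, Fin.rev_rev, min_comm]
      split_ifs <;> norm_num
    have hτ2 : ∀ a : Fin N, outerWeight k a * outerWeight k a = 1 := fun a => by
      rw [outerWeight]
      split_ifs <;> norm_num
    obtain ⟨χ, hχ, hχT⟩ := exists_isChar (q := q) hτ fun a ha => absurd ha (ne_rev_of_even hev a)
    have hχ2 : conv χ χ = Coalgebra.counit := (hχ.conv hχ).ext isChar_counit (by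
      rw [map_conv, map_counit, hχT, Matrix.diagonal_mul_diagonal]
      simp only [hτ2, Matrix.diagonal_one])
    obtain ⟨t, ht⟩ := hχ.isDiag_pull hev hq α.symm hχT
    have hχ' := hχ.pull α.symm
    have hT : (genT N q).map (pull α (pull α.symm χ)) = Matrix.diagonal (outerWeight k) := by
      rw [pull_symm_pull, hχT]
    rw [rootPairing_pull hN hn hE α (hz _) (hσE _) hχ' ht hT,
      rootPairing_pull hN hn hE α (hz _) (hσE _) hχ' ht hT]
    have ht2 : ∀ a, t a * t a = 1 := by
      have h1 := map_conv (pull α.symm χ) (pull α.symm χ)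
      rw [← pull_conv, hχ2, pull_counit, map_counit, ht, Matrix.diagonal_mul_diagonal,
        ← Matrix.diagonal_one] at h1
      exact fun a => (congrFun (Matrix.diagonal_injective h1) a).symm
    have ht1 := hχ'.diagonal_mul_rev ht ⟨n - 1, by omega⟩
    have e1 : rootFst hN ⟨n - 2, by omega⟩ = rootFst hN ⟨n - 1, by omega⟩ := by
      rw [Fin.ext_iff]
      simp only [rootFst]
      omega
    have e2 : (rootSnd hN ⟨n - 2, by omega⟩).rev = (⟨n - 1, by omega⟩ : Fin N).rev := by
      rw [Fin.rev_inj, Fin.ext_iff]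
      simp only [rootSnd]
      omega
    have e3 : (rootSnd hN ⟨n - 1, by omega⟩).rev = (⟨n - 1, by omega⟩ : Fin N) := by
      rw [Fin.ext_iff, Fin.val_rev]
      simp only [rootSnd]
      omega
    rw [rootPairing, rootPairing, e1, e2, e3]
    have h2 := ht2 ⟨n - 1, by omega⟩
    have h3 : t (⟨n - 1, by omega⟩ : Fin N).rev = t ⟨n - 1, by omega⟩ := by
      linear_combination t ⟨n - 1, by omega⟩ * ht1 - t (⟨n - 1, by omega⟩ : Fin N).rev * h2
    rw [h3]
  -- Taking `k` to be the position of `σ (n - 2)` makes one of the two pairings `-1`, so the other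
  -- is `-1` as well. Two different nodes at the same position must be the two fork nodes.
  have hmin : min (σ ⟨n - 1, by omega⟩ : ℕ) (n - 2) = min (σ ⟨n - 2, by omega⟩ : ℕ) (n - 2) := by
    have h1 := hsign (min (σ ⟨n - 2, by omega⟩ : ℕ) (n - 2)) (min_le_right _ _)
    rw [rootPairing_outerWeight hN hn,
      rootPairing_outerWeight hN hn, if_pos rfl] at h1
    by_contra h
    rw [if_neg h] at h1
    norm_num at h1
  have hfork : ∀ i : Fin n, n - 2 ≤ (i : ℕ) → n - 2 ≤ (σ i : ℕ) := by
    have hne : σ ⟨n - 1, by omega⟩ ≠ σ ⟨n - 2, by omega⟩ := fun e => by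
      have := hinj e
      rw [Fin.ext_iff] at this
      simp only at this
      omega
    rw [Ne, Fin.ext_iff] at hne
    intro i hi
    by_cases h : (i : ℕ) = n - 2
    · rw [show i = ⟨n - 2, by omega⟩ from Fin.ext h]
      omega
    · rw [show i = ⟨n - 1, by omega⟩ from Fin.ext (by simp only; omega)]
      omega
  have hfix := eq_of_rootPairing hN hq hinj (fun i j =>
    rootPairing_pull hN hn hE α (hz j) (hσE j) (hE i).isChar (hE i).map_char
      (by rw [hσ i, (hE (σ i)).map_char])) hfork j hj
  refine ⟨?_, z j, hz j, ?_⟩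
  · rw [hσ, hfix]
  · rw [hσE, hfix]

end DiagramAutomorphism

/-! ### Conjugates of the root functionals -/

section StarOnRoots

variable {N n : ℕ} {q : PosReal}

theorem map_starPull {s : SOq N q →ₗ⋆[ℂ] SOq N q} {P Q : Matrix (Fin N) (Fin N) ℂ}
    (hs : (genT N q).map s = sandwich P Q) (E : SOq N q →ₗ[ℂ] ℂ) :
    (genT N q).map (starPull s E) = P.map conj * ((genT N q).map E).map conj * Q.map conj := by
  let e : SOq N q →ₗ⋆[ℂ] ℂ :=
    { toFun := fun x => conj (E x)
      map_add' := fun x y => by simp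
      map_smul' := fun z x => by simp }
  have h1 : (genT N q).map (starPull s E) = ((genT N q).map s).map e := rfl
  have h2 := antiMap_scal_mul_scal e P Q (genT N q)
  rw [scal_complex, scal_complex] at h2
  rw [h1, hs]
  exact h2

/-- The conjugation `⋆^{♯♮}`. -/
def sharpStar (q : PosReal) (ε : SignVec N) : SOq N q →ₗ⋆[ℂ] SOq N q :=
  twist ((sharpAut N q).trans (natAut q ε)) (starConj N q)

theorem isStarStructure_sharpStar (ε : SignVec N) : IsStarStructure (sharpStar q ε) :=
  isStarStructure_starConj.twist (sharp_natAut_involutive ε) (sharp_natAut_starConj ε)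

theorem metricC_transpose_sandwich_apply (X : Matrix (Fin N) (Fin N) ℂ) (a b : Fin N) :
    ((metricC N q)ᵀ * X * (metricC N q)ᵀ) a b = qRho q a * X a.rev b.rev * (qRho q b)⁻¹ := by
  have h : ∀ c, (metricC N q)ᵀ a c = if c = a.rev then qRho q a else 0 := fun c => by
    rw [metricC_transpose_apply]; rfl
  rw [Matrix.mul_apply, Finset.sum_eq_single b.rev]
  · rw [Matrix.mul_apply, Finset.sum_eq_single a.rev]
    · rw [h, if_pos rfl, Matrix.transpose_apply, metricC_eq, if_pos rfl]
    · intro c _ hc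
      rw [h, if_neg hc, zero_mul]
    · simp
  · intro c _ hc
    rw [Matrix.transpose_apply, metricC_eq, if_neg hc, mul_zero]
  · simp

theorem map_starPull_sharpStar_apply (hN : Even N) (ε : SignVec N) (E : SOq N q →ₗ[ℂ] ℂ)
    (a b : Fin N) :
    starPull (sharpStar q ε) E (genT N q a b) = qRho q a * (qRho q b)⁻¹ *
      (((ε.1 a : ℤ) : ℂ) * ((ε.1 b : ℤ) : ℂ)) *
        conj (E (genT N q (midSwap a.rev) (midSwap b.rev))) := by
  have h1 := congrFun (congrFun (map_starPull (map_twist_sharp_natAut (q := q) ε) E) a) b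
  have hC : ((metricC N q)ᵀ).map conj = (metricC N q)ᵀ := by
    rw [Matrix.transpose_map, metricC_conj]
  have hε : ∀ a : Fin N, ε.1 (midSwap a.rev) = ε.1 a := fun a => by
    by_cases h : IsMiddle a
    · rw [midSwap_of_isMiddle h.rev, Fin.rev_rev]
    · rw [midSwap_of_not_isMiddle (isMiddle_rev.not.2 h), ε.val_rev]
  have h2 : ∀ Z : Matrix (Fin N) (Fin N) ℂ,
      (metricC N q)ᵀ * (matD N * ε.mat) * Z * (matD N * ε.mat * (metricC N q)ᵀ) =
      (metricC N q)ᵀ * (matD N * (ε.mat * Z * ε.mat) * matD N) * (metricC N q)ᵀ := fun Z => by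
    have e : matD N * (ε.mat * (metricC N q)ᵀ) = ε.mat * (matD N * (metricC N q)ᵀ) := by
      rw [← mul_assoc, ε.matD_comm_mat, mul_assoc]
    simp only [mul_assoc, e]
  simp only [Matrix.map_mul, hC, matD_conj, ε.mat_conj] at h1
  rw [h2, metricC_transpose_sandwich_apply, matD_of_even hN, mul_midSwapMat, midSwapMat_mul,
    SignVec.mat, Matrix.mul_diagonal, Matrix.diagonal_mul, hε, hε] at h1
  rw [← Matrix.map_apply (f := starPull _ E), sharpStar, h1, Matrix.map_apply, Matrix.map_apply]
  ring

/-- An equivalence between two conjugations intertwines the conjugations that they induce on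
functionals. -/
theorem starPull_pull {s t : SOq N q →ₗ⋆[ℂ] SOq N q} {α : SOq N q ≃ₐc[ℂ] SOq N q}
    (h : ∀ x, t x = α (s (α.symm x))) (E : SOq N q →ₗ[ℂ] ℂ) :
    pull α (starPull t E) = starPull s (pull α E) := by
  ext x
  have h1 : α.symm (α x) = x := α.left_inv x
  rw [pull_apply, starPull_apply, starPull_apply, pull_apply, h, h1]

theorem starPull_smul (s : SOq N q →ₗ⋆[ℂ] SOq N q) (z : ℂ) (E : SOq N q →ₗ[ℂ] ℂ) :
    starPull s (z • E) = conj z • starPull s E := by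
  ext x
  simp [starPull_apply]

theorem rootMat_eq_single (u v : Fin N) :
    rootMat u v = Matrix.single u v 1 - Matrix.single v.rev u.rev 1 := by
  ext a b
  rw [rootMat_apply, Matrix.sub_apply, Matrix.single_apply, Matrix.single_apply, unitMat, unitMat]
  simp only [eq_comm]

theorem conj_cq (q : PosReal) : conj (cq q) = cq q := Complex.conj_ofReal _

variable {u v : Fin N} {κ E : SOq N q →ₗ[ℂ] ℂ}

/-- The commutator is `e_{uu} + e_{v'v'} - e_{vv} - e_{u'u'}`, and on these indices the weights and
the reversed weights of `κ` differ by `±(q - q⁻¹)`. -/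
theorem rootMat_commutator (hN : Even N) (h : IsSimplePair u v) :
    (cq q - (cq q)⁻¹) • (rootMat u v * (rootMat u v)ᵀ - (rootMat u v)ᵀ * rootMat u v) =
      Matrix.diagonal (rootWeight q u v) -
        Matrix.diagonal fun a => rootWeight q u v a.rev := by
  have h1 := h.lt.ne
  have h2 := ne_rev_of_even hN u
  have h3 := ne_rev_of_even hN v
  have h4 := h.ne
  have h5 : u ≠ v.rev := fun e => h4 (by rw [e, Fin.rev_rev])
  have h6 : v.rev ≠ u.rev := fun e => h1 (Fin.rev_injective e).symm
  rw [rootMat_eq_single, Matrix.transpose_sub, Matrix.transpose_single, Matrix.transpose_single]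
  simp only [mul_sub, sub_mul, Matrix.single_mul_single_same,
    Matrix.single_mul_single_of_ne _ _ _ _ h4, Matrix.single_mul_single_of_ne _ _ _ _ h4.symm,
    Matrix.single_mul_single_of_ne _ _ _ _ h5, Matrix.single_mul_single_of_ne _ _ _ _ h5.symm]
  ext a b
  simp only [Matrix.smul_apply, Matrix.sub_apply, Matrix.single_apply, Matrix.diagonal_apply,
    rootWeight, Matrix.zero_apply, smul_eq_mul]
  have e1 : a.rev = u ↔ a = u.rev := rev_eq_iff
  have e2 : a.rev = v ↔ a = v.rev := rev_eq_iff
  simp only [Fin.rev_inj, e1, e2]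
  grind

/-- The weights are real and equal `1` at the middle indices when `u` and `v` are off the middle, so
`𝒟` has no effect, the signs square away, and only the index reversal from `Cᵗ` remains. -/
theorem IsRootPair.map_starPull_char (hN : Even N) (hE : IsRootPair u v κ E) (hu : ¬ IsMiddle u)
    (hv : ¬ IsMiddle v) (ε : SignVec N) :
    (genT N q).map (starPull (sharpStar q ε) κ) =
      Matrix.diagonal fun a => rootWeight q u v a.rev := by
  have h1 : ∀ a b, κ (genT N q a b) = Matrix.diagonal (rootWeight q u v) a b := fun a b =>
    congrFun (congrFun hE.map_char a) b
  have h2 : ∀ a : Fin N, conj (rootWeight q u v (midSwap a)) = rootWeight q u v a := by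
    intro a
    have hw : conj (rootWeight q u v a) = rootWeight q u v a := by
      rw [rootWeight]
      split_ifs <;> simp [conj_cq]
    by_cases ha : IsMiddle a
    · have hw1 : ∀ b : Fin N, IsMiddle b → rootWeight q u v b = 1 := by
        intro b ha
        rw [rootWeight, if_neg, if_neg]
        all_goals
          rintro (h | h)
          all_goals
            rw [h] at ha
            first
            | exact hu ha
            | exact hv ha
            | exact hu (isMiddle_rev.1 ha)
            | exact hv (isMiddle_rev.1 ha)
      rw [midSwap_of_isMiddle ha, hw1 _ ha, hw1 _ ha.rev, map_one]
    · rw [midSwap_of_not_isMiddle ha, hw]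
  ext a b
  rw [Matrix.map_apply, map_starPull_sharpStar_apply hN, h1, Matrix.diagonal_apply,
    Matrix.diagonal_apply]
  simp only [midSwap_inj, Fin.rev_inj]
  split_ifs with h
  · rw [h, h2, mul_inv_cancel₀ (qRho_ne_zero q b), ε.cast_mul_self, one_mul, one_mul]
  · simp

/-- The index reversal turns the root vector into minus its transpose, the metric contributes
`q^{ρ_v - ρ_u} = q⁻¹`, and `𝒟'` contributes `ε_u ε_v`. This is the only place where the sign vector
becomes visible in the dual. -/
theorem IsRootPair.map_starPull_skew (hN : Even N) (hE : IsRootPair u v κ E)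
    (h : IsSimplePair u v) (hu : ¬ IsMiddle u) (hv : ¬ IsMiddle v) (ε : SignVec N) :
    (genT N q).map (starPull (sharpStar q ε) E) =
      (-(((ε.1 u : ℤ) : ℂ) * ((ε.1 v : ℤ) : ℂ) * (cq q)⁻¹)) • (rootMat u v)ᵀ := by
  have h1 : ∀ a b, E (genT N q a b) = rootMat u v a b := fun a b =>
    congrFun (congrFun hE.map_skew a) b
  have hq0 := cq_ne_zero q
  have hv0 := qRho_ne_zero q v
  have hu' : midSwap u = u := midSwap_of_not_isMiddle hu
  have hv' : midSwap v = v := midSwap_of_not_isMiddle hv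
  have hu'' : midSwap u.rev = u.rev := by rw [midSwap_rev, hu']
  have hv'' : midSwap v.rev = v.rev := by rw [midSwap_rev, hv']
  ext a b
  rw [Matrix.map_apply, map_starPull_sharpStar_apply hN, h1, rootMat_apply, Matrix.smul_apply,
    Matrix.transpose_apply, rootMat_apply, smul_eq_mul]
  simp only [unitMat, midSwap_eq_iff, hu', hv', hu'', hv'', Fin.rev_inj]
  have e1 : a.rev = u ↔ a = u.rev := rev_eq_iff
  have e2 : b.rev = v ↔ b = v.rev := rev_eq_iff
  simp only [e1, e2]
  have huv : u ≠ v.rev := fun e => h.ne (by rw [e, Fin.rev_rev])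
  have huv' : v ≠ u.rev := h.ne
  by_cases c1 : a = v ∧ b = u
  · obtain ⟨rfl, rfl⟩ := c1
    simp [huv, huv', h.qRho_eq]
    field_simp
  by_cases c2 : a = u.rev ∧ b = v.rev
  · obtain ⟨rfl, rfl⟩ := c2
    simp [huv.symm, huv'.symm, h.qRho_eq, qRho_rev, ε.val_rev]
    field_simp
  · have c3 : ¬ (b = u ∧ a = v) := fun e => c1 e.symm
    have c4 : ¬ (b = v.rev ∧ a = u.rev) := fun e => c2 e.symm
    simp [c1, c2, c3, c4]

end StarOnRoots

/-! ### The products of neighbouring signs are invariants -/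

section Separation

variable {N n : ℕ} {q : PosReal} {u v : Fin N} {κ E : SOq N q →ₗ[ℂ] ℂ}

theorem IsRootPair.isSkew_starPull (hE : IsRootPair u v κ E) (ε : SignVec N) :
    IsSkew Coalgebra.counit (starPull (sharpStar q ε) κ) (starPull (sharpStar q ε) E) := by
  have h := hE.isSkew.starPull (isStarStructure_sharpStar ε)
  rwa [(isStarStructure_sharpStar ε).starPull_counit] at h

/-- The commutator of a root vector with its conjugate is a nonzero multiple of `κ - κ⋆`. -/
theorem IsRootPair.commutator_starPull (hN : Even N) (hq : q ≠ 1) (hE : IsRootPair u v κ E)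
    (h : IsSimplePair u v) (hu : ¬ IsMiddle u) (hv : ¬ IsMiddle v) (ε : SignVec N) :
    ∃ μ : ℂ, conv E (starPull (sharpStar q ε) E) - conv (starPull (sharpStar q ε) E) E =
        μ • (κ - starPull (sharpStar q ε) κ) ∧
      conv E (starPull (sharpStar q ε) E) - conv (starPull (sharpStar q ε) E) E ≠ 0 := by
  have hq0 := cq_ne_zero q
  have hl := cq_sub_inv_ne_zero hq
  have hκ' := hE.isChar.starPull (isStarStructure_sharpStar (q := q) ε)
  have hκT := hE.map_starPull_char hN hu hv ε
  have hF := hE.isSkew_starPull ε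
  have hFT := hE.map_starPull_skew hN h hu hv ε
  set κ' := starPull (sharpStar q ε) κ
  set F := starPull (sharpStar q ε) E
  have hκκ : conv κ κ' = conv κ' κ := (hE.isChar.conv hκ').ext (hκ'.conv hE.isChar) (by
    rw [map_conv, map_conv, hκT, hE.map_char, Matrix.diagonal_mul_diagonal,
      Matrix.diagonal_mul_diagonal]
    simp only [mul_comm])
  -- The conjugate `F` has the opposite weight `q⁻²`, which with `h2` supplies the inverse factors
  -- needed for the commutator to be a skew derivation.
  have h1 : conv κ F = (cq q ^ 2)⁻¹ • conv F κ := by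
    have e1 := hF.conv_char_left hE.isChar
    have e2 := (hF.conv_char_right hE.isChar).smul (cq q ^ 2)⁻¹
    rw [conv_counit_right] at e1
    rw [conv_counit_left, ← hκκ] at e2
    refine e1.ext e2 hE.isChar.map_one (hE.isChar.conv hκ').map_one ?_
    rw [map_smul_matrix, map_conv, map_conv, hE.map_char, hFT]
    ext a b
    have := rootWeight_mul_rootMat (q := q) hN h b a
    rw [Matrix.diagonal_mul, Matrix.smul_apply, Matrix.smul_apply, Matrix.mul_diagonal,
      Matrix.smul_apply, Matrix.transpose_apply, smul_eq_mul, smul_eq_mul,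
      eq_inv_mul_iff_mul_eq₀ (pow_ne_zero 2 hq0)]
    linear_combination (((ε.1 u : ℤ) : ℂ) * ((ε.1 v : ℤ) : ℂ) * (cq q)⁻¹) * this
  have h2 : conv E κ' = cq q ^ 2 • conv κ' E := by
    rw [hE.conv_char hκ' hκT, Fin.rev_rev, rootWeight, rootWeight, if_neg, if_pos (Or.inr rfl),
      if_neg, if_pos (Or.inl rfl), smul_smul]
    · field_simp
      rw [one_smul]
    · rintro (e | e)
      · exact h.lt.ne' e
      · exact ne_rev_of_even hN v e
    · rintro (e | e)
      · exact ne_rev_of_even hN u e.symm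
      · exact h.lt.ne (Fin.rev_injective e)
  have hD := hE.isSkew.commutator hF (inv_mul_cancel₀ (pow_ne_zero 2 hq0)) h1 h2
  have hη := ε.cast_mul_self u
  have hη' := ε.cast_mul_self v
  set η : ℂ := ((ε.1 u : ℤ) : ℂ) * ((ε.1 v : ℤ) : ℂ) with hη_def
  have hη0 : η ≠ 0 := fun e => by
    have : η * η = 1 := by rw [hη_def]; linear_combination ((ε.1 v : ℤ) : ℂ) ^ 2 * hη + hη'
    rw [e, zero_mul] at this
    exact zero_ne_one this
  set μ : ℂ := -(η * (cq q)⁻¹) * (cq q - (cq q)⁻¹)⁻¹ with hμ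
  have hμ0 : μ ≠ 0 := mul_ne_zero (neg_ne_zero.2 (mul_ne_zero hη0 (inv_ne_zero hq0)))
    (inv_ne_zero hl)
  -- Both sides are skew derivations for the pair `κ`, `κ'`, so the matrix identity on `T` is
  -- enough.
  have hDμ : conv E F - conv F E = μ • (κ - κ') := by
    refine hD.ext ((hE.isChar.isSkew_sub hκ').smul μ) hE.isChar.map_one hκ'.map_one ?_
    have e1 : (genT N q).map (κ - κ') = (genT N q).map κ - (genT N q).map κ' := rfl
    have e2 : (genT N q).map (conv E F - conv F E) =
      (genT N q).map (conv E F) - (genT N q).map (conv F E) := rfl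
    rw [map_smul_matrix, e1, e2, map_conv, map_conv, hE.map_char, hκT, hFT, hE.map_skew,
      ← rootMat_commutator hN h, smul_smul, hμ, inv_mul_cancel_right₀ hl, Matrix.mul_smul,
      Matrix.smul_mul, smul_sub]
  refine ⟨μ, hDμ, ?_⟩
  rw [hDμ]
  refine smul_ne_zero hμ0 fun e => ?_
  have e1 := congrFun (congrFun hκT u) u
  rw [← sub_eq_zero.1 e, hE.map_char, Matrix.diagonal_apply_eq, Matrix.diagonal_apply_eq,
    rootWeight, rootWeight, if_pos (Or.inl rfl), if_neg, if_pos (Or.inr rfl)] at e1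
  · exact hl (sub_eq_zero.2 e1)
  · rintro (e | e)
    · exact ne_rev_of_even hN u e.symm
    · exact h.lt.ne (Fin.rev_injective e)

/-- The commutator of `E` and its conjugate is a multiple of `κ - κ⋆`, which `α` fixes because `κ⋆`
is the same for all sign vectors. On the other hand `α` multiplies it by `η |z|²`, so the sign `η`
must be positive. -/
theorem sign_eq_of_starEquivalent (hN : Even N) (hq : q ≠ 1) (hE : IsRootPair u v κ E)
    (h : IsSimplePair u v) (hu : ¬ IsMiddle u) (hv : ¬ IsMiddle v) (ε₁ ε₂ : SignVec N)
    {α : SOq N q ≃ₐc[ℂ] SOq N q}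
    (hα : ∀ x, sharpStar q ε₂ x = α (sharpStar q ε₁ (α.symm x)))
    (hκ : pull α κ = κ) {z : ℂ} (hz : pull α E = z • E) :
    ε₁.1 u * ε₁.1 v = ε₂.1 u * ε₂.1 v := by
  have hq0 := cq_ne_zero q
  obtain ⟨μ, hμ, h0⟩ := hE.commutator_starPull hN hq h hu hv ε₁
  have hκ' : starPull (sharpStar q ε₂) κ = starPull (sharpStar q ε₁) κ :=
    (hE.isChar.starPull (isStarStructure_sharpStar ε₂)).ext
      (hE.isChar.starPull (isStarStructure_sharpStar ε₁)) (by
        rw [hE.map_starPull_char hN hu hv, hE.map_starPull_char hN hu hv])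
  have hpκ : pull α (starPull (sharpStar q ε₁) κ) = starPull (sharpStar q ε₁) κ := by
    conv_lhs => rw [← hκ']
    rw [starPull_pull hα, hκ]
  -- The number `η` is the ratio of the two sign products; the conjugates of `E` under the two
  -- conjugations differ exactly by this factor.
  set η : ℂ := (((ε₁.1 u * ε₁.1 v * (ε₂.1 u * ε₂.1 v) : ℤˣ) : ℤ) : ℂ) with hη
  have hη2 : η * η = 1 := by
    have : (ε₁.1 u * ε₁.1 v * (ε₂.1 u * ε₂.1 v)) * (ε₁.1 u * ε₁.1 v * (ε₂.1 u * ε₂.1 v)) = 1 :=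
      Int.units_mul_self _
    rw [hη]
    rw [← Int.cast_mul, ← Units.val_mul, this, Units.val_one, Int.cast_one]
  have hf : starPull (sharpStar q ε₁) E = η • starPull (sharpStar q ε₂) E := by
    have e1 := hE.isSkew_starPull ε₁
    rw [← hκ'] at e1
    refine e1.ext ((hE.isSkew_starPull ε₂).smul η) Bialgebra.counit_one
      (hE.isChar.starPull (isStarStructure_sharpStar ε₂)).map_one ?_
    rw [map_smul_matrix, hE.map_starPull_skew hN h hu hv, hE.map_starPull_skew hN h hu hv,
      smul_smul]
    congr 1
    rw [hη]
    push_cast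
    linear_combination (((ε₁.1 u : ℤ) : ℂ) * ((ε₁.1 v : ℤ) : ℂ) * (cq q)⁻¹) *
      (((ε₂.1 v : ℤ) : ℂ) ^ 2 * ε₂.cast_mul_self u + ε₂.cast_mul_self v)
  have hpf : pull α (starPull (sharpStar q ε₁) E) = (η * conj z) • starPull (sharpStar q ε₁) E := by
    conv_lhs => rw [hf]
    rw [pull_smul, starPull_pull hα, hz, starPull_smul, smul_smul]
  have hsub : ∀ x y : SOq N q →ₗ[ℂ] ℂ, pull α (x - y) = pull α x - pull α y := fun _ _ => rfl
  have e1 := congrArg (pull α) hμ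
  rw [pull_smul, hsub, hsub, hκ, hpκ, ← hμ, pull_conv, pull_conv, hz, hpf, conv_smul_left,
    conv_smul_right, conv_smul_left, conv_smul_right, smul_smul, smul_smul, mul_comm (η * conj z),
    ← smul_sub] at e1
  -- The scalars can be compared because the commutator is nonzero.
  have e2 : z * (η * conj z) = 1 :=
    smul_left_injective ℂ h0 (e1.trans (one_smul ℂ _).symm)
  have e3 : η * (Complex.normSq z : ℂ) = 1 := by
    rw [Complex.normSq_eq_conj_mul_self]
    linear_combination e2
  rcases Int.units_eq_one_or (ε₁.1 u * ε₁.1 v * (ε₂.1 u * ε₂.1 v)) with hc | hc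
  · rw [← Int.units_inv_eq_self (ε₂.1 u * ε₂.1 v)]
    exact eq_inv_of_mul_eq_one_left hc
  · exfalso
    rw [hη, hc] at e3
    have e4 : -(Complex.normSq z) = 1 := by
      push_cast at e3
      rw [neg_one_mul] at e3
      exact_mod_cast e3
    linarith [Complex.normSq_nonneg z]

/-- For `j + 3 ≤ n` the root `j` lies off the fork, so it is fixed by every automorphism up to a
scalar, and both of its indices lie off the middle. -/
theorem sharpClass_separation (hN : N = 2 * n) (hq : q ≠ 1) (ε₁ ε₂ : SignVec N)
    (h : sharpClass q ε₁ = sharpClass q ε₂) (j : ℕ) (hj : j + 3 ≤ n) :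
    ε₁.1 ⟨j, by omega⟩ * ε₁.1 ⟨j + 1, by omega⟩ =
      ε₂.1 ⟨j, by omega⟩ * ε₂.1 ⟨j + 1, by omega⟩ := by
  have hev : Even N := by rw [hN]; exact even_two_mul n
  have hn : 2 ≤ n := by omega
  obtain ⟨α, hα⟩ : StarEquivalent (sharpStar q ε₁) (sharpStar q ε₂) := Quotient.exact h
  choose κ E hE using fun i : Fin n => exists_isRootPair hev hq (isSimplePair_root hN hn i)
  obtain ⟨hκ, z, -, hz⟩ := exists_root_pull_fixed hN hq hE α ⟨j, by omega⟩ hj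
  have e : rootFst hN ⟨j, by omega⟩ = ⟨j, by omega⟩ := by
    rw [Fin.ext_iff]
    simp only [rootFst]
    omega
  have key := sign_eq_of_starEquivalent hev hq (hE ⟨j, by omega⟩) (isSimplePair_root hN hn _)
    (by rw [e]; unfold IsMiddle; simp only; omega)
    (by unfold IsMiddle; simp only [rootSnd]; omega) ε₁ ε₂ hα hκ hz
  rwa [e] at key

end Separation

end QuantumOrthogonal

end

/-! ### The main theorem -/

open QuantumOrthogonal
theorem mainTheorem4 (N : ℕ) (hN : 2 < N) :
    -- the conjugation `⋆`, the automorphism `♯`, the automorphisms `♮` given by sign vectors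
    ∃ (star : ∀ q : PosReal, SOq N q →ₗ⋆[ℂ] SOq N q)
      (sharp : ∀ q : PosReal, SOq N q ≃ₐc[ℂ] SOq N q)
      (nat : SignVec N → ∀ q : PosReal, SOq N q ≃ₐc[ℂ] SOq N q),
      -- `⋆` is a conjugation with `T^⋆ = Cᵗ T Cᵗ`
      (∀ q, IsStarStructure (star q) ∧
        (genT N q).map (star q) = sandwich (metricC N q)ᵀ (metricC N q)ᵀ) ∧
      -- `♯` is an involutive Hopf algebra automorphism with `T^♯ = 𝒟 T 𝒟⁻¹`
      (∀ q, (genT N q).map (sharp q) = sandwich (matD N) (matD N)⁻¹ ∧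
        (∀ x, sharp q (sharp q x) = x) ∧
        (∀ x, sharp q (HopfAlgebra.antipode ℂ x) = HopfAlgebra.antipode ℂ (sharp q x)) ∧
        (∀ x, sharp q (star q x) = star q (sharp q x))) ∧
      -- `𝒟'` commutes with `𝒟`, and `♮` is an involutive Hopf algebra automorphism with
      -- `T^♮ = 𝒟' T 𝒟'⁻¹` that commutes with `♯` and `⋆`
      (∀ ε : SignVec N, matD N * ε.mat = ε.mat * matD N) ∧
      (∀ (ε : SignVec N) (q : PosReal),
        (genT N q).map (nat ε q) = sandwich ε.mat ε.mat⁻¹ ∧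
        (∀ x, nat ε q (nat ε q x) = x) ∧
        (∀ x, nat ε q (HopfAlgebra.antipode ℂ x) = HopfAlgebra.antipode ℂ (nat ε q x)) ∧
        (∀ x, nat ε q (sharp q x) = sharp q (nat ε q x)) ∧
        (∀ x, nat ε q (star q x) = star q (nat ε q x))) ∧
      -- `⋆^♮` and `⋆^{♯♮}` are conjugations
      (∀ (ε : SignVec N) (q : PosReal),
        IsStarStructure (twist (nat ε q) (star q)) ∧
        IsStarStructure (twist ((sharp q).trans (nat ε q)) (star q))) ∧
      -- the signatures of the real forms that they give
      (∀ ε : SignVec N, Even ε.negCount ∧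
        GivesRealForm (fun q => twist (nat ε q) (star q)) (N - ε.negCount) ε.negCount ∧
        GivesRealForm (fun q => twist ((sharp q).trans (nat ε q)) (star q))
          (N - (ε.negCount + 1)) (ε.negCount + 1)) ∧
      -- all signatures occur
      (∀ l m : ℕ, l + m = N →
        (Odd N ∨ (Even l ∧ Even m) →
          ∃ ε : SignVec N, GivesRealForm (fun q => twist (nat ε q) (star q)) l m) ∧
        (Odd l ∧ Odd m →
          ∃ ε : SignVec N,
            GivesRealForm (fun q => twist ((sharp q).trans (nat ε q)) (star q)) l m)) ∧
      -- for even `N`, the sign vectors `ε` and `-ε` (off the middle) give equivalent `⋆^{♯♮}`, by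
      -- an automorphism `α` with `α(T) = A T A⁻¹`
      (Even N → ∀ (ε₁ ε₂ : SignVec N), (∀ j, ¬ IsMiddle j → ε₂.1 j = -ε₁.1 j) →
        ∀ q : PosReal, ∃ α : SOq N q ≃ₐc[ℂ] SOq N q,
          (genT N q).map α = sandwich (matA N) (matA N)⁻¹ ∧
          ∀ x, twist ((sharp q).trans (nat ε₂ q)) (star q) x =
            α (twist ((sharp q).trans (nat ε₁ q)) (star q) (α.symm x))) ∧
      -- for `N = 2 n` there are only `2 ^ (n - 2)` conjugations `⋆^{♯♮}` up to equivalence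
      (∀ n : ℕ, N = 2 * n → ∀ q : PosReal,
        (Set.range fun ε : SignVec N => (Quotient.mk (starSetoid (SOq N q))
          (twist ((sharp q).trans (nat ε q)) (star q)))).ncard ≤ 2 ^ (n - 2) ∧
        (q ≠ 1 →
          (Set.range fun ε : SignVec N => (Quotient.mk (starSetoid (SOq N q))
            (twist ((sharp q).trans (nat ε q)) (star q)))).ncard = 2 ^ (n - 2))) := by
  refine ⟨starConj N, sharpAut N, fun ε q => natAut q ε,
    fun q => ⟨isStarStructure_starConj, map_starConj⟩, fun q => ?_, SignVec.matD_comm_mat,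
    fun ε q => ?_, fun ε q => ?_,
    fun ε => ⟨even_negCount ε, givesRealForm_nat ε hN, givesRealForm_sharp_nat ε hN⟩,
    fun l m hlm => ⟨exists_givesRealForm_nat hN hlm,
      fun h => exists_givesRealForm_sharp_nat hN hlm h.1 h.2⟩,
    fun he ε₁ ε₂ h q => exists_conjAut_matA he ε₁ ε₂ h, fun n hn q => ?_⟩
  · exact ⟨map_conjAut _, conjAut_conjAut _ matD_mul_self, conjAut_antipode _, sharpAut_starConj⟩
  · exact ⟨map_conjAut _, conjAut_conjAut _ ε.mat_mul_self, conjAut_antipode _,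
      natAut_sharpAut ε, natAut_starConj ε⟩
  · exact ⟨isStarStructure_starConj.twist (conjAut_conjAut _ ε.mat_mul_self) (natAut_starConj ε),
      isStarStructure_starConj.twist (sharp_natAut_involutive ε) (sharp_natAut_starConj ε)⟩
  · exact ⟨ncard_range_sharpClass_le hn (by omega), fun hq =>
      ncard_range_sharpClass hn (by omega) (sharpClass_separation hn hq)⟩
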